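/- Let $k$ be a field of characteristic zero and let $(H,R)$ be a semisimple quasi-triangular Hopf algebra over $k$, with $R=R^1\otimes R^2$; $R_1,R_2,R_3$ denote copies of $R$. Let $A\neq 0$ be a left $H$-module algebra that is quantum commutative, i.e. $ab=(R^2\cdot b)(R^1\cdot a)$ for all $a,b\in A$, and strongly separable, i.e. it has a symmetric separability idempotent $x=x^1\otimes x^2\in A\otimes A$: $x^1x^2=1$, $ax^1\otimes x^2=x^1\otimes x^2a$ for all $a\in A$, and $x^1\otimes x^2=x^2\otimes x^1$; $x_1,x_2$ denote copies of $x$. Then $A$ is finite dimensional. Let $\alpha\in A^*$ be the element determined by $\langle\alpha,x^1\rangle x^2=1$ (the trace of the left regular representation of $A$). For $a,b\in A$, $h\in H$, $a^*\in A^*$ put $\langle a\rightharpoonup a^*,b\rangle=\langle a^*,ba\rangle$, $\langle a^*\leftharpoonup a,b\rangle=\langle a^*,ab\rangle$, $\langle a^*\triangleleft h,a\rangle=\langle a^*,h\cdot a\rangle$, and let $a^*_{(1)}\otimes a^*_{(2)}\in A^*\otimes A^*$ be defined by $\langle a^*_{(1)},a\rangle\langle a^*_{(2)},b\rangle=\langle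 a^*,ab\rangle$. Let $B=A\otimes H\otimes A^*$ be the algebra with product $(a\otimes h\otimes a^*)(b\otimes g\otimes b^*)=\langle b^*,a\rangle\, b\otimes hg\otimes a^*$ and unit $x^1\otimes 1_H\otimes (x^2\rightharpoonup\alpha)$. Then $$\Delta_B(a\otimes h\otimes a^*)=\bigl((R_1^2\cdot x^1)a\otimes R_2^1h_{(1)}R_1^1\otimes a^*_{(2)}\bigr)\otimes\bigl(x^2\otimes h_{(2)}\otimes a^*_{(1)}\triangleleft R_2^2\bigr),$$ $$\varepsilon_B(a\otimes h\otimes a^*)=\langle\alpha,a\rangle\,\varepsilon(h)\,\langle a^*,1\rangle,$$ $$S_B(a\otimes h\otimes a^*)=\langle a^*\triangleleft R_2^2,x^1\rangle\; x^2\otimes R_1^1S(R_2^1h)\otimes\alpha\leftharpoonup(R_1^2\cdot a),$$ $$R_B=\bigl((R_3^2\cdot x_2^1)x_1^1\otimes R_2^1R_3^1\otimes\alpha_{(1)}\triangleleft R_1^2\bigr)\otimes\bigl(x_2^2\otimes R_1^1R_2^2\otimes x_1^2\rightharpoonup\alpha_{(2)}\bigr)$$ make $B$ a quasi-triangular weak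 Hopf algebra. Let ${}_H\mathcal M$ and ${}_B\mathcal M$ be the braided monoidal categories of finite-dimensional left modules. In both of them the braiding is induced by $m\otimes n\mapsto r^2n\otimes r^1m$, with $r=R$ and $r=R_B$ respectively; the tensor product of $B$-modules $V,W$ is $\Delta_B(1)(V\otimes W)$ with $b(v\otimes w)=b_{(1)}v\otimes b_{(2)}w$, and the unit object of ${}_B\mathcal M$ is the target counital subalgebra $B_t$, which is a simple object. For $M\in{}_H\mathcal M$ let $F(M)=A^*\otimes M$ with the $B$-action $(a\otimes h\otimes a^*)(b^*\otimes m)=\langle b^*,a\rangle\,a^*\otimes hm$; it is an $A$-bimodule via $a\cdot(a^*\otimes m)=(a\rightharpoonup a^*)\otimes m$ and $(a^*\otimes m)\cdot a=a^*\leftharpoonup(R^2\cdot a)\otimes R^1m$. For all $M,N\in{}_H\mathcal M$, the map $t\mapsto\Delta_B(1)t$ on $F(M)\otimes F(N)$ has as its kernel the span of all $v\cdot a\otimes w-v\otimes a\cdot w$, so that it identifies $F(M)\otimes_AF(N)$ with the tensor product of $F(M)$ and $F(N)$ in ${}_B\mathcal M$. With these structures, the functor $F\colon{}_H\mathcal M\to{}_B\mathcal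 M$, $M\mapsto A^*\otimes M$, is a $k$-linear equivalence of categories, and together with the maps $$\xi_{M,N}\colon F(M\otimes N)\to F(M)\otimes_AF(N),\qquad \xi_{M,N}\bigl(a^*\otimes(m\otimes n)\bigr)=(a^*\otimes m)\otimes_A(\alpha\otimes n),$$ it is a braided monoidal functor, the $\xi_{M,N}$ being isomorphisms of $B$-modules. Hence ${}_H\mathcal M$ and ${}_B\mathcal M$ are equivalent as braided tensor categories. -/

import Mathlib

open CategoryTheory MonoidalCategory
open scoped TensorProduct

set_option maxSynthPendingDepth 3

universe u

noncomputable section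

namespace WeakHopf

/-! ### Finite-dimensional modules -/

/-- A finite-dimensional left module over a `k`-algebra `B`, given as a finite-dimensional vector
space together with the algebra map `ρ : B → End V`. -/
structure FDMod (k B : Type u) [Field k] [Ring B] [Algebra k B] where
  /-- the underlying space -/
  carrier : Type u
  [acg : AddCommGroup carrier]
  [mod : Module k carrier]
  [fin : Module.Finite k carrier]
  /-- the action -/
  ρ : B →ₐ[k] Module.End k carrier

attribute [instance] FDMod.acg FDMod.mod FDMod.fin

section basic
variable {k B : Type u} [Field k] [Ring B] [Algebra k B]

/-- The space of `B`-linear maps. -/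
def FDMod.homs (M N : FDMod k B) : Submodule k (M.carrier →ₗ[k] N.carrier) where
  carrier := {f | ∀ b m, f (M.ρ b m) = N.ρ b (f m)}
  add_mem' := by
    intro f g hf hg b m
    simp [hf b m, hg b m]
  zero_mem' := by intro b m; simp
  smul_mem' := by
    intro c f hf b m
    simp [hf b m]

instance : Category (FDMod k B) where
  Hom M N := M.homs N
  id M := ⟨LinearMap.id, fun _ _ => rfl⟩
  comp f g := ⟨g.1 ∘ₗ f.1, fun b m => by simp [f.2 b m, g.2 b _]⟩

instance : Preadditive (FDMod k B) where
  homGroup M N := inferInstanceAs (AddCommGroup (M.homs N))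
  add_comp _ _ _ _ _ _ := Subtype.ext (LinearMap.comp_add _ _ _)
  comp_add _ _ _ _ _ _ := Subtype.ext (LinearMap.add_comp _ _ _)

instance : Linear k (FDMod k B) where
  homModule M N := inferInstanceAs (Module k (M.homs N))
  smul_comp _ _ _ _ _ _ := Subtype.ext (LinearMap.comp_smul _ _ _)
  comp_smul _ _ _ _ _ _ := Subtype.ext (LinearMap.smul_comp _ _ _)

/-- The linear map underlying a morphism. -/
def FDMod.lin {M N : FDMod k B} (f : M ⟶ N) : M.carrier →ₗ[k] N.carrier := f.1

/-- Morphisms are the `B`-linear maps. -/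
def FDMod.ofLin {M N : FDMod k B} (f : M.carrier →ₗ[k] N.carrier)
    (h : ∀ b m, f (M.ρ b m) = N.ρ b (f m)) : M ⟶ N := ⟨f, h⟩

@[simp] lemma FDMod.lin_ofLin {M N : FDMod k B} (f : M.carrier →ₗ[k] N.carrier)
    (h : ∀ b m, f (M.ρ b m) = N.ρ b (f m)) : FDMod.lin (FDMod.ofLin f h) = f := rfl
@[simp] lemma FDMod.lin_id (M : FDMod k B) : FDMod.lin (𝟙 M) = LinearMap.id := rfl
@[simp] lemma FDMod.lin_comp {M N P : FDMod k B} (f : M ⟶ N) (g : N ⟶ P) :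
    FDMod.lin (f ≫ g) = FDMod.lin g ∘ₗ FDMod.lin f := rfl
@[simp] lemma FDMod.lin_add {M N : FDMod k B} (f g : M ⟶ N) :
    FDMod.lin (f + g) = FDMod.lin f + FDMod.lin g := rfl
@[simp] lemma FDMod.lin_smul {M N : FDMod k B} (c : k) (f : M ⟶ N) :
    FDMod.lin (c • f) = c • FDMod.lin f := rfl
lemma FDMod.lin_ρ {M N : FDMod k B} (f : M ⟶ N) (b : B) (m : M.carrier) :
    FDMod.lin f (M.ρ b m) = N.ρ b (FDMod.lin f m) := f.2 b m
lemma FDMod.hom_ext {M N : FDMod k B} {f g : M ⟶ N} (h : FDMod.lin f = FDMod.lin g) : f = g :=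
  Subtype.ext h

/-- A bijective `B`-linear map is an isomorphism. -/
def FDMod.isoOfEquiv {M N : FDMod k B} (e : M.carrier ≃ₗ[k] N.carrier)
    (h : ∀ b m, e (M.ρ b m) = N.ρ b (e m)) : M ≅ N where
  hom := FDMod.ofLin e.toLinearMap h
  inv := FDMod.ofLin e.symm.toLinearMap (fun b n => by
    apply e.injective
    simp [h])
  hom_inv_id := by apply FDMod.hom_ext; ext; simp
  inv_hom_id := by apply FDMod.hom_ext; ext; simp

end basic

/-! ### Tensor products of actions -/

section pair
variable {k : Type u} [Field k]
variable {B C D : Type u} [Ring B] [Algebra k B] [Ring C] [Algebra k C] [Ring D] [Algebra k D]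
variable {M N P : Type u} [AddCommGroup M] [Module k M] [AddCommGroup N] [Module k N]
  [AddCommGroup P] [Module k P]

/-- The action of `B ⊗ C` on `M ⊗ N`: `(b ⊗ c) (m ⊗ n) = b m ⊗ c n`. -/
def pairRep (ρ : B →ₐ[k] Module.End k M) (σ : C →ₐ[k] Module.End k N) :
    B ⊗[k] C →ₐ[k] Module.End k (M ⊗[k] N) :=
  (Module.endTensorEndAlgHom (R := k) (S := k) (A := k) (M := M) (N := N)).comp
    (Algebra.TensorProduct.map ρ σ)

lemma pairRep_tmul (ρ : B →ₐ[k] Module.End k M) (σ : C →ₐ[k] Module.End k N) (b : B) (c : C) :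
    pairRep ρ σ (b ⊗ₜ c) = TensorProduct.map (ρ b) (σ c) := rfl

@[simp] lemma pairRep_tmul_tmul (ρ : B →ₐ[k] Module.End k M) (σ : C →ₐ[k] Module.End k N)
    (b : B) (c : C) (m : M) (n : N) :
    pairRep ρ σ (b ⊗ₜ c) (m ⊗ₜ n) = ρ b m ⊗ₜ σ c n := rfl

lemma pairRep_mul (ρ : B →ₐ[k] Module.End k M) (σ : C →ₐ[k] Module.End k N)
    (z w : B ⊗[k] C) (t : M ⊗[k] N) :
    pairRep ρ σ (z * w) t = pairRep ρ σ z (pairRep ρ σ w t) := by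
  rw [map_mul]; rfl

variable {M' N' : Type u} [AddCommGroup M'] [Module k M'] [AddCommGroup N'] [Module k N']

/-- Compatibility with a linear map `φ : C → D` along which `g` is equivariant. -/
lemma map_pairRep {B' C' : Type u} [Ring B'] [Algebra k B'] [Ring C'] [Algebra k C']
    (ρ : B →ₐ[k] Module.End k M) (σ : C →ₐ[k] Module.End k N)
    (ρ' : B' →ₐ[k] Module.End k M') (σ' : C' →ₐ[k] Module.End k N')
    (φ : B →ₗ[k] B') (ψ : C →ₗ[k] C') (f : M →ₗ[k] M') (g : N →ₗ[k] N')
    (hf : ∀ b m, f (ρ b m) = ρ' (φ b) (f m)) (hg : ∀ b m, g (σ b m) = σ' (ψ b) (g m))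
    (z : B ⊗[k] C) (t : M ⊗[k] N) :
    TensorProduct.map f g (pairRep ρ σ z t) =
      pairRep ρ' σ' (TensorProduct.map φ ψ z) (TensorProduct.map f g t) := by
  induction z with
  | zero => simp
  | add z w hz hw => simp [hz, hw]
  | tmul b c =>
    induction t with
    | zero => simp
    | add z w hz hw => simp only [map_add, hz, hw]
    | tmul m n => simp [hf, hg]

lemma assoc_pairRep (ρ : B →ₐ[k] Module.End k M) (σ : C →ₐ[k] Module.End k N)
    (τ : D →ₐ[k] Module.End k P) (z : (B ⊗[k] C) ⊗[k] D) (t : (M ⊗[k] N) ⊗[k] P) :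
    TensorProduct.assoc k M N P (pairRep (pairRep ρ σ) τ z t) =
      pairRep ρ (pairRep σ τ) (TensorProduct.assoc k B C D z) (TensorProduct.assoc k M N P t) := by
  induction z with
  | zero => simp
  | add z w hz hw => simp [hz, hw]
  | tmul bc d =>
  induction bc with
  | zero => simp
  | add z w hz hw => simp only [TensorProduct.add_tmul, map_add, LinearMap.add_apply, hz, hw]
  | tmul b c =>
  induction t with
  | zero => simp
  | add z w hz hw => simp only [map_add, hz, hw]
  | tmul mn p =>
  induction mn with
  | zero => simp
  | add z w hz hw => simp only [TensorProduct.add_tmul, map_add, hz, hw]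
  | tmul m n => simp

lemma comm_pairRep (ρ : B →ₐ[k] Module.End k M) (σ : C →ₐ[k] Module.End k N)
    (z : B ⊗[k] C) (t : M ⊗[k] N) :
    TensorProduct.comm k M N (pairRep ρ σ z t) =
      pairRep σ ρ (TensorProduct.comm k B C z) (TensorProduct.comm k M N t) := by
  induction z with
  | zero => simp
  | add z w hz hw => simp [hz, hw]
  | tmul b c =>
    induction t with
    | zero => simp
    | add z w hz hw => simp only [map_add, hz, hw]
    | tmul m n => simp

/-- `z ↦ z₁₂ = z¹ ⊗ z² ⊗ 1` -/
def leg12 (B : Type u) [Ring B] [Algebra k B] : B ⊗[k] B →ₗ[k] B ⊗[k] (B ⊗[k] B) :=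
  (TensorProduct.assoc k B B B).toLinearMap ∘ₗ (TensorProduct.mk k (B ⊗[k] B) B).flip 1
/-- `z ↦ z₂₃ = 1 ⊗ z¹ ⊗ z²` -/
def leg23 (B : Type u) [Ring B] [Algebra k B] : B ⊗[k] B →ₗ[k] B ⊗[k] (B ⊗[k] B) :=
  TensorProduct.mk k B (B ⊗[k] B) 1
/-- `z ↦ z₁₃ = z¹ ⊗ 1 ⊗ z²` -/
def leg13 (B : Type u) [Ring B] [Algebra k B] : B ⊗[k] B →ₗ[k] B ⊗[k] (B ⊗[k] B) :=
  (TensorProduct.leftComm k B B B).toLinearMap ∘ₗ TensorProduct.mk k B (B ⊗[k] B) 1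

@[simp] lemma leg12_tmul (a b : B) : leg12 (k := k) B (a ⊗ₜ b) = a ⊗ₜ (b ⊗ₜ 1) := rfl
@[simp] lemma leg23_tmul (a b : B) : leg23 (k := k) B (a ⊗ₜ b) = 1 ⊗ₜ (a ⊗ₜ b) := rfl
@[simp] lemma leg13_tmul (a b : B) : leg13 (k := k) B (a ⊗ₜ b) = a ⊗ₜ (1 ⊗ₜ b) := rfl
lemma leg23_apply (z : B ⊗[k] B) : leg23 (k := k) B z = 1 ⊗ₜ z := rfl
lemma leg12_apply (z : B ⊗[k] B) :
    leg12 (k := k) B z = TensorProduct.assoc k B B B (z ⊗ₜ 1) := rfl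

end pair


/-! ### Quasi-triangular Hopf algebras and their module categories -/

section hexagon
variable {k : Type u} [Field k] {B : Type u} [Ring B] [Algebra k B]
variable {M N P : Type u} [AddCommGroup M] [Module k M] [AddCommGroup N] [Module k N]
  [AddCommGroup P] [Module k P]

/-- The map `m ⊗ n ↦ z² n ⊗ z¹ m`. -/
def flipAct (ρ : B →ₐ[k] Module.End k M) (σ : B →ₐ[k] Module.End k N) (z : B ⊗[k] B) :
    M ⊗[k] N →ₗ[k] N ⊗[k] M :=
  (TensorProduct.comm k M N).toLinearMap ∘ₗ pairRep ρ σ z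

lemma flipAct_apply (ρ : B →ₐ[k] Module.End k M) (σ : B →ₐ[k] Module.End k N) (z : B ⊗[k] B)
    (t : M ⊗[k] N) : flipAct ρ σ z t = TensorProduct.comm k M N (pairRep ρ σ z t) := rfl

lemma hexagon_aux₁ (ρ : B →ₐ[k] Module.End k M) (σ : B →ₐ[k] Module.End k N)
    (τ : B →ₐ[k] Module.End k P) (z w : B ⊗[k] B) (t : (M ⊗[k] N) ⊗[k] P) :
    TensorProduct.assoc k N P M (TensorProduct.comm k M (N ⊗[k] P)
      (pairRep ρ (pairRep σ τ) (leg13 B w * leg12 B z) (TensorProduct.assoc k M N P t))) =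
    (flipAct ρ τ w).lTensor N (TensorProduct.assoc k N M P ((flipAct ρ σ z).rTensor P t)) := by
  induction z with
  | zero => simp [flipAct]
  | add z z' hz hw =>
    simp only [map_add, mul_add, LinearMap.add_apply, hz, hw, flipAct, LinearMap.comp_add,
      LinearMap.rTensor_add]
  | tmul a b =>
  induction w with
  | zero => simp [flipAct]
  | add z z' hz hw =>
    simp only [map_add, add_mul, LinearMap.add_apply, hz, hw, flipAct, LinearMap.comp_add,
      LinearMap.lTensor_add]
  | tmul c d =>
  induction t with
  | zero => simp
  | add z w hz hw => simp only [map_add, hz, hw]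
  | tmul mn p =>
  induction mn with
  | zero => simp
  | add z w hz hw => simp only [TensorProduct.add_tmul, map_add, hz, hw]
  | tmul m n => simp [flipAct]

lemma hexagon_aux₂ (ρ : B →ₐ[k] Module.End k M) (σ : B →ₐ[k] Module.End k N)
    (τ : B →ₐ[k] Module.End k P) (z w : B ⊗[k] B) (t : M ⊗[k] (N ⊗[k] P)) :
    (TensorProduct.assoc k P M N).symm (TensorProduct.comm k (M ⊗[k] N) P
      ((TensorProduct.assoc k M N P).symm
        (pairRep ρ (pairRep σ τ) (leg13 B w * leg23 B z) t))) =
    (flipAct ρ τ w).rTensor N ((TensorProduct.assoc k M P N).symm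
      ((flipAct σ τ z).lTensor M t)) := by
  induction z with
  | zero => simp [flipAct]
  | add z z' hz hw =>
    simp only [map_add, mul_add, LinearMap.add_apply, hz, hw, flipAct, LinearMap.comp_add,
      LinearMap.lTensor_add]
  | tmul a b =>
  induction w with
  | zero => simp [flipAct]
  | add z z' hz hw =>
    simp only [map_add, add_mul, LinearMap.add_apply, hz, hw, flipAct, LinearMap.comp_add,
      LinearMap.rTensor_add]
  | tmul c d =>
  induction t with
  | zero => simp
  | add z w hz hw => simp only [map_add, hz, hw]
  | tmul m np =>
  induction np with
  | zero => simp
  | add z w hz hw => simp only [TensorProduct.tmul_add, map_add, hz, hw]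
  | tmul n p => simp [flipAct]

lemma flipAct_naturality {M N M' N' : FDMod k B} (f : M ⟶ M') (g : N ⟶ N') (z : B ⊗[k] B)
    (t : M.carrier ⊗[k] N.carrier) :
    flipAct M'.ρ N'.ρ z (TensorProduct.map (FDMod.lin f) (FDMod.lin g) t) =
      TensorProduct.map (FDMod.lin g) (FDMod.lin f) (flipAct M.ρ N.ρ z t) := by
  have := map_pairRep M.ρ N.ρ M'.ρ N'.ρ LinearMap.id LinearMap.id
      _ _ (FDMod.lin_ρ f) (FDMod.lin_ρ g) z t
  rw [TensorProduct.map_id, LinearMap.id_apply] at this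
  rw [flipAct_apply, ← this, flipAct_apply, TensorProduct.map_comm]

end hexagon

/-- A quasi-triangular structure on a Hopf algebra `H`: an invertible `R ∈ H ⊗ H` with
`R Δ(h) = Δᶜᵒᵖ(h) R`, `(Δ ⊗ id) R = R₁₃ R₂₃` and `(id ⊗ Δ) R = R₁₃ R₁₂`. -/
structure QuasiTriangular (k H : Type u) [Field k] [Ring H] [HopfAlgebra k H] where
  /-- the universal `R`-matrix -/
  R : H ⊗[k] H
  isUnit_R : IsUnit R
  R_mul_comul : ∀ h : H, R * Coalgebra.comul (R := k) h =
    TensorProduct.comm k H H (Coalgebra.comul (R := k) h) * R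
  comul_rTensor_R : TensorProduct.assoc k H H H ((Coalgebra.comul (R := k)).rTensor H R) =
    leg13 H R * leg23 H R
  comul_lTensor_R : (Coalgebra.comul (R := k)).lTensor H R = leg13 H R * leg12 H R

/-- The category of finite-dimensional left modules over a quasi-triangular Hopf algebra. -/
def QuasiTriangular.ModCat {k H : Type u} [Field k] [Ring H] [HopfAlgebra k H]
    (_ : QuasiTriangular k H) : Type (u + 1) := FDMod k H

namespace QuasiTriangular
variable {k H : Type u} [Field k] [Ring H] [HopfAlgebra k H] (Q : QuasiTriangular k H)

instance : Category Q.ModCat := inferInstanceAs (Category (FDMod k H))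
instance : Preadditive Q.ModCat := inferInstanceAs (Preadditive (FDMod k H))
instance : Linear k Q.ModCat := inferInstanceAs (Linear k (FDMod k H))

/-- `M ⊗ N` with `h (m ⊗ n) = h₁ m ⊗ h₂ n`. -/
abbrev tensor (M N : FDMod k H) : FDMod k H where
  carrier := M.carrier ⊗[k] N.carrier
  ρ := (pairRep M.ρ N.ρ).comp (Bialgebra.comulAlgHom k H)

lemma tensor_ρ (M N : FDMod k H) (h : H) (t : M.carrier ⊗[k] N.carrier) :
    (tensor M N).ρ h t = pairRep M.ρ N.ρ (Coalgebra.comul (R := k) h) t := rfl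

/-- The trivial module `k` with `h c = ε(h) c`. -/
abbrev unit (k H : Type u) [Field k] [Ring H] [HopfAlgebra k H] : FDMod k H where
  carrier := k
  ρ := (Algebra.ofId k (Module.End k k)).comp (Bialgebra.counitAlgHom k H)

lemma unit_ρ (h : H) (c : k) :
    (unit k H).ρ h c = Coalgebra.counit (R := k) h * c := rfl

/-- `f ⊗ g` -/
def tensorMap {M N M' N' : FDMod k H} (f : M ⟶ M') (g : N ⟶ N') : tensor M N ⟶ tensor M' N' :=
  FDMod.ofLin (TensorProduct.map (FDMod.lin f) (FDMod.lin g)) (fun b t => by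
    rw [tensor_ρ, tensor_ρ, map_pairRep M.ρ N.ρ M'.ρ N'.ρ LinearMap.id LinearMap.id
      _ _ (FDMod.lin_ρ f) (FDMod.lin_ρ g)]
    simp)

lemma pairRep_tensor_left (M N P : FDMod k H) (z : H ⊗[k] H)
    (t : (M.carrier ⊗[k] N.carrier) ⊗[k] P.carrier) :
    pairRep (tensor M N).ρ P.ρ z t =
      pairRep (pairRep M.ρ N.ρ) P.ρ ((Coalgebra.comul (R := k)).rTensor H z) t := by
  have := map_pairRep (tensor M N).ρ P.ρ (pairRep M.ρ N.ρ) P.ρ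
    (Coalgebra.comul (R := k)) LinearMap.id LinearMap.id LinearMap.id (fun _ _ => rfl)
    (fun _ _ => rfl) z t
  simp only [TensorProduct.map_id] at this
  exact this

lemma pairRep_tensor_right (M N P : FDMod k H) (z : H ⊗[k] H)
    (t : M.carrier ⊗[k] (N.carrier ⊗[k] P.carrier)) :
    pairRep M.ρ (tensor N P).ρ z t =
      pairRep M.ρ (pairRep N.ρ P.ρ) ((Coalgebra.comul (R := k)).lTensor H z) t := by
  have := map_pairRep M.ρ (tensor N P).ρ M.ρ (pairRep N.ρ P.ρ) LinearMap.id
    (Coalgebra.comul (R := k)) LinearMap.id LinearMap.id (fun _ _ => rfl)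
    (fun _ _ => rfl) z t
  simp only [TensorProduct.map_id] at this
  exact this

/-- The associativity isomorphism of vector spaces. -/
def associator (M N P : FDMod k H) : tensor (tensor M N) P ≅ tensor M (tensor N P) :=
  FDMod.isoOfEquiv (M := tensor (tensor M N) P) (N := tensor M (tensor N P))
    (TensorProduct.assoc k M.carrier N.carrier P.carrier) (fun h t => by
      rw [tensor_ρ, tensor_ρ, pairRep_tensor_left, pairRep_tensor_right]
      refine (assoc_pairRep M.ρ N.ρ P.ρ _ t).trans ?_
      rw [Coalgebra.coassoc_apply])

/-- `k ⊗ M ≅ M` -/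
def leftUnitor (M : FDMod k H) : tensor (unit k H) M ≅ M :=
  FDMod.isoOfEquiv (M := tensor (unit k H) M) (N := M)
    (TensorProduct.lid k M.carrier) (fun h (t : k ⊗[k] M.carrier) => by
      rw [tensor_ρ]
      have key : ∀ z : H ⊗[k] H, TensorProduct.lid k M.carrier (pairRep (unit k H).ρ M.ρ z t) =
          M.ρ (TensorProduct.lid k H ((Coalgebra.counit (R := k)).rTensor H z))
            (TensorProduct.lid k M.carrier t) := by
        intro z
        induction z with
        | zero => simp
        | add z w hz hw => simp only [map_add, LinearMap.add_apply, hz, hw]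
        | tmul a b =>
        induction t with
        | zero => simp
        | add z w hz hw => simp only [map_add, hz, hw]
        | tmul c m =>
          rw [pairRep_tmul_tmul, unit_ρ]
          simp [mul_smul, smul_comm c]
      rw [key, Coalgebra.rTensor_counit_comul]
      simp)

/-- `M ⊗ k ≅ M` -/
def rightUnitor (M : FDMod k H) : tensor M (unit k H) ≅ M :=
  FDMod.isoOfEquiv (M := tensor M (unit k H)) (N := M)
    (TensorProduct.rid k M.carrier) (fun h (t : M.carrier ⊗[k] k) => by
      rw [tensor_ρ]
      have key : ∀ z : H ⊗[k] H, TensorProduct.rid k M.carrier (pairRep M.ρ (unit k H).ρ z t) =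
          M.ρ (TensorProduct.rid k H ((Coalgebra.counit (R := k)).lTensor H z))
            (TensorProduct.rid k M.carrier t) := by
        intro z
        induction z with
        | zero => simp
        | add z w hz hw => simp only [map_add, LinearMap.add_apply, hz, hw]
        | tmul a b =>
        induction t with
        | zero => simp
        | add z w hz hw => simp only [map_add, hz, hw]
        | tmul m c =>
          rw [pairRep_tmul_tmul, unit_ρ]
          simp [mul_smul, smul_comm c]
      rw [key, Coalgebra.lTensor_counit_comul]
      simp)

instance : MonoidalCategoryStruct Q.ModCat where
  tensorObj M N := tensor (k := k) (H := H) M N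
  whiskerLeft M _ _ f := tensorMap (𝟙 M) f
  whiskerRight f N := tensorMap f (𝟙 N)
  tensorHom f g := tensorMap f g
  tensorUnit := unit k H
  associator M N P := associator (k := k) (H := H) M N P
  leftUnitor M := leftUnitor (k := k) (H := H) M
  rightUnitor M := rightUnitor (k := k) (H := H) M

instance : MonoidalCategory Q.ModCat := MonoidalCategory.ofTensorHom
  (id_tensorHom_id := fun (M N : FDMod k H) => FDMod.hom_ext (M := tensor M N)
    (N := tensor M N) TensorProduct.map_id)
  (id_tensorHom := fun _ _ _ _ => rfl)
  (tensorHom_id := fun _ _ => rfl)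
  (tensorHom_comp_tensorHom := fun {M₁ _ P₁ M₂ _ P₂ : FDMod k H} f₁ f₂ g₁ g₂ =>
    FDMod.hom_ext (M := tensor M₁ M₂) (N := tensor P₁ P₂)
      (TensorProduct.map_comp (FDMod.lin (k := k) (B := H) g₁) (FDMod.lin (k := k) (B := H) g₂)
        (FDMod.lin (k := k) (B := H) f₁) (FDMod.lin (k := k) (B := H) f₂)).symm)
  (associator_naturality := fun {M N P M' N' P' : FDMod k H} _ _ _ =>
    FDMod.hom_ext (M := tensor (tensor M N) P) (N := tensor M' (tensor N' P'))
      (TensorProduct.ext_threefold (fun _ _ _ => rfl)))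
  (leftUnitor_naturality := fun {M N : FDMod k H} f =>
    FDMod.hom_ext (M := tensor (unit k H) M) (N := N) (TensorProduct.ext' (fun c m =>
      (map_smul (FDMod.lin (k := k) (B := H) f) c m).symm)))
  (rightUnitor_naturality := fun {M N : FDMod k H} f =>
    FDMod.hom_ext (M := tensor M (unit k H)) (N := N) (TensorProduct.ext' (fun m c =>
      (map_smul (FDMod.lin (k := k) (B := H) f) c m).symm)))
  (pentagon := fun (M N P O : FDMod k H) =>
    FDMod.hom_ext (M := tensor (tensor (tensor M N) P) O) (N := tensor M (tensor N (tensor P O)))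
      (TensorProduct.ext_fourfold (fun _ _ _ _ => rfl)))
  (triangle := fun (M N : FDMod k H) =>
    FDMod.hom_ext (M := tensor (tensor M (unit k H)) N) (N := tensor M N)
      (TensorProduct.ext_threefold (fun m (c : k) n => (TensorProduct.smul_tmul c m n).symm)))

/-- The braiding `m ⊗ n ↦ R² n ⊗ R¹ m`. -/
def braid (M N : FDMod k H) : tensor M N ≅ tensor N M where
  hom := FDMod.ofLin (M := tensor M N) (N := tensor N M) (flipAct M.ρ N.ρ Q.R) (fun h t => by
    rw [tensor_ρ, tensor_ρ, flipAct_apply, flipAct_apply, ← pairRep_mul, Q.R_mul_comul,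
      pairRep_mul, comm_pairRep]
    congr 2
    simp)
  inv := FDMod.ofLin (M := tensor N M) (N := tensor M N)
    (pairRep M.ρ N.ρ ↑(Q.isUnit_R.unit⁻¹) ∘ₗ
      (TensorProduct.comm k N.carrier M.carrier).toLinearMap) (fun h t => by
    have e := Q.isUnit_R.val_inv_mul
    have e' := Q.isUnit_R.mul_val_inv
    have key : (↑(Q.isUnit_R.unit⁻¹) : H ⊗[k] H) *
        TensorProduct.comm k H H (Coalgebra.comul (R := k) h) =
        Coalgebra.comul (R := k) h * ↑(Q.isUnit_R.unit⁻¹) := by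
      calc _ = ↑(Q.isUnit_R.unit⁻¹) * (TensorProduct.comm k H H (Coalgebra.comul (R := k) h) *
            Q.R) * ↑(Q.isUnit_R.unit⁻¹) := by
              rw [mul_assoc, mul_assoc, e', mul_one]
        _ = _ := by rw [← Q.R_mul_comul, ← mul_assoc, e, one_mul]
    rw [tensor_ρ, tensor_ρ, LinearMap.comp_apply, LinearMap.comp_apply, LinearEquiv.coe_coe,
      comm_pairRep, ← pairRep_mul, key, pairRep_mul])
  hom_inv_id := FDMod.hom_ext (LinearMap.ext fun t => by
    have e := Q.isUnit_R.val_inv_mul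
    simp only [FDMod.lin_comp, FDMod.lin_ofLin, LinearMap.comp_apply, flipAct_apply,
      LinearEquiv.coe_coe, TensorProduct.comm_comm, FDMod.lin_id, LinearMap.id_apply]
    rw [← pairRep_mul, e, map_one]; rfl)
  inv_hom_id := FDMod.hom_ext (LinearMap.ext fun t => by
    have e := Q.isUnit_R.mul_val_inv
    simp only [FDMod.lin_comp, FDMod.lin_ofLin, LinearMap.comp_apply, flipAct_apply,
      LinearEquiv.coe_coe, FDMod.lin_id, LinearMap.id_apply]
    rw [← pairRep_mul, e, map_one]
    exact TensorProduct.comm_comm _ _ _ _)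

instance : BraidedCategory Q.ModCat where
  braiding M N := Q.braid M N
  braiding_naturality_right := fun (M : FDMod k H) {N P : FDMod k H} f =>
    FDMod.hom_ext (M := tensor M N) (N := tensor P M) (LinearMap.ext fun t =>
      flipAct_naturality (𝟙 M) f Q.R t)
  braiding_naturality_left := fun {M N : FDMod k H} f (P : FDMod k H) =>
    FDMod.hom_ext (M := tensor M P) (N := tensor P N) (LinearMap.ext fun t =>
      flipAct_naturality f (𝟙 P) Q.R t)
  hexagon_forward := fun (M N P : FDMod k H) =>
    FDMod.hom_ext (M := tensor (tensor M N) P) (N := tensor N (tensor P M))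
      (LinearMap.ext fun t => by
        have := hexagon_aux₁ M.ρ N.ρ P.ρ Q.R Q.R t
        rw [← Q.comul_lTensor_R, ← pairRep_tensor_right] at this
        exact this)
  hexagon_reverse := fun (M N P : FDMod k H) =>
    FDMod.hom_ext (M := tensor M (tensor N P)) (N := tensor (tensor P M) N)
      (LinearMap.ext fun t => by
        have := hexagon_aux₂ M.ρ N.ρ P.ρ Q.R Q.R t
        rw [← Q.comul_rTensor_R] at this
        have e := assoc_pairRep M.ρ N.ρ P.ρ ((Coalgebra.comul (R := k)).rTensor H Q.R)
          ((TensorProduct.assoc k _ _ _).symm t)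
        rw [LinearEquiv.apply_symm_apply] at e
        rw [← e, LinearEquiv.symm_apply_apply, ← pairRep_tensor_left] at this
        exact this)

end QuasiTriangular

/-! ### Weak bialgebras and quasi-triangular weak Hopf algebras -/

/-- A weak bialgebra structure on a `k`-algebra `B`: a coalgebra structure `(Δ, ε)` such that `Δ` is
multiplicative and
`(Δ ⊗ id) Δ(1) = (Δ(1) ⊗ 1)(1 ⊗ Δ(1)) = (1 ⊗ Δ(1))(Δ(1) ⊗ 1)`,
`ε(abc) = ε(a b₁) ε(b₂ c) = ε(a b₂) ε(b₁ c)`. -/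
structure WeakBialgebra (k B : Type u) [Field k] [Ring B] [Algebra k B] where
  /-- the coproduct -/
  comul : B →ₗ[k] B ⊗[k] B
  /-- the counit -/
  counit : B →ₗ[k] k
  coassoc : ∀ b, TensorProduct.assoc k B B B (comul.rTensor B (comul b)) =
    comul.lTensor B (comul b)
  counit_comul : ∀ b, TensorProduct.lid k B (counit.rTensor B (comul b)) = b
  comul_counit : ∀ b, TensorProduct.rid k B (counit.lTensor B (comul b)) = b
  comul_mul : ∀ a b, comul (a * b) = comul a * comul b
  comul_one₁ : comul.lTensor B (comul 1) = leg12 B (comul 1) * leg23 B (comul 1)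
  comul_one₂ : comul.lTensor B (comul 1) = leg23 B (comul 1) * leg12 B (comul 1)
  counit_mul₁ : ∀ a b c, counit (a * b * c) =
    LinearMap.mul' k k (TensorProduct.map (counit ∘ₗ LinearMap.mulLeft k a)
      (counit ∘ₗ LinearMap.mulRight k c) (comul b))
  counit_mul₂ : ∀ a b c, counit (a * b * c) =
    LinearMap.mul' k k (TensorProduct.map (counit ∘ₗ LinearMap.mulRight k c)
      (counit ∘ₗ LinearMap.mulLeft k a) (comul b))

namespace WeakBialgebra
variable {k B : Type u} [Field k] [Ring B] [Algebra k B] (W : WeakBialgebra k B)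

/-- The target counital map `ε_t(b) = ε(1₁ b) 1₂`. -/
def εt : B →ₗ[k] B where
  toFun b := TensorProduct.lid k B ((W.counit ∘ₗ LinearMap.mulRight k b).rTensor B (W.comul 1))
  map_add' b c := by
    rw [← map_add, ← LinearMap.add_apply, ← LinearMap.rTensor_add, ← LinearMap.comp_add]
    congr 4; ext; simp [mul_add]
  map_smul' r b := by
    rw [RingHom.id_apply, ← map_smul, ← LinearMap.smul_apply, ← LinearMap.rTensor_smul,
      ← LinearMap.comp_smul]
    congr 4; ext; simp

/-- The source counital map `ε_s(b) = 1₁ ε(b 1₂)`. -/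
def εs : B →ₗ[k] B where
  toFun b := TensorProduct.rid k B ((W.counit ∘ₗ LinearMap.mulLeft k b).lTensor B (W.comul 1))
  map_add' b c := by
    rw [← map_add, ← LinearMap.add_apply, ← LinearMap.lTensor_add, ← LinearMap.comp_add]
    congr 4; ext; simp [add_mul]
  map_smul' r b := by
    rw [RingHom.id_apply, ← map_smul, ← LinearMap.smul_apply, ← LinearMap.lTensor_smul,
      ← LinearMap.comp_smul]
    congr 4; ext; simp

lemma εt_apply (b : B) : W.εt b =
    TensorProduct.lid k B ((W.counit ∘ₗ LinearMap.mulRight k b).rTensor B (W.comul 1)) := rfl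
lemma εs_apply (b : B) : W.εs b =
    TensorProduct.rid k B ((W.counit ∘ₗ LinearMap.mulLeft k b).lTensor B (W.comul 1)) := rfl

lemma comul_one_mul (b : B) : W.comul 1 * W.comul b = W.comul b := by
  rw [← W.comul_mul, one_mul]
lemma comul_mul_one (b : B) : W.comul b * W.comul 1 = W.comul b := by
  rw [← W.comul_mul, mul_one]

/-- `ε(a ε_t(b)) = ε(a b)` -/
lemma counit_mul_εt (a b : B) : W.counit (a * W.εt b) = W.counit (a * b) := by
  have h := W.counit_mul₂ a 1 b
  rw [mul_one] at h
  rw [h, εt_apply]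
  generalize W.comul 1 = z
  induction z with
  | zero => simp
  | add z w hz hw => simp only [map_add, mul_add, hz, hw]
  | tmul c d => simp

lemma εt_mul_εt (a b : B) : W.εt (a * W.εt b) = W.εt (a * b) := by
  have : W.counit ∘ₗ LinearMap.mulRight k (a * W.εt b) =
      W.counit ∘ₗ LinearMap.mulRight k (a * b) := by
    ext c
    simp [counit_mul_εt]
  rw [W.εt_apply (a * W.εt b), this, ← W.εt_apply]

lemma εt_εt (b : B) : W.εt (W.εt b) = W.εt b := by
  simpa using W.εt_mul_εt 1 b

/-- `ε(b₁ c) b₂ = b ε_t(c)` -/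
lemma counit_mul_comul (b c : B) :
    TensorProduct.lid k B ((W.counit ∘ₗ LinearMap.mulRight k c).rTensor B (W.comul b)) =
      b * W.εt c := by
  let Φ : B ⊗[k] B → B ⊗[k] (B ⊗[k] B) →ₗ[k] B := fun w =>
    (TensorProduct.lid k B).toLinearMap ∘ₗ
      TensorProduct.map (W.counit ∘ₗ LinearMap.mulRight k c)
        ((TensorProduct.lid k B).toLinearMap ∘ₗ W.counit.rTensor B ∘ₗ LinearMap.mulLeft k w)
  have h1 : ∀ z, Φ (W.comul b) (W.comul.lTensor B z) = b *
      TensorProduct.lid k B ((W.counit ∘ₗ LinearMap.mulRight k c).rTensor B z) := by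
    intro z
    induction z with
    | zero => simp
    | add z w hz hw => simp only [map_add, mul_add, hz, hw]
    | tmul p q => simp [Φ, ← W.comul_mul, W.counit_comul]
  have h2 : ∀ z, Φ (W.comul b) (leg23 B (W.comul 1) * leg12 B z) =
      Φ (W.comul b) (leg12 B z) := by
    intro z
    induction z with
    | zero => simp
    | add z w hz hw => simp only [map_add, mul_add, hz, hw]
    | tmul p q =>
      rw [leg23_apply, leg12_tmul, Algebra.TensorProduct.tmul_mul_tmul, one_mul]
      simp [Φ, ← mul_assoc, W.comul_mul_one]
  have h3 : ∀ w, Φ w (leg12 B (W.comul 1)) =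
      TensorProduct.lid k B ((W.counit ∘ₗ LinearMap.mulRight k c).rTensor B w) := by
    intro w
    induction w with
    | zero => simp [Φ]
    | add z w hz hw =>
      have : Φ (z + w) = Φ z + Φ w := by
        apply TensorProduct.ext'
        intro x y
        simp [Φ, add_mul]
      rw [this, LinearMap.add_apply, hz, hw, map_add, map_add]
    | tmul d e =>
      have h := W.counit_mul₂ d 1 c
      rw [mul_one] at h
      simp only [LinearMap.rTensor_tmul, TensorProduct.lid_tmul, LinearMap.comp_apply,
        LinearMap.mulRight_apply, h]
      generalize W.comul 1 = z
      induction z with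
      | zero => simp
      | add z w hz hw => simp only [map_add, add_smul, hz, hw]
      | tmul p q => simp [Φ, mul_smul, smul_comm (W.counit (d * q))]
  rw [εt_apply, ← h1, W.comul_one₂, h2, h3]

/-- `b₁ ε(b₂ z) = b 1₁ ε(1₂ z)` -/
lemma comul_counit_mul (b c : B) :
    TensorProduct.rid k B ((W.counit ∘ₗ LinearMap.mulRight k c).lTensor B (W.comul b)) =
      b * TensorProduct.rid k B
        ((W.counit ∘ₗ LinearMap.mulRight k c).lTensor B (W.comul 1)) := by
  let Φ : B ⊗[k] B → B ⊗[k] (B ⊗[k] B) →ₗ[k] B := fun w =>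
    (TensorProduct.rid k B).toLinearMap ∘ₗ
      TensorProduct.map
        ((TensorProduct.rid k B).toLinearMap ∘ₗ W.counit.lTensor B ∘ₗ LinearMap.mulLeft k w)
        (W.counit ∘ₗ LinearMap.mulRight k c) ∘ₗ (TensorProduct.assoc k B B B).symm.toLinearMap
  have h1 : ∀ z, Φ (W.comul b) (TensorProduct.assoc k B B B (W.comul.rTensor B z)) = b *
      TensorProduct.rid k B ((W.counit ∘ₗ LinearMap.mulRight k c).lTensor B z) := by
    intro z
    induction z with
    | zero => simp
    | add z w hz hw => simp only [map_add, mul_add, hz, hw]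
    | tmul p q => simp [Φ, ← W.comul_mul, W.comul_counit]
  have h0 : ∀ (z : B ⊗[k] B) (q r : B), leg12 B z * (1 ⊗ₜ (q ⊗ₜ r)) =
      TensorProduct.assoc k B B B ((z * (1 ⊗ₜ q)) ⊗ₜ r) := by
    intro z q r
    induction z with
    | zero => simp
    | add z w hz hw => simp only [map_add, add_mul, TensorProduct.add_tmul, hz, hw]
    | tmul x y => simp
  have h2 : ∀ z, Φ (W.comul b) (leg12 B (W.comul 1) * leg23 B z) =
      Φ (W.comul b) (leg23 B z) := by
    intro z
    induction z with
    | zero => simp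
    | add z w hz hw => simp only [map_add, mul_add, hz, hw]
    | tmul p q =>
      rw [leg23_tmul, h0]
      simp [Φ, ← mul_assoc, W.comul_mul_one]
  have h3 : ∀ w, Φ w (leg23 B (W.comul 1)) =
      TensorProduct.rid k B ((W.counit ∘ₗ LinearMap.mulRight k c).lTensor B w) := by
    intro w
    induction w with
    | zero => simp [Φ]
    | add z w hz hw =>
      have : Φ (z + w) = Φ z + Φ w := by
        apply TensorProduct.ext_threefold'
        intro x y t
        simp [Φ, add_mul, TensorProduct.add_tmul]
      rw [this, LinearMap.add_apply, hz, hw, map_add, map_add]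
    | tmul d e =>
      have h := W.counit_mul₁ e 1 c
      rw [mul_one] at h
      simp only [LinearMap.lTensor_tmul, TensorProduct.rid_tmul, LinearMap.comp_apply,
        LinearMap.mulRight_apply, h]
      generalize W.comul 1 = z
      induction z with
      | zero => simp
      | add z w hz hw => simp only [map_add, add_smul, hz, hw]
      | tmul p q => simp [Φ, mul_smul, smul_comm (W.counit (q * c))]
  rw [← h1, W.coassoc, W.comul_one₁, h2, h3]

/-- `ε_t(p d) = ε_t(p₁) ε(p₂ d)` -/
lemma εt_mul (p d : B) : W.εt (p * d) =
    W.εt (TensorProduct.rid k B ((W.counit ∘ₗ LinearMap.mulRight k d).lTensor B (W.comul p))) := by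
  rw [εt_apply, εt_apply]
  have : W.counit ∘ₗ LinearMap.mulRight k (p * d) = W.counit ∘ₗ LinearMap.mulRight k
      (TensorProduct.rid k B ((W.counit ∘ₗ LinearMap.mulRight k d).lTensor B (W.comul p))) := by
    ext a
    simp only [LinearMap.comp_apply, LinearMap.mulRight_apply, ← mul_assoc, W.counit_mul₁]
    generalize W.comul p = z
    induction z with
    | zero => simp
    | add z w hz hw => simp only [map_add, mul_add, hz, hw]
    | tmul x y => simp [mul_comm]
  rw [this]

/-- `ε_t(h₁) ⊗ h₂ = ε_t(1₁) ⊗ 1₂ h` -/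
lemma εt_rTensor_comul (h : B) :
    W.εt.rTensor B (W.comul h) = W.εt.rTensor B (W.comul 1) * (1 ⊗ₜ h) := by
  let Ω : B ⊗[k] B → B ⊗[k] (B ⊗[k] B) →ₗ[k] B ⊗[k] B := fun w =>
    TensorProduct.map W.εt
      ((TensorProduct.lid k B).toLinearMap ∘ₗ W.counit.rTensor B ∘ₗ LinearMap.mulRight k w)
  have h1 : ∀ w z, Ω w (TensorProduct.assoc k B B B (W.comul.rTensor B z)) =
      W.εt.rTensor B (z * w) := by
    intro w z
    induction z with
    | zero => simp
    | add z w hz hw => simp only [map_add, add_mul, hz, hw]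
    | tmul p q =>
    induction w with
    | zero => simp [Ω]
    | add z w hz hw =>
      have : Ω (z + w) = Ω z + Ω w := by
        apply TensorProduct.ext_threefold'
        intro x y t
        simp [Ω, mul_add, TensorProduct.tmul_add]
      rw [this, LinearMap.add_apply, hz, hw, mul_add, map_add]
    | tmul d e =>
      simp only [Algebra.TensorProduct.tmul_mul_tmul, LinearMap.rTensor_tmul, W.εt_mul p d]
      generalize W.comul p = z
      induction z with
      | zero => simp
      | add z w hz hw => simp only [map_add, TensorProduct.add_tmul, hz, hw]
      | tmul x y => simp [Ω, TensorProduct.smul_tmul]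
  have h2 : ∀ z, Ω (W.comul h) (W.comul.lTensor B z) = W.εt.rTensor B z * (1 ⊗ₜ h) := by
    intro z
    induction z with
    | zero => simp
    | add z w hz hw => simp only [map_add, add_mul, hz, hw]
    | tmul p q => simp [Ω, ← W.comul_mul, W.counit_comul]
  rw [← h2, ← W.coassoc, h1, W.comul_one_mul]

end WeakBialgebra

namespace WeakBialgebra
variable {k B : Type u} [Field k] [Ring B] [Algebra k B] (W : WeakBialgebra k B)

/-- The category of finite-dimensional left modules over a weak bialgebra. -/
def ModCat (_ : WeakBialgebra k B) : Type (u + 1) := FDMod k B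

instance : Category W.ModCat := inferInstanceAs (Category (FDMod k B))

/-- The (non-unital) action `b (m ⊗ n) = b₁ m ⊗ b₂ n` on the full tensor product. -/
def act (M N : FDMod k B) (b : B) : Module.End k (M.carrier ⊗[k] N.carrier) :=
  pairRep M.ρ N.ρ (W.comul b)

lemma act_act (M N : FDMod k B) (b c : B) (t : M.carrier ⊗[k] N.carrier) :
    W.act M N b (W.act M N c t) = W.act M N (b * c) t := by
  rw [act, act, act, ← pairRep_mul, W.comul_mul]

lemma act_one_act (M N : FDMod k B) (b : B) (t : M.carrier ⊗[k] N.carrier) :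
    W.act M N 1 (W.act M N b t) = W.act M N b t := by
  rw [act_act, one_mul]

/-- The space `Δ(1) (M ⊗ N)`. -/
def tensorSpace (M N : FDMod k B) : Submodule k (M.carrier ⊗[k] N.carrier) :=
  LinearMap.range (W.act M N 1)

lemma mem_tensorSpace {M N : FDMod k B} {t : M.carrier ⊗[k] N.carrier} :
    t ∈ W.tensorSpace M N ↔ W.act M N 1 t = t := by
  constructor
  · rintro ⟨s, rfl⟩
    exact W.act_one_act M N 1 s
  · intro h
    exact ⟨t, h⟩

lemma act_mem (M N : FDMod k B) (b : B) (t : M.carrier ⊗[k] N.carrier) :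
    W.act M N b t ∈ W.tensorSpace M N := W.mem_tensorSpace.2 (W.act_one_act M N b t)

/-- The tensor product of modules over a weak bialgebra: the space `Δ(1) (M ⊗ N)` with
`b (m ⊗ n) = b₁ m ⊗ b₂ n`. -/
abbrev tensor (M N : FDMod k B) : FDMod k B where
  carrier := W.tensorSpace M N
  ρ := AlgHom.ofLinearMap
    { toFun := fun b => (W.act M N b).restrict (fun t _ => W.act_mem M N b t)
      map_add' := fun b c => by ext t; simp [act]
      map_smul' := fun r b => by ext t; simp [act] }
    (LinearMap.ext fun t => Subtype.ext (W.mem_tensorSpace.1 t.2))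
    (fun b c => LinearMap.ext fun t => Subtype.ext (W.act_act M N b c t).symm)

lemma tensor_ρ_val (M N : FDMod k B) (b : B) (t : W.tensorSpace M N) :
    (((W.tensor M N).ρ b t : W.tensorSpace M N) : M.carrier ⊗[k] N.carrier) =
      W.act M N b (t : M.carrier ⊗[k] N.carrier) := rfl

/-- The inclusion `Δ(1) (M ⊗ N) → M ⊗ N`. -/
abbrev incl (M N : FDMod k B) : W.tensorSpace M N →ₗ[k] M.carrier ⊗[k] N.carrier :=
  (W.tensorSpace M N).subtype

/-- The projection `t ↦ Δ(1) t`. -/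
def proj (M N : FDMod k B) : M.carrier ⊗[k] N.carrier →ₗ[k] W.tensorSpace M N :=
  (W.act M N 1).rangeRestrict

lemma incl_proj (M N : FDMod k B) (t : M.carrier ⊗[k] N.carrier) :
    W.incl M N (W.proj M N t) = W.act M N 1 t := rfl

lemma proj_incl (M N : FDMod k B) (t : W.tensorSpace M N) :
    W.proj M N (W.incl M N t) = t := Subtype.ext (W.mem_tensorSpace.1 t.2)

/-- `B_t` is finite-dimensional: it is spanned by the second legs of `Δ(1)`. -/
lemma finite_range_εt : Module.Finite k (LinearMap.range W.εt) := by
  obtain ⟨S, hS⟩ := TensorProduct.exists_finset (W.comul 1)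
  have hle : LinearMap.range W.εt ≤ Submodule.span k ((fun p : B × B => p.2) '' (S : Set (B × B))) := by
    rintro _ ⟨b, rfl⟩
    rw [εt_apply, hS, map_sum, map_sum]
    refine Submodule.sum_mem _ fun p hp => ?_
    rw [LinearMap.rTensor_tmul, TensorProduct.lid_tmul]
    exact Submodule.smul_mem _ _ (Submodule.subset_span ⟨p, hp, rfl⟩)
  have : Module.Finite k (Submodule.span k ((fun p : B × B => p.2) '' (S : Set (B × B)))) :=
    Module.Finite.span_of_finite k (S.finite_toSet.image _)
  exact Submodule.finiteDimensional_of_le hle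

/-- The unit object: the target subalgebra `B_t = ε_t(B)` with `b z = ε_t(b z)`. -/
abbrev unit : FDMod k B where
  carrier := LinearMap.range W.εt
  fin := W.finite_range_εt
  ρ := AlgHom.ofLinearMap
    { toFun := fun b => W.εt.rangeRestrict ∘ₗ LinearMap.mulLeft k b ∘ₗ
        (LinearMap.range W.εt).subtype
      map_add' := fun b c => by ext t; simp [add_mul]
      map_smul' := fun r b => by ext t; simp }
    (LinearMap.ext fun t => Subtype.ext (by
      obtain ⟨_, b, rfl⟩ := t
      simp [εt_εt]))
    (fun b c => LinearMap.ext fun t => Subtype.ext (by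
      simp [εt_mul_εt]))

lemma unit_ρ_val (b : B) (z : LinearMap.range W.εt) :
    ((W.unit.ρ b z : LinearMap.range W.εt) : B) = W.εt (b * (z : B)) := rfl

lemma map_act {M N M' N' : FDMod k B} (f : M ⟶ M') (g : N ⟶ N') (b : B)
    (t : M.carrier ⊗[k] N.carrier) :
    TensorProduct.map (FDMod.lin f) (FDMod.lin g) (W.act M N b t) =
      W.act M' N' b (TensorProduct.map (FDMod.lin f) (FDMod.lin g) t) := by
  have := map_pairRep M.ρ N.ρ M'.ρ N'.ρ LinearMap.id LinearMap.id
      _ _ (FDMod.lin_ρ f) (FDMod.lin_ρ g) (W.comul b) t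
  rw [TensorProduct.map_id, LinearMap.id_apply] at this
  exact this

/-- `f ⊗ g`, restricted to `Δ(1) (M ⊗ N)`. -/
def tensorMap {M N M' N' : FDMod k B} (f : M ⟶ M') (g : N ⟶ N') :
    W.tensor M N ⟶ W.tensor M' N' :=
  FDMod.ofLin (M := W.tensor M N) (N := W.tensor M' N')
    ((TensorProduct.map (FDMod.lin f) (FDMod.lin g)).restrict (fun t ht => by
      rw [mem_tensorSpace] at ht ⊢
      rw [← map_act, ht]))
    (fun b t => Subtype.ext (W.map_act f g b (t : M.carrier ⊗[k] N.carrier)))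

lemma tensorMap_val {M N M' N' : FDMod k B} (f : M ⟶ M') (g : N ⟶ N') (t : W.tensorSpace M N) :
    W.incl M' N' (FDMod.lin (W.tensorMap f g) t) =
      TensorProduct.map (FDMod.lin f) (FDMod.lin g) (W.incl M N t) := rfl

/-! #### Associativity -/

/-- `(id ⊗ Δ) Δ(b)` acting on `M ⊗ (N ⊗ P)`. -/
def act₃ (M N P : FDMod k B) (b : B) :
    Module.End k (M.carrier ⊗[k] (N.carrier ⊗[k] P.carrier)) :=
  pairRep M.ρ (pairRep N.ρ P.ρ) (W.comul.lTensor B (W.comul b))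

/-- `M ⊠ (N ⊠ P) → M ⊗ (N ⊗ P)` -/
def inclR (M N P : FDMod k B) : W.tensorSpace M (W.tensor N P) →ₗ[k]
    M.carrier ⊗[k] (N.carrier ⊗[k] P.carrier) :=
  (W.incl N P).lTensor M.carrier ∘ₗ W.incl M (W.tensor N P)

/-- `(M ⊠ N) ⊠ P → (M ⊗ N) ⊗ P` -/
def inclL (M N P : FDMod k B) : W.tensorSpace (W.tensor M N) P →ₗ[k]
    (M.carrier ⊗[k] N.carrier) ⊗[k] P.carrier :=
  (W.incl M N).rTensor P.carrier ∘ₗ W.incl (W.tensor M N) P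

/-- The projection `M ⊗ (N ⊗ P) → M ⊠ (N ⊠ P)`. -/
def projR (M N P : FDMod k B) : M.carrier ⊗[k] (N.carrier ⊗[k] P.carrier) →ₗ[k]
    W.tensorSpace M (W.tensor N P) :=
  W.proj M (W.tensor N P) ∘ₗ (W.proj N P).lTensor M.carrier

/-- The projection `(M ⊗ N) ⊗ P → (M ⊠ N) ⊠ P`. -/
def projL (M N P : FDMod k B) : (M.carrier ⊗[k] N.carrier) ⊗[k] P.carrier →ₗ[k]
    W.tensorSpace (W.tensor M N) P :=
  W.proj (W.tensor M N) P ∘ₗ (W.proj M N).rTensor P.carrier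

lemma lTensor_incl_pairRep (M N P : FDMod k B) (z : B ⊗[k] B)
    (t : M.carrier ⊗[k] W.tensorSpace N P) :
    (W.incl N P).lTensor M.carrier (pairRep M.ρ (W.tensor N P).ρ z t) =
      pairRep M.ρ (pairRep N.ρ P.ρ) (W.comul.lTensor B z) ((W.incl N P).lTensor M.carrier t) :=
  map_pairRep M.ρ (W.tensor N P).ρ M.ρ (pairRep N.ρ P.ρ) LinearMap.id W.comul
    LinearMap.id (W.incl N P) (fun _ _ => rfl) (fun _ _ => rfl) z t

lemma rTensor_incl_pairRep (M N P : FDMod k B) (z : B ⊗[k] B)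
    (t : W.tensorSpace M N ⊗[k] P.carrier) :
    (W.incl M N).rTensor P.carrier (pairRep (W.tensor M N).ρ P.ρ z t) =
      pairRep (pairRep M.ρ N.ρ) P.ρ (W.comul.rTensor B z) ((W.incl M N).rTensor P.carrier t) :=
  map_pairRep (W.tensor M N).ρ P.ρ (pairRep M.ρ N.ρ) P.ρ W.comul LinearMap.id
    (W.incl M N) LinearMap.id (fun _ _ => rfl) (fun _ _ => rfl) z t

lemma inclR_ρ (M N P : FDMod k B) (b : B) (t : W.tensorSpace M (W.tensor N P)) :
    W.inclR M N P ((W.tensor M (W.tensor N P)).ρ b t) = W.act₃ M N P b (W.inclR M N P t) :=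
  W.lTensor_incl_pairRep M N P (W.comul b) _

lemma inclL_ρ (M N P : FDMod k B) (b : B) (t : W.tensorSpace (W.tensor M N) P) :
    TensorProduct.assoc k _ _ _ (W.inclL M N P ((W.tensor (W.tensor M N) P).ρ b t)) =
      W.act₃ M N P b (TensorProduct.assoc k _ _ _ (W.inclL M N P t)) := by
  have h := W.rTensor_incl_pairRep M N P (W.comul b) (W.incl (W.tensor M N) P t)
  have h2 := assoc_pairRep M.ρ N.ρ P.ρ (W.comul.rTensor B (W.comul b)) (W.inclL M N P t)
  rw [W.coassoc] at h2
  exact (congrArg _ h).trans h2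

lemma inclR_injective (M N P : FDMod k B) : Function.Injective (W.inclR M N P) := by
  refine Function.Injective.comp (g := (W.incl N P).lTensor M.carrier) ?_
    (Submodule.injective_subtype _)
  exact Module.Flat.lTensor_preserves_injective_linearMap _ (Submodule.injective_subtype _)

lemma inclL_injective (M N P : FDMod k B) : Function.Injective (W.inclL M N P) := by
  refine Function.Injective.comp (g := (W.incl M N).rTensor P.carrier) ?_
    (Submodule.injective_subtype _)
  exact Module.Flat.rTensor_preserves_injective_linearMap _ (Submodule.injective_subtype _)

lemma pairRep_leg23 (M N P : FDMod k B) (z : B ⊗[k] B)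
    (t : M.carrier ⊗[k] (N.carrier ⊗[k] P.carrier)) :
    pairRep M.ρ (pairRep N.ρ P.ρ) (leg23 B z) t =
      (pairRep N.ρ P.ρ z : Module.End k _).lTensor M.carrier t := by
  rw [leg23_apply, pairRep_tmul, map_one]; rfl

lemma pairRep_leg12 (M N P : FDMod k B) (z : B ⊗[k] B)
    (t : (M.carrier ⊗[k] N.carrier) ⊗[k] P.carrier) :
    pairRep M.ρ (pairRep N.ρ P.ρ) (leg12 B z) (TensorProduct.assoc k _ _ _ t) =
      TensorProduct.assoc k _ _ _ ((pairRep M.ρ N.ρ z : Module.End k _).rTensor P.carrier t) := by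
  rw [leg12_apply, ← assoc_pairRep, pairRep_tmul, map_one]; rfl

lemma leg12_sq : leg12 (k := k) B (W.comul 1) * leg12 B (W.comul 1) = leg12 B (W.comul 1) := by
  have h : ∀ z w : B ⊗[k] B, leg12 (k := k) B z * leg12 B w = leg12 B (z * w) := by
    intro z w
    induction z with
    | zero => simp
    | add z w hz hw => simp only [map_add, add_mul, hz, hw]
    | tmul a b =>
    induction w with
    | zero => simp
    | add z w hz hw => simp only [map_add, mul_add, hz, hw]
    | tmul c d => simp
  rw [h, W.comul_one_mul]

lemma leg23_sq : leg23 (k := k) B (W.comul 1) * leg23 B (W.comul 1) = leg23 B (W.comul 1) := by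
  rw [leg23_apply, Algebra.TensorProduct.tmul_mul_tmul, W.comul_one_mul, one_mul]

lemma inclR_projR (M N P : FDMod k B) (t : M.carrier ⊗[k] (N.carrier ⊗[k] P.carrier)) :
    W.inclR M N P (W.projR M N P t) = W.act₃ M N P 1 t := by
  have h := W.lTensor_incl_pairRep M N P (W.comul 1) ((W.proj N P).lTensor M.carrier t)
  have h2 : (W.incl N P).lTensor M.carrier ((W.proj N P).lTensor M.carrier t) =
      pairRep M.ρ (pairRep N.ρ P.ρ) (leg23 B (W.comul 1)) t := by
    rw [pairRep_leg23, ← LinearMap.comp_apply, ← LinearMap.lTensor_comp]; rfl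
  rw [h2, ← pairRep_mul] at h
  refine h.trans ?_
  rw [act₃, W.comul_one₁, mul_assoc, leg23_sq]

lemma inclL_projL (M N P : FDMod k B) (t : (M.carrier ⊗[k] N.carrier) ⊗[k] P.carrier) :
    TensorProduct.assoc k _ _ _ (W.inclL M N P (W.projL M N P t)) =
      W.act₃ M N P 1 (TensorProduct.assoc k _ _ _ t) := by
  have h := W.rTensor_incl_pairRep M N P (W.comul 1) ((W.proj M N).rTensor P.carrier t)
  have h2 : TensorProduct.assoc k _ _ _
      ((W.incl M N).rTensor P.carrier ((W.proj M N).rTensor P.carrier t)) =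
      pairRep M.ρ (pairRep N.ρ P.ρ) (leg12 B (W.comul 1)) (TensorProduct.assoc k _ _ _ t) := by
    rw [pairRep_leg12, ← LinearMap.comp_apply, ← LinearMap.rTensor_comp]; rfl
  refine (congrArg (TensorProduct.assoc k _ _ _) h).trans ?_
  rw [assoc_pairRep, h2, W.coassoc, ← pairRep_mul, act₃, W.comul_one₂, mul_assoc, leg12_sq]

lemma act₃_inclR (M N P : FDMod k B) (t : W.tensorSpace M (W.tensor N P)) :
    W.act₃ M N P 1 (W.inclR M N P t) = W.inclR M N P t := by
  rw [← inclR_ρ, map_one]; rfl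

lemma act₃_inclL (M N P : FDMod k B) (t : W.tensorSpace (W.tensor M N) P) :
    W.act₃ M N P 1 (TensorProduct.assoc k _ _ _ (W.inclL M N P t)) =
      TensorProduct.assoc k _ _ _ (W.inclL M N P t) := by
  rw [← inclL_ρ, map_one]; rfl

/-- The linear map `(M ⊠ N) ⊠ P → M ⊠ (N ⊠ P)` underlying the associator. -/
def assocLin (M N P : FDMod k B) : W.tensorSpace (W.tensor M N) P →ₗ[k]
    W.tensorSpace M (W.tensor N P) :=
  W.projR M N P ∘ₗ (TensorProduct.assoc k M.carrier N.carrier P.carrier).toLinearMap ∘ₗ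
    W.inclL M N P

/-- The linear map `M ⊠ (N ⊠ P) → (M ⊠ N) ⊠ P` underlying the inverse associator. -/
def assocInvLin (M N P : FDMod k B) : W.tensorSpace M (W.tensor N P) →ₗ[k]
    W.tensorSpace (W.tensor M N) P :=
  W.projL M N P ∘ₗ (TensorProduct.assoc k M.carrier N.carrier P.carrier).symm.toLinearMap ∘ₗ
    W.inclR M N P

/-- The associator is the restriction of the associator of vector spaces. -/
lemma inclR_assocLin (M N P : FDMod k B) (t : W.tensorSpace (W.tensor M N) P) :
    W.inclR M N P (W.assocLin M N P t) = TensorProduct.assoc k _ _ _ (W.inclL M N P t) :=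
  (W.inclR_projR M N P _).trans (W.act₃_inclL M N P t)

lemma inclL_assocInvLin (M N P : FDMod k B) (t : W.tensorSpace M (W.tensor N P)) :
    W.inclL M N P (W.assocInvLin M N P t) =
      (TensorProduct.assoc k _ _ _).symm (W.inclR M N P t) := by
  rw [LinearEquiv.eq_symm_apply]
  refine (W.inclL_projL M N P _).trans ?_
  refine Eq.trans (congrArg _ (LinearEquiv.apply_symm_apply _ _)) (W.act₃_inclR M N P t)

/-- The associativity isomorphism. -/
def associator (M N P : FDMod k B) :
    W.tensor (W.tensor M N) P ≅ W.tensor M (W.tensor N P) :=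
  FDMod.isoOfEquiv (M := W.tensor (W.tensor M N) P) (N := W.tensor M (W.tensor N P))
    (LinearEquiv.ofLinearMap (W.assocLin M N P) (W.assocInvLin M N P)
      (LinearMap.ext fun t => W.inclR_injective M N P (by
        rw [LinearMap.comp_apply, inclR_assocLin, inclL_assocInvLin,
          LinearEquiv.apply_symm_apply]; rfl))
      (LinearMap.ext fun t => W.inclL_injective M N P (by
        rw [LinearMap.comp_apply, inclL_assocInvLin, inclR_assocLin,
          LinearEquiv.symm_apply_apply]; rfl)))
    (fun b t => W.inclR_injective M N P (by
      refine (W.inclR_assocLin M N P _).trans ?_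
      refine (W.inclL_ρ M N P b t).trans ?_
      refine Eq.trans ?_ (W.inclR_ρ M N P b _).symm
      exact congrArg _ (W.inclR_assocLin M N P t).symm))

end WeakBialgebra

namespace WeakBialgebra
variable {k B : Type u} [Field k] [Ring B] [Algebra k B] (W : WeakBialgebra k B)

/-! #### Unit constraints -/

lemma counit_εt (b : B) : W.counit (W.εt b) = W.counit b := by
  simpa using W.counit_mul_εt 1 b

lemma εt_one : W.εt 1 = 1 := by
  rw [εt_apply]
  have : W.counit ∘ₗ LinearMap.mulRight k (1 : B) = W.counit := by ext; simp
  rw [this, W.counit_comul]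

lemma comul_εt (b : B) : W.comul (W.εt b) = W.comul 1 * (W.εt b ⊗ₜ 1) := by
  let Φ : B ⊗[k] (B ⊗[k] B) →ₗ[k] B ⊗[k] B :=
    (TensorProduct.lid k (B ⊗[k] B)).toLinearMap ∘ₗ
      (W.counit ∘ₗ LinearMap.mulRight k b).rTensor (B ⊗[k] B)
  have h1 : ∀ z, Φ (W.comul.lTensor B z) =
      W.comul (TensorProduct.lid k B ((W.counit ∘ₗ LinearMap.mulRight k b).rTensor B z)) := by
    intro z
    induction z with
    | zero => simp
    | add z w hz hw => simp only [map_add, hz, hw]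
    | tmul p q => simp [Φ]
  have h2 : ∀ z, Φ (leg23 B (W.comul 1) * leg12 B z) = W.comul 1 *
      ((TensorProduct.lid k B ((W.counit ∘ₗ LinearMap.mulRight k b).rTensor B z)) ⊗ₜ 1) := by
    intro z
    induction z with
    | zero => simp
    | add z w hz hw => simp only [map_add, mul_add, TensorProduct.add_tmul, hz, hw]
    | tmul p q =>
      rw [leg23_apply, leg12_tmul, Algebra.TensorProduct.tmul_mul_tmul, one_mul]
      simp only [Φ, LinearMap.comp_apply, LinearMap.rTensor_tmul, LinearEquiv.coe_coe,
        TensorProduct.lid_tmul]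
      rw [← TensorProduct.smul_tmul', mul_smul_comm]
  rw [εt_apply, ← h1, W.comul_one₂, h2]

lemma εt_rTensor_mul (b : B) :
    W.εt.rTensor B (W.comul 1 * (W.εt b ⊗ₜ 1)) =
      W.εt.rTensor B (W.comul 1) * (1 ⊗ₜ W.εt b) := by
  rw [← comul_εt, εt_rTensor_comul]

/-- `ε'(z) = 1₁ ε(1₂ z)` -/
def εr (z : B) : B :=
  TensorProduct.rid k B ((W.counit ∘ₗ LinearMap.mulRight k z).lTensor B (W.comul 1))

lemma comul_one_mul_εr (z : B) :
    W.comul 1 * (W.εr z ⊗ₜ 1) = W.comul 1 * (1 ⊗ₜ W.εt z) := by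
  let Ψ : B ⊗[k] (B ⊗[k] B) →ₗ[k] B ⊗[k] B :=
    ((TensorProduct.lid k B).toLinearMap ∘ₗ
      (W.counit ∘ₗ LinearMap.mulRight k z).rTensor B).lTensor B
  have h1 : ∀ w, Ψ (TensorProduct.assoc k B B B (W.comul.rTensor B w)) = w * (W.εr z ⊗ₜ 1) := by
    intro w
    induction w with
    | zero => simp
    | add z w hz hw => simp only [map_add, add_mul, hz, hw]
    | tmul p q =>
      rw [Algebra.TensorProduct.tmul_mul_tmul, mul_one, εr, ← W.comul_counit_mul,
        LinearMap.rTensor_tmul]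
      generalize W.comul p = v
      induction v with
      | zero => simp
      | add z w hz hw => simp only [map_add, TensorProduct.add_tmul, hz, hw]
      | tmul x y => simp [Ψ, TensorProduct.smul_tmul]
  have h2 : ∀ w, Ψ (W.comul.lTensor B w) = w * (1 ⊗ₜ W.εt z) := by
    intro w
    induction w with
    | zero => simp
    | add z w hz hw => simp only [map_add, add_mul, hz, hw]
    | tmul p q =>
      have := W.counit_mul_comul q z
      simp [Ψ, this]
  rw [← h1, ← h2, W.coassoc]

/-- `z ⊗ m ↦ ε(z) m` -/
def lu (M : FDMod k B) : LinearMap.range W.εt ⊗[k] M.carrier →ₗ[k] M.carrier :=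
  (TensorProduct.lid k M.carrier).toLinearMap ∘ₗ
    (W.counit ∘ₗ (LinearMap.range W.εt).subtype).rTensor M.carrier

/-- `m ⊗ z ↦ ε(z) m` -/
def ru (M : FDMod k B) : M.carrier ⊗[k] LinearMap.range W.εt →ₗ[k] M.carrier :=
  (TensorProduct.rid k M.carrier).toLinearMap ∘ₗ
    (W.counit ∘ₗ (LinearMap.range W.εt).subtype).lTensor M.carrier

@[simp] lemma lu_tmul (M : FDMod k B) (z : LinearMap.range W.εt) (m : M.carrier) :
    W.lu M (z ⊗ₜ m) = W.counit (z : B) • m := rfl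
@[simp] lemma ru_tmul (M : FDMod k B) (z : LinearMap.range W.εt) (m : M.carrier) :
    W.ru M (m ⊗ₜ z) = W.counit (z : B) • m := rfl

/-- The element `1 ∈ B_t`. -/
def one_t : LinearMap.range W.εt := ⟨1, 1, W.εt_one⟩

lemma lu_act_tmul (M : FDMod k B) (b : B) (z : LinearMap.range W.εt) (m : M.carrier) :
    W.lu M (W.act W.unit M b (z ⊗ₜ m)) = M.ρ (b * (z : B)) m := by
  have hz : W.εt (z : B) = z := by
    obtain ⟨_, c, rfl⟩ := z
    exact W.εt_εt c
  have key : ∀ w : B ⊗[k] B, W.lu M (pairRep W.unit.ρ M.ρ w (z ⊗ₜ m)) =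
      M.ρ (TensorProduct.lid k B ((W.counit ∘ₗ LinearMap.mulRight k (z : B)).rTensor B w)) m := by
    intro w
    induction w with
    | zero => simp
    | add z w hz hw => simp only [map_add, LinearMap.add_apply, hz, hw]
    | tmul p q =>
      rw [pairRep_tmul_tmul, lu_tmul, unit_ρ_val, counit_εt]
      simp
  rw [act, key, W.counit_mul_comul, hz]

lemma ru_act_tmul (M : FDMod k B) (b : B) (z : LinearMap.range W.εt) (m : M.carrier) :
    W.ru M (W.act M W.unit b (m ⊗ₜ z)) = M.ρ (b * W.εr (z : B)) m := by
  have key : ∀ w : B ⊗[k] B, W.ru M (pairRep M.ρ W.unit.ρ w (m ⊗ₜ z)) =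
      M.ρ (TensorProduct.rid k B ((W.counit ∘ₗ LinearMap.mulRight k (z : B)).lTensor B w)) m := by
    intro w
    induction w with
    | zero => simp
    | add z w hz hw => simp only [map_add, LinearMap.add_apply, hz, hw]
    | tmul p q =>
      rw [pairRep_tmul_tmul, ru_tmul, unit_ρ_val, counit_εt]
      simp
  rw [act, key, W.comul_counit_mul, εr]

lemma lu_act (M : FDMod k B) (b : B) (t : LinearMap.range W.εt ⊗[k] M.carrier) :
    W.lu M (W.act W.unit M b t) = M.ρ b (W.lu M (W.act W.unit M 1 t)) := by
  induction t with
  | zero => simp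
  | add z w hz hw => simp only [map_add, hz, hw]
  | tmul z m => rw [lu_act_tmul, lu_act_tmul, one_mul, map_mul]; rfl

lemma ru_act (M : FDMod k B) (b : B) (t : M.carrier ⊗[k] LinearMap.range W.εt) :
    W.ru M (W.act M W.unit b t) = M.ρ b (W.ru M (W.act M W.unit 1 t)) := by
  induction t with
  | zero => simp
  | add z w hz hw => simp only [map_add, hz, hw]
  | tmul z m => rw [ru_act_tmul, ru_act_tmul, one_mul, map_mul]; rfl

lemma act_one_lu (M : FDMod k B) (t : LinearMap.range W.εt ⊗[k] M.carrier) :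
    W.act W.unit M 1 (W.one_t ⊗ₜ W.lu M (W.act W.unit M 1 t)) = W.act W.unit M 1 t := by
  induction t with
  | zero => simp
  | add z w hz hw => simp only [map_add, TensorProduct.tmul_add, hz, hw]
  | tmul z m =>
    have hinj : Function.Injective ((LinearMap.range W.εt).subtype.rTensor M.carrier) :=
      Module.Flat.rTensor_preserves_injective_linearMap _ (Submodule.injective_subtype _)
    apply hinj
    have key : ∀ (w : B ⊗[k] B) (z : LinearMap.range W.εt) (m : M.carrier),
        (LinearMap.range W.εt).subtype.rTensor M.carrier (pairRep W.unit.ρ M.ρ w (z ⊗ₜ m)) =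
          (M.ρ.toLinearMap.flip m).lTensor B (W.εt.rTensor B (w * ((z : B) ⊗ₜ 1))) := by
      intro w z m
      induction w with
      | zero => simp
      | add z w hz hw => simp only [map_add, add_mul, LinearMap.add_apply, hz, hw]
      | tmul p q =>
        rw [pairRep_tmul_tmul, LinearMap.rTensor_tmul, Submodule.subtype_apply, unit_ρ_val]
        simp
    have key2 : ∀ w : B ⊗[k] B, (M.ρ.toLinearMap.flip (M.ρ (z : B) m)).lTensor B w =
        (M.ρ.toLinearMap.flip m).lTensor B (w * (1 ⊗ₜ (z : B))) := by
      intro w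
      induction w with
      | zero => simp
      | add z w hz hw => simp only [map_add, add_mul, hz, hw]
      | tmul p q => simp
    rw [lu_act_tmul, one_mul, act, key, key]
    obtain ⟨_, c, rfl⟩ := z
    rw [W.εt_rTensor_mul]
    rw [key2]
    simp only [one_t, ← Algebra.TensorProduct.one_def, mul_one]

lemma act_one_ru (M : FDMod k B) (t : M.carrier ⊗[k] LinearMap.range W.εt) :
    W.act M W.unit 1 (W.ru M (W.act M W.unit 1 t) ⊗ₜ W.one_t) = W.act M W.unit 1 t := by
  induction t with
  | zero => simp
  | add z w hz hw => simp only [map_add, TensorProduct.add_tmul, hz, hw]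
  | tmul m z =>
    have hz : W.εt (z : B) = z := by
      obtain ⟨_, c, rfl⟩ := z
      exact W.εt_εt c
    have hinj : Function.Injective ((LinearMap.range W.εt).subtype.lTensor M.carrier) :=
      Module.Flat.lTensor_preserves_injective_linearMap _ (Submodule.injective_subtype _)
    apply hinj
    have key : ∀ (w : B ⊗[k] B) (z : LinearMap.range W.εt) (m : M.carrier),
        (LinearMap.range W.εt).subtype.lTensor M.carrier (pairRep M.ρ W.unit.ρ w (m ⊗ₜ z)) =
          (M.ρ.toLinearMap.flip m).rTensor B (W.εt.lTensor B (w * (1 ⊗ₜ (z : B)))) := by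
      intro w z m
      induction w with
      | zero => simp
      | add z w hz hw => simp only [map_add, add_mul, LinearMap.add_apply, hz, hw]
      | tmul p q =>
        rw [pairRep_tmul_tmul, LinearMap.lTensor_tmul, Submodule.subtype_apply, unit_ρ_val]
        simp
    have key2 : ∀ (c : B) (w : B ⊗[k] B),
        (M.ρ.toLinearMap.flip (M.ρ c m)).rTensor B (W.εt.lTensor B w) =
        (M.ρ.toLinearMap.flip m).rTensor B (W.εt.lTensor B (w * (c ⊗ₜ 1))) := by
      intro c w
      induction w with
      | zero => simp
      | add z w hz hw => simp only [map_add, add_mul, hz, hw]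
      | tmul p q => simp
    rw [ru_act_tmul, one_mul, act, key, key, key2]
    simp only [one_t, ← Algebra.TensorProduct.one_def, mul_one]
    rw [W.comul_one_mul_εr, hz]

/-- `B_t ⊠ M ≅ M`, `z ⊗ m ↦ ε(z) m`, which equals `z m` on `Δ(1) (B_t ⊗ M)`; the inverse is
`m ↦ Δ(1) (1 ⊗ m)`. -/
def leftUnitor (M : FDMod k B) : W.tensor W.unit M ≅ M :=
  FDMod.isoOfEquiv (M := W.tensor W.unit M) (N := M)
    (LinearEquiv.ofLinearMap (W.lu M ∘ₗ W.incl W.unit M)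
      (W.proj W.unit M ∘ₗ TensorProduct.mk k (LinearMap.range W.εt) M.carrier W.one_t)
      (LinearMap.ext fun m => by
        have := W.lu_act_tmul M 1 W.one_t m
        rw [one_mul, one_t, map_one] at this
        exact this)
      (LinearMap.ext fun t => Subtype.ext (by
        have := W.act_one_lu M (t : LinearMap.range W.εt ⊗[k] M.carrier)
        rw [W.mem_tensorSpace.1 t.2] at this
        exact this)))
    (fun b t => by
      have := W.lu_act M b (t : LinearMap.range W.εt ⊗[k] M.carrier)
      rw [W.mem_tensorSpace.1 t.2] at this
      exact this)

/-- `M ⊠ B_t ≅ M`, `m ⊗ z ↦ ε(z) m`; the inverse is `m ↦ Δ(1) (m ⊗ 1)`. -/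
def rightUnitor (M : FDMod k B) : W.tensor M W.unit ≅ M :=
  FDMod.isoOfEquiv (M := W.tensor M W.unit) (N := M)
    (LinearEquiv.ofLinearMap (W.ru M ∘ₗ W.incl M W.unit)
      (W.proj M W.unit ∘ₗ (TensorProduct.mk k M.carrier (LinearMap.range W.εt)).flip W.one_t)
      (LinearMap.ext fun m => by
        have := W.ru_act_tmul M 1 W.one_t m
        have h1 : W.εr 1 = 1 := by
          have : W.counit ∘ₗ LinearMap.mulRight k (1 : B) = W.counit := by ext; simp
          rw [εr, this, W.comul_counit]
        rw [one_mul, one_t, h1, map_one] at this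
        exact this)
      (LinearMap.ext fun t => Subtype.ext (by
        have := W.act_one_ru M (t : M.carrier ⊗[k] LinearMap.range W.εt)
        rw [W.mem_tensorSpace.1 t.2] at this
        exact this)))
    (fun b t => by
      have := W.ru_act M b (t : M.carrier ⊗[k] LinearMap.range W.εt)
      rw [W.mem_tensorSpace.1 t.2] at this
      exact this)

end WeakBialgebra

namespace WeakBialgebra
variable {k B : Type u} [Field k] [Ring B] [Algebra k B] (W : WeakBialgebra k B)

instance : MonoidalCategoryStruct W.ModCat where
  tensorObj M N := W.tensor M N
  whiskerLeft M _ _ f := W.tensorMap (𝟙 M) f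
  whiskerRight f N := W.tensorMap f (𝟙 N)
  tensorHom f g := W.tensorMap f g
  tensorUnit := W.unit
  associator M N P := W.associator M N P
  leftUnitor M := W.leftUnitor M
  rightUnitor M := W.rightUnitor M

lemma inclR_tensorMap {M N P M' N' P' : FDMod k B} (f : M ⟶ M') (g : N ⟶ N') (h : P ⟶ P')
    (t : W.tensorSpace M (W.tensor N P)) :
    W.inclR M' N' P' (FDMod.lin (W.tensorMap f (W.tensorMap g h)) t) =
      TensorProduct.map (FDMod.lin f) (TensorProduct.map (FDMod.lin g) (FDMod.lin h))
        (W.inclR M N P t) := by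
  have : ∀ s : M.carrier ⊗[k] W.tensorSpace N P, (W.incl N' P').lTensor M'.carrier
      (TensorProduct.map (FDMod.lin f) (FDMod.lin (W.tensorMap g h)) s) =
      TensorProduct.map (FDMod.lin f) (TensorProduct.map (FDMod.lin g) (FDMod.lin h))
        ((W.incl N P).lTensor M.carrier s) := by
    intro s
    induction s with
    | zero => simp
    | add z w hz hw => simp only [map_add, hz, hw]
    | tmul m s => rfl
  exact this _

lemma inclL_tensorMap {M N P M' N' P' : FDMod k B} (f : M ⟶ M') (g : N ⟶ N') (h : P ⟶ P')
    (t : W.tensorSpace (W.tensor M N) P) :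
    W.inclL M' N' P' (FDMod.lin (W.tensorMap (W.tensorMap f g) h) t) =
      TensorProduct.map (TensorProduct.map (FDMod.lin f) (FDMod.lin g)) (FDMod.lin h)
        (W.inclL M N P t) := by
  have : ∀ s : W.tensorSpace M N ⊗[k] P.carrier, (W.incl M' N').rTensor P'.carrier
      (TensorProduct.map (FDMod.lin (W.tensorMap f g)) (FDMod.lin h) s) =
      TensorProduct.map (TensorProduct.map (FDMod.lin f) (FDMod.lin g)) (FDMod.lin h)
        ((W.incl M N).rTensor P.carrier s) := by
    intro s
    induction s with
    | zero => simp
    | add z w hz hw => simp only [map_add, hz, hw]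
    | tmul m s => rfl
  exact this _

lemma associator_natural {M N P M' N' P' : FDMod k B} (f : M ⟶ M') (g : N ⟶ N') (h : P ⟶ P')
    (t : W.tensorSpace (W.tensor M N) P) :
    W.assocLin M' N' P' (FDMod.lin (W.tensorMap (W.tensorMap f g) h) t) =
      FDMod.lin (W.tensorMap f (W.tensorMap g h)) (W.assocLin M N P t) := by
  apply W.inclR_injective
  rw [inclR_assocLin, inclL_tensorMap, inclR_tensorMap, inclR_assocLin,
    TensorProduct.map_map_assoc]

/-- The inclusion of `M ⊠ (N ⊠ (P ⊠ O))` into the full tensor product. -/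
def incl₄ (M N P O : FDMod k B) : W.tensorSpace M (W.tensor N (W.tensor P O)) →ₗ[k]
    M.carrier ⊗[k] (N.carrier ⊗[k] (P.carrier ⊗[k] O.carrier)) :=
  (W.inclR N P O).lTensor M.carrier ∘ₗ W.incl M (W.tensor N (W.tensor P O))

lemma incl₄_injective (M N P O : FDMod k B) : Function.Injective (W.incl₄ M N P O) := by
  refine Function.Injective.comp (g := (W.inclR N P O).lTensor M.carrier) ?_
    (Submodule.injective_subtype _)
  exact Module.Flat.lTensor_preserves_injective_linearMap _ (W.inclR_injective N P O)

lemma pentagon_lin (M N P O : FDMod k B)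
    (t : W.tensorSpace (W.tensor (W.tensor M N) P) O) :
    FDMod.lin (W.tensorMap (𝟙 M) (W.associator N P O).hom)
      (W.assocLin M (W.tensor N P) O
        (FDMod.lin (W.tensorMap (W.associator M N P).hom (𝟙 O)) t)) =
      W.assocLin M N (W.tensor P O) (W.assocLin (W.tensor M N) P O t) := by
  apply W.incl₄_injective
  -- the inclusion of the source
  let t₀ : ((M.carrier ⊗[k] N.carrier) ⊗[k] P.carrier) ⊗[k] O.carrier :=
    (W.inclL M N P).rTensor O.carrier (W.incl (W.tensor (W.tensor M N) P) O t)
  -- right-hand side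
  have hR : W.incl₄ M N P O (W.assocLin M N (W.tensor P O) (W.assocLin (W.tensor M N) P O t)) =
      TensorProduct.assoc k M.carrier N.carrier (P.carrier ⊗[k] O.carrier)
        (TensorProduct.assoc k (M.carrier ⊗[k] N.carrier) P.carrier O.carrier t₀) := by
    have e1 : ∀ s : M.carrier ⊗[k] (N.carrier ⊗[k] W.tensorSpace P O),
        TensorProduct.map LinearMap.id (TensorProduct.map LinearMap.id (W.incl P O)) s =
        ((W.incl P O).lTensor N.carrier).lTensor M.carrier s := fun _ => rfl
    have e2 : W.incl₄ M N P O (W.assocLin M N (W.tensor P O) (W.assocLin (W.tensor M N) P O t)) =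
        ((W.incl P O).lTensor N.carrier).lTensor M.carrier (W.inclR M N (W.tensor P O)
          (W.assocLin M N (W.tensor P O) (W.assocLin (W.tensor M N) P O t))) := by
      have : ∀ s : M.carrier ⊗[k] W.tensorSpace N (W.tensor P O),
          (W.inclR N P O).lTensor M.carrier s = ((W.incl P O).lTensor N.carrier).lTensor M.carrier
            ((W.incl N (W.tensor P O)).lTensor M.carrier s) := by
        intro s
        rw [← LinearMap.comp_apply, ← LinearMap.lTensor_comp]; rfl
      exact this _
    rw [e2, inclR_assocLin, ← e1, TensorProduct.map_map_assoc]
    congr 1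
    have e3 : TensorProduct.map (TensorProduct.map LinearMap.id LinearMap.id) (W.incl P O)
        (W.inclL M N (W.tensor P O) (W.assocLin (W.tensor M N) P O t)) =
        (W.incl M N).rTensor (P.carrier ⊗[k] O.carrier)
          (W.inclR (W.tensor M N) P O (W.assocLin (W.tensor M N) P O t)) := by
      have : ∀ s : W.tensorSpace M N ⊗[k] W.tensorSpace P O,
          TensorProduct.map (TensorProduct.map LinearMap.id LinearMap.id) (W.incl P O)
            ((W.incl M N).rTensor (W.tensorSpace P O) s) =
          (W.incl M N).rTensor (P.carrier ⊗[k] O.carrier)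
            ((W.incl P O).lTensor (W.tensorSpace M N) s) := by
        intro s
        induction s with
        | zero => simp
        | add z w hz hw => simp only [map_add, hz, hw]
        | tmul m s => simp
      exact this _
    rw [e3, inclR_assocLin]
    have e4 : ∀ s : (W.tensorSpace M N ⊗[k] P.carrier) ⊗[k] O.carrier,
        (W.incl M N).rTensor (P.carrier ⊗[k] O.carrier) (TensorProduct.assoc k _ _ _ s) =
        TensorProduct.assoc k _ _ _ (((W.incl M N).rTensor P.carrier).rTensor O.carrier s) := by
      intro s
      have := TensorProduct.map_map_assoc (W.incl M N) (LinearMap.id : P.carrier →ₗ[k] P.carrier)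
        (LinearMap.id : O.carrier →ₗ[k] O.carrier) s
      rw [TensorProduct.map_id] at this
      exact this
    rw [e4]
    congr 1
    have : ∀ s : W.tensorSpace (W.tensor M N) P ⊗[k] O.carrier,
        ((W.incl M N).rTensor P.carrier).rTensor O.carrier
          ((W.incl (W.tensor M N) P).rTensor O.carrier s) = (W.inclL M N P).rTensor O.carrier s := by
      intro s
      rw [← LinearMap.comp_apply, ← LinearMap.rTensor_comp]; rfl
    exact this _
  -- left-hand side
  have hL : W.incl₄ M N P O (FDMod.lin (W.tensorMap (𝟙 M) (W.associator N P O).hom)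
      (W.assocLin M (W.tensor N P) O
        (FDMod.lin (W.tensorMap (W.associator M N P).hom (𝟙 O)) t))) =
      (TensorProduct.assoc k N.carrier P.carrier O.carrier).toLinearMap.lTensor M.carrier
        (TensorProduct.assoc k M.carrier (N.carrier ⊗[k] P.carrier) O.carrier
          ((TensorProduct.assoc k M.carrier N.carrier P.carrier).toLinearMap.rTensor O.carrier
            t₀)) := by
    have f1 : ∀ s : M.carrier ⊗[k] W.tensorSpace (W.tensor N P) O,
        (W.inclR N P O).lTensor M.carrier
          (TensorProduct.map LinearMap.id (W.assocLin N P O) s) =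
        (TensorProduct.assoc k N.carrier P.carrier O.carrier).toLinearMap.lTensor M.carrier
          (((W.incl N P).rTensor O.carrier).lTensor M.carrier
            ((W.incl (W.tensor N P) O).lTensor M.carrier s)) := by
      intro s
      induction s with
      | zero => simp
      | add z w hz hw => simp only [map_add, hz, hw]
      | tmul m s =>
        have := W.inclR_assocLin N P O s
        simp only [TensorProduct.map_tmul, LinearMap.lTensor_tmul, LinearMap.id_apply, this]
        rfl
    have f2 : ∀ s : W.tensorSpace (W.tensor M (W.tensor N P)) O,
        ((W.incl N P).rTensor O.carrier).lTensor M.carrier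
          (W.inclR M (W.tensor N P) O (W.assocLin M (W.tensor N P) O s)) =
        TensorProduct.assoc k M.carrier (N.carrier ⊗[k] P.carrier) O.carrier
          ((W.inclR M N P).rTensor O.carrier (W.incl (W.tensor M (W.tensor N P)) O s)) := by
      intro s
      have := TensorProduct.map_map_assoc (LinearMap.id : M.carrier →ₗ[k] M.carrier) (W.incl N P)
        (LinearMap.id : O.carrier →ₗ[k] O.carrier) (W.inclL M (W.tensor N P) O s)
      rw [inclR_assocLin]
      refine this.trans (congrArg _ ?_)
      have h : ∀ r : W.tensorSpace M (W.tensor N P) ⊗[k] O.carrier,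
          ((W.incl N P).lTensor M.carrier).rTensor O.carrier
            ((W.incl M (W.tensor N P)).rTensor O.carrier r) =
          (W.inclR M N P).rTensor O.carrier r := by
        intro r
        rw [← LinearMap.comp_apply, ← LinearMap.rTensor_comp]; rfl
      exact h _
    have f3 : (W.inclR M N P).rTensor O.carrier (W.incl (W.tensor M (W.tensor N P)) O
        (FDMod.lin (W.tensorMap (W.associator M N P).hom (𝟙 O)) t)) =
        (TensorProduct.assoc k M.carrier N.carrier P.carrier).toLinearMap.rTensor O.carrier t₀ := by
      have h : ∀ r : W.tensorSpace (W.tensor M N) P ⊗[k] O.carrier,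
          (W.inclR M N P).rTensor O.carrier
            (TensorProduct.map (W.assocLin M N P) LinearMap.id r) =
          (TensorProduct.assoc k M.carrier N.carrier P.carrier).toLinearMap.rTensor O.carrier
            ((W.inclL M N P).rTensor O.carrier r) := by
        intro r
        induction r with
        | zero => simp
        | add z w hz hw => simp only [map_add, hz, hw]
        | tmul m s => simp [W.inclR_assocLin M N P m]
      exact h _
    rw [← f3, ← f2]
    exact f1 _
  rw [hL, hR]
  induction t₀ with
  | zero => simp
  | add z w hz hw => simp only [map_add, hz, hw]
  | tmul x o =>
  induction x with
  | zero => simp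
  | add z w hz hw => simp only [map_add, TensorProduct.add_tmul, hz, hw]
  | tmul x p =>
  induction x with
  | zero => simp
  | add z w hz hw => simp only [map_add, TensorProduct.add_tmul, hz, hw]
  | tmul m n => simp

lemma triangle_lin (M N : FDMod k B) (t : W.tensorSpace (W.tensor M W.unit) N) :
    FDMod.lin (W.tensorMap (𝟙 M) (W.leftUnitor N).hom) (W.assocLin M W.unit N t) =
      FDMod.lin (W.tensorMap (W.rightUnitor M).hom (𝟙 N)) t := by
  apply Submodule.injective_subtype
  have h1 : ∀ s : M.carrier ⊗[k] W.tensorSpace W.unit N,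
      TensorProduct.map LinearMap.id (W.lu N ∘ₗ W.incl W.unit N) s =
        (W.lu N).lTensor M.carrier ((W.incl W.unit N).lTensor M.carrier s) := by
    intro s
    rw [← LinearMap.comp_apply, ← LinearMap.lTensor_comp]; rfl
  have h2 : ∀ s : W.tensorSpace M W.unit ⊗[k] N.carrier,
      TensorProduct.map (W.ru M ∘ₗ W.incl M W.unit) LinearMap.id s =
        (W.ru M).rTensor N.carrier ((W.incl M W.unit).rTensor N.carrier s) := by
    intro s
    rw [← LinearMap.comp_apply, ← LinearMap.rTensor_comp]; rfl
  have h3 : ∀ s : (M.carrier ⊗[k] LinearMap.range W.εt) ⊗[k] N.carrier,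
      (W.lu N).lTensor M.carrier (TensorProduct.assoc k _ _ _ s) = (W.ru M).rTensor N.carrier s := by
    intro s
    induction s with
    | zero => simp
    | add z w hz hw => simp only [map_add, hz, hw]
    | tmul x n =>
    induction x with
    | zero => simp
    | add z w hz hw => simp only [map_add, TensorProduct.add_tmul, hz, hw]
    | tmul m z => simp [TensorProduct.smul_tmul']
  refine (h1 _).trans (Eq.trans ?_ (h2 _).symm)
  rw [← h3]
  exact congrArg _ (W.inclR_assocLin M W.unit N t)

instance : MonoidalCategory W.ModCat := MonoidalCategory.ofTensorHom
  (id_tensorHom_id := fun (M N : FDMod k B) => FDMod.hom_ext (M := W.tensor M N)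
    (N := W.tensor M N) (LinearMap.ext fun t => Subtype.ext
      (LinearMap.congr_fun TensorProduct.map_id (W.incl M N t))))
  (id_tensorHom := fun _ _ _ _ => rfl)
  (tensorHom_id := fun _ _ => rfl)
  (tensorHom_comp_tensorHom := fun {M₁ _ P₁ M₂ _ P₂ : FDMod k B} f₁ f₂ g₁ g₂ =>
    FDMod.hom_ext (M := W.tensor M₁ M₂) (N := W.tensor P₁ P₂)
      (LinearMap.ext fun t => Subtype.ext (LinearMap.congr_fun
        (TensorProduct.map_comp (FDMod.lin (k := k) (B := B) g₁) (FDMod.lin (k := k) (B := B) g₂)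
        (FDMod.lin (k := k) (B := B) f₁) (FDMod.lin (k := k) (B := B) f₂)).symm
        (W.incl M₁ M₂ t))))
  (associator_naturality := fun {M N P M' N' P' : FDMod k B} f g h =>
    FDMod.hom_ext (M := W.tensor (W.tensor M N) P) (N := W.tensor M' (W.tensor N' P'))
      (LinearMap.ext fun t => W.associator_natural f g h t))
  (leftUnitor_naturality := fun {M N : FDMod k B} f =>
    FDMod.hom_ext (M := W.tensor W.unit M) (N := N) (LinearMap.ext fun t => by
      have h : ∀ s : LinearMap.range W.εt ⊗[k] M.carrier,
          W.lu N (TensorProduct.map LinearMap.id (FDMod.lin (k := k) (B := B) f) s) =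
          FDMod.lin (k := k) (B := B) f (W.lu M s) := by
        intro s
        induction s with
        | zero => simp
        | add z w hz hw => simp only [map_add, hz, hw]
        | tmul x n => simp
      exact h (W.incl W.unit M t)))
  (rightUnitor_naturality := fun {M N : FDMod k B} f =>
    FDMod.hom_ext (M := W.tensor M W.unit) (N := N) (LinearMap.ext fun t => by
      have h : ∀ s : M.carrier ⊗[k] LinearMap.range W.εt,
          W.ru N (TensorProduct.map (FDMod.lin (k := k) (B := B) f) LinearMap.id s) =
          FDMod.lin (k := k) (B := B) f (W.ru M s) := by
        intro s
        induction s with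
        | zero => simp
        | add z w hz hw => simp only [map_add, hz, hw]
        | tmul x n => simp
      exact h (W.incl M W.unit t)))
  (pentagon := fun (M N P O : FDMod k B) =>
    FDMod.hom_ext (M := W.tensor (W.tensor (W.tensor M N) P) O)
      (N := W.tensor M (W.tensor N (W.tensor P O)))
      (LinearMap.ext fun t => W.pentagon_lin M N P O t))
  (triangle := fun (M N : FDMod k B) =>
    FDMod.hom_ext (M := W.tensor (W.tensor M W.unit) N) (N := W.tensor M N)
      (LinearMap.ext fun t => W.triangle_lin M N t))

end WeakBialgebra

/-- A quasi-triangular weak Hopf algebra structure on a `k`-algebra `B`: a weak bialgebra structure,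
an antipode `S` with `b₁ S(b₂) = ε_t(b)`, `S(b₁) b₂ = ε_s(b)`, `S(b₁) b₂ S(b₃) = S(b)`, and
`R ∈ Δᶜᵒᵖ(1) (B ⊗ B) Δ(1)` with `R Δ(b) = Δᶜᵒᵖ(b) R`, `(Δ ⊗ id) R = R₁₃ R₂₃`,
`(id ⊗ Δ) R = R₁₃ R₁₂`, for which there is `R' ∈ Δ(1) (B ⊗ B) Δᶜᵒᵖ(1)` with `R R' = Δᶜᵒᵖ(1)` and
`R' R = Δ(1)`. -/
structure QuasiTriangularWeakHopf (k B : Type u) [Field k] [Ring B] [Algebra k B] extends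
    WeakBialgebra k B where
  /-- the antipode -/
  antipode : B →ₗ[k] B
  mul_antipode : ∀ b, LinearMap.mul' k B (antipode.lTensor B (comul b)) = toWeakBialgebra.εt b
  antipode_mul : ∀ b, LinearMap.mul' k B (antipode.rTensor B (comul b)) = toWeakBialgebra.εs b
  antipode_mul_antipode : ∀ b, LinearMap.mul' k B (TensorProduct.map antipode
    (LinearMap.mul' k B ∘ₗ antipode.lTensor B) (comul.lTensor B (comul b))) = antipode b
  /-- the universal `R`-matrix -/
  R : B ⊗[k] B
  one_mul_R_mul_one : TensorProduct.comm k B B (comul 1) * R * comul 1 = R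
  R_mul_comul : ∀ b, R * comul b = TensorProduct.comm k B B (comul b) * R
  comul_rTensor_R : TensorProduct.assoc k B B B (comul.rTensor B R) = leg13 B R * leg23 B R
  comul_lTensor_R : comul.lTensor B R = leg13 B R * leg12 B R
  exists_inverse : ∃ R' : B ⊗[k] B, comul 1 * R' * TensorProduct.comm k B B (comul 1) = R' ∧
    R * R' = TensorProduct.comm k B B (comul 1) ∧ R' * R = comul 1

namespace QuasiTriangularWeakHopf
variable {k B : Type u} [Field k] [Ring B] [Algebra k B] (W : QuasiTriangularWeakHopf k B)

/-- The category of finite-dimensional left modules over a quasi-triangular weak Hopf algebra. -/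
def ModCat (_ : QuasiTriangularWeakHopf k B) : Type (u + 1) := FDMod k B

instance : Category W.ModCat := inferInstanceAs (Category (FDMod k B))
instance : Preadditive W.ModCat := inferInstanceAs (Preadditive (FDMod k B))
instance : Linear k W.ModCat := inferInstanceAs (Linear k (FDMod k B))
instance : MonoidalCategory W.ModCat := inferInstanceAs (MonoidalCategory W.toWeakBialgebra.ModCat)

lemma comm_mul (z w : B ⊗[k] B) : TensorProduct.comm k B B (z * w) =
    TensorProduct.comm k B B z * TensorProduct.comm k B B w := by
  induction z with
  | zero => simp
  | add z z' hz hw => simp only [map_add, add_mul, hz, hw]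
  | tmul a b =>
  induction w with
  | zero => simp
  | add z w hz hw => simp only [map_add, mul_add, hz, hw]
  | tmul c d => simp

lemma comm_comul_one_mul (b : B) : TensorProduct.comm k B B (W.comul b) *
    TensorProduct.comm k B B (W.comul 1) = TensorProduct.comm k B B (W.comul b) := by
  rw [← comm_mul, W.comul_mul_one]

/-- An inverse of `R`. -/
def R' : B ⊗[k] B := W.exists_inverse.choose

lemma comul_one_mul_R' : W.comul 1 * W.R' = W.R' := by
  have h : _ = W.R' := W.exists_inverse.choose_spec.1
  rw [← h, ← mul_assoc, ← mul_assoc, W.comul_one_mul]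
lemma R_mul_R' : W.R * W.R' = TensorProduct.comm k B B (W.comul 1) :=
  W.exists_inverse.choose_spec.2.1
lemma R'_mul_R : W.R' * W.R = W.comul 1 := W.exists_inverse.choose_spec.2.2

lemma R'_mul_comul (b : B) : W.R' * TensorProduct.comm k B B (W.comul b) = W.comul b * W.R' := by
  rw [← W.comm_comul_one_mul, ← R_mul_R', ← mul_assoc, ← mul_assoc, mul_assoc W.R',
    ← W.R_mul_comul, ← mul_assoc, R'_mul_R, W.comul_one_mul]

lemma act_flip (M N : FDMod k B) (b : B) (t : M.carrier ⊗[k] N.carrier) :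
    flipAct M.ρ N.ρ W.R (W.act M N b t) = W.act N M b (flipAct M.ρ N.ρ W.R t) := by
  rw [flipAct_apply, flipAct_apply, WeakBialgebra.act, WeakBialgebra.act, ← pairRep_mul,
    W.R_mul_comul, pairRep_mul, comm_pairRep]
  congr 2
  simp

/-- The linear map `m ⊗ n ↦ R² n ⊗ R¹ m` from `M ⊠ N` to `N ⊠ M`. -/
def braidLin (M N : FDMod k B) : W.tensorSpace M N →ₗ[k] W.tensorSpace N M :=
  (flipAct M.ρ N.ρ W.R).restrict (fun t ht => by
    rw [WeakBialgebra.mem_tensorSpace] at ht ⊢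
    rw [← act_flip, ht])

lemma incl_braidLin (M N : FDMod k B) (t : W.tensorSpace M N) :
    W.incl N M (W.braidLin M N t) = flipAct M.ρ N.ρ W.R (W.incl M N t) := rfl

/-- The inverse of the braiding. -/
def braidInvLin (M N : FDMod k B) : W.tensorSpace N M →ₗ[k] W.tensorSpace M N :=
  (pairRep M.ρ N.ρ W.R' ∘ₗ
      (TensorProduct.comm k N.carrier M.carrier).toLinearMap).restrict (fun t ht => by
    rw [WeakBialgebra.mem_tensorSpace, LinearMap.comp_apply, WeakBialgebra.act, ← pairRep_mul,
      W.comul_one_mul_R'])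

/-- The braiding `m ⊗ n ↦ R² n ⊗ R¹ m`. -/
def braid (M N : FDMod k B) : W.tensor M N ≅ W.tensor N M :=
  FDMod.isoOfEquiv (M := W.tensor M N) (N := W.tensor N M)
    (LinearEquiv.ofLinearMap (W.braidLin M N) (W.braidInvLin M N)
      (LinearMap.ext fun t => Subtype.ext (by
        have ht := W.mem_tensorSpace.1 t.2
        change TensorProduct.comm k _ _ (pairRep M.ρ N.ρ W.R (pairRep M.ρ N.ρ W.R'
          (TensorProduct.comm k _ _ (t : N.carrier ⊗[k] M.carrier)))) = t
        rw [← pairRep_mul, R_mul_R', comm_pairRep, TensorProduct.comm_comm,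
          TensorProduct.comm_comm]
        exact ht))
      (LinearMap.ext fun t => Subtype.ext (by
        have ht := W.mem_tensorSpace.1 t.2
        change pairRep M.ρ N.ρ W.R' (TensorProduct.comm k _ _ (TensorProduct.comm k _ _
          (pairRep M.ρ N.ρ W.R (t : M.carrier ⊗[k] N.carrier)))) = t
        rw [TensorProduct.comm_comm, ← pairRep_mul, R'_mul_R]
        exact ht)))
    (fun b t => Subtype.ext (W.act_flip M N b _))

lemma inclL_braidLin (M N P : FDMod k B) (t : W.tensorSpace M (W.tensor N P)) :
    W.inclL N P M (W.braidLin M (W.tensor N P) t) = TensorProduct.comm k _ _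
      (pairRep M.ρ (pairRep N.ρ P.ρ) (W.comul.lTensor B W.R) (W.inclR M N P t)) := by
  have h := W.lTensor_incl_pairRep M N P W.R (W.incl M (W.tensor N P) t)
  refine Eq.trans ?_ (congrArg _ h)
  have h2 : ∀ s : M.carrier ⊗[k] W.tensorSpace N P,
      (W.incl N P).rTensor M.carrier (TensorProduct.comm k _ _ s) =
      TensorProduct.comm k _ _ ((W.incl N P).lTensor M.carrier s) := by
    intro s
    induction s with
    | zero => simp
    | add z w hz hw => simp only [map_add, hz, hw]
    | tmul m s => rfl
  exact h2 _

lemma inclR_braidLin (M N P : FDMod k B) (t : W.tensorSpace (W.tensor M N) P) :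
    W.inclR P M N (W.braidLin (W.tensor M N) P t) = TensorProduct.comm k _ _
      (pairRep (pairRep M.ρ N.ρ) P.ρ (W.comul.rTensor B W.R) (W.inclL M N P t)) := by
  have h := W.rTensor_incl_pairRep M N P W.R (W.incl (W.tensor M N) P t)
  refine Eq.trans ?_ (congrArg _ h)
  have h2 : ∀ s : W.tensorSpace M N ⊗[k] P.carrier,
      (W.incl M N).lTensor P.carrier (TensorProduct.comm k _ _ s) =
      TensorProduct.comm k _ _ ((W.incl M N).rTensor P.carrier s) := by
    intro s
    induction s with
    | zero => simp
    | add z w hz hw => simp only [map_add, hz, hw]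
    | tmul m s => rfl
  exact h2 _

lemma inclR_whisker_braid (M N P : FDMod k B) (t : W.tensorSpace N (W.tensor M P)) :
    W.inclR N P M (FDMod.lin (W.tensorMap (𝟙 N) (W.braid M P).hom) t) =
      (flipAct M.ρ P.ρ W.R).lTensor N.carrier (W.inclR N M P t) := by
  have h : ∀ s : N.carrier ⊗[k] W.tensorSpace M P,
      (W.incl P M).lTensor N.carrier (TensorProduct.map LinearMap.id (W.braidLin M P) s) =
      (flipAct M.ρ P.ρ W.R).lTensor N.carrier ((W.incl M P).lTensor N.carrier s) := by
    intro s
    induction s with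
    | zero => simp
    | add z w hz hw => simp only [map_add, hz, hw]
    | tmul m s => rfl
  exact h _

lemma inclL_whisker_braid (M N P : FDMod k B) (t : W.tensorSpace (W.tensor M N) P) :
    W.inclL N M P (FDMod.lin (W.tensorMap (W.braid M N).hom (𝟙 P)) t) =
      (flipAct M.ρ N.ρ W.R).rTensor P.carrier (W.inclL M N P t) := by
  have h : ∀ s : W.tensorSpace M N ⊗[k] P.carrier,
      (W.incl N M).rTensor P.carrier (TensorProduct.map (W.braidLin M N) LinearMap.id s) =
      (flipAct M.ρ N.ρ W.R).rTensor P.carrier ((W.incl M N).rTensor P.carrier s) := by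
    intro s
    induction s with
    | zero => simp
    | add z w hz hw => simp only [map_add, hz, hw]
    | tmul m s => rfl
  exact h _

lemma hexagon₁ (M N P : FDMod k B) (t : W.tensorSpace (W.tensor M N) P) :
    W.assocLin N P M (W.braidLin M (W.tensor N P) (W.assocLin M N P t)) =
      FDMod.lin (W.tensorMap (𝟙 N) (W.braid M P).hom) (W.assocLin N M P
        (FDMod.lin (W.tensorMap (W.braid M N).hom (𝟙 P)) t)) := by
  apply W.inclR_injective
  rw [inclR_whisker_braid, WeakBialgebra.inclR_assocLin, WeakBialgebra.inclR_assocLin,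
    inclL_braidLin, inclL_whisker_braid, W.comul_lTensor_R, WeakBialgebra.inclR_assocLin]
  exact hexagon_aux₁ M.ρ N.ρ P.ρ W.R W.R _

lemma hexagon₂ (M N P : FDMod k B) (t : W.tensorSpace M (W.tensor N P)) :
    W.assocInvLin P M N (W.braidLin (W.tensor M N) P (W.assocInvLin M N P t)) =
      FDMod.lin (W.tensorMap (W.braid M P).hom (𝟙 N)) (W.assocInvLin M P N
        (FDMod.lin (W.tensorMap (𝟙 M) (W.braid N P).hom) t)) := by
  apply W.inclL_injective
  rw [inclL_whisker_braid, WeakBialgebra.inclL_assocInvLin, WeakBialgebra.inclL_assocInvLin,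
    inclR_braidLin, inclR_whisker_braid, WeakBialgebra.inclL_assocInvLin,
    ← hexagon_aux₂, ← W.comul_rTensor_R]
  have e := assoc_pairRep M.ρ N.ρ P.ρ (W.comul.rTensor B W.R)
    ((TensorProduct.assoc k _ _ _).symm (W.inclR M N P t))
  rw [LinearEquiv.apply_symm_apply] at e
  rw [← e, LinearEquiv.symm_apply_apply]

instance : BraidedCategory W.ModCat where
  braiding M N := W.braid M N
  braiding_naturality_right := fun (M : FDMod k B) {N P : FDMod k B} f =>
    FDMod.hom_ext (M := W.tensor M N) (N := W.tensor P M) (LinearMap.ext fun t => Subtype.ext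
      (flipAct_naturality (𝟙 M) f W.R (W.incl M N t)))
  braiding_naturality_left := fun {M N : FDMod k B} f (P : FDMod k B) =>
    FDMod.hom_ext (M := W.tensor M P) (N := W.tensor P N) (LinearMap.ext fun t => Subtype.ext
      (flipAct_naturality f (𝟙 P) W.R (W.incl M P t)))
  hexagon_forward := fun (M N P : FDMod k B) =>
    FDMod.hom_ext (M := W.tensor (W.tensor M N) P) (N := W.tensor N (W.tensor P M))
      (LinearMap.ext fun t => W.hexagon₁ M N P t)
  hexagon_reverse := fun (M N P : FDMod k B) =>
    FDMod.hom_ext (M := W.tensor M (W.tensor N P)) (N := W.tensor (W.tensor P M) N)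
      (LinearMap.ext fun t => W.hexagon₂ M N P t)

end QuasiTriangularWeakHopf

/-! ### Sweedler notation -/

section sweedler
variable {k : Type u} [Field k] {M N P : Type u} [AddCommGroup M] [Module k M]
  [AddCommGroup N] [Module k N] [AddCommGroup P] [Module k P]

/-- A finite set of pairs representing `t ∈ M ⊗ N` as `∑ m ⊗ n`. -/
def reps (t : M ⊗[k] N) : Finset (M × N) := (TensorProduct.exists_finset t).choose

lemma sum_reps (t : M ⊗[k] N) : ∑ p ∈ reps t, p.1 ⊗ₜ[k] p.2 = t :=
  (TensorProduct.exists_finset t).choose_spec.symm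

/-- Sweedler notation: for `t = t¹ ⊗ t²`, the sum written `f(t¹, t²)`. -/
def sw (t : M ⊗[k] N) (f : M → N → P) : P := ∑ p ∈ reps t, f p.1 p.2

/-- If `f` is bilinear, then `sw t f` is the value at `t` of the linear map on the tensor product
defined by `f`; in particular it does not depend on the chosen representation. -/
lemma sw_eq_lift (t : M ⊗[k] N) (f : M →ₗ[k] N →ₗ[k] P) :
    sw t (fun m n => f m n) = TensorProduct.lift f t := by
  conv_rhs => rw [← sum_reps t]
  simp [sw]

end sweedler

/-! ### Module algebras and separability -/

/-- A left `H`-module algebra structure on `A`: an `H`-module structure with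
`h (a b) = (h₁ a) (h₂ b)` and `h 1 = ε(h) 1`. -/
structure ModuleAlgebra (k H A : Type u) [Field k] [Ring H] [HopfAlgebra k H] [Ring A]
    [Algebra k A] where
  /-- the action -/
  act : H →ₐ[k] Module.End k A
  act_mul : ∀ (h : H) (a b : A),
    act h (a * b) = sw (Coalgebra.comul (R := k) h) fun h₁ h₂ => act h₁ a * act h₂ b
  act_one : ∀ h : H, act h 1 = Coalgebra.counit (R := k) h • (1 : A)

/-- The module algebra `A` is quantum commutative: `a b = (R² b) (R¹ a)`. -/
def ModuleAlgebra.IsQuantumCommutative {k H A : Type u} [Field k] [Ring H] [HopfAlgebra k H]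
    [Ring A] [Algebra k A] (T : ModuleAlgebra k H A) (Q : QuasiTriangular k H) : Prop :=
  ∀ a b : A, a * b = sw Q.R fun R₁ R₂ => T.act R₂ b * T.act R₁ a

/-- A symmetric separability idempotent of `A`: an element `x = x¹ ⊗ x²` of `A ⊗ A` with
`x¹ x² = 1`, `a x¹ ⊗ x² = x¹ ⊗ x² a` and `x¹ ⊗ x² = x² ⊗ x¹`. -/
structure SymmSepIdempotent (k A : Type u) [Field k] [Ring A] [Algebra k A] where
  /-- the element of `A ⊗ A` -/
  x : A ⊗[k] A
  mul_x : LinearMap.mul' k A x = 1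
  tmul_mul_x : ∀ a : A, (a ⊗ₜ[k] (1 : A)) * x = TensorProduct.map LinearMap.id
    (LinearMap.mulRight k a) x
  comm_x : TensorProduct.comm k A A x = x

namespace SymmSepIdempotent
variable {k A : Type u} [Field k] [Ring A] [Algebra k A] (s : SymmSepIdempotent k A)

/-- An algebra with a separability idempotent is finite-dimensional. -/
lemma finite (s : SymmSepIdempotent k A) : Module.Finite k A := by
  let ℬ := Module.Basis.ofVectorSpace k A
  obtain ⟨c, hc⟩ := TensorProduct.eq_repr_basis_left ℬ s.x
  let ψ : ∀ i, A ⊗[k] A →ₗ[k] A := fun i =>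
    (TensorProduct.lid k A).toLinearMap ∘ₗ (ℬ.coord i).rTensor A
  have hψ : ∀ i, ψ i s.x = c i := by
    intro i
    classical
    rw [← hc, Finsupp.sum, map_sum, Finset.sum_eq_single i]
    · simp [ψ]
    · intro j _ hj
      simp [ψ, hj]
    · intro hi
      simp [Finsupp.notMem_support_iff.1 hi]
  let V : Submodule k A := Submodule.span k (c '' (c.support : Set _))
  have hV : ∀ i, c i ∈ V := by
    intro i
    by_cases hi : i ∈ c.support
    · exact Submodule.subset_span ⟨i, hi, rfl⟩
    · rw [Finsupp.notMem_support_iff.1 hi]; exact V.zero_mem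
  have : Module.Finite k V := Module.Finite.span_of_finite k (c.support.finite_toSet.image _)
  have hVm : ∀ a : A, ∀ i, c i * a ∈ V := by
    intro a i
    have h1 : ψ i (TensorProduct.map LinearMap.id (LinearMap.mulRight k a) s.x) = c i * a := by
      rw [← hψ i]
      generalize s.x = z
      induction z with
      | zero => simp
      | add z w hz hw => simp only [map_add, add_mul, hz, hw]
      | tmul p q => simp [ψ]
    rw [← h1, ← s.tmul_mul_x, ← hc, Finsupp.sum, Finset.mul_sum, map_sum]
    refine V.sum_mem fun j _ => ?_
    simp only [ψ, Algebra.TensorProduct.tmul_mul_tmul, one_mul, LinearMap.comp_apply,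
      LinearMap.rTensor_tmul, LinearEquiv.coe_coe, TensorProduct.lid_tmul]
    exact V.smul_mem _ (hV j)
  have hVm' : ∀ a : A, ∀ v ∈ V, v * a ∈ V := by
    intro a v hv
    induction hv using Submodule.span_induction with
    | mem y hy => obtain ⟨i, _, rfl⟩ := hy; exact hVm a i
    | zero => simp
    | add y z _ _ hy hz => rw [add_mul]; exact V.add_mem hy hz
    | smul r y _ hy => rw [smul_mul_assoc]; exact V.smul_mem r hy
  let Φ : A →ₗ[k] (V →ₗ[k] V) :=
    { toFun := fun a => (LinearMap.mulRight k a).restrict (hVm' a)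
      map_add' := fun a b => LinearMap.ext fun v => Subtype.ext (mul_add v.1 a b)
      map_smul' := fun r a => LinearMap.ext fun v => Subtype.ext (mul_smul_comm r v.1 a) }
  refine Module.Finite.of_injective Φ ((injective_iff_map_eq_zero Φ).2 fun a ha => ?_)
  have hca : ∀ i, c i * a = 0 := by
    intro i
    exact congrArg Subtype.val (LinearMap.congr_fun ha ⟨c i, hV i⟩)
  have h1 : LinearMap.mul' k A s.x * a = 0 := by
    rw [← hc, Finsupp.sum, map_sum, Finset.sum_mul]
    refine Finset.sum_eq_zero fun i _ => ?_
    rw [LinearMap.mul'_apply, mul_assoc, hca, mul_zero]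
  rwa [s.mul_x, one_mul] at h1

/-- `x¹ a ⊗ x² = x¹ ⊗ a x²` -/
lemma map_mulRight (a : A) : TensorProduct.map (LinearMap.mulRight k a) LinearMap.id s.x =
    TensorProduct.map LinearMap.id (LinearMap.mulLeft k a) s.x := by
  have h := congrArg (TensorProduct.comm k A A) (s.tmul_mul_x a)
  have h1 : ∀ z : A ⊗[k] A, TensorProduct.comm k A A ((a ⊗ₜ[k] (1 : A)) * z) =
      TensorProduct.map LinearMap.id (LinearMap.mulLeft k a) (TensorProduct.comm k A A z) := by
    intro z
    induction z with
    | zero => simp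
    | add z w hz hw => simp only [map_add, mul_add, hz, hw]
    | tmul p q => simp
  have h2 : ∀ z : A ⊗[k] A, TensorProduct.comm k A A
      (TensorProduct.map LinearMap.id (LinearMap.mulRight k a) z) =
      TensorProduct.map (LinearMap.mulRight k a) LinearMap.id (TensorProduct.comm k A A z) := by
    intro z
    induction z with
    | zero => simp
    | add z w hz hw => simp only [map_add, hz, hw]
    | tmul p q => simp
  rw [h1, h2, s.comm_x] at h
  exact h.symm

/-- The element `α ∈ A*`, the trace of the left regular representation. It is the unique element
of `A*` with `⟨α, x¹⟩ x² = 1`, see `contract_α` and `eq_α`. -/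
def α (_ : SymmSepIdempotent k A) : Module.Dual k A :=
  LinearMap.trace k A ∘ₗ LinearMap.mul k A

/-- `⟨α, x¹⟩ x² = 1` -/
lemma contract_α : TensorProduct.lid k A (s.α.rTensor A s.x) = 1 := by
  have := s.finite
  let ℬ := Module.finBasis k A
  have h0 : ∀ z : A ⊗[k] A, TensorProduct.lid k A (s.α.rTensor A z) =
      ∑ j, TensorProduct.lid k A ((ℬ.coord j).rTensor A
        (TensorProduct.map (LinearMap.mulRight k (ℬ j)) LinearMap.id z)) := by
    intro z
    induction z with
    | zero => simp
    | add z w hz hw => simp only [map_add, Finset.sum_add_distrib, hz, hw]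
    | tmul p q =>
      have : s.α p = ∑ j, ℬ.coord j (p * ℬ j) := by
        rw [α, LinearMap.comp_apply, LinearMap.trace_eq_matrix_trace k ℬ, Matrix.trace]
        simp [LinearMap.toMatrix_apply]
      simp [this, Finset.sum_smul]
  rw [h0, ← s.mul_x]
  simp only [map_mulRight]
  generalize s.x = z
  induction z with
  | zero => simp
  | add z w hz hw => simp only [map_add, Finset.sum_add_distrib, hz, hw]
  | tmul p q =>
    simp only [TensorProduct.map_tmul, LinearMap.rTensor_tmul, TensorProduct.lid_tmul,
      LinearMap.id_apply, LinearMap.mulLeft_apply, LinearMap.mul'_apply]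
    simp_rw [← smul_mul_assoc]
    rw [← Finset.sum_mul]
    congr 1
    exact ℬ.sum_repr p

/-- `⟨α, x²⟩ x¹ = 1` -/
lemma contract_α' : TensorProduct.rid k A (s.α.lTensor A s.x) = 1 := by
  rw [← s.contract_α]
  conv_lhs => rw [← s.comm_x]
  generalize s.x = z
  induction z with
  | zero => simp
  | add z w hz hw => simp only [map_add, hz, hw]
  | tmul p q => simp

/-- `x¹ ⟨α, a x²⟩ = a` -/
lemma dual_basis (a : A) :
    TensorProduct.rid k A ((s.α ∘ₗ LinearMap.mulLeft k a).lTensor A s.x) = a := by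
  have h : (s.α ∘ₗ LinearMap.mulLeft k a).lTensor A s.x =
      s.α.lTensor A (TensorProduct.map LinearMap.id (LinearMap.mulLeft k a) s.x) := by
    generalize s.x = z
    induction z with
    | zero => simp
    | add z w hz hw => simp only [map_add, hz, hw]
    | tmul p q => simp
  rw [h, ← map_mulRight]
  have h2 : ∀ z : A ⊗[k] A, TensorProduct.rid k A (s.α.lTensor A
      (TensorProduct.map (LinearMap.mulRight k a) LinearMap.id z)) =
      TensorProduct.rid k A (s.α.lTensor A z) * a := by
    intro z
    induction z with
    | zero => simp
    | add z w hz hw => simp only [map_add, add_mul, hz, hw]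
    | tmul p q => simp
  rw [h2, contract_α', one_mul]

/-- `α` is determined by `⟨α, x¹⟩ x² = 1`. -/
lemma eq_α (β : Module.Dual k A) (h : TensorProduct.lid k A (β.rTensor A s.x) = 1) :
    β = s.α := by
  ext a
  have h1 := congrArg β (s.dual_basis a)
  rw [← h1]
  have h2 : ∀ z : A ⊗[k] A, β (TensorProduct.rid k A
      ((s.α ∘ₗ LinearMap.mulLeft k a).lTensor A z)) =
      s.α (a * TensorProduct.lid k A (β.rTensor A z)) := by
    intro z
    induction z with
    | zero => simp
    | add z w hz hw => simp only [map_add, mul_add, hz, hw]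
    | tmul p q => simp [mul_comm]
  rw [h2, h, mul_one]

end SymmSepIdempotent

/-! ### The algebra `B = A ⊗ H ⊗ A*` -/

section dual
variable {k H A : Type u} [Field k] [Ring H] [HopfAlgebra k H] [Ring A] [Algebra k A]

/-- `⟨a ⇀ φ, b⟩ = ⟨φ, b a⟩` -/
def lharp (a : A) (φ : Module.Dual k A) : Module.Dual k A := φ ∘ₗ LinearMap.mulRight k a

/-- `⟨φ ↼ a, b⟩ = ⟨φ, a b⟩` -/
def rharp (φ : Module.Dual k A) (a : A) : Module.Dual k A := φ ∘ₗ LinearMap.mulLeft k a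

/-- The right transpose action `⟨φ ◁ h, a⟩ = ⟨φ, h a⟩` of `H` on `A*`. -/
def ModuleAlgebra.transp (T : ModuleAlgebra k H A) (φ : Module.Dual k A) (h : H) :
    Module.Dual k A := φ ∘ₗ T.act h

/-- The coproduct of `A*`: the element `φ₁ ⊗ φ₂` of `A* ⊗ A*` with
`⟨φ₁, a⟩ ⟨φ₂, b⟩ = ⟨φ, a b⟩`, for `A` finite-dimensional. -/
def SymmSepIdempotent.comulDual (s : SymmSepIdempotent k A) (φ : Module.Dual k A) :
    Module.Dual k A ⊗[k] Module.Dual k A :=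
  have := s.finite
  (TensorProduct.dualDistribEquiv k A A).symm (φ ∘ₗ LinearMap.mul' k A)

lemma SymmSepIdempotent.comulDual_apply (s : SymmSepIdempotent k A) (φ : Module.Dual k A)
    (a b : A) : TensorProduct.dualDistrib k A A (s.comulDual φ) (a ⊗ₜ b) = φ (a * b) := by
  have := s.finite
  have h : TensorProduct.dualDistrib k A A (s.comulDual φ) = φ ∘ₗ LinearMap.mul' k A :=
    (TensorProduct.dualDistribEquiv k A A).apply_symm_apply _
  rw [h]
  simp

end dual

section BAlg
variable {k A : Type u} [Field k] [Ring A] [Algebra k A]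

/-- The space `B = A ⊗ H ⊗ A*`. -/
def BAlg (H : Type u) [Ring H] [Algebra k H] (_ : SymmSepIdempotent k A) : Type u :=
  A ⊗[k] (H ⊗[k] Module.Dual k A)

namespace BAlg
variable {H : Type u} [Ring H] [Algebra k H] (s : SymmSepIdempotent k A)

instance : AddCommGroup (BAlg H s) :=
  inferInstanceAs (AddCommGroup (A ⊗[k] (H ⊗[k] Module.Dual k A)))
instance : Module k (BAlg H s) :=
  inferInstanceAs (Module k (A ⊗[k] (H ⊗[k] Module.Dual k A)))

/-- The element `a ⊗ h ⊗ φ` of `B`. -/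
def tri (a : A) (h : H) (φ : Module.Dual k A) : BAlg H s :=
  (a ⊗ₜ (h ⊗ₜ φ) : A ⊗[k] (H ⊗[k] Module.Dual k A))

variable {s} in
lemma induction_tri {p : BAlg H s → Prop} (b : BAlg H s) (h0 : p 0)
    (ha : ∀ b c, p b → p c → p (b + c)) (ht : ∀ a h φ, p (tri s a h φ)) : p b := by
  refine TensorProduct.induction_on (motive := p) b h0 (fun a y => ?_) ha
  induction y with
  | zero => rw [TensorProduct.tmul_zero]; exact h0
  | add y z hy hz => rw [TensorProduct.tmul_add]; exact ha _ _ hy hz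
  | tmul h φ => exact ht a h φ

/-- Left multiplication on `B`. -/
def mulLin : BAlg H s →ₗ[k] BAlg H s →ₗ[k] BAlg H s :=
  (LinearMap.lTensorHom A ∘ₗ
    TensorProduct.homTensorHomMap (RingHom.id k) H (Module.Dual k A) H (Module.Dual k A) ∘ₗ
    TensorProduct.map (LinearMap.mul k H)
      (TensorProduct.lift (LinearMap.smulRightₗ ∘ₗ Module.Dual.eval k A)) ∘ₗ
    (TensorProduct.leftComm k A H (Module.Dual k A)).toLinearMap :
    A ⊗[k] (H ⊗[k] Module.Dual k A) →ₗ[k] Module.End k (A ⊗[k] (H ⊗[k] Module.Dual k A)))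

lemma mulLin_tri (a b : A) (h g : H) (φ ψ : Module.Dual k A) :
    mulLin s (tri s a h φ) (tri s b g ψ) = ψ a • tri s b (h * g) φ := by
  refine Eq.trans (b := (b ⊗ₜ ((h * g) ⊗ₜ (ψ a • φ)) : A ⊗[k] (H ⊗[k] Module.Dual k A))) rfl ?_
  rw [TensorProduct.tmul_smul, TensorProduct.tmul_smul]
  rfl

/-- The unit `x¹ ⊗ 1 ⊗ (x² ⇀ α)` of `B`. -/
def oneB : BAlg H s := sw s.x fun x₁ x₂ => tri s x₁ 1 (lharp x₂ s.α)

lemma mulLin_assoc (b c d : BAlg H s) :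
    mulLin s (mulLin s b c) d = mulLin s b (mulLin s c d) := by
  induction b using induction_tri with
  | h0 => simp
  | ha b b' hb hb' => simp only [map_add, LinearMap.add_apply, hb, hb']
  | ht a h φ =>
  induction c using induction_tri with
  | h0 => simp
  | ha b b' hb hb' => simp only [map_add, LinearMap.add_apply, hb, hb']
  | ht a' h' φ' =>
  induction d using induction_tri with
  | h0 => simp
  | ha b b' hb hb' => simp only [map_add, hb, hb']
  | ht a'' h'' φ'' =>
    simp only [mulLin_tri, map_smul, LinearMap.smul_apply, smul_smul, mul_assoc]
    rw [mul_comm]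

lemma sum_dual_basis (a : A) :
    ∑ p ∈ reps s.x, s.α (a * p.2) • p.1 = a := by
  have h := s.dual_basis a
  conv_lhs at h => rw [← sum_reps s.x]
  simpa using h

lemma mulLin_oneB (b : BAlg H s) : mulLin s b (oneB s) = b := by
  induction b using induction_tri with
  | h0 => simp
  | ha b b' hb hb' => simp only [map_add, LinearMap.add_apply, hb, hb']
  | ht a h φ =>
    simp only [oneB, sw, map_sum, mulLin_tri, mul_one]
    let f : A →ₗ[k] BAlg H s :=
      ((TensorProduct.mk k A (H ⊗[k] Module.Dual k A)).flip (h ⊗ₜ φ) :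
        A →ₗ[k] A ⊗[k] (H ⊗[k] Module.Dual k A))
    have hf := congrArg f (sum_dual_basis s a)
    simp only [map_sum, map_smul] at hf
    exact hf

lemma oneB_mulLin (b : BAlg H s) : mulLin s (oneB s) b = b := by
  induction b using induction_tri with
  | h0 => simp
  | ha b b' hb hb' => simp only [map_add, hb, hb']
  | ht a h φ =>
    simp only [oneB, sw, map_sum, LinearMap.sum_apply, mulLin_tri, one_mul]
    let f : Module.Dual k A →ₗ[k] BAlg H s :=
      (TensorProduct.mk k A (H ⊗[k] Module.Dual k A) a ∘ₗ TensorProduct.mk k H _ h :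
        Module.Dual k A →ₗ[k] A ⊗[k] (H ⊗[k] Module.Dual k A))
    have hφ : ∑ p ∈ reps s.x, φ p.1 • lharp p.2 s.α = φ := by
      ext c
      have := congrArg φ (sum_dual_basis s c)
      simp only [map_sum, map_smul, smul_eq_mul] at this
      simp only [LinearMap.sum_apply, LinearMap.smul_apply, lharp, LinearMap.comp_apply,
        LinearMap.mulRight_apply, smul_eq_mul]
      rw [← this]
      exact Finset.sum_congr rfl fun p _ => mul_comm _ _
    have hf := congrArg f hφ
    simp only [map_sum, map_smul] at hf
    exact hf

/-- The algebra structure `(a ⊗ h ⊗ φ) (b ⊗ g ⊗ ψ) = ⟨ψ, a⟩ b ⊗ h g ⊗ φ` with unit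
`x¹ ⊗ 1 ⊗ (x² ⇀ α)`. -/
instance : Ring (BAlg H s) :=
  { (inferInstance : AddCommGroup (BAlg H s)) with
    mul := fun b c => mulLin s b c
    one := oneB s
    left_distrib := fun b c d => map_add (mulLin s b) c d
    right_distrib := fun b c d => LinearMap.map_add₂ (mulLin s) b c d
    zero_mul := fun b => LinearMap.map_zero₂ (mulLin s) b
    mul_zero := fun b => map_zero (mulLin s b)
    mul_assoc := mulLin_assoc s
    one_mul := oneB_mulLin s
    mul_one := mulLin_oneB s }

instance : Algebra k (BAlg H s) := Algebra.ofModule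
  (fun r b c => LinearMap.map_smul₂ (mulLin s) r b c) (fun r b c => map_smul (mulLin s b) r c)

lemma tri_mul_tri (a b : A) (h g : H) (φ ψ : Module.Dual k A) :
    tri s a h φ * tri s b g ψ = ψ a • tri s b (h * g) φ := mulLin_tri s a b h g φ ψ

lemma one_eq : (1 : BAlg H s) = sw s.x fun x₁ x₂ => tri s x₁ 1 (lharp x₂ s.α) := rfl

/-- The action `(a ⊗ h ⊗ φ) (ψ ⊗ m) = ⟨ψ, a⟩ φ ⊗ h m` of `B` on `A* ⊗ M`. -/
def actLin {M : Type u} [AddCommGroup M] [Module k M] (ρ : H →ₐ[k] Module.End k M) :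
    BAlg H s →ₗ[k] Module.End k (Module.Dual k A ⊗[k] M) :=
  (TensorProduct.homTensorHomMap (RingHom.id k) (Module.Dual k A) M (Module.Dual k A) M ∘ₗ
    TensorProduct.map (TensorProduct.lift (LinearMap.smulRightₗ ∘ₗ Module.Dual.eval k A))
      ρ.toLinearMap ∘ₗ
    (TensorProduct.comm k H (A ⊗[k] Module.Dual k A)).toLinearMap ∘ₗ
    (TensorProduct.leftComm k A H (Module.Dual k A)).toLinearMap :
    A ⊗[k] (H ⊗[k] Module.Dual k A) →ₗ[k] Module.End k (Module.Dual k A ⊗[k] M))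

lemma actLin_tri {M : Type u} [AddCommGroup M] [Module k M] (ρ : H →ₐ[k] Module.End k M)
    (a : A) (h : H) (φ ψ : Module.Dual k A) (m : M) :
    actLin s ρ (tri s a h φ) (ψ ⊗ₜ m) = ψ a • (φ ⊗ₜ ρ h m) := by
  refine Eq.trans (b := ((ψ a • φ) ⊗ₜ ρ h m : Module.Dual k A ⊗[k] M)) rfl ?_
  rw [TensorProduct.smul_tmul']

lemma actLin_mul {M : Type u} [AddCommGroup M] [Module k M] (ρ : H →ₐ[k] Module.End k M)
    (b c : BAlg H s) : actLin s ρ (b * c) = actLin s ρ b * actLin s ρ c := by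
  induction b using induction_tri with
  | h0 => simp
  | ha b b' hb hb' => simp only [map_add, add_mul, hb, hb']
  | ht a h φ =>
  induction c using induction_tri with
  | h0 => simp
  | ha b b' hb hb' => simp only [map_add, mul_add, hb, hb']
  | ht a' h' φ' =>
    apply TensorProduct.ext'
    intro ψ m
    rw [tri_mul_tri, map_smul, LinearMap.smul_apply, actLin_tri, Module.End.mul_apply, actLin_tri,
      map_smul, actLin_tri, smul_smul, smul_smul, mul_comm, map_mul, Module.End.mul_apply]

lemma actLin_one {M : Type u} [AddCommGroup M] [Module k M] (ρ : H →ₐ[k] Module.End k M) :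
    actLin s ρ 1 = 1 := by
  apply TensorProduct.ext'
  intro ψ m
  simp only [one_eq, sw, map_sum, LinearMap.sum_apply, actLin_tri, map_one, Module.End.one_apply,
    TensorProduct.smul_tmul', ← TensorProduct.sum_tmul]
  congr 1
  ext c
  have := congrArg ψ (sum_dual_basis s c)
  simp only [map_sum, map_smul, smul_eq_mul] at this
  simp only [LinearMap.sum_apply, LinearMap.smul_apply, lharp, LinearMap.comp_apply,
    LinearMap.mulRight_apply, smul_eq_mul]
  rw [← this]
  exact Finset.sum_congr rfl fun p _ => mul_comm _ _

/-- The `B`-module `A* ⊗ M`. -/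
abbrev dualTensor (M : FDMod k H) : FDMod k (BAlg H s) where
  carrier := Module.Dual k A ⊗[k] M.carrier
  fin := by
    have := s.finite
    infer_instance
  ρ := AlgHom.ofLinearMap (actLin s M.ρ) (actLin_one s M.ρ) (actLin_mul s M.ρ)

lemma dualTensor_ρ_tri (M : FDMod k H) (a : A) (h : H) (φ ψ : Module.Dual k A) (m : M.carrier) :
    (dualTensor s M).ρ (tri s a h φ) (ψ ⊗ₜ m) = ψ a • (φ ⊗ₜ M.ρ h m) := actLin_tri s M.ρ a h φ ψ m

/-- The map `id ⊗ f : A* ⊗ M → A* ⊗ N`. -/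
def dualTensorMap {M N : FDMod k H} (f : M ⟶ N) : dualTensor s M ⟶ dualTensor s N :=
  FDMod.ofLin (M := dualTensor s M) (N := dualTensor s N)
    ((FDMod.lin f).lTensor (Module.Dual k A)) (fun b t => by
      induction b using induction_tri with
      | h0 => simp
      | ha b b' hb hb' => simp only [map_add, LinearMap.add_apply, hb, hb']
      | ht a h φ =>
      refine TensorProduct.induction_on t (by simp) (fun ψ m => ?_)
        (fun y z hy hz => by simp only [map_add, hy, hz])
      · rw [dualTensor_ρ_tri, map_smul, LinearMap.lTensor_tmul, LinearMap.lTensor_tmul,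
          dualTensor_ρ_tri, FDMod.lin_ρ])

end BAlg
end BAlg

/-! ### The weak Hopf algebra `B` and the functor `A* ⊗ -` -/

section main
variable {k H A : Type u} [Field k] [Ring H] [HopfAlgebra k H] [Ring A] [Algebra k A]

open BAlg in
/-- The structure maps of a quasi-triangular weak Hopf algebra structure `W` on `B = A ⊗ H ⊗ A*`
are those determined by `R`, the action of `H` on `A`, and `x`. -/
structure IsStructureOnB (Q : QuasiTriangular k H) (T : ModuleAlgebra k H A)
    (s : SymmSepIdempotent k A) (W : QuasiTriangularWeakHopf k (BAlg H s)) : Prop where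
  /-- `Δ(a ⊗ h ⊗ φ) = ((R₁² x¹) a ⊗ R₂¹ h₁ R₁¹ ⊗ φ₂) ⊗ (x² ⊗ h₂ ⊗ (φ₁ ◁ R₂²))`,
  where `R₁ = R₂ = R`. -/
  comul_eq : ∀ (a : A) (h : H) (φ : Module.Dual k A), W.comul (tri s a h φ) =
    sw Q.R fun R₁₁ R₁₂ => sw Q.R fun R₂₁ R₂₂ => sw s.x fun x₁ x₂ =>
      sw (Coalgebra.comul (R := k) h) fun h₁ h₂ => sw (s.comulDual φ) fun φ₁ φ₂ =>
        tri s (T.act R₁₂ x₁ * a) (R₂₁ * h₁ * R₁₁) φ₂ ⊗ₜ[k] tri s x₂ h₂ (T.transp φ₁ R₂₂)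
  /-- `ε(a ⊗ h ⊗ φ) = ⟨α, a⟩ ε(h) ⟨φ, 1⟩` -/
  counit_eq : ∀ (a : A) (h : H) (φ : Module.Dual k A), W.counit (tri s a h φ) =
    s.α a * Coalgebra.counit (R := k) h * φ 1
  /-- `S(a ⊗ h ⊗ φ) = ⟨φ ◁ R₂², x¹⟩ x² ⊗ R₁¹ S(R₂¹ h) ⊗ (α ↼ (R₁² a))` -/
  antipode_eq : ∀ (a : A) (h : H) (φ : Module.Dual k A), W.antipode (tri s a h φ) =
    sw Q.R fun R₁₁ R₁₂ => sw Q.R fun R₂₁ R₂₂ => sw s.x fun x₁ x₂ =>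
      T.transp φ R₂₂ x₁ • tri s x₂ (R₁₁ * HopfAlgebra.antipode k (R₂₁ * h))
        (rharp s.α (T.act R₁₂ a))
  /-- `R_B = ((R₃² x₂¹) x₁¹ ⊗ R₂¹ R₃¹ ⊗ (α₁ ◁ R₁²)) ⊗ (x₂² ⊗ R₁¹ R₂² ⊗ (x₁² ⇀ α₂))`,
  where `R₁ = R₂ = R₃ = R` and `x₁ = x₂ = x`. -/
  R_eq : W.R =
    sw Q.R fun R₁₁ R₁₂ => sw Q.R fun R₂₁ R₂₂ => sw Q.R fun R₃₁ R₃₂ =>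
      sw s.x fun x₁₁ x₁₂ => sw s.x fun x₂₁ x₂₂ => sw (s.comulDual s.α) fun α₁ α₂ =>
        tri s (T.act R₃₂ x₂₁ * x₁₁) (R₂₁ * R₃₁) (T.transp α₁ R₁₂) ⊗ₜ[k]
          tri s x₂₂ (R₁₁ * R₂₂) (lharp x₁₂ α₂)

/-- The functor `F : M ↦ A* ⊗ M` from `H`-modules to `B`-modules. -/
def functorF (Q : QuasiTriangular k H) (s : SymmSepIdempotent k A)
    (W : QuasiTriangularWeakHopf k (BAlg H s)) : Q.ModCat ⥤ W.ModCat where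
  obj M := BAlg.dualTensor s (M : FDMod k H)
  map f := BAlg.dualTensorMap (k := k) (H := H) s f
  map_id := fun (M : FDMod k H) => FDMod.hom_ext (M := BAlg.dualTensor s M)
    (N := BAlg.dualTensor s M) (LinearMap.lTensor_id _ _)
  map_comp := fun {M _ P : FDMod k H} f g => FDMod.hom_ext (M := BAlg.dualTensor s M)
    (N := BAlg.dualTensor s P) (LinearMap.lTensor_comp (Module.Dual k A)
      (FDMod.lin (k := k) (B := H) g) (FDMod.lin (k := k) (B := H) f))

/-- The left `A`-action `a (φ ⊗ m) = (a ⇀ φ) ⊗ m` on `F(M) = A* ⊗ M`. -/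
def leftA (M : FDMod k H) (a : A) : Module.End k (Module.Dual k A ⊗[k] M.carrier) :=
  LinearMap.rTensor M.carrier (LinearMap.mulRight k a).dualMap

/-- The right `A`-action `(φ ⊗ m) a = (φ ↼ (R² a)) ⊗ R¹ m` on `F(M) = A* ⊗ M`. -/
def rightA (Q : QuasiTriangular k H) (T : ModuleAlgebra k H A) (M : FDMod k H) (a : A) :
    Module.End k (Module.Dual k A ⊗[k] M.carrier) :=
  sw Q.R fun R₁ R₂ => TensorProduct.map (LinearMap.mulLeft k (T.act R₂ a)).dualMap (M.ρ R₁)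

/-- The relations `v a ⊗ w = v ⊗ a w` that define `F(M) ⊗_A F(N)` as a quotient of
`F(M) ⊗ F(N)`. -/
def balanced (Q : QuasiTriangular k H) (T : ModuleAlgebra k H A) (M N : FDMod k H) :
    Submodule k ((Module.Dual k A ⊗[k] M.carrier) ⊗[k] (Module.Dual k A ⊗[k] N.carrier)) :=
  Submodule.span k {t | ∃ v w, ∃ a : A, t = rightA Q T M a v ⊗ₜ[k] w - v ⊗ₜ[k] leftA N a w}

end main

end WeakHopf

end

/-!
A semisimple Hopf algebra `H` over a field of characteristic zero has `S² = id` (Larson–Radford,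
`antipode_antipode_of_isSemisimpleRing`). One may pass to an algebraic closure. The trace of `S²`
is the value at `1` of the right integral `λ` of `H*`, and it is a sum of squared norms of traces
of endomorphisms of finite order that do not all vanish, hence nonzero
(`IsIntegral.modularElt_blocks`). This forces the modular element to be `1` and `S²` to be an
involution, and a comparison with the projection proportional to `h ↦ χ(h₁) h₂`, for the regular
character `χ`, leaves only `S² = ±1` (`eq_one_or_eq_neg_one_of_trace`).
Consequently the trace form `α` of the module algebra `A` and its separability idempotent `x` are
`H`-invariant (`α_act`, `pairRep_x`). So `c ↦ α (- c)` identifies `A` with `A*` as an `H`-module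
(`toDual`), and `A` is a special Frobenius algebra in the category of `H`-modules.

Everything about `B` is read off from its faithful action on `A ⊗ H`
(`algAct_injective`, `ext_algAct`). Under `A ≅ A*` the functor `F` is `M ↦ A ⊗ M`, and it is
both lax and colax monoidal, through maps `π : F M ⊗ F N → F (M ⊗ N)` and `ι` in the other
direction built from the multiplication of `A`, from `x` and from the braiding. These satisfy
`π ι = 1` (`piLin_ioLin`), they are associative and coassociative (`piLin_assoc`,
`ioLin_coassoc`), and they satisfy the two Frobenius relations (`piLin_ioLin_right`,
`piLin_ioLin_left`). The formulas defining the structure of `B` are then identified as follows: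

* `Δ_B b` acts on `F M ⊗ F N` as `ι b π` (`pairRep_comulB`);
* `R_B`, followed by the flip, acts as `ι σ π`, where `σ` is the braiding of `H`-modules
  (`flipAct_RB`);
* `ε_B b` is `α (b · 1)` (`counitB_eq`);
* `S_B` gives the adjoint for the evaluation pairing on `F H` (`evF_antipodeB`).

The axioms of a quasi-triangular weak Hopf algebra follow by formal manipulation of `π`, `ι` and
`σ`; the hexagons and the coherence of `σ` are those of `H`.

For the categories: `Δ_B 1` acts as `ι π`, so its kernel is the kernel of `π`, which is the span
of the balancing relations (`ker_act_one_eq_balanced`). The functor `F` is the Morita equivalence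
between `H` and `End(A) ⊗ H`, with inverse cut out by an idempotent `a ⊗ 1 ⊗ α` with `α a = 1`
(`functorF_isEquivalence`). The maps `π` and `ι` restrict to inverse isomorphisms between
`F M ⊗_B F N` and `F (M ⊗ N)` (`tensorIso`), which together with `unitIso` make `F` monoidal
(`functorFCoreMonoidal`) and compatible with the braidings (`tensorIso_braid`). The map `ξ` of the
statement is a section of `π` (`piD_α`), and so represents the inverse isomorphism.
The unit object is simple because `End(A)` already acts transitively on the nonzero vectors of `A`
(`simple_of_transitive`).
-/

open CategoryTheory MonoidalCategory
open scoped TensorProduct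

set_option maxSynthPendingDepth 3
set_option linter.unusedSectionVars false

noncomputable section

/-! ### Convolution and the antipode -/

namespace HopfConv

open Coalgebra HopfAlgebra

section conv
variable {k C X Y : Type*} [Field k] [AddCommGroup C] [Module k C] [Coalgebra k C]
  [Ring X] [Algebra k X] [Ring Y] [Algebra k Y]

/-- The convolution product `c ↦ f(c₁) g(c₂)` of linear maps from a coalgebra to an algebra. -/
def conv (f g : C →ₗ[k] X) : C →ₗ[k] X :=
  LinearMap.mul' k X ∘ₗ TensorProduct.map f g ∘ₗ comul

scoped infixl:70 " ⋆ " => conv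

variable (k C X) in
/-- The unit `c ↦ ε(c) 1` of the convolution product. -/
def convOne : C →ₗ[k] X := Algebra.linearMap k X ∘ₗ counit

lemma conv_apply (f g : C →ₗ[k] X) (c : C) :
    (f ⋆ g) c = LinearMap.mul' k X (TensorProduct.map f g (comul c)) := rfl

lemma conv_sum (f g : C →ₗ[k] X) (c : C) :
    (f ⋆ g) c = ∑ i ∈ (ℛ k c).index, f ((ℛ k c).left i) * g ((ℛ k c).right i) := by
  rw [conv_apply, ← (ℛ k c).eq]
  simp

lemma convOne_apply (c : C) : convOne k C X c = counit (R := k) c • (1 : X) := by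
  simp [convOne, Algebra.algebraMap_eq_smul_one]

lemma conv_assoc (f g h : C →ₗ[k] X) : f ⋆ g ⋆ h = f ⋆ (g ⋆ h) :=
  congrArg WithConv.ofConv (mul_assoc (WithConv.toConv f) (WithConv.toConv g) (WithConv.toConv h))

@[simp] lemma conv_one (f : C →ₗ[k] X) : f ⋆ convOne k C X = f :=
  congrArg WithConv.ofConv (mul_one (WithConv.toConv f))

@[simp] lemma one_conv (f : C →ₗ[k] X) : convOne k C X ⋆ f = f :=
  congrArg WithConv.ofConv (one_mul (WithConv.toConv f))

lemma inv_unique {f g h : C →ₗ[k] X} (hg : g ⋆ f = convOne k C X) (hh : f ⋆ h = convOne k C X) :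
    g = h := by
  rw [← conv_one g, ← hh, ← conv_assoc, hg, one_conv]

lemma mul_inv_cancel_conv {f f' g g' : C →ₗ[k] X} (hf : f' ⋆ f = convOne k C X)
    (hg : g' ⋆ g = convOne k C X) : (g' ⋆ f') ⋆ (f ⋆ g) = convOne k C X := by
  rw [conv_assoc, ← conv_assoc f', hf, one_conv, hg]

lemma algHom_comp_conv (φ : X →ₐ[k] Y) (f g : C →ₗ[k] X) :
    φ.toLinearMap ∘ₗ (f ⋆ g) = (φ.toLinearMap ∘ₗ f) ⋆ (φ.toLinearMap ∘ₗ g) := by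
  ext c
  simp [conv_sum]

lemma algHom_comp_convOne (φ : X →ₐ[k] Y) :
    φ.toLinearMap ∘ₗ convOne k C X = convOne k C Y := by
  ext c
  simp [convOne_apply]

lemma mulLeft_conv (a : X) (f g : C →ₗ[k] X) :
    (LinearMap.mulLeft k a ∘ₗ f) ⋆ g = LinearMap.mulLeft k a ∘ₗ (f ⋆ g) := by
  ext c
  simp [conv_sum, mul_assoc]

lemma conv_mulRight (a : X) (f g : C →ₗ[k] X) :
    f ⋆ (LinearMap.mulRight k a ∘ₗ g) = LinearMap.mulRight k a ∘ₗ (f ⋆ g) := by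
  ext c
  simp [conv_sum, mul_assoc]

end conv

section hopf
variable {k H X : Type*} [Field k] [Ring H] [HopfAlgebra k H] [Ring X] [Algebra k X]

lemma id_conv_antipode : (LinearMap.id : H →ₗ[k] H) ⋆ antipode k = convOne k H H :=
  congrArg WithConv.ofConv LinearMap.id_mul_antipode

lemma antipode_conv_id : antipode k ⋆ (LinearMap.id : H →ₗ[k] H) = convOne k H H :=
  congrArg WithConv.ofConv LinearMap.antipode_mul_id

/-- An algebra map `f` has convolution inverse `f ∘ S`. -/
lemma algHom_conv_antipode (f : H →ₐ[k] X) :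
    f.toLinearMap ⋆ (f.toLinearMap ∘ₗ antipode k) = convOne k H X := by
  rw [← algHom_comp_convOne f, ← id_conv_antipode, algHom_comp_conv, LinearMap.comp_id]

lemma antipode_conv_algHom (f : H →ₐ[k] X) :
    (f.toLinearMap ∘ₗ antipode k) ⋆ f.toLinearMap = convOne k H X := by
  rw [← algHom_comp_convOne f, ← antipode_conv_id, algHom_comp_conv, LinearMap.comp_id]

variable (k H) in
/-- The inclusion `h ↦ h ⊗ 1`. -/
def inl : H →ₐ[k] H ⊗[k] H := Algebra.TensorProduct.includeLeft
variable (k H) in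
/-- The inclusion `h ↦ 1 ⊗ h`. -/
def inr : H →ₐ[k] H ⊗[k] H := Algebra.TensorProduct.includeRight

@[simp] lemma inl_apply (h : H) : inl k H h = h ⊗ₜ 1 := rfl

@[simp] lemma inr_apply (h : H) : inr k H h = 1 ⊗ₜ h := rfl

lemma inl_conv_inr : (inl k H).toLinearMap ⋆ (inr k H).toLinearMap = comul := by
  ext h
  rw [conv_sum, ← (ℛ k h).eq]
  simp

/-- The antipode reverses the coproduct. -/
lemma comul_comp_antipode :
    comul ∘ₗ antipode k (A := H) = ((inr k H).toLinearMap ∘ₗ antipode k) ⋆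
        ((inl k H).toLinearMap ∘ₗ antipode k) := by
  have e : (Bialgebra.comulAlgHom k H).toLinearMap = comul := rfl
  have h := algHom_conv_antipode (Bialgebra.comulAlgHom k H)
  rw [e] at h
  refine (inv_unique ?_ h).symm
  rw [← inl_conv_inr]
  exact mul_inv_cancel_conv (antipode_conv_algHom (inl k H)) (antipode_conv_algHom (inr k H))

lemma comul_antipode (h : H) :
    comul (R := k) (antipode k h) =
      TensorProduct.map (antipode k) (antipode k) (TensorProduct.comm k H H (comul (R := k) h)) := by
  rw [← LinearMap.comp_apply, comul_comp_antipode, conv_sum]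
  conv_rhs => rw [← (ℛ k h).eq]
  simp

end hopf
end HopfConv

/-! ### Separability and integrals -/

section separability
variable {k A : Type u} [Field k] [Ring A] [Algebra k A]

/-- An algebra with a separability element `x` is finite-dimensional: the right legs of `x` span a
finite-dimensional right ideal `V`, and `A` acts faithfully on `V`. -/
lemma finite_of_separability (x : A ⊗[k] A) (hx : LinearMap.mul' k A x = 1)
    (hax : ∀ a : A, (a ⊗ₜ[k] (1 : A)) * x = x * ((1 : A) ⊗ₜ[k] a)) : Module.Finite k A := by
  let ℬ := Module.Basis.ofVectorSpace k A
  obtain ⟨c, hc⟩ := TensorProduct.eq_repr_basis_left ℬ x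
  let ψ : ∀ i, A ⊗[k] A →ₗ[k] A := fun i =>
    (TensorProduct.lid k A).toLinearMap ∘ₗ (ℬ.coord i).rTensor A
  have hψ : ∀ i, ψ i x = c i := by
    intro i
    classical
    rw [← hc, Finsupp.sum, map_sum, Finset.sum_eq_single i]
    · simp [ψ]
    · intro j _ hj
      simp [ψ, hj]
    · intro hi
      simp [Finsupp.notMem_support_iff.1 hi]
  let V : Submodule k A := Submodule.span k (c '' (c.support : Set _))
  have hV : ∀ i, c i ∈ V := by
    intro i
    by_cases hi : i ∈ c.support
    · exact Submodule.subset_span ⟨i, hi, rfl⟩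
    · rw [Finsupp.notMem_support_iff.1 hi]; exact V.zero_mem
  have : Module.Finite k V := Module.Finite.span_of_finite k (c.support.finite_toSet.image _)
  have hVm : ∀ a : A, ∀ i, c i * a ∈ V := by
    intro a i
    have h1 : ψ i (x * ((1 : A) ⊗ₜ[k] a)) = c i * a := by
      rw [← hψ i]
      generalize x = z
      induction z with
      | zero => simp
      | add z w hz hw => simp only [map_add, add_mul, hz, hw]
      | tmul p q => simp [ψ]
    rw [← h1, ← hax, ← hc, Finsupp.sum, Finset.mul_sum, map_sum]
    refine V.sum_mem fun j _ => ?_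
    simp only [ψ, Algebra.TensorProduct.tmul_mul_tmul, one_mul, LinearMap.comp_apply,
      LinearMap.rTensor_tmul, LinearEquiv.coe_coe, TensorProduct.lid_tmul]
    exact V.smul_mem _ (hV j)
  have hVm' : ∀ a : A, ∀ v ∈ V, v * a ∈ V := by
    intro a v hv
    induction hv using Submodule.span_induction with
    | mem y hy => obtain ⟨i, _, rfl⟩ := hy; exact hVm a i
    | zero => simp
    | add y z _ _ hy hz => rw [add_mul]; exact V.add_mem hy hz
    | smul r y _ hy => rw [smul_mul_assoc]; exact V.smul_mem r hy
  let Φ : A →ₗ[k] (V →ₗ[k] V) :=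
    { toFun := fun a => (LinearMap.mulRight k a).restrict (hVm' a)
      map_add' := fun a b => LinearMap.ext fun v => Subtype.ext (mul_add v.1 a b)
      map_smul' := fun r a => LinearMap.ext fun v => Subtype.ext (mul_smul_comm r v.1 a) }
  refine Module.Finite.of_injective Φ ((injective_iff_map_eq_zero Φ).2 fun a ha => ?_)
  have hca : ∀ i, c i * a = 0 := by
    intro i
    exact congrArg Subtype.val (LinearMap.congr_fun ha ⟨c i, hV i⟩)
  have h1 : LinearMap.mul' k A x * a = 0 := by
    rw [← hc, Finsupp.sum, map_sum, Finset.sum_mul]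
    refine Finset.sum_eq_zero fun i _ => ?_
    rw [LinearMap.mul'_apply, mul_assoc, hca, mul_zero]
  rwa [hx, one_mul] at h1

/-- Maschke's theorem for separable algebras. -/
lemma isSemisimpleRing_of_separability (x : A ⊗[k] A) (hx : LinearMap.mul' k A x = 1)
    (hax : ∀ a : A, (a ⊗ₜ[k] (1 : A)) * x = x * ((1 : A) ⊗ₜ[k] a)) : IsSemisimpleRing A := by
  suffices h : ComplementedLattice (Submodule A A) from IsSemisimpleModule.mk
  refine ⟨fun N => ?_⟩
  obtain ⟨π, hπ⟩ := (N.restrictScalars k).subtype.exists_leftInverse_of_injective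
    (LinearMap.ker_eq_bot.2 (Submodule.injective_subtype _))
  -- the average `v ↦ x¹ π(x² v)` of the projection `π`
  let avg : A → A ⊗[k] A →ₗ[k] N.restrictScalars k := fun v =>
    TensorProduct.lift (LinearMap.mk₂ k (fun p q => (⟨p * (π (q * v) : A),
      N.smul_mem p (π (q * v)).2⟩ : N.restrictScalars k))
      (fun a b c => Subtype.ext (add_mul _ _ _)) (fun r a b => Subtype.ext (smul_mul_assoc _ _ _))
      (fun a b c => Subtype.ext (by simp [add_mul, mul_add]))
      (fun r a b => Subtype.ext (by simp)))
  have havg : ∀ v p q, (avg v (p ⊗ₜ q) : A) = p * (π (q * v) : A) := fun _ _ _ => rfl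
  have h1 : ∀ (a v : A) (z : A ⊗[k] A),
      (avg v (z * (1 ⊗ₜ a)) : A) = (avg (a * v) z : A) := by
    intro a v z
    induction z with
    | zero => simp
    | add z w hz hw => simp only [add_mul, map_add, Submodule.coe_add, hz, hw]
    | tmul p q => simp [havg, mul_assoc]
  have h2 : ∀ (a v : A) (z : A ⊗[k] A),
      (avg v ((a ⊗ₜ 1) * z) : A) = a * (avg v z : A) := by
    intro a v z
    induction z with
    | zero => simp
    | add z w hz hw => simp only [mul_add, map_add, Submodule.coe_add, hz, hw]
    | tmul p q => simp [havg, mul_assoc]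
  have h3 : ∀ (v w : A) (z : A ⊗[k] A), (avg (v + w) z : A) = avg v z + avg w z := by
    intro v w z
    induction z with
    | zero => simp
    | add z w hz hw => simp only [map_add, Submodule.coe_add, hz, hw]; abel
    | tmul p q => simp [havg, mul_add]
  have h4 : ∀ v ∈ N, ∀ z : A ⊗[k] A, (avg v z : A) = LinearMap.mul' k A z * v := by
    intro v hv z
    induction z with
    | zero => simp
    | add z w hz hw => simp only [map_add, Submodule.coe_add, hz, hw, add_mul]
    | tmul p q =>
      have := LinearMap.congr_fun hπ ⟨q * v, N.smul_mem q hv⟩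
      have e : (π (q * v) : A) = q * v := congrArg Subtype.val this
      simp [havg, e, mul_assoc]
  let P : A →ₗ[A] N :=
    { toFun := fun v => avg v x
      map_add' := fun v w => Subtype.ext (h3 v w x)
      map_smul' := fun a v => Subtype.ext (by
        change (avg (a * v) x : A) = a * (avg v x : A)
        rw [← h1, ← hax, h2]) }
  exact ⟨_, LinearMap.isCompl_of_proj (f := P) fun n => Subtype.ext (by
    change (avg n x : A) = n
    rw [h4 _ n.2, hx, one_mul])⟩

end separability

namespace HopfConv
open Coalgebra HopfAlgebra

section integral
variable {k H : Type*} [Field k] [Ring H] [HopfAlgebra k H]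

/-- A normalised two-sided integral of a Hopf algebra. -/
structure IsIntegral (k : Type*) {H : Type*} [Field k] [Ring H] [HopfAlgebra k H] (Λ : H) :
    Prop where
  mul_left : ∀ h : H, h * Λ = counit (R := k) h • Λ
  mul_right : ∀ h : H, Λ * h = counit (R := k) h • Λ
  counit : counit (R := k) Λ = 1

variable (k H) in
/-- A semisimple Hopf algebra has a normalised integral: a complement of the augmentation ideal
supplies a left integral and, in the opposite algebra, a right one, and the two agree. -/
lemma exists_isIntegral [IsSemisimpleRing H] : ∃ Λ : H, IsIntegral k Λ := by
  -- an augmented semisimple algebra has a normalised left integral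
  have hl : ∀ (A : Type _) [Ring A] [IsSemisimpleRing A] [Algebra k A] (ε : A →ₐ[k] k),
      ∃ e : A, (∀ a, a * e = ε a • e) ∧ ε e = 1 := by
    intro A _ _ _ ε
    let I : Submodule A A := RingHom.ker ε.toRingHom
    obtain ⟨J, hJ⟩ := exists_isCompl I
    obtain ⟨i, hi, e, he, hie⟩ := Submodule.mem_sup.1
      (hJ.sup_eq_top ▸ Submodule.mem_top : (1 : A) ∈ I ⊔ J)
    have hi0 : ε i = 0 := hi
    refine ⟨e, fun a => ?_, ?_⟩
    · have h1 : (a - algebraMap k A (ε a)) * e ∈ I := by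
        change ε _ = 0
        simp
      have h2 : (a - algebraMap k A (ε a)) * e ∈ J := J.smul_mem _ he
      have := Submodule.disjoint_def.1 hJ.disjoint _ h1 h2
      rw [sub_mul, sub_eq_zero] at this
      rw [this, Algebra.smul_def]
    · have := congrArg ε hie
      simpa [hi0] using this
  obtain ⟨e, he, he1⟩ := hl H (Bialgebra.counitAlgHom k H)
  obtain ⟨f, hf, hf1⟩ := hl Hᵐᵒᵖ (AlgHom.fromOpposite (Bialgebra.counitAlgHom k H)
    fun _ _ => mul_comm _ _)
  have hfr : ∀ h : H, f.unop * h = counit (R := k) h • f.unop := fun h =>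
    MulOpposite.op_injective (hf (MulOpposite.op h))
  have hf1' : counit (R := k) f.unop = 1 := hf1
  have he1' : counit (R := k) e = 1 := he1
  have hee : ∀ h : H, h * e = counit (R := k) h • e := he
  have hef : f.unop = e := by
    have h1 := hee f.unop
    rw [hfr, he1', hf1', one_smul, one_smul] at h1
    exact h1
  exact ⟨e, hee, fun h => hef ▸ hfr h, he1'⟩

end integral
end HopfConv

/-! ### Integrals in the dual -/

namespace HopfConv
open Coalgebra HopfAlgebra

section integral
variable {k H : Type*} [Field k] [Ring H] [HopfAlgebra k H]

/-- The element `S(Λ₁) ⊗ Λ₂` attached to an integral `Λ`. -/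
def sepElt (k : Type*) {H : Type*} [Field k] [Ring H] [HopfAlgebra k H] (Λ : H) : H ⊗[k] H :=
  (antipode k).rTensor H (comul Λ)

lemma mul'_sepElt {Λ : H} (hΛ : IsIntegral k Λ) : LinearMap.mul' k H (sepElt k Λ) = 1 := by
  rw [sepElt, mul_antipode_rTensor_comul_apply, hΛ.counit, map_one]

/-- `h S(Λ₁) ⊗ Λ₂ = S(Λ₁) ⊗ Λ₂ h`, so that a Hopf algebra with a normalised integral is separable. -/
lemma tmul_mul_sepElt {Λ : H} (hΛ : IsIntegral k Λ) (h : H) :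
    (h ⊗ₜ[k] (1 : H)) * sepElt k Λ = sepElt k Λ * ((1 : H) ⊗ₜ[k] h) := by
  -- `f(h) = S(Λ₁ h₁) ⊗ Λ₂ h₂ = (S(h₁) ⊗ 1) E (1 ⊗ h₂)`, where `E = S(Λ₁) ⊗ Λ₂`
  let g : H →ₗ[k] H ⊗[k] H := LinearMap.mulLeft k (sepElt k Λ) ∘ₗ (inr k H).toLinearMap
  have hf : ∀ h, (((inl k H).toLinearMap ∘ₗ antipode k) ⋆ g) h =
      counit (R := k) h • sepElt k Λ := by
    intro h
    have h1 : ∀ e z : H ⊗[k] H, LinearMap.mul' k (H ⊗[k] H)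
        (TensorProduct.map ((inl k H).toLinearMap ∘ₗ antipode k)
          (LinearMap.mulLeft k ((antipode k).rTensor H e) ∘ₗ (inr k H).toLinearMap) z) =
        (antipode k).rTensor H (e * z) := by
      intro e z
      induction z with
      | zero => simp
      | add z w hz hw => simp only [map_add, mul_add, hz, hw]
      | tmul p q =>
      induction e with
      | zero => simp
      | add z w hz hw =>
        simp only [TensorProduct.map_tmul, LinearMap.mul'_apply, LinearMap.comp_apply,
          LinearMap.mulLeft_apply, map_add, add_mul, mul_add] at hz hw ⊢
        rw [hz, hw]
      | tmul a b => simp [antipode_mul_antidistrib]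
    rw [conv_apply]
    refine (h1 (comul Λ) (comul h)).trans ?_
    rw [← Bialgebra.comul_mul, hΛ.mul_right, map_smul, map_smul]
    rfl
  have h2 : ((inl k H).toLinearMap ∘ₗ antipode k) ⋆ g =
      LinearMap.toSpanSingleton k _ (sepElt k Λ) ∘ₗ counit := by
    ext h
    rw [hf]
    rfl
  have h3 : (inl k H).toLinearMap ⋆ (((inl k H).toLinearMap ∘ₗ antipode k) ⋆ g) = g := by
    rw [← conv_assoc, algHom_conv_antipode, one_conv]
  have h4 : (inl k H).toLinearMap ⋆ (LinearMap.toSpanSingleton k _ (sepElt k Λ) ∘ₗ counit) =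
      LinearMap.mulRight k (sepElt k Λ) ∘ₗ (inl k H).toLinearMap := by
    have : LinearMap.toSpanSingleton k _ (sepElt k Λ) ∘ₗ counit (A := H) =
        LinearMap.mulRight k (sepElt k Λ) ∘ₗ convOne k H (H ⊗[k] H) := by
      ext h
      simp [convOne_apply]
    rw [this, conv_mulRight, conv_one]
  rw [h2, h4] at h3
  exact LinearMap.congr_fun h3 h

/-- `Λ₁ ⊗ h Λ₂ = S(h) Λ₁ ⊗ Λ₂` -/
lemma tmul_mul_comul {Λ : H} (hΛ : IsIntegral k Λ) (h : H) :
    ((1 : H) ⊗ₜ[k] h) * comul Λ = (antipode k h ⊗ₜ[k] (1 : H)) * comul Λ := by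
  have h1 : ((inl k H).toLinearMap ∘ₗ antipode k) ⋆ comul = (inr k H).toLinearMap := by
    rw [← inl_conv_inr, ← conv_assoc, antipode_conv_algHom, one_conv]
  have h2 : LinearMap.mulRight k (comul Λ) ∘ₗ comul (A := H) =
      LinearMap.mulRight k (comul Λ) ∘ₗ convOne k H (H ⊗[k] H) := by
    ext h
    simp [convOne_apply, ← Bialgebra.comul_mul, hΛ.mul_left]
  have h3 := congrArg (fun f => LinearMap.mulRight k (comul (R := k) Λ) ∘ₗ f) h1
  rw [← conv_mulRight, h2, conv_mulRight, conv_one] at h3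
  exact (LinearMap.congr_fun h3 h).symm

/-- `Λ₁ h ⊗ Λ₂ = Λ₁ ⊗ Λ₂ S(h)` -/
lemma comul_mul_tmul {Λ : H} (hΛ : IsIntegral k Λ) (h : H) :
    comul Λ * (h ⊗ₜ[k] (1 : H)) = comul Λ * ((1 : H) ⊗ₜ[k] antipode k h) := by
  have h1 : comul ⋆ ((inr k H).toLinearMap ∘ₗ antipode k) = (inl k H).toLinearMap := by
    rw [← inl_conv_inr, conv_assoc, algHom_conv_antipode, conv_one]
  have h2 : LinearMap.mulLeft k (comul Λ) ∘ₗ comul (A := H) =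
      LinearMap.mulLeft k (comul Λ) ∘ₗ convOne k H (H ⊗[k] H) := by
    ext h
    simp [convOne_apply, ← Bialgebra.comul_mul, hΛ.mul_right]
  have h3 := congrArg (fun f => LinearMap.mulLeft k (comul (R := k) Λ) ∘ₗ f) h1
  rw [← mulLeft_conv, h2, mulLeft_conv, one_conv] at h3
  exact (LinearMap.congr_fun h3 h).symm

/-- A functional `f` with `f(h₁) h₂ = f(h) 1`. -/
def IsRightIntegral (f : H →ₗ[k] k) : Prop :=
  (Algebra.linearMap k H ∘ₗ f) ⋆ LinearMap.id = Algebra.linearMap k H ∘ₗ f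

lemma isRightIntegral_iff (f : H →ₗ[k] k) : IsRightIntegral f ↔
    ∀ h, TensorProduct.lid k H (f.rTensor H (comul h)) = f h • (1 : H) := by
  have h1 : ∀ h, ((Algebra.linearMap k H ∘ₗ f) ⋆ LinearMap.id) h =
      TensorProduct.lid k H (f.rTensor H (comul h)) := by
    intro h
    rw [conv_apply]
    generalize comul (R := k) h = z
    induction z with
    | zero => simp
    | add z w hz hw => simp only [map_add, hz, hw]
    | tmul p q => simp [Algebra.smul_def]
  constructor
  · intro hf h
    rw [← h1, hf]
    simp [Algebra.algebraMap_eq_smul_one]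
  · intro hf
    ext h
    rw [h1, hf]
    simp [Algebra.algebraMap_eq_smul_one]

variable (k H) in
/-- The functional `h ↦ tr(y ↦ S²(y) h)`. -/
def traceIntegral : H →ₗ[k] k :=
  LinearMap.trace k H ∘ₗ LinearMap.lcomp k H (antipode k ∘ₗ antipode k) ∘ₗ (LinearMap.mul k H).flip

lemma traceIntegral_apply (h : H) : traceIntegral k H h =
    LinearMap.trace k H (LinearMap.mulRight k h ∘ₗ (antipode k ∘ₗ antipode k)) := rfl

section
variable [Module.Finite k H]

/-- `φ(1) tr(y ↦ S²(y) h) = φ(h₂) tr(y ↦ S²(y) h₁)`: with `φ(pq) = ∑ⱼ φ(p bⱼ) bʲ(q)`, write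
`φ(1) S² = ∑ⱼ Cⱼ Gⱼ`, where `Cⱼ(y) = S²(y₁) φ(S(y₂) bⱼ)` and `Gⱼ(y) = y₁ bʲ(y₂)`, and use that the
trace is cyclic. -/
lemma traceIntegral_contract (φ : H →ₗ[k] k) (h : H) :
    traceIntegral k H (TensorProduct.rid k H (φ.lTensor H (comul h))) =
      φ 1 * traceIntegral k H h := by
  let b := Module.finBasis k H
  let Φ : H ⊗[k] H →ₗ[k] H := (TensorProduct.rid k H).toLinearMap ∘ₗ φ.lTensor H
  let P : H →ₗ[k] H ⊗[k] H := (antipode k).rTensor H ∘ₗ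
    (TensorProduct.comm k H H).toLinearMap ∘ₗ comul ∘ₗ antipode k
  let C : Fin (Module.finrank k H) → H →ₗ[k] H := fun j =>
    Φ ∘ₗ LinearMap.mulRight k ((1 : H) ⊗ₜ[k] b j) ∘ₗ P
  let G : Fin (Module.finrank k H) → H →ₗ[k] H := fun j =>
    (TensorProduct.rid k H).toLinearMap ∘ₗ (b.coord j).lTensor H ∘ₗ comul
  have hΦ : ∀ p q, Φ (p ⊗ₜ q) = φ q • p := fun p q => by simp [Φ]
  have hP : P = ((inl k H).toLinearMap ∘ₗ antipode k ∘ₗ antipode k) ⋆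
      ((inr k H).toLinearMap ∘ₗ antipode k) := by
    ext y
    rw [conv_sum]
    simp only [P, LinearMap.comp_apply]
    rw [comul_antipode]
    conv_lhs => rw [← (ℛ k y).eq]
    simp
  have hP2 : P ⋆ (inr k H).toLinearMap = (inl k H).toLinearMap ∘ₗ antipode k ∘ₗ antipode k := by
    rw [hP, conv_assoc, antipode_conv_algHom, conv_one]
  have s1 : ∑ j, C j ∘ₗ G j = φ 1 • (antipode k ∘ₗ antipode k) := by
    ext y
    have e1 : ∀ z : H ⊗[k] H,
        ∑ j, C j (TensorProduct.rid k H ((b.coord j).lTensor H z)) =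
        Φ (LinearMap.mul' k _ (TensorProduct.map P (inr k H).toLinearMap z)) := by
      intro z
      induction z with
      | zero => simp
      | add z w hz hw => simp only [map_add, Finset.sum_add_distrib, hz, hw]
      | tmul p q =>
        have : (1 : H) ⊗ₜ[k] q = ∑ j, b.coord j q • ((1 : H) ⊗ₜ[k] b j) := by
          simp_rw [← TensorProduct.tmul_smul, ← TensorProduct.tmul_sum]
          congr 1
          exact (b.sum_repr q).symm
        simp only [LinearMap.lTensor_tmul, TensorProduct.rid_tmul, map_smul,
          TensorProduct.map_tmul, LinearMap.mul'_apply, AlgHom.toLinearMap_apply, inr_apply, this,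
          Finset.mul_sum, map_sum, mul_smul_comm]
        rfl
    have e2 := e1 (comul y)
    rw [← conv_apply, hP2] at e2
    simp only [LinearMap.sum_apply, LinearMap.comp_apply]
    refine e2.trans ?_
    simp [hΦ]
  -- `(1 ⊗ q) Δ(p)` at `p ⊗ q = S²(y₁) ⊗ S(y₂)` is `S²(y) ⊗ 1`
  let Ξ : H ⊗[k] H →ₗ[k] H ⊗[k] H := TensorProduct.lift
    ((LinearMap.mul k (H ⊗[k] H)).flip.compl₁₂ comul (inr k H).toLinearMap)
  have hΞ : ∀ p q, Ξ (p ⊗ₜ q) = (1 ⊗ₜ q) * comul p := fun p q => rfl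
  have hΞP : ∀ y, Ξ (P y) = antipode k (antipode k y) ⊗ₜ 1 := by
    intro y
    have e1 : (inr k H).toLinearMap ⋆ (comul ∘ₗ antipode k) =
        (inl k H).toLinearMap ∘ₗ antipode k := by
      rw [comul_comp_antipode, ← conv_assoc, algHom_conv_antipode, one_conv]
    have e2 : ∀ z, Ξ ((antipode k).rTensor H (TensorProduct.comm k H H z)) =
        LinearMap.mul' k _ (TensorProduct.map (inr k H).toLinearMap (comul ∘ₗ antipode k) z) := by
      intro z
      induction z with
      | zero => simp
      | add z w hz hw => simp only [map_add, hz, hw]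
      | tmul p q => simp [hΞ]
    have e3 := LinearMap.congr_fun e1 (antipode k y)
    rw [conv_apply, ← e2] at e3
    exact e3
  have s2 : ∑ j, G j ∘ₗ (LinearMap.mulRight k h ∘ₗ C j) =
      LinearMap.mulRight k (Φ (comul h)) ∘ₗ (antipode k ∘ₗ antipode k) := by
    ext y
    have e1 : ∀ z : H ⊗[k] H,
        ∑ j, G j (Φ (z * ((1 : H) ⊗ₜ[k] b j)) * h) = Φ (Ξ z * comul h) := by
      intro z
      induction z with
      | zero => simp
      | add z w hz hw => simp only [map_add, add_mul, Finset.sum_add_distrib, hz, hw]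
      | tmul p q =>
        have e : ∀ w : H ⊗[k] H, ∑ j, φ (q * b j) • TensorProduct.rid k H
            ((b.coord j).lTensor H w) = Φ ((1 ⊗ₜ q) * w) := by
          intro w
          induction w with
          | zero => simp
          | add z w hz hw => simp only [map_add, smul_add, mul_add, Finset.sum_add_distrib, hz, hw]
          | tmul c d =>
            simp only [LinearMap.lTensor_tmul, TensorProduct.rid_tmul, smul_smul,
              Algebra.TensorProduct.tmul_mul_tmul, one_mul, hΦ, ← Finset.sum_smul]
            congr 1
            conv_rhs => rw [← b.sum_repr d, Finset.mul_sum, map_sum]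
            exact Finset.sum_congr rfl fun j _ => by simp [mul_comm]
        simp only [Algebra.TensorProduct.tmul_mul_tmul, mul_one, hΦ, smul_mul_assoc, map_smul, hΞ,
          mul_assoc, ← Bialgebra.comul_mul]
        exact e _
    have e2 := e1 (P y)
    rw [hΞP] at e2
    simp only [LinearMap.sum_apply, LinearMap.comp_apply]
    refine e2.trans ?_
    generalize comul (R := k) h = w
    induction w with
    | zero => simp
    | add z w hz hw =>
      simp only [LinearMap.mulRight_apply, map_add, mul_add] at hz hw ⊢
      rw [hz, hw]
    | tmul c d => simp [hΦ]
  change traceIntegral k H (Φ (comul h)) = _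
  rw [traceIntegral_apply, traceIntegral_apply, ← s2, ← smul_eq_mul, ← map_smul,
    ← LinearMap.comp_smul, ← s1]
  have e : LinearMap.mulRight k h ∘ₗ ∑ j, C j ∘ₗ G j =
      ∑ j, LinearMap.mulRight k h ∘ₗ (C j ∘ₗ G j) := by
    ext y
    simp
  rw [e, map_sum, map_sum]
  refine Finset.sum_congr rfl fun j _ => ?_
  rw [LinearMap.trace_comp_comm', LinearMap.comp_assoc]

/-- The trace functional is a right integral: `traceIntegral_contract` holds for all `φ`. -/
lemma isRightIntegral_traceIntegral : IsRightIntegral (traceIntegral k H) := by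
  rw [isRightIntegral_iff]
  intro h
  refine (Module.forall_dual_apply_eq_zero_iff k _).1 ?_ |> sub_eq_zero.1
  intro φ
  have h1 : ∀ z : H ⊗[k] H, φ (TensorProduct.lid k H ((traceIntegral k H).rTensor H z)) =
      traceIntegral k H (TensorProduct.rid k H (LinearMap.lTensor H φ z)) := by
    intro z
    induction z with
    | zero => simp
    | add z w hz hw => simp only [map_add, hz, hw]
    | tmul p q => simp [mul_comm]
  rw [map_sub, h1, traceIntegral_contract, map_smul, smul_eq_mul, mul_comm, sub_self]

end

end integral
end HopfConv

/-! ### Dual bases from an integral and the modular element -/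

namespace HopfConv
open Coalgebra HopfAlgebra

section dualBasis
variable {k H : Type*} [Field k] [Ring H] [HopfAlgebra k H]

variable [Module.Finite k H] {Λ : H}

lemma IsIntegral.traceIntegral_eq_one (hΛ : IsIntegral k Λ) : traceIntegral k H Λ = 1 := by
  have h1 : LinearMap.mulRight k Λ ∘ₗ (antipode k ∘ₗ antipode k) =
      (Coalgebra.counit (R := k) (A := H)).smulRight Λ := by
    ext y
    simp [hΛ.mul_left]
  rw [traceIntegral_apply, h1, LinearMap.trace_smulRight, hΛ.counit]

omit [Module.Finite k H] in
/-- `f(S(h) Λ₁) Λ₂ = f(Λ) h` for a right integral `f`. -/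
lemma IsIntegral.sum_antipode_mul (hΛ : IsIntegral k Λ) {f : H →ₗ[k] k} (hf : IsRightIntegral f)
    (h : H) : ∑ i ∈ (ℛ k Λ).index, f (antipode k h * (ℛ k Λ).left i) • (ℛ k Λ).right i =
      f Λ • h := by
  have h1 : TensorProduct.lid k H (f.rTensor H _) = TensorProduct.lid k H (f.rTensor H _) :=
    congrArg (fun z => TensorProduct.lid k H (f.rTensor H z)) (tmul_mul_comul hΛ h)
  have h2 : ∀ z, TensorProduct.lid k H (f.rTensor H ((1 ⊗ₜ h) * z)) =
      h * TensorProduct.lid k H (f.rTensor H z) := by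
    intro z
    induction z with
    | zero => simp
    | add z w hz hw => simp only [map_add, mul_add, hz, hw]
    | tmul p q => simp
  rw [h2, (isRightIntegral_iff f).1 hf] at h1
  conv_rhs at h1 => rw [← (ℛ k Λ).eq]
  simpa [Finset.mul_sum] using h1.symm

/-- The antipode is injective, because `h` is recovered from `S(h)` by `sum_antipode_mul`. -/
lemma IsIntegral.antipode_injective (hΛ : IsIntegral k Λ) :
    Function.Injective (antipode k : H →ₗ[k] H) := by
  refine (injective_iff_map_eq_zero _).2 fun h hh => ?_
  have := hΛ.sum_antipode_mul isRightIntegral_traceIntegral h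
  rw [hΛ.traceIntegral_eq_one, one_smul] at this
  rw [← this, hh]
  simp

lemma IsIntegral.antipode_surjective (hΛ : IsIntegral k Λ) :
    Function.Surjective (antipode k : H →ₗ[k] H) :=
  LinearMap.injective_iff_surjective.1 hΛ.antipode_injective

/-- `f(h Λ₁) S(Λ₂) = f(Λ) h` for a right integral `f`. -/
lemma IsIntegral.sum_mul_antipode (hΛ : IsIntegral k Λ) {f : H →ₗ[k] k} (hf : IsRightIntegral f)
    (h : H) : ∑ i ∈ (ℛ k Λ).index, f (h * (ℛ k Λ).left i) • antipode k ((ℛ k Λ).right i) =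
      f Λ • h := by
  obtain ⟨h, rfl⟩ := hΛ.antipode_surjective h
  have := congrArg (antipode k) (hΛ.sum_antipode_mul hf h)
  simpa using this

/-- `Λ₁ λ(S(Λ₂) h) = h`: the families `Λ₁` and `λ(S(Λ₂) ·)` are dual bases. -/
lemma IsIntegral.dual_basis (hΛ : IsIntegral k Λ) (h : H) :
    ∑ i ∈ (ℛ k Λ).index, traceIntegral k H (antipode k ((ℛ k Λ).right i) * h) •
      (ℛ k Λ).left i = h := by
  let D : Module.Dual k H →ₗ[k] H := ∑ i ∈ (ℛ k Λ).index,
    (Module.Dual.eval k H ((ℛ k Λ).left i)).smulRight (antipode k ((ℛ k Λ).right i))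
  have hD : ∀ φ, D φ = ∑ i ∈ (ℛ k Λ).index, φ ((ℛ k Λ).left i) • antipode k ((ℛ k Λ).right i) := by
    intro φ
    simp [D]
  have h1 : ∀ g : H, D (traceIntegral k H ∘ₗ LinearMap.mulLeft k g) = g := by
    intro g
    rw [hD]
    have := hΛ.sum_mul_antipode isRightIntegral_traceIntegral g
    rw [hΛ.traceIntegral_eq_one, one_smul] at this
    exact this
  have hinj : Function.Injective D :=
    (LinearMap.injective_iff_surjective_of_finrank_eq_finrank Subspace.dual_finrank_eq).2
      fun g => ⟨_, h1 g⟩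
  refine sub_eq_zero.1 ((Module.forall_dual_apply_eq_zero_iff k _).1 fun φ => ?_)
  have h2 := LinearMap.congr_fun (hinj (h1 (D φ))) h
  rw [map_sub, sub_eq_zero, ← h2, hD]
  simp [Finset.sum_mul, mul_comm]

/-- Right integrals in the dual are unique up to scalars. -/
lemma IsIntegral.eq_smul_traceIntegral (hΛ : IsIntegral k Λ) {f : H →ₗ[k] k}
    (hf : IsRightIntegral f) : f = f Λ • traceIntegral k H := by
  ext h
  have h1 := hΛ.sum_mul_antipode hf 1
  conv_lhs => rw [← hΛ.dual_basis h]
  have h2 := congrArg (fun z => traceIntegral k H (z * h)) h1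
  simp only [one_mul, Finset.sum_mul, smul_mul_assoc, map_sum, map_smul, smul_eq_mul] at h2
  simp only [map_sum, map_smul, smul_eq_mul, LinearMap.smul_apply]
  rw [← h2]
  exact Finset.sum_congr rfl fun _ _ => mul_comm _ _

/-- The trace of an endomorphism, computed in the dual bases `Λ₁` and `λ(S(Λ₂) ·)`. -/
lemma IsIntegral.trace_eq (hΛ : IsIntegral k Λ) (t : H →ₗ[k] H) :
    LinearMap.trace k H t = ∑ i ∈ (ℛ k Λ).index,
      traceIntegral k H (antipode k ((ℛ k Λ).right i) * t ((ℛ k Λ).left i)) := by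
  have h1 : t = ∑ i ∈ (ℛ k Λ).index, (traceIntegral k H ∘ₗ
      LinearMap.mulLeft k (antipode k ((ℛ k Λ).right i))).smulRight (t ((ℛ k Λ).left i)) := by
    ext h
    conv_lhs => rw [← hΛ.dual_basis h]
    simp
  conv_lhs => rw [h1]
  simp only [map_sum, LinearMap.trace_smulRight]
  rfl

variable (k) in
/-- The element `Λ₁ λ(Λ₂)`, for the right integral `λ` in the dual. -/
def modularElt (Λ : H) : H := TensorProduct.rid k H ((traceIntegral k H).lTensor H (comul Λ))

omit [Module.Finite k H] in
lemma conv_traceIntegral_apply (φ : H →ₗ[k] k) (h : H) : (φ ⋆ traceIntegral k H) h =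
    φ (TensorProduct.rid k H ((traceIntegral k H).lTensor H (comul h))) := by
  rw [conv_apply]
  generalize comul (R := k) h = z
  induction z with
  | zero => simp
  | add z w hz hw => simp only [map_add, hz, hw]
  | tmul p q => simp [mul_comm]

/-- `φ(h₁) λ(h₂) = φ(a) λ(h)`: the convolution `φ ⋆ λ` is a right integral again, hence a multiple
of `λ`. -/
lemma IsIntegral.conv_traceIntegral (hΛ : IsIntegral k Λ) (φ : H →ₗ[k] k) :
    φ ⋆ traceIntegral k H = φ (modularElt k Λ) • traceIntegral k H := by
  have h1 : IsRightIntegral (φ ⋆ traceIntegral k H) := by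
    have e : Algebra.linearMap k H = (Algebra.ofId k H).toLinearMap := rfl
    have e1 := isRightIntegral_traceIntegral (k := k) (H := H)
    rw [IsRightIntegral, e] at e1 ⊢
    rw [algHom_comp_conv, conv_assoc, e1]
  rw [hΛ.eq_smul_traceIntegral h1, conv_traceIntegral_apply]
  rfl

/-- `h₁ λ(h₂) = λ(h) a` -/
lemma IsIntegral.contract_right (hΛ : IsIntegral k Λ) (h : H) :
    TensorProduct.rid k H ((traceIntegral k H).lTensor H (comul h)) =
      traceIntegral k H h • modularElt k Λ := by
  refine sub_eq_zero.1 ((Module.forall_dual_apply_eq_zero_iff k _).1 fun φ => ?_)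
  have := LinearMap.congr_fun (hΛ.conv_traceIntegral φ) h
  rw [map_sub, ← conv_traceIntegral_apply φ h, this]
  simp [mul_comm]

/-- The modular element is group-like: by `conv_traceIntegral`, the map `φ ↦ φ(a)` is
multiplicative for the convolution product. -/
lemma IsIntegral.isGroupLikeElem_modularElt (hΛ : IsIntegral k Λ) :
    IsGroupLikeElem k (modularElt k Λ) where
  counit_eq_one := by
    have h1 := LinearMap.congr_fun (hΛ.conv_traceIntegral Coalgebra.counit) Λ
    have h2 : (Coalgebra.counit : H →ₗ[k] k) = convOne k H k := by ext h; simp [convOne_apply]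
    rw [h2, one_conv, ← h2, LinearMap.smul_apply, hΛ.traceIntegral_eq_one] at h1
    simpa using h1.symm
  comul_eq_tmul_self := by
    have h0 : ∀ (φ : H →ₗ[k] k), φ (modularElt k Λ) = (φ ⋆ traceIntegral k H) Λ := by
      intro φ
      rw [hΛ.conv_traceIntegral, LinearMap.smul_apply, hΛ.traceIntegral_eq_one, smul_eq_mul,
        mul_one]
    refine sub_eq_zero.1 ((Module.forall_dual_apply_eq_zero_iff k _).1 fun Φ => ?_)
    obtain ⟨w, rfl⟩ := (TensorProduct.dualDistribEquiv k H H).surjective Φ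
    rw [map_sub, sub_eq_zero]
    induction w with
    | zero => simp
    | add z w hz hw => simp only [map_add, LinearMap.add_apply, hz, hw]
    | tmul φ ψ =>
      have e : ∀ z, (TensorProduct.dualDistribEquiv k H H) (φ ⊗ₜ ψ) z =
          LinearMap.mul' k k (TensorProduct.map φ ψ z) := by
        intro z
        induction z with
        | zero => simp
        | add z w hz hw => simp only [map_add, hz, hw]
        | tmul p q => rfl
      have e1 : (TensorProduct.dualDistribEquiv k H H) (φ ⊗ₜ ψ) (comul (modularElt k Λ)) =
          (φ ⋆ ψ) (modularElt k Λ) := e _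
      rw [e1, h0, conv_assoc, hΛ.conv_traceIntegral ψ, e]
      have e2 : φ ⋆ (ψ (modularElt k Λ) • traceIntegral k H) =
          ψ (modularElt k Λ) • (φ ⋆ traceIntegral k H) := by
        ext h
        simp [conv_apply, TensorProduct.map_smul_right]
      rw [e2, LinearMap.smul_apply, ← h0]
      simp [mul_comm]

end dualBasis
end HopfConv

/-! ### Traces in characteristic zero -/

section traces

/-- The trace of `y ↦ a y b` on a product of matrix algebras. -/
lemma trace_mulLeft_comp_mulRight {K : Type*} [Field K] {n : ℕ} {d : Fin n → ℕ} {H : Type*}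
    [Ring H] [Algebra K H] (e : H ≃ₐ[K] Π i, Matrix (Fin (d i)) (Fin (d i)) K) (a b : H) :
    LinearMap.trace K H (LinearMap.mulLeft K a ∘ₗ LinearMap.mulRight K b) =
      ∑ i, (e a i).trace * (e b i).trace := by
  let v : Module.Basis (Σ i, Fin (d i) × Fin (d i)) K (Π i, Matrix (Fin (d i)) (Fin (d i)) K) :=
    Pi.basis fun i => Matrix.stdBasis K (Fin (d i)) (Fin (d i))
  have h1 : e.toLinearEquiv.conj (LinearMap.mulLeft K a ∘ₗ LinearMap.mulRight K b) =
      LinearMap.mulLeft K (e a) ∘ₗ LinearMap.mulRight K (e b) := by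
    refine LinearMap.ext fun y => ?_
    simp [LinearEquiv.conj_apply]
  rw [← LinearMap.trace_conj' _ e.toLinearEquiv, h1, LinearMap.trace_eq_matrix_trace K v,
    Matrix.trace, Fintype.sum_sigma]
  refine Finset.sum_congr rfl fun i _ => ?_
  rw [Matrix.trace, Matrix.trace, Finset.sum_mul_sum, Fintype.sum_prod_type]
  refine Finset.sum_congr rfl fun p _ => Finset.sum_congr rfl fun q _ => ?_
  have h2 : v ⟨i, (p, q)⟩ = Pi.single i (Matrix.single p q 1) := by
    simp [v, Matrix.stdBasis_eq_single]
  have h3 : ∀ (z : Π i, Matrix (Fin (d i)) (Fin (d i)) K), v.repr z ⟨i, (p, q)⟩ = z i p q := by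
    intro z
    simp [v, Pi.basis_repr, Matrix.stdBasis]
  rw [Matrix.diag_apply, LinearMap.toMatrix_apply, h3, h2]
  simp [Matrix.mul_apply, Matrix.single_apply, Pi.single_eq_same, ite_and]

variable {K V : Type*} [Field K] [CharZero K] [IsAlgClosed K] [AddCommGroup V] [Module K V]
  [Module.Finite K V]

/-- The eigenvalues of an endomorphism `f` with `f ^ N = 1`, listed with multiplicity. -/
lemma exists_eigenvalues_of_pow_eq_one {N : ℕ} (hN : N ≠ 0) (f : Module.End K V)
    (hf : f ^ N = 1) : ∃ (r : ℕ) (μ : Fin r → K), (∀ i, μ i ^ N = 1) ∧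
      ∀ j : ℕ, LinearMap.trace K V (f ^ j) = ∑ i, μ i ^ j := by
  classical
  have hss : f.IsSemisimple := by
    refine Module.End.isSemisimple_of_squarefree_aeval_eq_zero
      (p := Polynomial.X ^ N - 1) ?_ (by simp [hf])
    exact (Polynomial.separable_X_pow_sub_C (1 : K) (Nat.cast_ne_zero.2 hN) one_ne_zero).squarefree
  have hint : DirectSum.IsInternal f.eigenspace :=
    DirectSum.isInternal_submodule_of_iSupIndep_of_iSup_eq_top f.eigenspaces_iSupIndep
      hss.iSup_eigenspace_eq_top
  let v := hint.collectedBasis fun μ => Module.finBasis K (f.eigenspace μ)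
  let hI := FiniteDimensional.fintypeBasisIndex v
  have hv : ∀ i, f (v i) = i.1 • v i := by
    intro i
    exact Module.End.mem_eigenspace_iff.1 (hint.collectedBasis_mem _ i)
  have hvj : ∀ (j : ℕ) i, (f ^ j) (v i) = i.1 ^ j • v i := by
    intro j i
    induction j with
    | zero => simp
    | succ j ih => rw [pow_succ, Module.End.mul_apply, hv, map_smul, ih, smul_smul, pow_succ']
  let ε := Fintype.equivFin (Σ μ, Fin (Module.finrank K (f.eigenspace μ)))
  refine ⟨_, fun i => (ε.symm i).1, fun i => ?_, fun j => ?_⟩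
  · dsimp only
    generalize ε.symm i = i
    have h1 := hvj N i
    rw [hf, Module.End.one_apply] at h1
    have h2 : (i.1 ^ N - 1) • v i = 0 := by rw [sub_smul, one_smul, ← h1, sub_self]
    exact sub_eq_zero.1 ((smul_eq_zero.1 h2).resolve_right (v.ne_zero i))
  · rw [LinearMap.trace_eq_matrix_trace K v, Matrix.trace,
      Equiv.sum_comp ε.symm fun i => i.1 ^ j]
    refine Finset.sum_congr rfl fun i _ => ?_
    rw [Matrix.diag_apply, LinearMap.toMatrix_apply, hvj]
    simp

/-- Positivity of the squared norms `tr(f) tr(f⁻¹)` of endomorphisms of finite order: the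
eigenvalues are roots of unity, and under an embedding of the algebraic numbers of `K` into `ℂ`
the traces of `f` and of `f⁻¹` become complex conjugate. -/
lemma trace_eq_zero_of_sum_trace_mul_eq_zero {J : Type*} [Fintype J] {V : J → Type*}
    [∀ j, AddCommGroup (V j)] [∀ j, Module K (V j)] [∀ j, Module.Finite K (V j)]
    {N : ℕ} (f : ∀ j, Module.End K (V j)) (hf : ∀ j, f j ^ (N + 1) = 1)
    (hsum : ∑ j, LinearMap.trace K (V j) (f j) * LinearMap.trace K (V j) (f j ^ N) = 0) (j : J) :
    LinearMap.trace K (V j) (f j) = 0 := by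
  let E := algebraicClosure ℚ K
  have hEalg : Algebra.IsAlgebraic ℚ E := algebraicClosure.isAlgebraic ℚ K
  let φ : E →ₐ[ℚ] ℂ := IsAlgClosed.lift
  -- `t` and `t'` are the traces of `f j` and of its inverse, as algebraic numbers
  have key : ∀ j, ∃ t t' : E, (t : K) = LinearMap.trace K (V j) (f j) ∧
      (t' : K) = LinearMap.trace K (V j) (f j ^ N) ∧ φ t' = starRingEnd ℂ (φ t) := by
    intro j
    obtain ⟨r, μ, hμ, hμt⟩ := exists_eigenvalues_of_pow_eq_one N.succ_ne_zero (f j) (hf j)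
    have hE : ∀ i, μ i ∈ E := fun i =>
      (mem_algebraicClosure_iff).2 ((IsIntegral.of_pow N.succ_pos
        (by rw [hμ]; exact isIntegral_one)).isAlgebraic)
    let ν : Fin r → E := fun i => ⟨μ i, hE i⟩
    refine ⟨∑ i, ν i, ∑ i, ν i ^ N, ?_, ?_, ?_⟩
    · have := hμt 1
      rw [pow_one] at this
      simp [this, ν]
    · simp [hμt N, ν]
    · rw [map_sum, map_sum, map_sum]
      refine Finset.sum_congr rfl fun i _ => ?_
      have h1 : φ (ν i) ^ (N + 1) = 1 := by
        rw [← map_pow, ← map_one φ]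
        exact congrArg φ (Subtype.ext (hμ i))
      rw [map_pow, ← Complex.inv_eq_conj (Complex.norm_eq_one_of_pow_eq_one h1 N.succ_ne_zero)]
      exact eq_inv_of_mul_eq_one_left (by rw [← pow_succ, h1])
  choose t t' ht ht' hφ using key
  have h1 : ∑ j, t j * t' j = 0 := by
    apply Subtype.ext
    push_cast
    simpa [ht, ht'] using hsum
  have h2 : ∑ j, Complex.normSq (φ (t j)) = 0 := by
    have := congrArg φ h1
    simp only [map_sum, map_mul, hφ, Complex.mul_conj, map_zero] at this
    exact_mod_cast this
  have h3 := (Finset.sum_eq_zero_iff_of_nonneg fun j _ => Complex.normSq_nonneg _).1 h2 j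
    (Finset.mem_univ j)
  have h4 : t j = 0 := (map_eq_zero φ).1 (Complex.normSq_eq_zero.1 h3)
  rw [← ht, h4]
  rfl

omit [CharZero K] [IsAlgClosed K] in
/-- The trace of an idempotent is its rank, and vanishes only for the zero idempotent. -/
lemma exists_trace_eq_natCast {e : Module.End K V} (he : e * e = e) :
    ∃ m : ℕ, m ≤ Module.finrank K V ∧ LinearMap.trace K V e = m ∧ (m = 0 → e = 0) := by
  refine ⟨Module.finrank K (LinearMap.range e), Submodule.finrank_le _, ?_, fun h => ?_⟩
  · exact (LinearMap.IsIdempotentElem.isProj_range e he).trace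
  · exact LinearMap.range_eq_bot.1 (Submodule.finrank_eq_zero.1 h)

omit [IsAlgClosed K] in
/-- Let `s` be an involution with nonzero trace, and let `F` commute with `s` and satisfy
`F² = n F` for `n = dim V`. If `tr(s F) = tr(s)`, then `tr(s)` is a nonzero multiple of `n`, so that
`s = ±1`. -/
lemma eq_one_or_eq_neg_one_of_trace {s F : Module.End K V} (hs : s * s = 1)
    (hF : F * F = (Module.finrank K V : K) • F) (hsF : s * F = F * s)
    (ht : LinearMap.trace K V (s * F) = LinearMap.trace K V s)
    (h0 : LinearMap.trace K V s ≠ 0) : s = 1 ∨ s = -1 := by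
  set n := Module.finrank K V with hn
  have hn0 : n ≠ 0 := by
    intro h
    have : Subsingleton V := Module.finrank_zero_iff.1 (hn.symm.trans h)
    exact h0 (by rw [Subsingleton.elim s 0, map_zero])
  have hnK : (n : K) ≠ 0 := Nat.cast_ne_zero.2 hn0
  have h2 : (2 : K) ≠ 0 := two_ne_zero
  -- `p` and `q` are the projections onto the eigenspaces of `s`, and `e` is the one defined by `F`
  let p : Module.End K V := (2 : K)⁻¹ • (1 + s)
  let q : Module.End K V := (2 : K)⁻¹ • (1 - s)
  let e : Module.End K V := (n : K)⁻¹ • F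
  have hp : p * p = p := by
    simp only [p, smul_mul_assoc, mul_smul_comm, add_mul, mul_add, one_mul, mul_one, hs]
    module
  have hq : q * q = q := by
    simp only [q, smul_mul_assoc, mul_smul_comm, sub_mul, mul_sub, one_mul, mul_one, hs]
    module
  have he : e * e = e := by
    simp only [e, smul_mul_assoc, mul_smul_comm, hF, smul_smul]
    congr 1
    field_simp
  have hse : s * e = e * s := by simp only [e, smul_mul_assoc, mul_smul_comm, hsF]
  have hpe : p * e = e * p := by
    simp only [p, smul_mul_assoc, mul_smul_comm, add_mul, mul_add, one_mul, mul_one, hse]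
  have hqe : q * e = e * q := by
    simp only [q, smul_mul_assoc, mul_smul_comm, sub_mul, mul_sub, one_mul, mul_one, hse]
  have hpq : s = p - q := by
    simp only [p, q]
    module
  obtain ⟨a, ha, hpa, ha0⟩ := exists_trace_eq_natCast hp
  obtain ⟨b, hb, hqb, hb0⟩ := exists_trace_eq_natCast hq
  obtain ⟨c, -, hpc, -⟩ := exists_trace_eq_natCast (e := p * e)
    (by rw [mul_assoc, ← mul_assoc e, ← hpe, mul_assoc, he, ← mul_assoc, hp])
  obtain ⟨d, -, hqd, -⟩ := exists_trace_eq_natCast (e := q * e)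
    (by rw [mul_assoc, ← mul_assoc e, ← hqe, mul_assoc, he, ← mul_assoc, hq])
  have hs1 : LinearMap.trace K V s = a - b := by rw [hpq, map_sub, hpa, hqb]
  have hab : a + b = n := by
    have h3 : p + q = 1 := by simp only [p, q]; module
    have h4 := congrArg (LinearMap.trace K V) h3
    rw [map_add, hpa, hqb, LinearMap.trace_one] at h4
    exact_mod_cast h4
  have hs2 : LinearMap.trace K V s = n * (c - d) := by
    have h3 : s * F = (n : K) • (p * e - q * e) := by
      rw [← sub_mul, ← hpq]
      simp only [e, mul_smul_comm, smul_smul]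
      rw [mul_inv_cancel₀ hnK, one_smul]
    rw [← ht, h3, map_smul, map_sub, hpc, hqd, smul_eq_mul]
  have hz : (a : ℤ) - b = n * (c - d) := by
    have := hs1.symm.trans hs2
    exact_mod_cast this
  have hz0 : (a : ℤ) - b ≠ 0 := by
    intro h
    apply h0
    rw [hs1]
    exact_mod_cast congrArg (Int.cast (R := K)) h
  have hcd : (1 : ℤ) ≤ |(c : ℤ) - d| := by
    refine Int.one_le_abs fun h => hz0 ?_
    rw [hz, h, mul_zero]
  have hge : (n : ℤ) ≤ |(a : ℤ) - b| := by
    rw [hz, abs_mul, Nat.abs_cast]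
    nlinarith [Int.natCast_nonneg n]
  -- `|a - b| ≥ n = a + b` forces one of the two ranks to vanish
  rcases le_or_gt b a with h | h
  · left
    have : b = 0 := by
      rw [abs_of_nonneg (by omega)] at hge
      omega
    have hq0 := hb0 this
    have h3 : s = 1 - (2 : K) • q := by simp only [q]; module
    rw [h3, hq0, smul_zero, sub_zero]
  · right
    have : a = 0 := by
      rw [abs_of_neg (by omega)] at hge
      omega
    have hp0 := ha0 this
    have h3 : s = (2 : K) • p - 1 := by simp only [p]; module
    rw [h3, hp0, smul_zero, zero_sub]

end traces

/-! ### The twist element and the regular character -/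

namespace HopfConv
open Coalgebra HopfAlgebra

section twist
variable {k H : Type*} [Field k] [Ring H] [HopfAlgebra k H] {Λ : H}

lemma comul_antipode_antipode (h : H) : comul (R := k) (antipode k (antipode k h)) =
    TensorProduct.map (antipode k ∘ₗ antipode k) (antipode k ∘ₗ antipode k) (comul h) := by
  rw [comul_antipode, comul_antipode]
  generalize comul (R := k) h = z
  induction z with
  | zero => simp
  | add z w hz hw => simp only [map_add, hz, hw]
  | tmul p q => simp

variable (k) in
/-- The element `S(Λ₂) Λ₁`. -/
def twistElt (Λ : H) : H :=
  LinearMap.mul' k H (TensorProduct.comm k H H ((antipode k).lTensor H (comul Λ)))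

lemma twistElt_eq_sum (Λ : H) : twistElt k Λ =
    ∑ i ∈ (ℛ k Λ).index, antipode k ((ℛ k Λ).right i) * (ℛ k Λ).left i := by
  rw [twistElt, ← (ℛ k Λ).eq]
  simp

/-- The twist element `θ = S(Λ₂) Λ₁` implements the square of the antipode: `θ h = S²(h) θ`. -/
lemma IsIntegral.twistElt_mul (hΛ : IsIntegral k Λ) (h : H) :
    twistElt k Λ * h = antipode k (antipode k h) * twistElt k Λ := by
  let Ψ : H ⊗[k] H →ₗ[k] H := LinearMap.mul' k H ∘ₗ (TensorProduct.comm k H H).toLinearMap ∘ₗ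
    (antipode k).lTensor H
  have h1 : ∀ z, Ψ (z * (h ⊗ₜ 1)) = Ψ z * h := by
    intro z
    induction z with
    | zero => simp
    | add z w hz hw => simp only [map_add, add_mul, hz, hw]
    | tmul p q => simp [Ψ, mul_assoc]
  have h2 : ∀ g z, Ψ (z * (1 ⊗ₜ g)) = antipode k g * Ψ z := by
    intro g z
    induction z with
    | zero => simp
    | add z w hz hw => simp only [map_add, add_mul, mul_add, hz, hw]
    | tmul p q => simp [Ψ, mul_assoc, antipode_mul_antidistrib]
  have h3 := congrArg Ψ (comul_mul_tmul hΛ h)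
  rw [h1, h2] at h3
  exact h3

variable [Module.Finite k H]

/-- `tr(y ↦ y h) = λ(θ h)` -/
lemma IsIntegral.trace_mulRight (hΛ : IsIntegral k Λ) (h : H) :
    LinearMap.trace k H (LinearMap.mulRight k h) = traceIntegral k H (twistElt k Λ * h) := by
  rw [hΛ.trace_eq, twistElt_eq_sum, Finset.sum_mul, map_sum]
  simp [mul_assoc]

/-- `S` as a linear automorphism. -/
def IsIntegral.antipodeEquiv (hΛ : IsIntegral k Λ) : H ≃ₗ[k] H :=
  LinearEquiv.ofBijective (antipode k) ⟨hΛ.antipode_injective, hΛ.antipode_surjective⟩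

lemma IsIntegral.antipodeEquiv_apply (hΛ : IsIntegral k Λ) (h : H) :
    hΛ.antipodeEquiv h = antipode k h := rfl

/-- `λ(h) = tr(y ↦ S(h) S²(y))`, by conjugation with the antipode. -/
lemma IsIntegral.traceIntegral_eq_trace_mulLeft (hΛ : IsIntegral k Λ) (h : H) :
    traceIntegral k H h = LinearMap.trace k H (LinearMap.mulLeft k (antipode k h) ∘ₗ
      (antipode k ∘ₗ antipode k)) := by
  rw [traceIntegral_apply, ← LinearMap.trace_conj' _ hΛ.antipodeEquiv]
  congr 1
  refine LinearMap.ext fun y => ?_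
  obtain ⟨y, rfl⟩ := hΛ.antipodeEquiv.surjective y
  rw [LinearEquiv.conj_apply_apply, LinearEquiv.symm_apply_apply]
  simp [IsIntegral.antipodeEquiv_apply, antipode_mul_antidistrib]

/-- `λ(· a)` is a left integral in the dual, so that `λ(S(·) a)` is a multiple of `λ`. -/
lemma IsIntegral.exists_traceIntegral_mul_modularElt (hΛ : IsIntegral k Λ) :
    ∃ c : k, ∀ h, traceIntegral k H (antipode k h * modularElt k Λ) = c * traceIntegral k H h := by
  set a := modularElt k Λ with ha
  have hga := hΛ.isGroupLikeElem_modularElt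
  let g : H →ₗ[k] k := traceIntegral k H ∘ₗ LinearMap.mulRight k a
  have h1 : ∀ h, TensorProduct.rid k H (g.lTensor H (comul h)) = g h • 1 := by
    intro h
    have e := hΛ.contract_right (h * a)
    rw [Bialgebra.comul_mul, hga.comul_eq_tmul_self] at e
    have e1 : ∀ z : H ⊗[k] H, TensorProduct.rid k H ((traceIntegral k H).lTensor H
        (z * (a ⊗ₜ a))) = TensorProduct.rid k H (g.lTensor H z) * a := by
      intro z
      induction z with
      | zero => simp
      | add z w hz hw => simp only [map_add, add_mul, hz, hw]
      | tmul p q => simp [g]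
    rw [← ha, e1] at e
    refine hga.isUnit.mul_left_injective ?_
    dsimp only
    rw [e]
    simp [g, ha]
  have h2 : IsRightIntegral (g ∘ₗ antipode k) := by
    rw [isRightIntegral_iff]
    intro h
    apply hΛ.antipode_injective
    have e := h1 (antipode k h)
    rw [comul_antipode] at e
    have e1 : ∀ z : H ⊗[k] H, TensorProduct.rid k H (g.lTensor H
        (TensorProduct.map (antipode k) (antipode k) (TensorProduct.comm k H H z))) =
        antipode k (TensorProduct.lid k H ((g ∘ₗ antipode k).rTensor H z)) := by
      intro z
      induction z with
      | zero => simp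
      | add z w hz hw => simp only [map_add, hz, hw]
      | tmul p q => simp
    rw [← e1, e]
    simp
  refine ⟨(g ∘ₗ antipode k) Λ, fun h => ?_⟩
  have h3 := LinearMap.congr_fun (hΛ.eq_smul_traceIntegral h2) h
  rw [LinearMap.smul_apply, smul_eq_mul] at h3
  exact h3

/-- The modular element has finite order, because distinct group-like elements are linearly
independent. -/
lemma IsIntegral.exists_modularElt_pow_eq_one (hΛ : IsIntegral k Λ) :
    ∃ N, 0 < N ∧ modularElt k Λ ^ N = 1 := by
  let a : GroupLike k H := ⟨modularElt k Λ, hΛ.isGroupLikeElem_modularElt⟩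
  have : Finite (GroupLike k H) := (linearIndep_groupLikeVal (R := k) (A := H)).finite
  obtain ⟨N, hN, h⟩ := isOfFinOrder_iff_pow_eq_one.1 (isOfFinOrder_of_finite a)
  exact ⟨N, hN, congrArg GroupLike.val h⟩

end twist

section regular
variable (k H : Type*) [Field k] [Ring H] [HopfAlgebra k H]

/-- The character `h ↦ tr(y ↦ h y)` of the regular representation. -/
def regChar : H →ₗ[k] k := LinearMap.trace k H ∘ₗ LinearMap.mul k H

/-- The operator `h ↦ χ(h₁) h₂`, for the character `χ` of the regular representation. -/
def regContract : Module.End k H := TensorProduct.lid k H ∘ₗ (regChar k H).rTensor H ∘ₗ comul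

variable {k H}

lemma regChar_apply (h : H) : regChar k H h = LinearMap.trace k H (LinearMap.mulLeft k h) := rfl

lemma regContract_eq_conv : regContract k H =
    (Algebra.linearMap k H ∘ₗ regChar k H) ⋆ LinearMap.id := by
  ext h
  rw [conv_apply]
  change TensorProduct.lid k H ((regChar k H).rTensor H (comul h)) = _
  generalize comul (R := k) h = z
  induction z with
  | zero => simp
  | add z w hz hw => simp only [map_add, hz, hw]
  | tmul p q => simp [Algebra.smul_def]

variable [Module.Finite k H]

/-- `χ(h₁) χ(h₂) = n χ(h)`: the map `y ⊗ z ↦ y₁ ⊗ y₂ z` is an isomorphism from the tensor product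
of the regular representation with a trivial one to its tensor square. -/
lemma regChar_conv_regChar : regChar k H ⋆ regChar k H =
    (Module.finrank k H : k) • regChar k H := by
  let β : H ⊗[k] H →ₗ[k] H ⊗[k] H :=
    TensorProduct.lift ((LinearMap.mul k (H ⊗[k] H)).compl₁₂ comul (inr k H).toLinearMap)
  have hβ : ∀ y z, β (y ⊗ₜ z) = comul y * (1 ⊗ₜ z) := fun _ _ => rfl
  have hsurj : Function.Surjective β := by
    intro w
    induction w with
    | zero => exact ⟨0, map_zero _⟩
    | add z w hz hw =>
      obtain ⟨a, rfl⟩ := hz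
      obtain ⟨b, rfl⟩ := hw
      exact ⟨a + b, map_add _ _ _⟩
    | tmul y z =>
      have h1 : comul ⋆ ((inr k H).toLinearMap ∘ₗ antipode k) = (inl k H).toLinearMap := by
        rw [← inl_conv_inr, conv_assoc, algHom_conv_antipode, conv_one]
      refine ⟨(antipode k).lTensor H (comul y) * (1 ⊗ₜ z), ?_⟩
      have h2 : ∀ w : H ⊗[k] H, β ((antipode k).lTensor H w * (1 ⊗ₜ z)) =
          LinearMap.mul' k _ (TensorProduct.map comul ((inr k H).toLinearMap ∘ₗ antipode k) w) *
            (1 ⊗ₜ z) := by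
        intro w
        induction w with
        | zero => simp
        | add z w hz hw => simp only [map_add, add_mul, hz, hw]
        | tmul p q => simp [hβ, mul_assoc]
      rw [h2, ← conv_apply, h1]
      simp
  let e : H ⊗[k] H ≃ₗ[k] H ⊗[k] H :=
    LinearEquiv.ofBijective β ⟨LinearMap.injective_iff_surjective.2 hsurj, hsurj⟩
  ext h
  have h1 : e.conj (TensorProduct.map (LinearMap.mulLeft k h) LinearMap.id) =
      LinearMap.mulLeft k (comul (R := k) h) := by
    refine LinearMap.ext fun y => ?_
    obtain ⟨y, rfl⟩ := e.surjective y
    rw [LinearEquiv.conj_apply_apply, LinearEquiv.symm_apply_apply]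
    change β _ = comul h * β y
    induction y with
    | zero => simp
    | add z w hz hw => simp only [map_add, mul_add, hz, hw]
    | tmul p q => simp [hβ, mul_assoc]
  have h2 : ∀ z : H ⊗[k] H, LinearMap.mul' k k (TensorProduct.map (regChar k H) (regChar k H) z) =
      LinearMap.trace k _ (LinearMap.mulLeft k z) := by
    intro z
    induction z with
    | zero => simp
    | add z w hz hw =>
      have : LinearMap.mulLeft k (z + w) = LinearMap.mulLeft k z + LinearMap.mulLeft k w :=
        map_add (LinearMap.mul k _) z w
      simp only [map_add, hz, hw, this]
    | tmul p q =>
      have : LinearMap.mulLeft k (p ⊗ₜ[k] q) =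
          TensorProduct.map (LinearMap.mulLeft k p) (LinearMap.mulLeft k q) := by
        ext
        simp
      rw [this, LinearMap.trace_tensorProduct']
      rfl
  rw [conv_apply, h2, ← h1, LinearMap.trace_conj', LinearMap.trace_tensorProduct',
    LinearMap.trace_id, LinearMap.smul_apply, smul_eq_mul, mul_comm]
  rfl

/-- The operator `F(h) = χ(h₁) h₂` satisfies `F² = n F`, so that `n⁻¹ F` is a projection. -/
lemma regContract_mul_self : regContract k H * regContract k H =
    (Module.finrank k H : k) • regContract k H := by
  have h1 : ∀ f : H →ₗ[k] k, ∀ G : Module.End k H,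
      G ∘ₗ ((Algebra.linearMap k H ∘ₗ f) ⋆ LinearMap.id) = (Algebra.linearMap k H ∘ₗ f) ⋆ G := by
    intro f G
    ext h
    simp [conv_sum, ← Algebra.smul_def]
  have e : Algebra.linearMap k H = (Algebra.ofId k H).toLinearMap := rfl
  conv_lhs => rw [Module.End.mul_eq_comp]; arg 2; rw [regContract_eq_conv]
  rw [h1, regContract_eq_conv, ← conv_assoc, e, ← algHom_comp_conv, regChar_conv_regChar]
  ext h
  simp [conv_sum, Algebra.smul_def, mul_assoc]

lemma regChar_antipode_antipode {Λ : H} (hΛ : IsIntegral k Λ) (h : H) :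
    regChar k H (antipode k (antipode k h)) = regChar k H h := by
  rw [regChar_apply, regChar_apply,
    ← LinearMap.trace_conj' (LinearMap.mulLeft k h) (hΛ.antipodeEquiv.trans hΛ.antipodeEquiv)]
  congr 1
  refine LinearMap.ext fun y => ?_
  obtain ⟨y, rfl⟩ := (hΛ.antipodeEquiv.trans hΛ.antipodeEquiv).surjective y
  rw [LinearEquiv.conj_apply_apply, LinearEquiv.symm_apply_apply]
  simp [IsIntegral.antipodeEquiv_apply, antipode_mul_antidistrib]

lemma antipode_sq_mul_regContract {Λ : H} (hΛ : IsIntegral k Λ) :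
    (antipode k ∘ₗ antipode k : Module.End k H) * regContract k H =
      regContract k H * (antipode k ∘ₗ antipode k) := by
  ext h
  change antipode k (antipode k (TensorProduct.lid k H ((regChar k H).rTensor H (comul h)))) =
    TensorProduct.lid k H ((regChar k H).rTensor H (comul (antipode k (antipode k h))))
  rw [comul_antipode_antipode]
  generalize comul (R := k) h = z
  induction z with
  | zero => simp
  | add z w hz hw => simp only [map_add, hz, hw]
  | tmul p q => simp [regChar_antipode_antipode hΛ]

/-- `tr(S² F) = λ(1) = tr(S²)` for the operator `F(h) = χ(h₁) h₂`. -/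
lemma trace_antipode_sq_mul_regContract {Λ : H} (hΛ : IsIntegral k Λ) :
    LinearMap.trace k H ((antipode k ∘ₗ antipode k : Module.End k H) * regContract k H) =
      LinearMap.trace k H (antipode k ∘ₗ antipode k) := by
  have h0 : LinearMap.trace k H (antipode k ∘ₗ antipode k) = traceIntegral k H 1 := by
    rw [traceIntegral_apply]
    congr 1
    ext
    simp
  have hχ : regChar k H Λ = 1 := by
    have : LinearMap.mulLeft k Λ = (counit (R := k) (A := H)).smulRight Λ := by
      ext y
      simp [hΛ.mul_right]
    rw [regChar_apply, this, LinearMap.trace_smulRight, hΛ.counit]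
  let T : (H ⊗[k] H) ⊗[k] H →ₗ[k] k := LinearMap.mul' k k ∘ₗ TensorProduct.map (regChar k H)
    (traceIntegral k H ∘ₗ antipode k ∘ₗ LinearMap.mul' k H ∘ₗ (antipode k).rTensor H) ∘ₗ
    (TensorProduct.assoc k H H H).toLinearMap
  have h1 : ∀ z : H ⊗[k] H, T (comul.rTensor H z) = traceIntegral k H
      (TensorProduct.lift ((LinearMap.mul k H).flip.compl₁₂
        ((antipode k ∘ₗ antipode k : Module.End k H) * regContract k H) (antipode k)) z) := by
    intro z
    induction z with
    | zero => simp
    | add z w hz hw => simp only [map_add, hz, hw]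
    | tmul p q =>
      change T (comul p ⊗ₜ q) = traceIntegral k H (antipode k q * antipode k (antipode k
        (TensorProduct.lid k H ((regChar k H).rTensor H (comul p)))))
      generalize comul (R := k) p = w
      induction w with
      | zero => simp
      | add z w hz hw =>
        simp only [TensorProduct.add_tmul, map_add, mul_add, hz, hw]
      | tmul a b => simp [T, antipode_mul_antidistrib]
  have h2 : ∀ z : H ⊗[k] H, T ((TensorProduct.assoc k H H H).symm (comul.lTensor H z)) =
      regChar k H (TensorProduct.rid k H (counit.lTensor H z)) * traceIntegral k H 1 := by
    intro z
    induction z with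
    | zero => simp
    | add z w hz hw => simp only [map_add, add_mul, hz, hw]
    | tmul p q => simp [T, Algebra.algebraMap_eq_smul_one]; ring
  have h3 := h2 (comul Λ)
  rw [coassoc_symm_apply, h1, lTensor_counit_comul] at h3
  rw [h0, hΛ.trace_eq]
  conv_lhs at h3 => rw [← (ℛ k Λ).eq]
  simp only [map_sum, TensorProduct.lift.tmul, TensorProduct.rid_tmul, one_smul, hχ, one_mul] at h3
  exact h3

end regular
end HopfConv

/-! ### The square of the antipode -/

namespace HopfConv
open Coalgebra HopfAlgebra

section closed
variable {K H : Type*} [Field K] [CharZero K] [IsAlgClosed K] [Ring H] [HopfAlgebra K H]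
  [Module.Finite K H] {Λ : H} {n : ℕ} {d : Fin n → ℕ} [∀ i, NeZero (d i)]

omit [IsAlgClosed K] in
/-- The twist element `θ` is invertible, since the trace form of the regular representation
is nondegenerate and `tr(y ↦ y h) = λ(θ h)`. -/
lemma IsIntegral.exists_twistElt_inv (hΛ : IsIntegral K Λ)
    (e : H ≃ₐ[K] Π i, Matrix (Fin (d i)) (Fin (d i)) K) :
    ∃ t : H, twistElt K Λ * t = 1 ∧ t * twistElt K Λ = 1 := by
  set θ := twistElt K Λ with hθ
  have htr : ∀ h : H, LinearMap.trace K H (LinearMap.mulRight K h) =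
      ∑ i, (d i : K) * (e h i).trace := by
    intro h
    have := trace_mulLeft_comp_mulRight e 1 h
    rw [LinearMap.mulLeft_one, LinearMap.id_comp] at this
    simpa using this
  have hinj : Function.Injective (LinearMap.mulLeft K θ) := by
    refine (injective_iff_map_eq_zero _).2 fun h hh => ?_
    apply e.injective
    rw [map_zero]
    ext1 i
    rw [Pi.zero_apply]
    refine Matrix.ext_iff_trace_mul_right.2 fun M => ?_
    have h1 : LinearMap.trace K H (LinearMap.mulRight K (h * e.symm (Pi.single i M))) = 0 := by
      rw [hΛ.trace_mulRight, ← mul_assoc, ← hθ]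
      rw [LinearMap.mulLeft_apply] at hh
      rw [hh, zero_mul, map_zero]
    rw [htr, Finset.sum_eq_single i] at h1
    · have := (mul_eq_zero.1 h1).resolve_left (Nat.cast_ne_zero.2 (NeZero.ne (d i)))
      simpa using this
    · intro j _ hj
      simp [Pi.single_eq_of_ne hj]
    · simp
  obtain ⟨t, ht⟩ := LinearMap.injective_iff_surjective.1 hinj 1
  refine ⟨t, ht, hinj ?_⟩
  rw [LinearMap.mulLeft_apply] at ht
  rw [LinearMap.mulLeft_apply, LinearMap.mulLeft_apply, ← mul_assoc, ht, one_mul, mul_one]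

omit [CharZero K] [IsAlgClosed K] [Module.Finite K H] [∀ i, NeZero (d i)] in
lemma sum_trace_single (e : H ≃ₐ[K] Π i, Matrix (Fin (d i)) (Fin (d i)) K) (c : Fin n → K)
    (f : ∀ i, Matrix (Fin (d i)) (Fin (d i)) K → K) (hf : ∀ i, f i 0 = 0)
    (i : Fin n) (M : Matrix (Fin (d i)) (Fin (d i)) K) :
    ∑ j, c j * f j (e (e.symm (Pi.single i M)) j) = c i * f i M := by
  rw [Finset.sum_eq_single i]
  · simp
  · intro j _ hj
    simp [Pi.single_eq_of_ne hj, hf]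
  · simp

/-- In a semisimple Hopf algebra over an algebraically closed field of characteristic zero,
`λ(1) = tr(S²) ≠ 0`. In the block `i` of `H` the modular element `a` is a multiple of `θᵢ²`, so
that a multiple `ιᵢ` of `θᵢ` has finite order, and `λ(1)` is the sum of the squared norms
`tr(ιᵢ) tr(ιᵢ⁻¹)`, where `tr(θᵢ)` is the size of the block. -/
lemma IsIntegral.modularElt_blocks (hΛ : IsIntegral K Λ)
    (e : H ≃ₐ[K] Π i, Matrix (Fin (d i)) (Fin (d i)) K) :
    traceIntegral K H 1 ≠ 0 ∧
      ∀ i, ∃ c : K, e (modularElt K Λ) i = c • (e (twistElt K Λ) i * e (twistElt K Λ) i) := by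
  obtain ⟨t, hθt, htθ⟩ := hΛ.exists_twistElt_inv e
  set θ := twistElt K Λ with hθ
  set a := modularElt K Λ with ha
  have hd : ∀ i, (d i : K) ≠ 0 := fun i => Nat.cast_ne_zero.2 (NeZero.ne (d i))
  have hS : ∀ y, antipode K (antipode K y) = θ * y * t := by
    intro y
    rw [hΛ.twistElt_mul, mul_assoc, hθt, mul_one]
  have hlam : ∀ h, traceIntegral K H h = ∑ i, (e θ i).trace * (e t i * e h i).trace := by
    intro h
    have : LinearMap.mulRight K h ∘ₗ (antipode K ∘ₗ antipode K) =
        LinearMap.mulLeft K θ ∘ₗ LinearMap.mulRight K (t * h) := by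
      ext y
      simp [hS, mul_assoc]
    rw [traceIntegral_apply, this, trace_mulLeft_comp_mulRight e]
    simp
  have htrθ : ∀ i, (e θ i).trace = d i := by
    intro i
    have h1 : ∀ h, ∑ i, (e θ i).trace * (e h i).trace = ∑ i, (d i : K) * (e h i).trace := by
      intro h
      have h2 := trace_mulLeft_comp_mulRight e 1 h
      rw [LinearMap.mulLeft_one, LinearMap.id_comp, hΛ.trace_mulRight, hlam] at h2
      have h3 : ∀ i, e t i * (e θ i * e h i) = e h i := by
        intro i
        rw [← mul_assoc, ← Pi.mul_apply, ← map_mul, htθ]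
        simp
      simpa [← hθ, h3] using h2
    have h2 := h1 (e.symm (Pi.single i (Matrix.single 0 0 1)))
    rw [sum_trace_single e _ (fun _ M => M.trace) (by simp),
      sum_trace_single e _ (fun _ M => M.trace) (by simp)] at h2
    simpa using h2
  -- comparing `λ(S(h) a)` with `λ(h) = tr(y ↦ S(h) S²(y))` in each block
  obtain ⟨c, hc⟩ := hΛ.exists_traceIntegral_mul_modularElt
  have hblock : ∀ i, e a i = (c * (e t i).trace / d i) • (e θ i * e θ i) := by
    intro i
    have h1 : ∀ x, ∑ i, (d i : K) * (e t i * (e x i * e a i)).trace =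
        ∑ i, (c * (e t i).trace) * (e x i * e θ i).trace := by
      intro x
      obtain ⟨h, rfl⟩ := hΛ.antipode_surjective x
      have h2 := hc h
      rw [hΛ.traceIntegral_eq_trace_mulLeft h, hlam] at h2
      have : LinearMap.mulLeft K (antipode K h) ∘ₗ (antipode K ∘ₗ antipode K) =
          LinearMap.mulLeft K (antipode K h * θ) ∘ₗ LinearMap.mulRight K t := by
        ext y
        simp [hS, mul_assoc]
      rw [this, trace_mulLeft_comp_mulRight e, Finset.mul_sum] at h2
      simp only [htrθ, map_mul, Pi.mul_apply] at h2
      rw [h2]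
      exact Finset.sum_congr rfl fun i _ => by ring
    have h2 : (d i : K) • (e a i * e t i) = (c * (e t i).trace) • e θ i := by
      refine Matrix.ext_iff_trace_mul_left.2 fun M => ?_
      have h3 := h1 (e.symm (Pi.single i M))
      rw [sum_trace_single e _ (fun j M => (e t j * (M * e a j)).trace) (by simp),
        sum_trace_single e _ (fun j M => (M * e θ j).trace) (by simp)] at h3
      rw [mul_smul_comm, mul_smul_comm, Matrix.trace_smul, Matrix.trace_smul, smul_eq_mul,
        smul_eq_mul, ← h3, ← mul_assoc, Matrix.trace_mul_comm]
    have h3 : e a i = e a i * e t i * e θ i := by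
      rw [mul_assoc, ← Pi.mul_apply (e t), ← map_mul, htθ]
      simp
    have h4 : e a i * e t i = (c * (e t i).trace / d i) • e θ i := by
      rw [div_eq_inv_mul, mul_smul, ← h2, smul_smul, inv_mul_cancel₀ (hd i), one_smul]
    rw [h3, h4, smul_mul_assoc]
  refine ⟨fun h0 => ?_, fun i => ⟨_, hblock i⟩⟩
  obtain ⟨N, hN, haN⟩ := hΛ.exists_modularElt_pow_eq_one
  have hone : ∀ i, (e a i) ^ N = 1 := by
    intro i
    rw [← Pi.pow_apply, ← map_pow, haN, map_one, Pi.one_apply]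
  have hne : ∀ i, (c * (e t i).trace / d i) ≠ 0 := by
    intro i hi
    have h1 := hone i
    rw [hblock, hi, zero_smul, zero_pow hN.ne'] at h1
    exact zero_ne_one h1
  choose r hr using fun i => IsAlgClosed.exists_pow_nat_eq (c * (e t i).trace / d i) two_pos
  have hr0 : ∀ i, r i ≠ 0 := by
    intro i hi
    apply hne i
    rw [← hr, hi, zero_pow two_ne_zero]
  -- `ιᵢ² = aᵢ`, so that `ιᵢ` has finite order like the modular element
  let ι : ∀ i, Matrix (Fin (d i)) (Fin (d i)) K := fun i => r i • e θ i
  have hι2 : ∀ i, ι i ^ (2 * N) = 1 := by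
    intro i
    rw [pow_mul]
    have : ι i ^ 2 = e a i := by
      rw [hblock, ← hr, sq, smul_mul_smul_comm, sq]
    rw [this, hone]
  obtain ⟨M, hM⟩ : ∃ M, 2 * N = M + 1 := ⟨2 * N - 1, by omega⟩
  rw [hM] at hι2
  have hιM : ∀ i, ι i ^ M = (r i)⁻¹ • e t i := by
    intro i
    have h1 : ι i * ((r i)⁻¹ • e t i) = 1 := by
      rw [smul_mul_smul_comm, mul_inv_cancel₀ (hr0 i), one_smul, ← Pi.mul_apply, ← map_mul, hθt]
      simp
    have h2 := hι2 i
    rw [pow_succ] at h2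
    calc ι i ^ M = ι i ^ M * (ι i * ((r i)⁻¹ • e t i)) := by rw [h1, mul_one]
      _ = _ := by rw [← mul_assoc, h2, one_mul]
  have hzero := trace_eq_zero_of_sum_trace_mul_eq_zero (N := M)
    (fun i => Matrix.toLinAlgEquiv' (ι i)) (fun i => by rw [← map_pow, hι2, map_one]) (by
      rw [hlam] at h0
      rw [← h0]
      refine Finset.sum_congr rfl fun i _ => ?_
      rw [← map_pow, hιM]
      change LinearMap.trace K _ (Matrix.toLin' _) * LinearMap.trace K _ (Matrix.toLin' _) = _
      rw [Matrix.trace_toLin'_eq, Matrix.trace_toLin'_eq]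
      simp only [ι, Matrix.trace_smul, map_one, Pi.one_apply, mul_one, smul_eq_mul]
      rw [mul_mul_mul_comm, mul_inv_cancel₀ (hr0 i), one_mul])
  have hn : n ≠ 0 := by
    rintro rfl
    have h1 : (1 : H) = 0 := e.injective (Subsingleton.elim _ _)
    have h2 := congrArg (Coalgebra.counit (R := K)) h1
    rw [Bialgebra.counit_one, map_zero] at h2
    exact one_ne_zero h2
  have h1 := hzero ⟨0, Nat.pos_of_ne_zero hn⟩
  change LinearMap.trace K _ (Matrix.toLin' _) = 0 at h1
  rw [Matrix.trace_toLin'_eq, Matrix.trace_smul, htrθ] at h1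
  exact mul_ne_zero (hr0 _) (hd _) h1

/-- Since `λ(1) = tr(S²)` is nonzero, the modular element is `1`. Then `θ²` is central by
`modularElt_blocks`, so that `S²` is an involution, and `eq_one_or_eq_neg_one_of_trace` applies to
it and to the operator `F(h) = χ(h₁) h₂`. The case `S² = -1` is excluded by `S²(1) = 1`. -/
lemma IsIntegral.antipode_antipode_of_isAlgClosed [IsSemisimpleRing H] (hΛ : IsIntegral K Λ)
    (h : H) : antipode K (antipode K h) = h := by
  obtain ⟨n, d, hd, ⟨e⟩⟩ := IsSemisimpleRing.exists_algEquiv_pi_matrix_of_isAlgClosed K H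
  obtain ⟨h1, hblock⟩ := hΛ.modularElt_blocks e
  obtain ⟨t, hθt, htθ⟩ := hΛ.exists_twistElt_inv e
  set θ := twistElt K Λ with hθ
  have ha : modularElt K Λ = 1 := by
    have h2 := hΛ.contract_right 1
    rw [Bialgebra.comul_one, Algebra.TensorProduct.one_def, LinearMap.lTensor_tmul,
      TensorProduct.rid_tmul] at h2
    exact (smul_right_injective H h1 h2).symm
  -- `θ²` is central, so that `S⁴ = 1`
  have hcent : ∀ y, θ * θ * y = y * (θ * θ) := by
    intro y
    apply e.injective
    ext1 i
    obtain ⟨c, hc⟩ := hblock i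
    rw [ha, map_one, Pi.one_apply] at hc
    have hc0 : c ≠ 0 := by
      rintro rfl
      rw [zero_smul] at hc
      have := hd i
      exact one_ne_zero hc
    refine smul_right_injective _ hc0 ?_
    simp only [map_mul, Pi.mul_apply]
    rw [← smul_mul_assoc c (e θ i * e θ i), ← mul_smul_comm c (e y i), ← hc, one_mul, mul_one]
  have hS : ∀ y, antipode K (antipode K y) = θ * y * t := by
    intro y
    rw [hΛ.twistElt_mul, mul_assoc, hθt, mul_one]
  have hs : (antipode K ∘ₗ antipode K : Module.End K H) * (antipode K ∘ₗ antipode K) = 1 := by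
    refine LinearMap.ext fun y => ?_
    change antipode K (antipode K (antipode K (antipode K y))) = y
    rw [hS, hS]
    calc θ * (θ * y * t) * t = θ * θ * y * t * t := by simp only [mul_assoc]
      _ = y * (θ * (θ * t) * t) := by rw [hcent]; simp only [mul_assoc]
      _ = y := by rw [hθt, mul_one, hθt, mul_one]
  have h0 : LinearMap.trace K H (antipode K ∘ₗ antipode K) ≠ 0 := by
    rw [traceIntegral_apply, LinearMap.mulRight_one, LinearMap.id_comp] at h1
    exact h1
  rcases eq_one_or_eq_neg_one_of_trace hs regContract_mul_self (antipode_sq_mul_regContract hΛ)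
    (trace_antipode_sq_mul_regContract hΛ) h0 with h2 | h2
  · exact LinearMap.congr_fun h2 h
  · have h3 := LinearMap.congr_fun h2 1
    have h4 := congrArg (Coalgebra.counit (R := K)) h3
    simp only [LinearMap.comp_apply, antipode_one, LinearMap.neg_apply, Module.End.one_apply,
      map_neg, Bialgebra.counit_one] at h4
    exact absurd h4 (by norm_num)

end closed

section baseChange
variable {k H : Type u} [Field k] [CharZero k] [Ring H] [HopfAlgebra k H]

variable (k) in
/-- The square of the antipode of a semisimple Hopf algebra in characteristic zero is the
identity (Larson and Radford). -/
theorem antipode_antipode_of_isSemisimpleRing [IsSemisimpleRing H] (h : H) :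
    antipode k (antipode k h) = h := by
  obtain ⟨Λ, hΛ⟩ := exists_isIntegral k H
  have hfin : Module.Finite k H :=
    finite_of_separability (sepElt k Λ) (mul'_sepElt hΛ) (tmul_mul_sepElt hΛ)
  -- the integral, hence separability and semisimplicity, survives the passage to the closure
  let K := AlgebraicClosure k
  have hΛ' : IsIntegral K ((1 : K) ⊗ₜ[k] Λ) := by
    refine ⟨fun x => ?_, fun x => ?_, ?_⟩
    · induction x with
      | zero => simp
      | add z w hz hw => simp only [map_add, add_mul, add_smul, hz, hw]
      | tmul p q =>
      rw [Algebra.TensorProduct.tmul_mul_tmul, hΛ.mul_left, TensorProduct.counit_tmul,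
        TensorProduct.smul_tmul', ← TensorProduct.smul_tmul]
      simp
    · induction x with
      | zero => simp
      | add z w hz hw => simp only [map_add, mul_add, add_smul, hz, hw]
      | tmul p q =>
      rw [Algebra.TensorProduct.tmul_mul_tmul, hΛ.mul_right, TensorProduct.counit_tmul,
        TensorProduct.smul_tmul', ← TensorProduct.smul_tmul]
      simp
    · simp [hΛ.counit]
  have : IsSemisimpleRing (K ⊗[k] H) :=
    isSemisimpleRing_of_separability (sepElt K _) (mul'_sepElt hΛ') (tmul_mul_sepElt hΛ')
  have : CharZero K := charZero_of_injective_algebraMap (algebraMap k K).injective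
  have h1 := hΛ'.antipode_antipode_of_isAlgClosed ((1 : K) ⊗ₜ[k] h)
  have h2 : ∀ y : H, antipode K ((1 : K) ⊗ₜ[k] y) = (1 : K) ⊗ₜ[k] antipode k y := by
    intro y
    simp [TensorProduct.antipode_def]
  rw [h2, h2] at h1
  exact Algebra.TensorProduct.includeRight_injective (R := k) (A := K) (B := H)
    (algebraMap k K).injective h1

end baseChange
end HopfConv

/-! ### Tensoring with a Frobenius algebra in a braided category -/

namespace FrobeniusFunctor

variable {C : Type*} [Category C] [MonoidalCategory C] [BraidedCategory C]

lemma tensorδ_natural {X₁ X₂ Y₁ Y₂ U₁ U₂ V₁ V₂ : C} (f₁ : X₁ ⟶ Y₁) (f₂ : X₂ ⟶ Y₂)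
    (g₁ : U₁ ⟶ V₁) (g₂ : U₂ ⟶ V₂) :
    ((f₁ ⊗ₘ g₁) ⊗ₘ f₂ ⊗ₘ g₂) ≫ tensorδ Y₁ Y₂ V₁ V₂ =
      tensorδ X₁ X₂ U₁ U₂ ≫ ((f₁ ⊗ₘ f₂) ⊗ₘ g₁ ⊗ₘ g₂) := by
  have h := tensorμ_natural f₁ f₂ g₁ g₂
  have h2 := congrArg (fun z => tensorδ X₁ X₂ U₁ U₂ ≫ z ≫ tensorδ Y₁ Y₂ V₁ V₂) h
  simpa using h2.symm

lemma tensorδ_associativity (X₁ X₂ Y₁ Y₂ Z₁ Z₂ : C) :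
    ((X₁ ⊗ X₂) ◁ tensorδ Y₁ Y₂ Z₁ Z₂) ≫ (α_ (X₁ ⊗ X₂) (Y₁ ⊗ Y₂) (Z₁ ⊗ Z₂)).inv ≫
      (tensorμ X₁ X₂ Y₁ Y₂ ▷ (Z₁ ⊗ Z₂)) =
      tensorμ X₁ X₂ (Y₁ ⊗ Z₁) (Y₂ ⊗ Z₂) ≫ ((α_ X₁ Y₁ Z₁).inv ⊗ₘ (α_ X₂ Y₂ Z₂).inv) ≫
        tensorδ (X₁ ⊗ Y₁) (X₂ ⊗ Y₂) Z₁ Z₂ := by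
  have h := tensor_associativity X₁ X₂ Y₁ Y₂ Z₁ Z₂
  have h2 := congrArg (fun z => ((X₁ ⊗ X₂) ◁ tensorδ Y₁ Y₂ Z₁ Z₂) ≫
    (α_ (X₁ ⊗ X₂) (Y₁ ⊗ Y₂) (Z₁ ⊗ Z₂)).inv ≫ z ≫
    ((α_ X₁ Y₁ Z₁).inv ⊗ₘ (α_ X₂ Y₂ Z₂).inv) ≫ tensorδ (X₁ ⊗ Y₁) (X₂ ⊗ Y₂) Z₁ Z₂) h
  simp only [Category.assoc, Iso.inv_hom_id_assoc, ← whiskerLeft_comp_assoc, tensorδ_tensorμ,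
    whiskerLeft_id, Category.id_comp, tensorHom_comp_tensorHom_assoc, Iso.hom_inv_id,
    id_tensorHom_id, tensorμ_tensorδ, Category.comp_id] at h2
  exact h2

lemma tensorδ_associativity_left (X₁ X₂ Y₁ Y₂ Z₁ Z₂ : C) :
    (tensorδ X₁ X₂ Y₁ Y₂ ▷ (Z₁ ⊗ Z₂)) ≫ (α_ (X₁ ⊗ X₂) (Y₁ ⊗ Y₂) (Z₁ ⊗ Z₂)).hom ≫
      ((X₁ ⊗ X₂) ◁ tensorμ Y₁ Y₂ Z₁ Z₂) =
      tensorμ (X₁ ⊗ Y₁) (X₂ ⊗ Y₂) Z₁ Z₂ ≫ ((α_ X₁ Y₁ Z₁).hom ⊗ₘ (α_ X₂ Y₂ Z₂).hom) ≫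
        tensorδ X₁ X₂ (Y₁ ⊗ Z₁) (Y₂ ⊗ Z₂) := by
  have h := tensor_associativity X₁ X₂ Y₁ Y₂ Z₁ Z₂
  have h2 := congrArg (fun z => (tensorδ X₁ X₂ Y₁ Y₂ ▷ (Z₁ ⊗ Z₂)) ≫ z ≫
    tensorδ X₁ X₂ (Y₁ ⊗ Z₁) (Y₂ ⊗ Z₂)) h
  simp only [Category.assoc, ← comp_whiskerRight_assoc, tensorδ_tensorμ,
    id_whiskerRight, Category.id_comp, tensorμ_tensorδ, Category.comp_id] at h2
  exact h2.symm

lemma tensorδ_associativity_hom (X₁ X₂ Y₁ Y₂ Z₁ Z₂ : C) :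
    tensorδ (X₁ ⊗ Y₁) (X₂ ⊗ Y₂) Z₁ Z₂ ≫ (tensorδ X₁ X₂ Y₁ Y₂ ▷ (Z₁ ⊗ Z₂)) ≫
      (α_ (X₁ ⊗ X₂) (Y₁ ⊗ Y₂) (Z₁ ⊗ Z₂)).hom =
      ((α_ X₁ Y₁ Z₁).hom ⊗ₘ (α_ X₂ Y₂ Z₂).hom) ≫ tensorδ X₁ X₂ (Y₁ ⊗ Z₁) (Y₂ ⊗ Z₂) ≫
        ((X₁ ⊗ X₂) ◁ tensorδ Y₁ Y₂ Z₁ Z₂) := by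
  have h := tensorδ_associativity_left X₁ X₂ Y₁ Y₂ Z₁ Z₂
  have h2 := congrArg (fun z => tensorδ (X₁ ⊗ Y₁) (X₂ ⊗ Y₂) Z₁ Z₂ ≫ z ≫
    ((X₁ ⊗ X₂) ◁ tensorδ Y₁ Y₂ Z₁ Z₂)) h
  simp only [Category.assoc, ← whiskerLeft_comp, tensorμ_tensorδ, whiskerLeft_id,
    Category.comp_id, tensorδ_tensorμ_assoc] at h2
  exact h2

variable {X : C} (m : X ⊗ X ⟶ X) (δ : X ⟶ X ⊗ X)

/-- The multiplication `(X ⊗ M) ⊗ (X ⊗ N) ⟶ X ⊗ (M ⊗ N)`. -/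
def pi (M N : C) : (X ⊗ M) ⊗ (X ⊗ N) ⟶ X ⊗ (M ⊗ N) := tensorμ X M X N ≫ m ▷ (M ⊗ N)

/-- The comultiplication `X ⊗ (M ⊗ N) ⟶ (X ⊗ M) ⊗ (X ⊗ N)`. -/
def io (M N : C) : X ⊗ (M ⊗ N) ⟶ (X ⊗ M) ⊗ (X ⊗ N) := δ ▷ (M ⊗ N) ≫ tensorδ X M X N

lemma pi_natural {M M' N N' : C} (f : M ⟶ M') (g : N ⟶ N') :
    (X ◁ f ⊗ₘ X ◁ g) ≫ pi m M' N' = pi m M N ≫ X ◁ (f ⊗ₘ g) := by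
  have h := tensorμ_natural_assoc (𝟙 X) f (𝟙 X) g (m ⊗ₘ 𝟙 _)
  simp only [pi, ← tensorHom_id, ← id_tensorHom, Category.assoc, tensorHom_comp_tensorHom,
          Category.comp_id, Category.id_comp, id_tensorHom_id]  at h ⊢
  exact h

lemma io_natural {M M' N N' : C} (f : M ⟶ M') (g : N ⟶ N') :
    X ◁ (f ⊗ₘ g) ≫ io δ M' N' = io δ M N ≫ (X ◁ f ⊗ₘ X ◁ g) := by
  have h := tensorδ_natural (𝟙 X) f (𝟙 X) g
  have h2 := congrArg (fun z => (δ ⊗ₘ 𝟙 _) ≫ z) h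
  simp only [io, ← tensorHom_id, ← id_tensorHom, Category.assoc,
          tensorHom_comp_tensorHom_assoc, Category.comp_id, Category.id_comp, id_tensorHom_id]  at h2 ⊢
  exact h2

lemma io_pi (h : δ ≫ m = 𝟙 X) (M N : C) : io δ M N ≫ pi m M N = 𝟙 _ := by
  rw [io, pi, Category.assoc, tensorδ_tensorμ_assoc, ← comp_whiskerRight, h, id_whiskerRight]

/-- An associative multiplication `m` makes `pi` associative. -/
lemma pi_assoc (h : m ▷ X ≫ m = (α_ X X X).hom ≫ X ◁ m ≫ m) (M N P : C) :
    pi m M N ▷ (X ⊗ P) ≫ pi m (M ⊗ N) P ≫ X ◁ (α_ M N P).hom =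
      (α_ _ _ _).hom ≫ (X ⊗ M) ◁ pi m N P ≫ pi m M (N ⊗ P) := by
  have h1 := tensorμ_natural m (𝟙 (M ⊗ N)) (𝟙 X) (𝟙 P)
  have h2 := tensorμ_natural (𝟙 X) (𝟙 M) m (𝟙 (N ⊗ P))
  have h3 := tensor_associativity X M X N X P
  calc _ = tensorμ X M X N ▷ (X ⊗ P) ≫ (((m ⊗ₘ 𝟙 (M ⊗ N)) ⊗ₘ (𝟙 X ⊗ₘ 𝟙 P)) ≫
        tensorμ X (M ⊗ N) X P) ≫ (m ⊗ₘ (α_ M N P).hom) := by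
        simp only [pi, ← tensorHom_id, ← id_tensorHom, Category.assoc, tensorHom_comp_tensorHom,
          tensorHom_comp_tensorHom_assoc, Category.comp_id, Category.id_comp, id_tensorHom_id]
    _ = (tensorμ X M X N ▷ (X ⊗ P) ≫ tensorμ (X ⊗ X) (M ⊗ N) X P) ≫
        ((m ▷ X ≫ m) ⊗ₘ (α_ M N P).hom) := by
        rw [h1]
        simp only [← tensorHom_id, Category.assoc, tensorHom_comp_tensorHom,
          Category.id_comp, id_tensorHom_id]
    _ = (tensorμ X M X N ▷ (X ⊗ P) ≫ tensorμ (X ⊗ X) (M ⊗ N) X P ≫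
        ((α_ X X X).hom ⊗ₘ (α_ M N P).hom)) ≫ ((X ◁ m ≫ m) ⊗ₘ 𝟙 _) := by
        rw [h]
        simp only [← tensorHom_id, ← id_tensorHom, Category.assoc, tensorHom_comp_tensorHom,
          Category.comp_id]
    _ = (α_ _ _ _).hom ≫ (X ⊗ M) ◁ tensorμ X N X P ≫ (tensorμ X M (X ⊗ X) (N ⊗ P) ≫
        ((𝟙 X ⊗ₘ m) ⊗ₘ (𝟙 M ⊗ₘ 𝟙 (N ⊗ P)))) ≫ (m ⊗ₘ 𝟙 _) := by
        rw [h3]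
        simp only [← id_tensorHom, Category.assoc, tensorHom_comp_tensorHom,
          Category.comp_id, id_tensorHom_id]
    _ = _ := by
        rw [← h2]
        simp only [pi, ← tensorHom_id, ← id_tensorHom, Category.assoc,
          tensorHom_comp_tensorHom_assoc, Category.comp_id, id_tensorHom_id]

/-- A coassociative comultiplication `δ` makes `io` coassociative. -/
lemma io_coassoc (h : δ ≫ δ ▷ X ≫ (α_ X X X).hom = δ ≫ X ◁ δ) (M N P : C) :
    io δ (M ⊗ N) P ≫ io δ M N ▷ (X ⊗ P) ≫ (α_ _ _ _).hom =
      X ◁ (α_ M N P).hom ≫ io δ M (N ⊗ P) ≫ (X ⊗ M) ◁ io δ N P := by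
  have h1 := tensorδ_natural δ (𝟙 (M ⊗ N)) (𝟙 X) (𝟙 P)
  have h2 := tensorδ_natural (𝟙 X) (𝟙 M) δ (𝟙 (N ⊗ P))
  have h3 := tensorδ_associativity_hom X M X N X P
  calc _ = (δ ⊗ₘ 𝟙 _) ≫ (tensorδ X (M ⊗ N) X P ≫ ((δ ⊗ₘ 𝟙 (M ⊗ N)) ⊗ₘ (𝟙 X ⊗ₘ 𝟙 P))) ≫
        tensorδ X M X N ▷ (X ⊗ P) ≫ (α_ _ _ _).hom := by
        simp only [io, ← tensorHom_id, Category.assoc,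
          tensorHom_comp_tensorHom_assoc, Category.comp_id, id_tensorHom_id]
    _ = (δ ⊗ₘ 𝟙 _) ≫ (δ ▷ X ⊗ₘ 𝟙 _) ≫ (tensorδ (X ⊗ X) (M ⊗ N) X P ≫
        tensorδ X M X N ▷ (X ⊗ P) ≫ (α_ _ _ _).hom) := by
        rw [← h1]
        simp only [← tensorHom_id, Category.assoc,
          tensorHom_comp_tensorHom_assoc, Category.comp_id, id_tensorHom_id]
    _ = ((δ ≫ δ ▷ X ≫ (α_ X X X).hom) ⊗ₘ (α_ M N P).hom) ≫
        tensorδ X M (X ⊗ X) (N ⊗ P) ≫ ((X ⊗ M) ◁ tensorδ X N X P) := by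
        rw [h3]
        simp only [← tensorHom_id, ← id_tensorHom,
          tensorHom_comp_tensorHom_assoc, Category.id_comp]
    _ = (δ ⊗ₘ (α_ M N P).hom) ≫ (((𝟙 X ⊗ₘ δ) ⊗ₘ (𝟙 M ⊗ₘ 𝟙 (N ⊗ P))) ≫
        tensorδ X M (X ⊗ X) (N ⊗ P)) ≫ ((X ⊗ M) ◁ tensorδ X N X P) := by
        rw [h]
        simp only [← id_tensorHom, Category.assoc,
          tensorHom_comp_tensorHom_assoc, Category.comp_id, id_tensorHom_id]
    _ = _ := by
        rw [h2]
        simp only [io, ← tensorHom_id, ← id_tensorHom, Category.assoc, tensorHom_comp_tensorHom,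
          tensorHom_comp_tensorHom_assoc, Category.comp_id, Category.id_comp, id_tensorHom_id]

/-- The Frobenius relation `(1 ⊗ δ) (m ⊗ 1) = m δ` passes to `pi` and `io`. -/
lemma frob₁ (h : X ◁ δ ≫ (α_ X X X).inv ≫ m ▷ X = m ≫ δ) (M N P : C) :
    (X ⊗ M) ◁ io δ N P ≫ (α_ _ _ _).inv ≫ pi m M N ▷ (X ⊗ P) =
      pi m M (N ⊗ P) ≫ X ◁ (α_ M N P).inv ≫ io δ (M ⊗ N) P := by
  have h1 := tensorδ_natural m (𝟙 (M ⊗ N)) (𝟙 X) (𝟙 P)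
  have h2 := tensorμ_natural (𝟙 X) (𝟙 M) δ (𝟙 (N ⊗ P))
  have h3 := tensorδ_associativity X M X N X P
  calc _ = ((𝟙 X ⊗ₘ 𝟙 M) ⊗ₘ (δ ⊗ₘ 𝟙 (N ⊗ P))) ≫ ((X ⊗ M) ◁ tensorδ X N X P ≫ (α_ _ _ _).inv ≫
        tensorμ X M X N ▷ (X ⊗ P)) ≫ ((m ⊗ₘ 𝟙 (M ⊗ N)) ⊗ₘ (𝟙 X ⊗ₘ 𝟙 P)) := by
        simp only [io, pi, ← tensorHom_id, ← id_tensorHom, Category.assoc, tensorHom_comp_tensorHom,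
          tensorHom_comp_tensorHom_assoc, Category.comp_id, id_tensorHom_id]
    _ = (((𝟙 X ⊗ₘ 𝟙 M) ⊗ₘ (δ ⊗ₘ 𝟙 (N ⊗ P))) ≫ tensorμ X M (X ⊗ X) (N ⊗ P)) ≫
        ((α_ X X X).inv ⊗ₘ (α_ M N P).inv) ≫
        (tensorδ (X ⊗ X) (M ⊗ N) X P ≫ ((m ⊗ₘ 𝟙 (M ⊗ N)) ⊗ₘ (𝟙 X ⊗ₘ 𝟙 P))) := by
        rw [h3]
        simp only [Category.assoc]
    _ = tensorμ X M X (N ⊗ P) ≫ ((X ◁ δ ≫ (α_ X X X).inv ≫ m ▷ X) ⊗ₘ (α_ M N P).inv) ≫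
        tensorδ X (M ⊗ N) X P := by
        rw [h2, ← h1]
        simp only [← tensorHom_id, ← id_tensorHom, Category.assoc,
          tensorHom_comp_tensorHom_assoc, Category.comp_id, Category.id_comp, id_tensorHom_id]
    _ = _ := by
        rw [h]
        simp only [io, pi, ← tensorHom_id, ← id_tensorHom, Category.assoc,
          tensorHom_comp_tensorHom_assoc, Category.comp_id, Category.id_comp]

/-- The Frobenius relation `(δ ⊗ 1) (1 ⊗ m) = m δ` passes to `pi` and `io`. -/
lemma frob₂ (h : δ ▷ X ≫ (α_ X X X).hom ≫ X ◁ m = m ≫ δ) (M N P : C) :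
    io δ M N ▷ (X ⊗ P) ≫ (α_ _ _ _).hom ≫ (X ⊗ M) ◁ pi m N P =
      pi m (M ⊗ N) P ≫ X ◁ (α_ M N P).hom ≫ io δ M (N ⊗ P) := by
  have h1 := tensorμ_natural δ (𝟙 (M ⊗ N)) (𝟙 X) (𝟙 P)
  have h2 := tensorδ_natural (𝟙 X) (𝟙 M) m (𝟙 (N ⊗ P))
  have h3 := tensorδ_associativity_left X M X N X P
  calc _ = ((δ ⊗ₘ 𝟙 (M ⊗ N)) ⊗ₘ (𝟙 X ⊗ₘ 𝟙 P)) ≫ (tensorδ X M X N ▷ (X ⊗ P) ≫ (α_ _ _ _).hom ≫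
        (X ⊗ M) ◁ tensorμ X N X P) ≫ ((𝟙 X ⊗ₘ 𝟙 M) ⊗ₘ (m ⊗ₘ 𝟙 (N ⊗ P))) := by
        simp only [io, pi, ← tensorHom_id, ← id_tensorHom, Category.assoc, tensorHom_comp_tensorHom,
          tensorHom_comp_tensorHom_assoc, Category.comp_id, id_tensorHom_id]
    _ = (((δ ⊗ₘ 𝟙 (M ⊗ N)) ⊗ₘ (𝟙 X ⊗ₘ 𝟙 P)) ≫ tensorμ (X ⊗ X) (M ⊗ N) X P) ≫
        ((α_ X X X).hom ⊗ₘ (α_ M N P).hom) ≫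
        (tensorδ X M (X ⊗ X) (N ⊗ P) ≫ ((𝟙 X ⊗ₘ 𝟙 M) ⊗ₘ (m ⊗ₘ 𝟙 (N ⊗ P)))) := by
        rw [h3]
        simp only [Category.assoc]
    _ = tensorμ X (M ⊗ N) X P ≫ ((δ ▷ X ≫ (α_ X X X).hom ≫ X ◁ m) ⊗ₘ (α_ M N P).hom) ≫
        tensorδ X M X (N ⊗ P) := by
        rw [h1, ← h2]
        simp only [← tensorHom_id, ← id_tensorHom, Category.assoc,
          tensorHom_comp_tensorHom_assoc, Category.comp_id, Category.id_comp, id_tensorHom_id]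
    _ = _ := by
        rw [h]
        simp only [io, pi, ← tensorHom_id, ← id_tensorHom, Category.assoc,
          tensorHom_comp_tensorHom_assoc, Category.comp_id, Category.id_comp]

end FrobeniusFunctor

/-! ### The universal `R`-matrix -/

namespace WeakHopf

open Coalgebra HopfAlgebra

section sums
variable {k : Type u} [Field k] {M N P : Type u} [AddCommGroup M] [Module k M]
  [AddCommGroup N] [Module k N] [AddCommGroup P] [Module k P]

lemma sum_reps_lift (z : M ⊗[k] N) (f : M →ₗ[k] N →ₗ[k] P) :
    ∑ p ∈ reps z, f p.1 p.2 = TensorProduct.lift f z := sw_eq_lift z f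

end sums

namespace QuasiTriangular
variable {k H : Type u} [Field k] [Ring H] [HopfAlgebra k H] (Q : QuasiTriangular k H)

/-- `R¹ ε(R²) = 1` -/
lemma counit_lTensor_R : TensorProduct.rid k H ((counit (R := k)).lTensor H Q.R) = 1 := by
  let e : H ⊗[k] H →ₐ[k] H := (Algebra.TensorProduct.rid k k H).toAlgHom.comp
    (Algebra.TensorProduct.map (AlgHom.id k H) (Bialgebra.counitAlgHom k H))
  let e' : H ⊗[k] H →ₐ[k] H := (Algebra.TensorProduct.lid k H).toAlgHom.comp
    (Algebra.TensorProduct.map (Bialgebra.counitAlgHom k H) (AlgHom.id k H))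
  let Φ : H ⊗[k] (H ⊗[k] H) →ₐ[k] H ⊗[k] H := Algebra.TensorProduct.map (AlgHom.id k H) e'
  have h1 : ∀ z, Φ ((comul (R := k)).lTensor H z) = z := by
    intro z
    induction z with
    | zero => simp
    | add z w hz hw => simp only [map_add, hz, hw]
    | tmul a b =>
      have : e' (comul (R := k) b) = b := by
        exact (congrArg (TensorProduct.lid k H)
          (Coalgebra.rTensor_counit_comul (R := k) b)).trans (one_smul k b)
      simp [Φ, this]
  have h2 : ∀ z, Φ (leg13 H z) = z := by
    intro z
    induction z with
    | zero => simp
    | add z w hz hw => simp only [map_add, hz, hw]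
    | tmul a b => simp [Φ, e']
  have h3 : ∀ z, Φ (leg12 H z) = e z ⊗ₜ 1 := by
    intro z
    induction z with
    | zero => simp
    | add z w hz hw => simp only [map_add, hz, hw, TensorProduct.add_tmul]
    | tmul a b => simp [Φ, e', e, TensorProduct.smul_tmul]
  have h := congrArg Φ Q.comul_lTensor_R
  rw [map_mul, h1, h2, h3] at h
  have h4 : e Q.R ⊗ₜ[k] (1 : H) = 1 := by
    have := Q.isUnit_R.mul_left_cancel (h.symm.trans (mul_one _).symm)
    exact this
  have h5 := congrArg e h4
  have h6 : e (e Q.R ⊗ₜ[k] (1 : H)) = e Q.R := by simp [e]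
  rw [h6, map_one] at h5
  exact h5

/-- `ε(R¹) R² = 1` -/
lemma counit_rTensor_R : TensorProduct.lid k H ((counit (R := k)).rTensor H Q.R) = 1 := by
  let e : H ⊗[k] H →ₐ[k] H := (Algebra.TensorProduct.rid k k H).toAlgHom.comp
    (Algebra.TensorProduct.map (AlgHom.id k H) (Bialgebra.counitAlgHom k H))
  let e' : H ⊗[k] H →ₐ[k] H := (Algebra.TensorProduct.lid k H).toAlgHom.comp
    (Algebra.TensorProduct.map (Bialgebra.counitAlgHom k H) (AlgHom.id k H))
  let Φ : H ⊗[k] (H ⊗[k] H) →ₐ[k] H ⊗[k] H := Algebra.TensorProduct.map (AlgHom.id k H) e'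
  have h1 : ∀ z, Φ (TensorProduct.assoc k H H H ((comul (R := k)).rTensor H z)) = z := by
    intro z
    induction z with
    | zero => simp
    | add z w hz hw => simp only [map_add, hz, hw]
    | tmul a b =>
      have h0 : ∀ t : H ⊗[k] H, Φ (TensorProduct.assoc k H H H (t ⊗ₜ[k] b)) = e t ⊗ₜ b := by
        intro t
        induction t with
        | zero => simp
        | add z w hz hw => simp only [map_add, TensorProduct.add_tmul, hz, hw]
        | tmul c d => simp [Φ, e, e', TensorProduct.smul_tmul]
      have : e (comul (R := k) a) = a := by
        exact (congrArg (TensorProduct.rid k H)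
          (Coalgebra.lTensor_counit_comul (R := k) a)).trans (one_smul k a)
      rw [LinearMap.rTensor_tmul, h0, this]
  have h2 : ∀ z, Φ (leg13 H z) = z := by
    intro z
    induction z with
    | zero => simp
    | add z w hz hw => simp only [map_add, hz, hw]
    | tmul a b => simp [Φ, e']
  have h3 : ∀ z, Φ (leg23 H z) = 1 ⊗ₜ e' z := by
    intro z
    rw [leg23_apply]
    simp [Φ]
  have h := congrArg Φ Q.comul_rTensor_R
  rw [map_mul, h1, h2, h3] at h
  have h4 : (1 : H) ⊗ₜ[k] e' Q.R = 1 :=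
    Q.isUnit_R.mul_left_cancel (h.symm.trans (mul_one _).symm)
  have h5 := congrArg e' h4
  have h6 : e' ((1 : H) ⊗ₜ[k] e' Q.R) = e' Q.R := by simp [e']
  rw [h6, map_one] at h5
  exact h5

/-- `R₁¹ R₂¹ ⊗ R₂² S(R₁²) = 1` -/
lemma contract_leg13_leg12 : (LinearMap.mul' k H ∘ₗ (antipode k).lTensor H).lTensor H
    (leg13 H Q.R * leg12 H Q.R) = (1 : H ⊗[k] H) := by
  rw [← Q.comul_lTensor_R, ← LinearMap.comp_apply, ← LinearMap.lTensor_comp]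
  have : (LinearMap.mul' k H ∘ₗ (antipode k).lTensor H) ∘ₗ comul =
      Algebra.linearMap k H ∘ₗ counit := HopfAlgebra.mul_antipode_lTensor_comul
  rw [this]
  have h : ∀ z : H ⊗[k] H, (Algebra.linearMap k H ∘ₗ counit (R := k)).lTensor H z =
      TensorProduct.rid k H ((counit (R := k)).lTensor H z) ⊗ₜ 1 := by
    intro z
    induction z with
    | zero => simp
    | add z w hz hw => simp only [map_add, hz, hw, TensorProduct.add_tmul]
    | tmul a b => simp [Algebra.algebraMap_eq_smul_one, TensorProduct.smul_tmul']
  rw [h, counit_lTensor_R]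
  rfl

/-- `(S ⊗ id) R` is a left inverse of `R`. -/
lemma rTensor_antipode_R_mul_R : (antipode k).rTensor H Q.R * Q.R = 1 := by
  let Ψ : H ⊗[k] (H ⊗[k] H) →ₗ[k] H ⊗[k] H :=
    (LinearMap.mul' k H ∘ₗ (antipode k).rTensor H).rTensor H ∘ₗ
      (TensorProduct.assoc k H H H).symm.toLinearMap
  have h := congrArg Ψ Q.comul_rTensor_R
  have h1 : ∀ z w : H ⊗[k] H, Ψ (leg13 H z * leg23 H w) = (antipode k).rTensor H z * w := by
    intro z w
    induction z with
    | zero => simp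
    | add z z' hz hw => simp only [map_add, add_mul, hz, hw]
    | tmul a b =>
    induction w with
    | zero => simp
    | add z z' hz hw => simp only [map_add, mul_add, hz, hw]
    | tmul c d => simp [Ψ]
  rw [h1] at h
  rw [← h]
  simp only [Ψ, LinearMap.comp_apply, LinearEquiv.coe_coe, LinearEquiv.symm_apply_apply]
  rw [← LinearMap.comp_apply, ← LinearMap.rTensor_comp]
  have : (LinearMap.mul' k H ∘ₗ (antipode k).rTensor H) ∘ₗ comul =
      Algebra.linearMap k H ∘ₗ counit := HopfAlgebra.mul_antipode_rTensor_comul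
  rw [this]
  have h2 : ∀ z : H ⊗[k] H, (Algebra.linearMap k H ∘ₗ counit (R := k)).rTensor H z =
      1 ⊗ₜ TensorProduct.lid k H ((counit (R := k)).rTensor H z) := by
    intro z
    induction z with
    | zero => simp
    | add z w hz hw => simp only [map_add, hz, hw, TensorProduct.tmul_add]
    | tmul a b => simp [Algebra.algebraMap_eq_smul_one, TensorProduct.smul_tmul]
  rw [h2, counit_rTensor_R]
  rfl

lemma R_mul_rTensor_antipode_R : Q.R * (antipode k).rTensor H Q.R = 1 :=
  Q.isUnit_R.mul_right_cancel (by
    rw [mul_assoc, Q.rTensor_antipode_R_mul_R, mul_one, one_mul])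

section involutive
variable [CharZero k] [IsSemisimpleRing H]

/-- `R (id ⊗ S)(R) = 1`. For a general Hopf algebra the inverse of `R` involves `S⁻¹` on the right leg;
here `S⁻¹ = S`. -/
lemma R_mul_lTensor_antipode_R : Q.R * (antipode k).lTensor H Q.R = 1 := by
  have h := congrArg ((antipode k).lTensor H) Q.contract_leg13_leg12
  have h1 : ∀ z w : H ⊗[k] H, (antipode k).lTensor H
      ((LinearMap.mul' k H ∘ₗ (antipode k).lTensor H).lTensor H (leg13 H z * leg12 H w)) =
      z * (antipode k).lTensor H w := by
    intro z w
    induction z with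
    | zero => simp
    | add z z' hz hw => simp only [map_add, add_mul, hz, hw]
    | tmul a b =>
    induction w with
    | zero => simp
    | add z z' hz hw => simp only [map_add, mul_add, hz, hw]
    | tmul c d => simp [HopfAlgebra.antipode_mul_antidistrib,
      HopfConv.antipode_antipode_of_isSemisimpleRing]
  rw [h1] at h
  rw [h]
  simp [Algebra.TensorProduct.one_def]

lemma lTensor_antipode_R : (antipode k).lTensor H Q.R = (antipode k).rTensor H Q.R :=
  Q.isUnit_R.mul_left_cancel
    ((Q.R_mul_lTensor_antipode_R).trans Q.R_mul_rTensor_antipode_R.symm)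

lemma map_antipode_R : TensorProduct.map (antipode k) (antipode k) Q.R = Q.R := by
  have h : (antipode k).lTensor H ((antipode k).rTensor H Q.R) =
      TensorProduct.map (antipode k) (antipode k) Q.R := by
    rw [← LinearMap.comp_apply, LinearMap.lTensor_comp_rTensor]
  rw [← h, ← Q.lTensor_antipode_R, ← LinearMap.comp_apply, ← LinearMap.lTensor_comp]
  have : antipode k ∘ₗ antipode k = (LinearMap.id : H →ₗ[k] H) :=
    LinearMap.ext (HopfConv.antipode_antipode_of_isSemisimpleRing k)
  rw [this, LinearMap.lTensor_id]; rfl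

end involutive
end QuasiTriangular

end WeakHopf

/-! ### The trace form of the module algebra -/

namespace WeakHopf

open Coalgebra HopfAlgebra HopfConv

section hopf
variable {k H : Type u} [Field k] [CharZero k] [Ring H] [HopfAlgebra k H] [IsSemisimpleRing H]

lemma sum_antipode_right_mul_left (h : H) :
    ∑ i ∈ (ℛ k h).index, antipode k ((ℛ k h).right i) * (ℛ k h).left i =
      counit (R := k) h • (1 : H) := by
  have e := congrArg (antipode k) (sum_antipode_mul_eq_smul (R := k) (ℛ k h))
  simpa [map_sum, antipode_mul_antidistrib, antipode_antipode_of_isSemisimpleRing] using e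

lemma sum_right_mul_antipode_left (h : H) :
    ∑ i ∈ (ℛ k h).index, (ℛ k h).right i * antipode k ((ℛ k h).left i) =
      counit (R := k) h • (1 : H) := by
  have e := congrArg (antipode k) (sum_mul_antipode_eq_smul (R := k) (ℛ k h))
  simpa [map_sum, antipode_mul_antidistrib, antipode_antipode_of_isSemisimpleRing] using e

end hopf

namespace ModuleAlgebra
variable {k H A : Type u} [Field k] [Ring H] [HopfAlgebra k H] [Ring A] [Algebra k A]
  (T : ModuleAlgebra k H A)

lemma act_mul_eq (h : H) (a b : A) : T.act h (a * b) =
    LinearMap.mul' k A (pairRep T.act T.act (comul (R := k) h) (a ⊗ₜ b)) := by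
  rw [T.act_mul, sw]
  conv_rhs => rw [← sum_reps (comul (R := k) h)]
  simp [map_sum]

/-- Multiplication by `h a` is `b ↦ h₁ (a (S(h₂) b))`. -/
lemma mulLeft_act (a : A) : LinearMap.mul k A ∘ₗ T.act.toLinearMap.flip a =
    T.act.toLinearMap ⋆ (LinearMap.mulLeft k (LinearMap.mulLeft k a) ∘ₗ T.act.toLinearMap ∘ₗ
      antipode k) := by
  have h1 : LinearMap.mulRight k (LinearMap.mulLeft k a) ∘ₗ T.act.toLinearMap =
      (LinearMap.mul k A ∘ₗ T.act.toLinearMap.flip a) ⋆ T.act.toLinearMap := by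
    ext h b
    simp [conv_sum, act_mul_eq, ← (ℛ k h).eq]
  have h2 := congrArg (fun f => f ⋆ (T.act.toLinearMap ∘ₗ antipode k)) h1
  simp only [conv_assoc, algHom_conv_antipode, conv_one] at h2
  rw [← h2]
  ext h b
  simp [conv_sum]

end ModuleAlgebra

namespace SymmSepIdempotent
variable {k A : Type u} [Field k] [Ring A] [Algebra k A] (s : SymmSepIdempotent k A)

lemma α_mul_comm (a b : A) : s.α (a * b) = s.α (b * a) := by
  have h : ∀ c d : A, LinearMap.mul k A (c * d) = LinearMap.mul k A c * LinearMap.mul k A d := by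
    intro c d; ext; simp [mul_assoc]
  simp only [α, LinearMap.comp_apply, h]
  exact LinearMap.trace_mul_comm k _ _

/-- `⟨α, a x¹⟩ x² = a` -/
lemma dual_basis' (a : A) :
    TensorProduct.lid k A ((s.α ∘ₗ LinearMap.mulLeft k a).rTensor A s.x) = a := by
  conv_rhs => rw [← s.dual_basis a]
  conv_lhs => rw [← s.comm_x]
  generalize s.x = z
  induction z with
  | zero => simp
  | add z w hz hw => simp only [map_add, hz, hw]
  | tmul p q => simp

lemma sum_α_mul (a : A) : ∑ p ∈ reps s.x, s.α (a * p.1) • p.2 = a := by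
  conv_rhs => rw [← s.dual_basis' a, ← sum_reps s.x]
  simp [map_sum]

lemma sum_α_mul' (a : A) : ∑ p ∈ reps s.x, s.α (p.1 * a) • p.2 = a := by
  simp only [s.α_mul_comm _ a, sum_α_mul]

lemma sum_α_mul_snd (a : A) : ∑ p ∈ reps s.x, s.α (a * p.2) • p.1 = a := by
  conv_rhs => rw [← s.dual_basis a, ← sum_reps s.x]
  simp [map_sum]

/-- Identification of `A` with its dual: `c ↦ α(- c)`. -/
def toDual : A ≃ₗ[k] Module.Dual k A :=
  LinearEquiv.ofLinearMap
    { toFun := fun c => lharp c s.α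
      map_add' := fun c d => by ext; simp [lharp, mul_add]
      map_smul' := fun r c => by ext; simp [lharp] }
    { toFun := fun φ => ∑ p ∈ reps s.x, φ p.1 • p.2
      map_add' := fun φ ψ => by simp [add_smul, Finset.sum_add_distrib]
      map_smul' := fun r φ => by simp [mul_smul, Finset.smul_sum] }
    (by
      ext φ a
      have h := congrArg φ (s.sum_α_mul_snd a)
      simp only [map_sum, map_smul, smul_eq_mul] at h
      simp [lharp, Finset.mul_sum, mul_comm (φ _), h])
    (by
      ext c
      simp [lharp, sum_α_mul'])

lemma toDual_apply (c a : A) : s.toDual c a = s.α (a * c) := rfl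

lemma toDual_one : s.toDual 1 = s.α := by ext; simp [toDual_apply]

lemma rharp_toDual (c a : A) : rharp (s.toDual c) a = s.toDual (c * a) := by
  ext b
  simp only [rharp, LinearMap.comp_apply, LinearMap.mulLeft_apply, toDual_apply]
  rw [s.α_mul_comm, s.α_mul_comm b, mul_assoc c a b, s.α_mul_comm c, s.α_mul_comm]

lemma lharp_toDual (c a : A) : lharp a (s.toDual c) = s.toDual (a * c) := by
  ext b
  simp [lharp, toDual_apply, mul_assoc]

/-- The coproduct of `A*` in terms of `A`: it sends `α(- c)` to `α(- x²) ⊗ α(- c x¹)`. -/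
lemma comulDual_toDual (c : A) : s.comulDual (s.toDual c) =
    ∑ p ∈ reps s.x, s.toDual p.2 ⊗ₜ[k] s.toDual (c * p.1) := by
  have := s.finite
  apply (TensorProduct.dualDistribEquiv k A A).injective
  change TensorProduct.dualDistrib k A A _ = TensorProduct.dualDistrib k A A _
  ext u v
  simp only [TensorProduct.AlgebraTensorModule.curry_apply, LinearMap.restrictScalars_self,
    TensorProduct.curry_apply, comulDual_apply, map_sum, LinearMap.sum_apply,
    TensorProduct.dualDistrib_apply, toDual_apply]
  have h := congrArg (fun w => s.α (u * w)) (s.sum_α_mul (v * c))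
  simp only [Finset.mul_sum, map_sum, mul_smul_comm, map_smul, smul_eq_mul] at h
  rw [mul_assoc, ← h]
  exact Finset.sum_congr rfl fun p _ => by rw [mul_comm, mul_assoc]

section contr
variable {M : Type u} [AddCommGroup M] [Module k M]

/-- The contraction `a ⊗ m ↦ α(a c) m`. -/
def contr (M : Type u) [AddCommGroup M] [Module k M] (c : A) : A ⊗[k] M →ₗ[k] M :=
  (TensorProduct.lid k M).toLinearMap ∘ₗ (s.α ∘ₗ LinearMap.mulRight k c).rTensor M

@[simp] lemma contr_tmul (c a : A) (m : M) : s.contr M c (a ⊗ₜ m) = s.α (a * c) • m := rfl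

lemma sum_tmul_contr (w : A ⊗[k] M) : ∑ p ∈ reps s.x, p.1 ⊗ₜ[k] s.contr M p.2 w = w := by
  induction w with
  | zero => simp
  | add z w hz hw =>
    simp only [map_add, TensorProduct.tmul_add, Finset.sum_add_distrib, hz, hw]
  | tmul a m =>
    conv_rhs => rw [← s.sum_α_mul_snd a]
    simp [TensorProduct.sum_tmul, TensorProduct.smul_tmul']

/-- The contractions `contr M c` separate the elements of `A ⊗ M`. -/
lemma ext_contr {w w' : A ⊗[k] M} (h : ∀ c, s.contr M c w = s.contr M c w') : w = w' := by
  rw [← s.sum_tmul_contr w, ← s.sum_tmul_contr w']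
  simp only [h]

/-- `α(x¹ c) x² = c` -/
lemma contr_x (c : A) : s.contr A c s.x = c := by
  conv_rhs => rw [← s.sum_α_mul' c]
  conv_lhs => rw [← sum_reps s.x]
  simp

end contr

end SymmSepIdempotent

section invariance
variable {k H A : Type u} [Field k] [CharZero k] [Ring H] [HopfAlgebra k H] [IsSemisimpleRing H]
  [Ring A] [Algebra k A] (T : ModuleAlgebra k H A) (s : SymmSepIdempotent k A)

/-- The trace form is invariant; this is where `S² = id` enters. -/
lemma α_act (h : H) (a : A) : s.α (T.act h a) = counit (R := k) h * s.α a := by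
  have e := LinearMap.congr_fun (T.mulLeft_act a) h
  have e' := congrArg (LinearMap.trace k A) e
  rw [conv_sum] at e'
  have e2 : ∀ i, LinearMap.trace k A (T.act.toLinearMap ((ℛ k h).left i) *
      (LinearMap.mulLeft k (LinearMap.mulLeft k a) ∘ₗ T.act.toLinearMap ∘ₗ antipode k)
        ((ℛ k h).right i)) =
      LinearMap.trace k A (LinearMap.mulLeft k a *
        T.act (antipode k ((ℛ k h).right i) * (ℛ k h).left i)) := by
    intro i
    rw [LinearMap.trace_mul_comm, map_mul T.act, ← mul_assoc]
    rfl
  rw [map_sum] at e'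
  simp only [e2] at e'
  rw [← map_sum, ← Finset.mul_sum, ← map_sum, sum_antipode_right_mul_left] at e'
  refine Eq.trans ?_ (e'.trans ?_)
  · rfl
  · rw [map_smul, map_one, mul_smul_comm, mul_one, map_smul]
    rfl

/-- The action of `S(h)` is adjoint to that of `h` with respect to the trace form. -/
lemma α_act_mul (h : H) (a b : A) :
    s.α (T.act h a * b) = s.α (a * T.act (antipode k h) b) := by
  have e := LinearMap.congr_fun (LinearMap.congr_fun (T.mulLeft_act a) h) b
  have e' := congrArg s.α e
  rw [conv_sum] at e'
  refine Eq.trans ?_ (e'.trans ?_)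
  · rfl
  · simp only [LinearMap.sum_apply, Module.End.mul_apply, map_sum, AlgHom.toLinearMap_apply,
      LinearMap.comp_apply, LinearMap.mulLeft_apply, α_act]
    have e3 := congrArg (fun g => s.α (a * T.act (antipode k g) b))
      (sum_counit_smul (R := k) (ℛ k h))
    simpa only [map_sum, map_smul, LinearMap.sum_apply, LinearMap.smul_apply, Finset.mul_sum,
      mul_smul_comm, smul_eq_mul, Module.End.mul_apply] using e3

lemma α_mul_act (h : H) (a b : A) :
    s.α (a * T.act h b) = s.α (T.act (antipode k h) a * b) := by
  rw [α_act_mul, antipode_antipode_of_isSemisimpleRing]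

/-- `contr M c` intertwines the action of `h` on `A ⊗ M` with actions on `c` and on `M`. -/
lemma contr_pairRep (M : FDMod k H) (h : H) (c : A) (w : A ⊗[k] M.carrier) :
    s.contr _ c (pairRep T.act M.ρ (comul (R := k) h) w) =
      ∑ i ∈ (ℛ k h).index, M.ρ ((ℛ k h).right i)
        (s.contr _ (T.act (antipode k ((ℛ k h).left i)) c) w) := by
  induction w with
  | zero => simp
  | add z w hz hw => simp only [map_add, hz, hw, Finset.sum_add_distrib]
  | tmul a m =>
    conv_lhs => rw [← (ℛ k h).eq]
    simp [map_sum, α_act_mul]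

/-- The separability idempotent is `H`-invariant. -/
lemma pairRep_x (h : H) :
    pairRep T.act T.act (comul (R := k) h) s.x = counit (R := k) h • s.x := by
  have := s.finite
  refine s.ext_contr fun c => ?_
  refine (contr_pairRep T s ⟨A, T.act⟩ h c s.x).trans ?_
  simp only [s.contr_x, ← Module.End.mul_apply, ← map_mul, ← LinearMap.sum_apply, ← map_sum,
    sum_right_mul_antipode_left, map_smul]
  simp

end invariance

end WeakHopf

/-! ### The Frobenius algebra `A` in the category of `H`-modules -/

namespace WeakHopf

open Coalgebra HopfAlgebra HopfConv QuasiTriangular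

section frobenius
variable {k H A : Type u} [Field k] [CharZero k] [Ring H] [HopfAlgebra k H] [IsSemisimpleRing H]
  [Ring A] [Algebra k A] (Q : QuasiTriangular k H) (T : ModuleAlgebra k H A)
  (s : SymmSepIdempotent k A)

lemma modCat_hom_ext {M N : FDMod k H} {f g : (M : Q.ModCat) ⟶ (N : Q.ModCat)}
    (h : ∀ t : M.carrier, FDMod.lin (k := k) (B := H) f t = FDMod.lin (k := k) (B := H) g t) :
    f = g := FDMod.hom_ext (k := k) (B := H) (LinearMap.ext h)

/-- The `H`-module algebra `A` as a finite-dimensional `H`-module. -/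
abbrev algMod : FDMod k H where
  carrier := A
  fin := s.finite
  ρ := T.act

/-- The `H`-module algebra `A` as an object of the category of `H`-modules. -/
abbrev algObj : Q.ModCat := algMod T s

/-- The multiplication of `A` as a morphism of `H`-modules. -/
def mulHom : algObj Q T s ⊗ algObj Q T s ⟶ algObj Q T s :=
  FDMod.ofLin (M := tensor (algMod T s) (algMod T s)) (N := algMod T s)
    (LinearMap.mul' k A) (fun h t => by
      change A ⊗[k] A at t
      change LinearMap.mul' k A (pairRep T.act T.act (comul (R := k) h) t) =
        T.act h (LinearMap.mul' k A t)
      induction t with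
      | zero => simp
      | add z w hz hw => simp only [map_add, hz, hw]
      | tmul a b => rw [LinearMap.mul'_apply, T.act_mul_eq])

/-- The separability idempotent as an invariant element of `A ⊗ A`. -/
def sepHom : 𝟙_ Q.ModCat ⟶ algObj Q T s ⊗ algObj Q T s :=
  FDMod.ofLin (M := QuasiTriangular.unit k H) (N := tensor (algMod T s) (algMod T s))
    (LinearMap.toSpanSingleton k (A ⊗[k] A) s.x) (fun h (r : k) => by
      change (counit (R := k) h * r) • s.x = pairRep T.act T.act (comul (R := k) h) (r • s.x)
      rw [map_smul, pairRep_x T s, smul_smul, mul_comm])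

/-- The comultiplication `c ↦ c x¹ ⊗ x²`, with which `A` is a Frobenius algebra in the category of
`H`-modules. -/
def comulHom : algObj Q T s ⟶ algObj Q T s ⊗ algObj Q T s :=
  (ρ_ _).inv ≫ algObj Q T s ◁ sepHom Q T s ≫ (α_ _ _ _).inv ≫ mulHom Q T s ▷ algObj Q T s

/-- The linear map `c ↦ c x¹ ⊗ x²`. -/
def comulLin : A →ₗ[k] A ⊗[k] A :=
  LinearMap.mulRight k s.x ∘ₗ (TensorProduct.mk k A A).flip 1

lemma comulLin_apply (c : A) : comulLin s c = (c ⊗ₜ 1) * s.x := rfl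

lemma comulLin_eq_sum (c : A) : comulLin s c = ∑ p ∈ reps s.x, (c * p.1) ⊗ₜ[k] p.2 := by
  rw [comulLin_apply]
  conv_lhs => rw [← sum_reps s.x]
  simp [Finset.mul_sum]

lemma lin_comulHom : FDMod.lin (k := k) (B := H) (M := algMod T s)
    (N := tensor (algMod T s) (algMod T s)) (comulHom Q T s) = comulLin s := by
  refine LinearMap.ext fun (c : A) => ?_
  have h : ∀ z : A ⊗[k] A, (LinearMap.mul' k A).rTensor A
      ((TensorProduct.assoc k A A A).symm (c ⊗ₜ z)) = (c ⊗ₜ 1) * z := by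
    intro z
    induction z with
    | zero => simp
    | add z w hz hw => simp only [TensorProduct.tmul_add, map_add, mul_add, hz, hw]
    | tmul a b => simp
  refine Eq.trans ?_ (h s.x)
  change (LinearMap.mul' k A).rTensor A
      ((TensorProduct.assoc k A A A).symm (c ⊗ₜ ((1 : k) • s.x))) = _
  rw [one_smul]

/-- The Frobenius algebra `A` is special: `c x¹ x² = c`. -/
lemma comulHom_mulHom : comulHom Q T s ≫ mulHom Q T s = 𝟙 _ := by
  refine modCat_hom_ext (M := algMod T s) fun (c : A) => ?_
  refine Eq.trans (congrArg (LinearMap.mul' k A) (LinearMap.congr_fun (lin_comulHom Q T s) c)) ?_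
  have h : ∀ z : A ⊗[k] A, LinearMap.mul' k A ((c ⊗ₜ 1) * z) = c * LinearMap.mul' k A z := by
    intro z
    induction z with
    | zero => simp
    | add z w hz hw => simp only [map_add, mul_add, hz, hw]
    | tmul a b => simp [mul_assoc]
  rw [comulLin_apply, h, s.mul_x, mul_one]
  rfl

lemma mulHom_assoc : mulHom Q T s ▷ _ ≫ mulHom Q T s =
    (α_ _ _ _).hom ≫ algObj Q T s ◁ mulHom Q T s ≫ mulHom Q T s :=
  FDMod.hom_ext (k := k) (B := H) (M := tensor (tensor (algMod T s) (algMod T s)) (algMod T s))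
    (N := algMod T s) (TensorProduct.ext_threefold (fun a b c : A => mul_assoc a b c))

/-- The comultiplication is a map of right `A`-modules, by the separability relation
`d x¹ ⊗ x² = x¹ ⊗ x² d`. -/
lemma comulLin_mul_tmul (c d : A) :
    comulLin s (c * d) = (LinearMap.mulRight k d).lTensor A (comulLin s c) := by
  have h := s.tmul_mul_x d
  have h1 : comulLin s (c * d) = (c ⊗ₜ 1) * ((d ⊗ₜ 1) * s.x) := by
    rw [← mul_assoc, Algebra.TensorProduct.tmul_mul_tmul, mul_one]; rfl
  rw [h1, h, comulLin_apply]
  generalize s.x = z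
  induction z with
  | zero => simp
  | add z w hz hw => simp only [map_add, mul_add, hz, hw]
  | tmul a b => simp

lemma comulLin_mul_left (c d : A) :
    comulLin s (c * d) = (LinearMap.mulLeft k c).rTensor A (comulLin s d) := by
  rw [comulLin_eq_sum, comulLin_eq_sum]
  simp [mul_assoc]

lemma mulHom_comulHom_left : comulHom Q T s ▷ _ ≫ (α_ _ _ _).hom ≫ _ ◁ mulHom Q T s =
    mulHom Q T s ≫ comulHom Q T s := by
  refine FDMod.hom_ext (k := k) (B := H) (M := tensor (algMod T s) (algMod T s))
    (N := tensor (algMod T s) (algMod T s)) (TensorProduct.ext' fun (c d : A) => ?_)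
  have h : ∀ z : A ⊗[k] A, (LinearMap.mul' k A).lTensor A
      (TensorProduct.assoc k A A A (z ⊗ₜ d)) = (LinearMap.mulRight k d).lTensor A z := by
    intro z
    induction z with
    | zero => simp
    | add z w hz hw => simp only [TensorProduct.add_tmul, map_add, hz, hw]
    | tmul a b => simp
  have e := lin_comulHom Q T s
  refine Eq.trans (congrArg (fun w => (LinearMap.mul' k A).lTensor A
      (TensorProduct.assoc k A A A (w ⊗ₜ d))) (LinearMap.congr_fun e c)) ?_
  refine Eq.trans ?_ (LinearMap.congr_fun e (c * d)).symm
  rw [comulLin_mul_tmul]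
  exact h _

lemma mulHom_comulHom_right : _ ◁ comulHom Q T s ≫ (α_ _ _ _).inv ≫ mulHom Q T s ▷ _ =
    mulHom Q T s ≫ comulHom Q T s := by
  refine FDMod.hom_ext (k := k) (B := H) (M := tensor (algMod T s) (algMod T s))
    (N := tensor (algMod T s) (algMod T s)) (TensorProduct.ext' fun (c d : A) => ?_)
  have h : ∀ z : A ⊗[k] A, (LinearMap.mul' k A).rTensor A
      ((TensorProduct.assoc k A A A).symm (c ⊗ₜ z)) = (LinearMap.mulLeft k c).rTensor A z := by
    intro z
    induction z with
    | zero => simp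
    | add z w hz hw => simp only [TensorProduct.tmul_add, map_add, hz, hw]
    | tmul a b => simp
  have e := lin_comulHom Q T s
  refine Eq.trans (congrArg (fun w => (LinearMap.mul' k A).rTensor A
      ((TensorProduct.assoc k A A A).symm (c ⊗ₜ w))) (LinearMap.congr_fun e d)) ?_
  refine Eq.trans ?_ (LinearMap.congr_fun e (c * d)).symm
  rw [comulLin_mul_left]
  exact h _

lemma comulHom_coassoc : comulHom Q T s ≫ comulHom Q T s ▷ _ ≫ (α_ _ _ _).hom =
    comulHom Q T s ≫ _ ◁ comulHom Q T s := by
  refine modCat_hom_ext (M := algMod T s) fun (c : A) => ?_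
  have e := lin_comulHom Q T s
  let f₁ := comulHom Q T s ≫ comulHom Q T s ▷ algObj Q T s ≫ (α_ _ _ _).hom
  let f₂ := comulHom Q T s ≫ algObj Q T s ◁ comulHom Q T s
  have h1 : FDMod.lin (k := k) (B := H) f₁ c =
      TensorProduct.assoc k A A A ((comulLin s).rTensor A (comulLin s c)) := by
    rw [← e]; rfl
  have h2 : FDMod.lin (k := k) (B := H) f₂ c =
      (comulLin s).lTensor A (comulLin s c) := by
    rw [← e]; rfl
  refine h1.trans (Eq.trans ?_ h2.symm)
  have h3 : ∀ a b : A, TensorProduct.assoc k A A A (comulLin s (c * a) ⊗ₜ b) =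
      ∑ p ∈ reps s.x, (c * p.1) ⊗ₜ[k] ((p.2 * a) ⊗ₜ[k] b) := by
    intro a b
    rw [comulLin_mul_tmul, comulLin_eq_sum]
    simp [TensorProduct.sum_tmul, map_sum]
  have h4 : ∀ a b : A, a ⊗ₜ[k] comulLin s b =
      ∑ p ∈ reps s.x, a ⊗ₜ[k] ((b * p.1) ⊗ₜ[k] p.2) := by
    intro a b
    rw [comulLin_eq_sum, TensorProduct.tmul_sum]
  conv_lhs => rw [comulLin_eq_sum s c]
  conv_rhs => rw [comulLin_eq_sum s c]
  simp only [map_sum, LinearMap.rTensor_tmul, LinearMap.lTensor_tmul, h3, h4]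
  rw [Finset.sum_comm]

end frobenius

section maps
variable {k H A : Type u} [Field k] [CharZero k] [Ring H] [HopfAlgebra k H] [IsSemisimpleRing H]
  [Ring A] [Algebra k A] (Q : QuasiTriangular k H) (T : ModuleAlgebra k H A)
  (s : SymmSepIdempotent k A)

/-- The multiplication `(b ⊗ m) ⊗ (d ⊗ n) ↦ b (R² d) ⊗ R¹ m ⊗ n`. -/
def piLin (M N : FDMod k H) : (A ⊗[k] M.carrier) ⊗[k] (A ⊗[k] N.carrier) →ₗ[k]
    A ⊗[k] (M.carrier ⊗[k] N.carrier) :=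
  FDMod.lin (k := k) (B := H) (FrobeniusFunctor.pi (mulHom Q T s) (M : Q.ModCat) (N : Q.ModCat))

/-- The comultiplication `c ⊗ m ⊗ n ↦ (c x¹ ⊗ R¹ m) ⊗ (S(R²) x² ⊗ n)`. -/
def ioLin (M N : FDMod k H) : A ⊗[k] (M.carrier ⊗[k] N.carrier) →ₗ[k]
    (A ⊗[k] M.carrier) ⊗[k] (A ⊗[k] N.carrier) :=
  FDMod.lin (k := k) (B := H) (FrobeniusFunctor.io (comulHom Q T s) (M : Q.ModCat) (N : Q.ModCat))

lemma piLin_tmul (M N : FDMod k H) (b d : A) (m : M.carrier) (n : N.carrier) :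
    piLin Q T s M N ((b ⊗ₜ m) ⊗ₜ (d ⊗ₜ n)) =
      ∑ p ∈ reps Q.R, (b * T.act p.2 d) ⊗ₜ[k] (M.ρ p.1 m ⊗ₜ[k] n) := by
  let K : A ⊗[k] M.carrier →ₗ[k] A ⊗[k] (M.carrier ⊗[k] N.carrier) :=
    (TensorProduct.assoc k A M.carrier N.carrier).toLinearMap ∘ₗ
      (TensorProduct.mk k (A ⊗[k] M.carrier) N.carrier).flip n ∘ₗ
      (LinearMap.mulLeft k b).rTensor M.carrier
  have h : ∀ w : A ⊗[k] M.carrier, (LinearMap.mul' k A).rTensor (M.carrier ⊗[k] N.carrier)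
      ((TensorProduct.assoc k A A (M.carrier ⊗[k] N.carrier)).symm
        (b ⊗ₜ (TensorProduct.assoc k A M.carrier N.carrier (w ⊗ₜ n)))) = K w := by
    intro w
    induction w with
    | zero => simp
    | add z w hz hw => simp only [TensorProduct.add_tmul, TensorProduct.tmul_add, map_add, hz, hw]
    | tmul a b => simp [K]
  refine Eq.trans (b := K (flipAct M.ρ T.act Q.R (m ⊗ₜ d))) (h _) ?_
  rw [flipAct_apply]
  conv_lhs => rw [← sum_reps Q.R]
  simp [K, map_sum]

lemma ioLin_tmul (M N : FDMod k H) (c : A) (m : M.carrier) (n : N.carrier) :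
    ioLin Q T s M N (c ⊗ₜ (m ⊗ₜ n)) =
      ∑ q ∈ reps s.x, ∑ p ∈ reps Q.R,
        ((c * q.1) ⊗ₜ[k] M.ρ p.1 m) ⊗ₜ[k] (T.act (antipode k p.2) q.2 ⊗ₜ[k] n) := by
  let L₀ : (A ⊗[k] A) ⊗[k] (M.carrier ⊗[k] N.carrier) →ₗ[k]
      (A ⊗[k] M.carrier) ⊗[k] (A ⊗[k] N.carrier) :=
    FDMod.lin (k := k) (B := H) (tensorδ (algObj Q T s) (M : Q.ModCat) (algObj Q T s)
      (N : Q.ModCat))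
  let L : A ⊗[k] A →ₗ[k] (A ⊗[k] M.carrier) ⊗[k] (A ⊗[k] N.carrier) :=
    L₀ ∘ₗ (TensorProduct.mk k (A ⊗[k] A) (M.carrier ⊗[k] N.carrier)).flip (m ⊗ₜ n)
  have h1 : ioLin Q T s M N (c ⊗ₜ (m ⊗ₜ n)) = L (comulLin s c) := by
    rw [← lin_comulHom Q T s]; rfl
  have hR : (↑(Q.isUnit_R.unit⁻¹) : H ⊗[k] H) = (antipode k).lTensor H Q.R :=
    Units.inv_eq_of_mul_eq_one_right Q.R_mul_lTensor_antipode_R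
  have h2 : ∀ a b : A, L (a ⊗ₜ b) =
      ∑ p ∈ reps Q.R, (a ⊗ₜ[k] M.ρ p.1 m) ⊗ₜ[k] (T.act (antipode k p.2) b ⊗ₜ[k] n) := by
    intro a b
    let K : M.carrier ⊗[k] A →ₗ[k] (A ⊗[k] M.carrier) ⊗[k] (A ⊗[k] N.carrier) :=
      (TensorProduct.assoc k A M.carrier (A ⊗[k] N.carrier)).symm.toLinearMap ∘ₗ
        TensorProduct.mk k A (M.carrier ⊗[k] (A ⊗[k] N.carrier)) a ∘ₗ
        (TensorProduct.assoc k M.carrier A N.carrier).toLinearMap ∘ₗ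
        (TensorProduct.mk k (M.carrier ⊗[k] A) N.carrier).flip n
    refine Eq.trans (b := K (pairRep M.ρ T.act (↑(Q.isUnit_R.unit⁻¹) : H ⊗[k] H) (m ⊗ₜ b)))
      rfl ?_
    rw [hR]
    conv_lhs => rw [← sum_reps Q.R]
    simp [K, map_sum]
  rw [h1, comulLin_eq_sum, map_sum]
  exact Finset.sum_congr rfl fun q _ => h2 _ _

end maps

end WeakHopf

/-! ### The transported braiding -/

namespace FrobeniusFunctor

variable {C : Type*} [Category C] [MonoidalCategory C] [BraidedCategory C]
variable {X : C} (m : X ⊗ X ⟶ X) (δ : X ⟶ X ⊗ X)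

/-- The braiding transported along `pi` and `io`. -/
def br (M N : C) : (X ⊗ M) ⊗ (X ⊗ N) ⟶ (X ⊗ N) ⊗ (X ⊗ M) :=
  pi m M N ≫ X ◁ (β_ M N).hom ≫ io δ N M

/-- First hexagon for the transported braiding. Only the middle factor of a braiding of `M ⊗ N` with
`P` uses the hexagon of the category; the rest is associativity and the Frobenius relation. -/
lemma br_tensor_left (ha : m ▷ X ≫ m = (α_ X X X).hom ≫ X ◁ m ≫ m)
    (hc : δ ≫ δ ▷ X ≫ (α_ X X X).hom = δ ≫ X ◁ δ)
    (hf : X ◁ δ ≫ (α_ X X X).inv ≫ m ▷ X = m ≫ δ) (M N P : C) :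
    pi m M N ▷ (X ⊗ P) ≫ br m δ (M ⊗ N) P ≫ (X ⊗ P) ◁ io δ M N =
      (α_ _ _ _).hom ≫ (X ⊗ M) ◁ br m δ N P ≫ (α_ _ _ _).inv ≫
        br m δ M P ▷ (X ⊗ N) ≫ (α_ _ _ _).hom := by
  have h1 := frob₁ m δ hf M P N
  have h2 := io_coassoc δ hc P M N
  have h3 := pi_assoc m ha M N P
  have h4 := pi_natural m (𝟙 M) (β_ N P).hom
  have h5 := io_natural δ (β_ M P).hom (𝟙 N)
  rw [tensorHom_id, whiskerLeft_id, tensorHom_id] at h5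
  rw [id_tensorHom, whiskerLeft_id, id_tensorHom] at h4
  have h7 : (β_ (M ⊗ N) P).hom =
      (α_ M N P).hom ≫ M ◁ (β_ N P).hom ≫ (α_ M P N).inv ≫ (β_ M P).hom ▷ N ≫
        (α_ P M N).hom := by
    simp
  rw [br, h7]
  simp only [br, MonoidalCategory.whiskerLeft_comp, comp_whiskerRight, Category.assoc]
  rw [reassoc_of% h1, ← reassoc_of% h5, h2, reassoc_of% h4, reassoc_of% h3]

/-- Second hexagon for the transported braiding. -/
lemma br_tensor_right (ha : m ▷ X ≫ m = (α_ X X X).hom ≫ X ◁ m ≫ m)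
    (hc : δ ≫ δ ▷ X ≫ (α_ X X X).hom = δ ≫ X ◁ δ)
    (hf : δ ▷ X ≫ (α_ X X X).hom ≫ X ◁ m = m ≫ δ) (M N P : C) :
    (X ⊗ M) ◁ pi m N P ≫ br m δ M (N ⊗ P) ≫ io δ N P ▷ (X ⊗ M) =
      (α_ _ _ _).inv ≫ br m δ M N ▷ (X ⊗ P) ≫ (α_ _ _ _).hom ≫
        (X ⊗ N) ◁ br m δ M P ≫ (α_ _ _ _).inv := by
  have h1 := frob₂ m δ hf N M P
  have h2 := io_coassoc δ hc N P M
  have h3 := pi_assoc m ha M N P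
  have h4 := pi_natural m (β_ M N).hom (𝟙 P)
  have h5 := io_natural δ (𝟙 N) (β_ M P).hom
  rw [tensorHom_id, whiskerLeft_id, tensorHom_id] at h4
  rw [id_tensorHom, whiskerLeft_id, id_tensorHom] at h5
  have h7 : (β_ M (N ⊗ P)).hom =
      (α_ M N P).inv ≫ (β_ M N).hom ▷ P ≫ (α_ N M P).hom ≫ N ◁ (β_ M P).hom ≫
        (α_ N P M).inv := by
    simp
  have h3' : (X ⊗ M) ◁ pi m N P ≫ pi m M (N ⊗ P) ≫ X ◁ (α_ M N P).inv =
      (α_ _ _ _).inv ≫ pi m M N ▷ (X ⊗ P) ≫ pi m (M ⊗ N) P := by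
    rw [Iso.eq_inv_comp, ← reassoc_of% h3, ← MonoidalCategory.whiskerLeft_comp]
    simp
  have h2' : X ◁ (α_ N P M).inv ≫ io δ (N ⊗ P) M ≫ io δ N P ▷ (X ⊗ M) =
      io δ N (P ⊗ M) ≫ (X ⊗ N) ◁ io δ P M ≫ (α_ _ _ _).inv := by
    rw [← cancel_epi (X ◁ (α_ N P M).hom), ← reassoc_of% h2, ← whiskerLeft_comp_assoc]
    simp
  rw [br, h7]
  simp only [br, MonoidalCategory.whiskerLeft_comp, comp_whiskerRight, Category.assoc]
  rw [reassoc_of% h1, h2', reassoc_of% h3', ← reassoc_of% h4, ← reassoc_of% h5]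

end FrobeniusFunctor

namespace WeakHopf

open Coalgebra HopfAlgebra HopfConv QuasiTriangular

section laws
variable {k H A : Type u} [Field k] [CharZero k] [Ring H] [HopfAlgebra k H] [IsSemisimpleRing H]
  [Ring A] [Algebra k A] (Q : QuasiTriangular k H) (T : ModuleAlgebra k H A)
  (s : SymmSepIdempotent k A)

/-- `A ⊗ f` -/
abbrev lA {M N : FDMod k H} (f : M ⟶ N) : A ⊗[k] M.carrier →ₗ[k] A ⊗[k] N.carrier :=
  (FDMod.lin f).lTensor A

lemma piLin_ioLin (M N : FDMod k H) (t : A ⊗[k] (M.carrier ⊗[k] N.carrier)) :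
    piLin Q T s M N (ioLin Q T s M N t) = t :=
  LinearMap.congr_fun (congrArg (FDMod.lin (k := k) (B := H)
    (M := tensor (algMod T s) (tensor M N)) (N := tensor (algMod T s) (tensor M N)))
    (FrobeniusFunctor.io_pi (mulHom Q T s) (comulHom Q T s) (comulHom_mulHom Q T s)
      (M : Q.ModCat) (N : Q.ModCat))) t

lemma piLin_natural {M M' N N' : FDMod k H} (f : M ⟶ M') (g : N ⟶ N')
    (t : (A ⊗[k] M.carrier) ⊗[k] (A ⊗[k] N.carrier)) :
    piLin Q T s M' N' (TensorProduct.map (lA f) (lA g) t) =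
      (TensorProduct.map (FDMod.lin f) (FDMod.lin g)).lTensor A (piLin Q T s M N t) :=
  LinearMap.congr_fun (congrArg (FDMod.lin (k := k) (B := H)
    (M := tensor (tensor (algMod T s) M) (tensor (algMod T s) N))
    (N := tensor (algMod T s) (tensor M' N')))
    (FrobeniusFunctor.pi_natural (C := Q.ModCat) (mulHom Q T s) f g)) t

lemma ioLin_natural {M M' N N' : FDMod k H} (f : M ⟶ M') (g : N ⟶ N')
    (t : A ⊗[k] (M.carrier ⊗[k] N.carrier)) :
    ioLin Q T s M' N' ((TensorProduct.map (FDMod.lin f) (FDMod.lin g)).lTensor A t) =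
      TensorProduct.map (lA f) (lA g) (ioLin Q T s M N t) :=
  LinearMap.congr_fun (congrArg (FDMod.lin (k := k) (B := H)
    (M := tensor (algMod T s) (tensor M N))
    (N := tensor (tensor (algMod T s) M') (tensor (algMod T s) N')))
    (FrobeniusFunctor.io_natural (C := Q.ModCat) (comulHom Q T s) f g)) t

/-- The associativity isomorphism tensored with `A`. -/
abbrev assocA (A : Type u) [Ring A] [Algebra k A] (M N P : FDMod k H) :
    A ⊗[k] ((M.carrier ⊗[k] N.carrier) ⊗[k] P.carrier) ≃ₗ[k]
      A ⊗[k] (M.carrier ⊗[k] (N.carrier ⊗[k] P.carrier)) :=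
  (TensorProduct.assoc k M.carrier N.carrier P.carrier).lTensor A

lemma piLin_assoc (M N P : FDMod k H)
    (t : ((A ⊗[k] M.carrier) ⊗[k] (A ⊗[k] N.carrier)) ⊗[k] (A ⊗[k] P.carrier)) :
    assocA A M N P (piLin Q T s (tensor M N) P ((piLin Q T s M N).rTensor _ t)) =
      piLin Q T s M (tensor N P) ((piLin Q T s N P).lTensor _ (TensorProduct.assoc k _ _ _ t)) :=
  LinearMap.congr_fun (congrArg (FDMod.lin (k := k) (B := H)
    (M := tensor (tensor (tensor (algMod T s) M) (tensor (algMod T s) N)) (tensor (algMod T s) P))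
    (N := tensor (algMod T s) (tensor M (tensor N P))))
    (FrobeniusFunctor.pi_assoc (C := Q.ModCat) (mulHom Q T s) (mulHom_assoc Q T s) M N P)) t

lemma ioLin_coassoc (M N P : FDMod k H)
    (t : A ⊗[k] ((M.carrier ⊗[k] N.carrier) ⊗[k] P.carrier)) :
    TensorProduct.assoc k _ _ _
      ((ioLin Q T s M N).rTensor _ (ioLin Q T s (tensor M N) P t)) =
      (ioLin Q T s N P).lTensor _ (ioLin Q T s M (tensor N P) (assocA A M N P t)) :=
  LinearMap.congr_fun (congrArg (FDMod.lin (k := k) (B := H)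
    (M := tensor (algMod T s) (tensor (tensor M N) P))
    (N := tensor (tensor (algMod T s) M) (tensor (tensor (algMod T s) N) (tensor (algMod T s) P))))
    (FrobeniusFunctor.io_coassoc (C := Q.ModCat) (comulHom Q T s) (comulHom_coassoc Q T s) M N P)) t

lemma piLin_ioLin_right (M N P : FDMod k H)
    (t : (A ⊗[k] M.carrier) ⊗[k] (A ⊗[k] (N.carrier ⊗[k] P.carrier))) :
    (piLin Q T s M N).rTensor _ ((TensorProduct.assoc k _ _ _).symm
      ((ioLin Q T s N P).lTensor _ t)) =
      ioLin Q T s (tensor M N) P ((assocA A M N P).symm (piLin Q T s M (tensor N P) t)) :=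
  LinearMap.congr_fun (congrArg (FDMod.lin (k := k) (B := H)
    (M := tensor (tensor (algMod T s) M) (tensor (algMod T s) (tensor N P)))
    (N := tensor (tensor (algMod T s) (tensor M N)) (tensor (algMod T s) P)))
    (FrobeniusFunctor.frob₁ (C := Q.ModCat) (mulHom Q T s) (comulHom Q T s)
      (mulHom_comulHom_right Q T s) M N P)) t

lemma piLin_ioLin_left (M N P : FDMod k H)
    (t : (A ⊗[k] (M.carrier ⊗[k] N.carrier)) ⊗[k] (A ⊗[k] P.carrier)) :
    (piLin Q T s N P).lTensor _ (TensorProduct.assoc k _ _ _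
      ((ioLin Q T s M N).rTensor _ t)) =
      ioLin Q T s M (tensor N P) (assocA A M N P (piLin Q T s (tensor M N) P t)) :=
  LinearMap.congr_fun (congrArg (FDMod.lin (k := k) (B := H)
    (M := tensor (tensor (algMod T s) (tensor M N)) (tensor (algMod T s) P))
    (N := tensor (tensor (algMod T s) M) (tensor (algMod T s) (tensor N P))))
    (FrobeniusFunctor.frob₂ (C := Q.ModCat) (mulHom Q T s) (comulHom Q T s)
      (mulHom_comulHom_left Q T s) M N P)) t

/-- The braiding of `M` and `N`, transported to `A ⊗ M` and `A ⊗ N` along `π` and `ι`. -/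
def brLin (M N : FDMod k H) : (A ⊗[k] M.carrier) ⊗[k] (A ⊗[k] N.carrier) →ₗ[k]
    (A ⊗[k] N.carrier) ⊗[k] (A ⊗[k] M.carrier) :=
  ioLin Q T s N M ∘ₗ (flipAct M.ρ N.ρ Q.R).lTensor A ∘ₗ piLin Q T s M N

lemma brLin_tensor_left (M N P : FDMod k H)
    (t : ((A ⊗[k] M.carrier) ⊗[k] (A ⊗[k] N.carrier)) ⊗[k] (A ⊗[k] P.carrier)) :
    (ioLin Q T s M N).lTensor _ (brLin Q T s (tensor M N) P ((piLin Q T s M N).rTensor _ t)) =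
      TensorProduct.assoc k _ _ _ ((brLin Q T s M P).rTensor _
        ((TensorProduct.assoc k _ _ _).symm ((brLin Q T s N P).lTensor _
          (TensorProduct.assoc k _ _ _ t)))) :=
  LinearMap.congr_fun (congrArg (FDMod.lin (k := k) (B := H)
    (M := tensor (tensor (tensor (algMod T s) M) (tensor (algMod T s) N)) (tensor (algMod T s) P))
    (N := tensor (tensor (algMod T s) P) (tensor (tensor (algMod T s) M) (tensor (algMod T s) N))))
    (FrobeniusFunctor.br_tensor_left (C := Q.ModCat) (mulHom Q T s) (comulHom Q T s)
      (mulHom_assoc Q T s) (comulHom_coassoc Q T s) (mulHom_comulHom_right Q T s) M N P)) t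

lemma brLin_tensor_right (M N P : FDMod k H)
    (t : (A ⊗[k] M.carrier) ⊗[k] ((A ⊗[k] N.carrier) ⊗[k] (A ⊗[k] P.carrier))) :
    (ioLin Q T s N P).rTensor _ (brLin Q T s M (tensor N P) ((piLin Q T s N P).lTensor _ t)) =
      (TensorProduct.assoc k _ _ _).symm ((brLin Q T s M P).lTensor _
        (TensorProduct.assoc k _ _ _ ((brLin Q T s M N).rTensor _
          ((TensorProduct.assoc k _ _ _).symm t)))) :=
  LinearMap.congr_fun (congrArg (FDMod.lin (k := k) (B := H)
    (M := tensor (tensor (algMod T s) M) (tensor (tensor (algMod T s) N) (tensor (algMod T s) P)))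
    (N := tensor (tensor (tensor (algMod T s) N) (tensor (algMod T s) P)) (tensor (algMod T s) M)))
    (FrobeniusFunctor.br_tensor_right (C := Q.ModCat) (mulHom Q T s) (comulHom Q T s)
      (mulHom_assoc Q T s) (comulHom_coassoc Q T s) (mulHom_comulHom_left Q T s) M N P)) t

end laws
end WeakHopf

/-! ### The structure maps of `B` -/

namespace WeakHopf

open Coalgebra HopfAlgebra HopfConv QuasiTriangular

section sums
variable {k : Type u} [Field k] {M N P : Type u} [AddCommGroup M] [Module k M]
  [AddCommGroup N] [Module k N] [AddCommGroup P] [Module k P]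

lemma sw_sum {ι : Type*} (I : Finset ι) (u : ι → M) (v : ι → N) (f : M →ₗ[k] N →ₗ[k] P) :
    sw (∑ i ∈ I, u i ⊗ₜ[k] v i) (fun m n => f m n) = ∑ i ∈ I, f (u i) (v i) := by
  rw [sw_eq_lift]; simp

end sums

section faithful
variable {k B C M N : Type u} [Field k] [Ring B] [Algebra k B] [Ring C] [Algebra k C]
  [AddCommGroup M] [Module k M] [AddCommGroup N] [Module k N]
  [Module.Finite k M] [Module.Finite k N]

/-- Faithful finite-dimensional representations have a faithful tensor product. -/
lemma pairRep_injective {ρ : B →ₐ[k] Module.End k M} {σ : C →ₐ[k] Module.End k N}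
    (hρ : Function.Injective ρ) (hσ : Function.Injective σ) :
    Function.Injective (pairRep ρ σ) := by
  have h1 : Function.Injective (TensorProduct.map ρ.toLinearMap σ.toLinearMap) :=
    TensorProduct.map_injective_of_flat_flat _ _ hρ hσ
  have h2 : Function.Injective (TensorProduct.homTensorHomMap (RingHom.id k) M N M N) := by
    have h3 : TensorProduct.homTensorHomMap (RingHom.id k) M N M N =
        (homTensorHomEquiv k M N M N).toLinearMap := by
      ext; simp
    rw [h3]
    exact (homTensorHomEquiv k M N M N).injective
  intro z w hzw
  exact h1 (h2 hzw)

end faithful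

section module
variable {k H A : Type u} [Field k] [Ring H] [HopfAlgebra k H] [Ring A] [Algebra k A]
  (s : SymmSepIdempotent k A)

/-- The identification `A ⊗ M ≃ A* ⊗ M` induced by `A ≃ A*`. -/
def dualTensorEquiv (M : FDMod k H) :
    A ⊗[k] M.carrier ≃ₗ[k] Module.Dual k A ⊗[k] M.carrier := s.toDual.rTensor M.carrier

@[simp] lemma dualTensorEquiv_tmul (M : FDMod k H) (a : A) (m : M.carrier) :
    dualTensorEquiv s M (a ⊗ₜ m) = s.toDual a ⊗ₜ m := rfl

/-- The action of `B` on `A ⊗ M`, transported from `A* ⊗ M`. -/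
def algAct (M : FDMod k H) : BAlg H s →ₐ[k] Module.End k (A ⊗[k] M.carrier) :=
  (((dualTensorEquiv s M).symm.conjAlgEquiv k).toAlgHom).comp (BAlg.dualTensor s M).ρ

/-- The `B`-module `A* ⊗ M`, with underlying space `A ⊗ M`. -/
abbrev algTensor (M : FDMod k H) : FDMod k (BAlg H s) where
  carrier := A ⊗[k] M.carrier
  fin := by
    have := s.finite
    infer_instance
  ρ := algAct s M

lemma algAct_apply (M : FDMod k H) (b : BAlg H s) (t : A ⊗[k] M.carrier) : algAct s M b t =
      (dualTensorEquiv s M).symm ((BAlg.dualTensor s M).ρ b (dualTensorEquiv s M t)) := rfl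

lemma algAct_tri (M : FDMod k H) (a b c : A) (h : H) (m : M.carrier) :
    algAct s M (BAlg.tri s a h (s.toDual c)) (b ⊗ₜ m) =
      s.α (b * a) • (c ⊗ₜ[k] M.ρ h m) := by
  rw [algAct_apply, dualTensorEquiv_tmul, BAlg.dualTensor_ρ_tri, LinearEquiv.symm_apply_eq,
    map_smul, dualTensorEquiv_tmul, s.toDual_apply, s.α_mul_comm]

/-- Induction on elements of `B`, in terms of `A ≃ A*`. -/
lemma BAlg.induction_toDual {p : BAlg H s → Prop} (b : BAlg H s) (h0 : p 0)
    (ha : ∀ b c, p b → p c → p (b + c)) (ht : ∀ a h c, p (tri s a h (s.toDual c))) : p b := by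
  refine BAlg.induction_tri b h0 ha fun a h φ => ?_
  obtain ⟨c, rfl⟩ := s.toDual.surjective φ
  exact ht a h c

/-- The action of `B` on `A ⊗ M` is natural in `M`. -/
lemma algAct_natural {M N : FDMod k H} (f : M ⟶ N) (b : BAlg H s) (t : A ⊗[k] M.carrier) :
    (FDMod.lin f).lTensor A (algAct s M b t) =
      algAct s N b ((FDMod.lin f).lTensor A t) := by
  induction b using BAlg.induction_toDual with
  | h0 => simp
  | ha b b' hb hb' => simp only [map_add, LinearMap.add_apply, hb, hb']
  | ht a h c =>
  induction t with
  | zero => simp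
  | add z w hz hw => simp only [map_add, hz, hw]
  | tmul d m =>
    rw [algAct_tri, LinearMap.lTensor_tmul, algAct_tri, map_smul, LinearMap.lTensor_tmul,
      FDMod.lin_ρ]

/-- The action on `A ⊗ M` is faithful if `h ↦ h m` is injective for some vector `m`: the element `b`
is recovered from the vectors `b (x² ⊗ m)`. -/
lemma algAct_injective (M : FDMod k H) (m : M.carrier)
    (hm : Function.Injective fun h => M.ρ h m) : Function.Injective (algAct s M) := by
  let e : H →ₗ[k] M.carrier := (LinearMap.applyₗ m) ∘ₗ M.ρ.toLinearMap
  let F : (A ⊗[k] (H ⊗[k] Module.Dual k A)) →ₗ[k] A ⊗[k] (A ⊗[k] M.carrier) :=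
    (TensorProduct.map s.toDual.symm.toLinearMap e ∘ₗ
      (TensorProduct.comm k H (Module.Dual k A)).toLinearMap).lTensor A
  have hF : Function.Injective F := by
    refine Module.Flat.lTensor_preserves_injective_linearMap _ ?_
    exact (TensorProduct.map_injective_of_flat_flat s.toDual.symm.toLinearMap e
      s.toDual.symm.injective hm).comp (TensorProduct.comm k H (Module.Dual k A)).injective
  have key : ∀ b : BAlg H s, F b = ∑ p ∈ reps s.x,
      p.1 ⊗ₜ[k] algAct s M b (p.2 ⊗ₜ m) := by
    intro b
    induction b using BAlg.induction_toDual with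
    | h0 => exact (map_zero F).trans (by simp)
    | ha b b' hb hb' =>
      refine (map_add F b b').trans ?_
      simp only [map_add, LinearMap.add_apply, TensorProduct.tmul_add, Finset.sum_add_distrib]
      exact congrArg₂ (· + ·) hb hb'
    | ht a h c =>
      refine Eq.trans (b := a ⊗ₜ[k] (s.toDual.symm (s.toDual c) ⊗ₜ[k] M.ρ h m)) rfl ?_
      rw [LinearEquiv.symm_apply_apply]
      conv_lhs => rw [← s.sum_α_mul_snd a]
      simp only [algAct_tri, TensorProduct.sum_tmul, TensorProduct.tmul_smul,
        ← TensorProduct.smul_tmul', s.α_mul_comm a]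
  intro b c hbc
  refine hF ?_
  rw [key, key, hbc]

end module

namespace BAlg
variable {k H A : Type u} [Field k] [Ring H] [HopfAlgebra k H]
  [Ring A] [Algebra k A] (Q : QuasiTriangular k H) (T : ModuleAlgebra k H A)
  (s : SymmSepIdempotent k A)

/-- The coproduct of `A*` as a linear map. -/
def comulDualLin : Module.Dual k A →ₗ[k] Module.Dual k A ⊗[k] Module.Dual k A :=
  have := s.finite
  (TensorProduct.dualDistribEquiv k A A).symm.toLinearMap ∘ₗ (LinearMap.mul' k A).dualMap

/-- The map `a ⊗ (h₁ ⊗ h₂) ⊗ (φ₁ ⊗ φ₂) ↦ (a ⊗ h₁ ⊗ φ₂) ⊗ (v ⊗ h₂ ⊗ φ₁)`. -/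
def shuffle (v : A) : A ⊗[k] ((H ⊗[k] H) ⊗[k] (Module.Dual k A ⊗[k] Module.Dual k A)) →ₗ[k]
    BAlg H s ⊗[k] BAlg H s :=
  (TensorProduct.map LinearMap.id (TensorProduct.mk k A (H ⊗[k] Module.Dual k A) v) ∘ₗ
    (TensorProduct.assoc k A (H ⊗[k] Module.Dual k A) (H ⊗[k] Module.Dual k A)).symm.toLinearMap ∘ₗ
    ((TensorProduct.tensorTensorTensorComm k H H (Module.Dual k A) (Module.Dual k A)).toLinearMap ∘ₗ
      (TensorProduct.comm k (Module.Dual k A) (Module.Dual k A)).toLinearMap.lTensor _).lTensor A :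
    A ⊗[k] ((H ⊗[k] H) ⊗[k] (Module.Dual k A ⊗[k] Module.Dual k A)) →ₗ[k]
      (A ⊗[k] (H ⊗[k] Module.Dual k A)) ⊗[k] (A ⊗[k] (H ⊗[k] Module.Dual k A)))

lemma shuffle_tmul (v a : A) (h₁ h₂ : H) (φ₁ φ₂ : Module.Dual k A) :
    shuffle s v (a ⊗ₜ ((h₁ ⊗ₜ h₂) ⊗ₜ (φ₁ ⊗ₜ φ₂))) = tri s a h₁ φ₂ ⊗ₜ[k] tri s v h₂ φ₁ := rfl

/-- The coproduct of `B`. -/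
def comulB : BAlg H s →ₗ[k] BAlg H s ⊗[k] BAlg H s :=
  ∑ p ∈ reps Q.R, ∑ q ∈ reps Q.R, ∑ x ∈ reps s.x, shuffle s x.2 ∘ₗ
    (TensorProduct.map (LinearMap.mulLeft k (T.act p.2 x.1))
      (TensorProduct.map ((LinearMap.mulLeft k q.1 ∘ₗ LinearMap.mulRight k p.1).rTensor H ∘ₗ comul)
        ((T.act q.2).dualMap.rTensor (Module.Dual k A) ∘ₗ comulDualLin s)) :
      A ⊗[k] (H ⊗[k] Module.Dual k A) →ₗ[k]
        A ⊗[k] ((H ⊗[k] H) ⊗[k] (Module.Dual k A ⊗[k] Module.Dual k A)))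

/-- The coproduct of `a ⊗ h ⊗ φ`, for arbitrary representatives of `Δ(h)` and of `Δ(φ)`. -/
lemma comulB_tri_aux {ι κ : Type*} (I : Finset ι) (J : Finset κ) (u v : ι → H)
    (f g : κ → Module.Dual k A) (a : A) (h : H) (φ : Module.Dual k A)
    (hh : ∑ i ∈ I, u i ⊗ₜ[k] v i = comul (R := k) h)
    (hφ : ∑ j ∈ J, f j ⊗ₜ[k] g j = s.comulDual φ) :
    comulB Q T s (tri s a h φ) = ∑ p ∈ reps Q.R, ∑ q ∈ reps Q.R, ∑ x ∈ reps s.x, ∑ i ∈ I,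
      ∑ j ∈ J, tri s (T.act p.2 x.1 * a) (q.1 * u i * p.1) (g j) ⊗ₜ[k]
        tri s x.2 (v i) (T.transp (f j) q.2) := by
  simp only [comulB, LinearMap.sum_apply]
  refine Finset.sum_congr rfl fun p _ => Finset.sum_congr rfl fun q _ =>
    Finset.sum_congr rfl fun x _ => ?_
  refine Eq.trans (b := shuffle s x.2 ((T.act p.2 x.1 * a) ⊗ₜ
    (((LinearMap.mulLeft k q.1 ∘ₗ LinearMap.mulRight k p.1).rTensor H (comul (R := k) h)) ⊗ₜ
      ((T.act q.2).dualMap.rTensor (Module.Dual k A) (s.comulDual φ))))) rfl ?_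
  rw [← hh, ← hφ]
  simp only [map_sum, TensorProduct.sum_tmul, TensorProduct.tmul_sum, LinearMap.rTensor_tmul,
    shuffle_tmul, LinearMap.comp_apply, LinearMap.mulLeft_apply, LinearMap.mulRight_apply,
    mul_assoc]
  rw [Finset.sum_comm]
  rfl

lemma comulB_tri (a : A) (h : H) (φ : Module.Dual k A) : comulB Q T s (tri s a h φ) =
    sw Q.R fun R₁₁ R₁₂ => sw Q.R fun R₂₁ R₂₂ => sw s.x fun x₁ x₂ =>
      sw (comul (R := k) h) fun h₁ h₂ => sw (s.comulDual φ) fun φ₁ φ₂ =>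
        tri s (T.act R₁₂ x₁ * a) (R₂₁ * h₁ * R₁₁) φ₂ ⊗ₜ[k] tri s x₂ h₂ (T.transp φ₁ R₂₂) :=
  comulB_tri_aux Q T s (reps _) (reps _) Prod.fst Prod.snd Prod.fst Prod.snd a h φ
    (sum_reps _) (sum_reps _)

/-- The counit of `B`. -/
def counitB : BAlg H s →ₗ[k] k :=
  (LinearMap.mul' k k ∘ₗ TensorProduct.map s.α (LinearMap.mul' k k ∘ₗ
    TensorProduct.map (counit (R := k)) (Module.Dual.eval k A 1)) :
    A ⊗[k] (H ⊗[k] Module.Dual k A) →ₗ[k] k)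

lemma counitB_tri (a : A) (h : H) (φ : Module.Dual k A) :
    counitB s (tri s a h φ) = s.α a * counit (R := k) h * φ 1 := by
  rw [mul_assoc]; rfl

/-- The map `a ⊗ h ⊗ φ ↦ φ(u) v ⊗ r S(r' h) ⊗ (α ↼ g a)`. -/
def antipodeTerm (g r r' : H) (u v : A) : BAlg H s →ₗ[k] BAlg H s :=
  (TensorProduct.mk k A (H ⊗[k] Module.Dual k A) v ∘ₗ
    (TensorProduct.comm k (Module.Dual k A) H).toLinearMap ∘ₗ
    TensorProduct.map ((LinearMap.mul k A).compr₂ s.α ∘ₗ T.act g)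
      ((TensorProduct.rid k H).toLinearMap ∘ₗ TensorProduct.map
        (LinearMap.mulLeft k r ∘ₗ antipode k ∘ₗ LinearMap.mulLeft k r')
        (Module.Dual.eval k A u)) :
    A ⊗[k] (H ⊗[k] Module.Dual k A) →ₗ[k] A ⊗[k] (H ⊗[k] Module.Dual k A))

lemma antipodeTerm_tri (g r r' : H) (u v a : A) (h : H) (φ : Module.Dual k A) :
    antipodeTerm T s g r r' u v (tri s a h φ) =
      φ u • tri s v (r * antipode k (r' * h)) (rharp s.α (T.act g a)) := by
  refine Eq.trans (b := (v ⊗ₜ[k] ((φ u • (r * antipode k (r' * h))) ⊗ₜ[k]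
    (rharp s.α (T.act g a))) : A ⊗[k] (H ⊗[k] Module.Dual k A))) rfl ?_
  rw [← TensorProduct.smul_tmul', TensorProduct.tmul_smul]
  rfl

/-- The antipode of `B`. -/
def antipodeB : BAlg H s →ₗ[k] BAlg H s :=
  ∑ p ∈ reps Q.R, ∑ q ∈ reps Q.R, ∑ x ∈ reps s.x,
    antipodeTerm T s p.2 p.1 q.1 (T.act q.2 x.1) x.2

lemma antipodeB_tri (a : A) (h : H) (φ : Module.Dual k A) : antipodeB Q T s (tri s a h φ) =
    sw Q.R fun R₁₁ R₁₂ => sw Q.R fun R₂₁ R₂₂ => sw s.x fun x₁ x₂ =>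
      T.transp φ R₂₂ x₁ • tri s x₂ (R₁₁ * antipode k (R₂₁ * h)) (rharp s.α (T.act R₁₂ a)) := by
  simp only [antipodeB, LinearMap.sum_apply, antipodeTerm_tri]
  rfl

end BAlg

end WeakHopf

/-! ### The action of the coproduct -/

namespace WeakHopf

open Coalgebra HopfAlgebra HopfConv QuasiTriangular

lemma sum_reorder {ι₁ ι₂ ι₃ ι₄ ι₅ P : Type*} [AddCommMonoid P] (I₁ : Finset ι₁) (I₂ : Finset ι₂)
    (I₃ : Finset ι₃) (I₄ : Finset ι₄) (I₅ : Finset ι₅) (f : ι₁ → ι₂ → ι₃ → ι₄ → ι₅ → P) :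
    ∑ a ∈ I₁, ∑ b ∈ I₂, ∑ c ∈ I₃, ∑ d ∈ I₄, ∑ e ∈ I₅, f a b c d e =
      ∑ b ∈ I₂, ∑ e ∈ I₅, ∑ d ∈ I₄, ∑ a ∈ I₁, ∑ c ∈ I₃, f a b c d e := by
  rw [Finset.sum_comm]
  refine Finset.sum_congr rfl fun b _ => ?_
  calc _ = ∑ a ∈ I₁, ∑ c ∈ I₃, ∑ e ∈ I₅, ∑ d ∈ I₄, f a b c d e :=
        Finset.sum_congr rfl fun a _ => Finset.sum_congr rfl fun c _ => Finset.sum_comm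
    _ = ∑ a ∈ I₁, ∑ e ∈ I₅, ∑ d ∈ I₄, ∑ c ∈ I₃, f a b c d e :=
        Finset.sum_congr rfl fun a _ => Finset.sum_comm.trans
          (Finset.sum_congr rfl fun c _ => Finset.sum_comm)
    _ = _ := Finset.sum_comm.trans (Finset.sum_congr rfl fun e _ => Finset.sum_comm)

lemma sum_reverse {ι₁ ι₂ ι₃ ι₄ P : Type*} [AddCommMonoid P] (I₁ : Finset ι₁) (I₂ : Finset ι₂)
    (I₃ : Finset ι₃) (I₄ : Finset ι₄) (f : ι₁ → ι₂ → ι₃ → ι₄ → P) :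
    ∑ a ∈ I₁, ∑ b ∈ I₂, ∑ c ∈ I₃, ∑ d ∈ I₄, f a b c d =
      ∑ d ∈ I₄, ∑ c ∈ I₃, ∑ b ∈ I₂, ∑ a ∈ I₁, f a b c d := by
  calc _ = ∑ a ∈ I₁, ∑ b ∈ I₂, ∑ d ∈ I₄, ∑ c ∈ I₃, f a b c d :=
        Finset.sum_congr rfl fun a _ => Finset.sum_congr rfl fun c _ => Finset.sum_comm
    _ = ∑ a ∈ I₁, ∑ d ∈ I₄, ∑ c ∈ I₃, ∑ b ∈ I₂, f a b c d :=
        Finset.sum_congr rfl fun a _ => Finset.sum_comm.trans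
          (Finset.sum_congr rfl fun c _ => Finset.sum_comm)
    _ = _ := Finset.sum_comm.trans (Finset.sum_congr rfl fun e _ => Finset.sum_comm.trans
          (Finset.sum_congr rfl fun c _ => Finset.sum_comm))

section triLinear
variable {k H A : Type u} [Field k] [Ring H] [HopfAlgebra k H] [Ring A] [Algebra k A]
  (s : SymmSepIdempotent k A)

/-- `a ⊗ h ⊗ φ`, as a trilinear function. -/
def triLin : A →ₗ[k] H →ₗ[k] Module.Dual k A →ₗ[k] BAlg H s :=
  (LinearMap.mk₂ k (fun (a : A) (h : H) =>
    (TensorProduct.mk k A (H ⊗[k] Module.Dual k A) a ∘ₗ TensorProduct.mk k H (Module.Dual k A) h))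
    (fun a b h => by ext; simp)
    (fun r a h => by ext; simp [TensorProduct.smul_tmul'])
    (fun a h g => by ext; simp [TensorProduct.tmul_add])
    (fun r a h => by ext; simp) :
    A →ₗ[k] H →ₗ[k] Module.Dual k A →ₗ[k] A ⊗[k] (H ⊗[k] Module.Dual k A))

end triLinear

section formulas
variable {k H A : Type u} [Field k] [CharZero k] [Ring H] [HopfAlgebra k H] [IsSemisimpleRing H]
  [Ring A] [Algebra k A] (Q : QuasiTriangular k H) (T : ModuleAlgebra k H A)
  (s : SymmSepIdempotent k A)

lemma transp_toDual (e : A) (g : H) :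
    T.transp (s.toDual e) g = s.toDual (T.act (antipode k g) e) := by
  ext u
  exact α_act_mul T s g u e

/-- `S(R¹) ⊗ S(R²) = R¹ ⊗ R²`, in summation form. -/
lemma sum_R_antipode {P : Type u} [AddCommGroup P] [Module k P] (f : H →ₗ[k] H →ₗ[k] P) :
    ∑ q ∈ reps Q.R, f (antipode k q.1) (antipode k q.2) = ∑ q ∈ reps Q.R, f q.1 q.2 := by
  have h := sum_reps_lift Q.R (f.compl₁₂ (antipode k) (antipode k))
  simp only [LinearMap.compl₁₂_apply] at h
  rw [h, sum_reps_lift]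
  conv_rhs => rw [← Q.map_antipode_R]
  generalize Q.R = z
  induction z with
  | zero => simp
  | add z w hz hw => simp only [map_add, hz, hw]
  | tmul a b => simp

/-- `S(R₁¹) R₂¹ ⊗ R₁² R₂² = 1 ⊗ 1`, in summation form. -/
lemma sum_antipode_R_mul_R {P : Type u} [AddCommGroup P] [Module k P] (f : H →ₗ[k] H →ₗ[k] P) :
    ∑ p ∈ reps Q.R, ∑ q ∈ reps Q.R, f (antipode k p.1 * q.1) (p.2 * q.2) = f 1 1 := by
  have h := congrArg (TensorProduct.lift f) Q.rTensor_antipode_R_mul_R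
  conv_lhs at h => rw [← sum_reps Q.R]
  simpa [Finset.sum_mul_sum, map_sum, Algebra.TensorProduct.one_def] using h

/-- The coproduct of `a ⊗ h ⊗ α(- e)`, with the dual leg expressed through the separability
idempotent `y`. -/
lemma comulB_toDual (a : A) (h : H) (e : A) :
    BAlg.comulB Q T s (BAlg.tri s a h (s.toDual e)) =
      ∑ q ∈ reps Q.R, ∑ y ∈ reps s.x, ∑ i ∈ (ℛ k h).index, ∑ p ∈ reps Q.R, ∑ x ∈ reps s.x,
        BAlg.tri s (T.act p.2 x.1 * a) (q.1 * (ℛ k h).left i * p.1) (s.toDual (e * y.1)) ⊗ₜ[k]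
          BAlg.tri s x.2 ((ℛ k h).right i) (s.toDual (T.act (antipode k q.2) y.2)) := by
  rw [BAlg.comulB_tri_aux Q T s _ (reps s.x) _ _ (fun y => s.toDual y.2)
    (fun y => s.toDual (e * y.1)) a h _ (ℛ k h).eq (s.comulDual_toDual e).symm, sum_reorder]
  simp only [transp_toDual]

/-- The coproduct of `B` acts on `(A ⊗ M) ⊗ (A ⊗ N)` through `A ⊗ (M ⊗ N)`: the element `Δ_B(b)` acts
as `ι b π`. -/
theorem pairRep_comulB (M N : FDMod k H) (b : BAlg H s)
    (t : (A ⊗[k] M.carrier) ⊗[k] (A ⊗[k] N.carrier)) :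
    pairRep (algAct s M) (algAct s N) (BAlg.comulB Q T s b) t =
      ioLin Q T s M N (algAct s (tensor M N) b (piLin Q T s M N t)) := by
  induction b using BAlg.induction_toDual with
  | h0 => simp
  | ha b b' hb hb' => simp only [map_add, LinearMap.add_apply, hb, hb']
  | ht a h e =>
  induction t with
  | zero => simp
  | add z w hz hw => simp only [map_add, hz, hw]
  | tmul v w =>
  induction v with
  | zero => simp
  | add z w hz hw => simp only [TensorProduct.add_tmul, map_add, hz, hw]
  | tmul b m =>
  induction w with
  | zero => simp
  | add z w hz hw => simp only [TensorProduct.tmul_add, map_add, hz, hw]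
  | tmul d n =>
    have hx : ∀ g : H, ∑ x ∈ reps s.x, s.α (d * x.2) * s.α (b * (T.act g x.1 * a)) =
        s.α (b * T.act g d * a) := by
      intro g
      have h := congrArg (fun w => s.α (b * (T.act g w * a))) (s.sum_α_mul_snd d)
      simpa only [map_sum, map_smul, Finset.sum_mul, Finset.mul_sum, smul_mul_assoc,
        mul_smul_comm, smul_eq_mul, mul_assoc] using h
    have hρ : ∀ (g : H), (tensor M N).ρ h (M.ρ g m ⊗ₜ n) = ∑ i ∈ (ℛ k h).index,
        M.ρ ((ℛ k h).left i) (M.ρ g m) ⊗ₜ[k] N.ρ ((ℛ k h).right i) n := by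
      intro g
      rw [tensor_ρ]
      conv_lhs => rw [← (ℛ k h).eq]
      simp [map_sum]
    have hr : ∀ p ∈ reps Q.R, ioLin Q T s M N (algAct s (tensor M N)
        (BAlg.tri s a h (s.toDual e)) ((b * T.act p.2 d) ⊗ₜ[k] (M.ρ p.1 m ⊗ₜ[k] n))) =
        ∑ i ∈ (ℛ k h).index, ∑ y ∈ reps s.x, ∑ q ∈ reps Q.R, s.α (b * T.act p.2 d * a) •
          (((e * y.1) ⊗ₜ[k] M.ρ q.1 (M.ρ ((ℛ k h).left i) (M.ρ p.1 m))) ⊗ₜ[k]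
            (T.act (antipode k q.2) y.2 ⊗ₜ[k] N.ρ ((ℛ k h).right i) n)) := by
      intro p _
      rw [algAct_tri, hρ, map_smul, TensorProduct.tmul_sum, map_sum]
      simp only [ioLin_tmul, Finset.smul_sum]
    rw [comulB_toDual, piLin_tmul]
    simp only [map_sum]
    rw [Finset.sum_congr rfl hr, sum_reverse]
    simp only [LinearMap.sum_apply, pairRep_tmul_tmul, algAct_tri, ← TensorProduct.smul_tmul',
      TensorProduct.tmul_smul, smul_smul, ← Finset.sum_smul, hx, map_mul, Module.End.mul_apply]

end formulas

end WeakHopf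

/-! ### The action of the `R`-matrix and of the counit -/

namespace WeakHopf

open Coalgebra HopfAlgebra HopfConv QuasiTriangular

section formulas
variable {k H A : Type u} [Field k] [CharZero k] [Ring H] [HopfAlgebra k H] [IsSemisimpleRing H]
  [Ring A] [Algebra k A] (Q : QuasiTriangular k H) (T : ModuleAlgebra k H A)
  (s : SymmSepIdempotent k A)

/-- The universal `R`-matrix of `B`. -/
def BAlg.RB : BAlg H s ⊗[k] BAlg H s :=
  sw Q.R fun R₁₁ R₁₂ => sw Q.R fun R₂₁ R₂₂ => sw Q.R fun R₃₁ R₃₂ =>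
    sw s.x fun x₁₁ x₁₂ => sw s.x fun x₂₁ x₂₂ => sw (s.comulDual s.α) fun α₁ α₂ =>
      tri s (T.act R₃₂ x₂₁ * x₁₁) (R₂₁ * R₃₁) (T.transp α₁ R₁₂) ⊗ₜ[k]
        tri s x₂₂ (R₁₁ * R₂₂) (lharp x₁₂ α₂)

/-- The sum over the coproduct of `α` in `R_B`, expressed through the separability idempotent `y`. -/
lemma sw_comulDual_α (a b c : A) (g h l : H) :
    (sw (s.comulDual s.α) fun φ ψ =>
      BAlg.tri s a g (T.transp φ l) ⊗ₜ[k] BAlg.tri s b h (lharp c ψ)) =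
    ∑ y ∈ reps s.x, BAlg.tri s a g (s.toDual (T.act (antipode k l) y.2)) ⊗ₜ[k]
      BAlg.tri s b h (s.toDual (c * y.1)) := by
  let f : Module.Dual k A →ₗ[k] Module.Dual k A →ₗ[k] BAlg H s ⊗[k] BAlg H s :=
    (TensorProduct.mk k (BAlg H s) (BAlg H s)).compl₁₂ (triLin s a g ∘ₗ (T.act l).dualMap)
      (triLin s b h ∘ₗ (LinearMap.mulRight k c).dualMap)
  have h1 := sw_sum (reps s.x) (fun y => s.toDual y.2) (fun y => s.toDual (1 * y.1)) f
  rw [← s.comulDual_toDual, s.toDual_one] at h1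
  refine h1.trans (Finset.sum_congr rfl fun y _ => ?_)
  rw [one_mul, ← transp_toDual, ← s.lharp_toDual]
  rfl

lemma RB_eq : BAlg.RB Q T s =
    ∑ p ∈ reps Q.R, ∑ q ∈ reps Q.R, ∑ r ∈ reps Q.R, ∑ y ∈ reps s.x, ∑ x ∈ reps s.x,
      ∑ z ∈ reps s.x,
        BAlg.tri s (T.act r.2 z.1 * x.1) (q.1 * r.1)
            (s.toDual (T.act (antipode k p.2) y.2)) ⊗ₜ[k]
          BAlg.tri s z.2 (p.1 * q.2) (s.toDual (x.2 * y.1)) := by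
  rw [BAlg.RB]
  simp only [sw_comulDual_α]
  refine Finset.sum_congr rfl fun p _ => Finset.sum_congr rfl fun q _ =>
    Finset.sum_congr rfl fun r _ => ?_
  exact (Finset.sum_congr rfl fun x _ => Finset.sum_comm).trans Finset.sum_comm

/-- The `R`-matrix of `B` acts by the transported braiding: followed by the flip, it is `ι σ π` for
the braiding `σ` of `M` and `N`. -/
theorem flipAct_RB (M N : FDMod k H) (t : (A ⊗[k] M.carrier) ⊗[k] (A ⊗[k] N.carrier)) :
    flipAct (algAct s M) (algAct s N) (BAlg.RB Q T s) t = brLin Q T s M N t := by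
  induction t with
  | zero => simp
  | add z w hz hw => simp only [map_add, hz, hw]
  | tmul v w =>
  induction v with
  | zero => simp
  | add z w hz hw => simp only [TensorProduct.add_tmul, map_add, hz, hw]
  | tmul b m =>
  induction w with
  | zero => simp
  | add z w hz hw => simp only [TensorProduct.tmul_add, map_add, hz, hw]
  | tmul d n =>
    have hx : ∀ (g : H) (y : A) (u : N.carrier), ∑ x ∈ reps s.x, ∑ z ∈ reps s.x,
        (s.α (b * (T.act g z.1 * x.1)) * s.α (d * z.2)) • ((x.2 * y) ⊗ₜ[k] u) =
        (b * T.act g d * y) ⊗ₜ[k] u := by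
      intro g y u
      have h1 : ∀ x : A, ∑ z ∈ reps s.x, s.α (b * (T.act g z.1 * x)) * s.α (d * z.2) =
          s.α (b * T.act g d * x) := by
        intro x
        have h := congrArg (fun w => s.α (b * (T.act g w * x))) (s.sum_α_mul_snd d)
        simpa only [map_sum, map_smul, Finset.sum_mul, Finset.mul_sum, smul_mul_assoc,
          mul_smul_comm, smul_eq_mul, mul_assoc, mul_comm] using h
      simp only [← Finset.sum_smul, h1]
      conv_rhs => rw [← s.sum_α_mul (b * T.act g d)]
      simp only [Finset.sum_mul, TensorProduct.sum_tmul, smul_mul_assoc, TensorProduct.smul_tmul']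
    have hr : ∀ r ∈ reps Q.R, ioLin Q T s N M ((flipAct M.ρ N.ρ Q.R).lTensor A
        ((b * T.act r.2 d) ⊗ₜ[k] (M.ρ r.1 m ⊗ₜ[k] n))) =
        ∑ q ∈ reps Q.R, ∑ y ∈ reps s.x, ∑ p ∈ reps Q.R,
          (((b * T.act r.2 d) * y.1) ⊗ₜ[k] N.ρ p.1 (N.ρ q.2 n)) ⊗ₜ[k]
            (T.act (antipode k p.2) y.2 ⊗ₜ[k] M.ρ q.1 (M.ρ r.1 m)) := by
      intro r _
      have h : flipAct M.ρ N.ρ Q.R (M.ρ r.1 m ⊗ₜ n) =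
          ∑ q ∈ reps Q.R, N.ρ q.2 n ⊗ₜ[k] M.ρ q.1 (M.ρ r.1 m) := by
        rw [flipAct_apply]
        conv_lhs => rw [← sum_reps Q.R]
        simp [map_sum]
      rw [LinearMap.lTensor_tmul, h, TensorProduct.tmul_sum, map_sum]
      simp only [ioLin_tmul]
    rw [brLin, LinearMap.comp_apply, LinearMap.comp_apply, piLin_tmul, map_sum, map_sum,
      Finset.sum_congr rfl hr, sum_reverse, RB_eq, flipAct_apply]
    simp only [map_sum, LinearMap.sum_apply, pairRep_tmul_tmul, algAct_tri, ← TensorProduct.smul_tmul',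
      TensorProduct.tmul_smul, smul_smul, map_smul, TensorProduct.comm_tmul, map_mul,
      Module.End.mul_apply]
    refine Finset.sum_congr rfl fun p _ => ?_
    refine Eq.trans ?_ (Eq.trans (Finset.sum_congr rfl fun q _ => Finset.sum_comm)
      Finset.sum_comm)
    refine Finset.sum_congr rfl fun q _ => Finset.sum_congr rfl fun r _ =>
      Finset.sum_congr rfl fun y _ => ?_
    rw [← hx]
    simp only [TensorProduct.sum_tmul, TensorProduct.smul_tmul', mul_comm]

end formulas

section units
variable {k H A : Type u} [Field k] [CharZero k] [Ring H] [HopfAlgebra k H] [IsSemisimpleRing H]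
  [Ring A] [Algebra k A] (Q : QuasiTriangular k H) (T : ModuleAlgebra k H A)
  (s : SymmSepIdempotent k A)

lemma sum_counit_fst {P : Type u} [AddCommGroup P] [Module k P] (f : H →ₗ[k] P) :
    ∑ p ∈ reps Q.R, counit (R := k) p.1 • f p.2 = f 1 := by
  rw [← Q.counit_rTensor_R]
  conv_rhs => rw [← sum_reps Q.R]
  simp

lemma sum_counit_snd {P : Type u} [AddCommGroup P] [Module k P] (f : H →ₗ[k] P) :
    ∑ p ∈ reps Q.R, counit (R := k) p.2 • f p.1 = f 1 := by
  rw [← Q.counit_lTensor_R]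
  conv_rhs => rw [← sum_reps Q.R]
  simp

/-- The functional `c ⊗ r ↦ α(c) r` on `A ⊗ k`. -/
def epsA : A ⊗[k] k →ₗ[k] k := (TensorProduct.rid k k).toLinearMap ∘ₗ s.α.rTensor k

@[simp] lemma epsA_tmul (c : A) (r : k) : epsA s (c ⊗ₜ r) = r * s.α c := rfl

/-- `ε_B(b)` is `α` of the value of `b` at the generator `1 ⊗ 1` of `A ⊗ k`. -/
lemma counitB_eq (b : BAlg H s) :
    BAlg.counitB s b = epsA s (algAct s (QuasiTriangular.unit k H) b (1 ⊗ₜ (1 : k))) := by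
  induction b using BAlg.induction_toDual with
  | h0 => simp
  | ha b b' hb hb' => simp only [map_add, LinearMap.add_apply, hb, hb']
  | ht a h e =>
    rw [BAlg.counitB_tri, algAct_tri, map_smul, epsA_tmul, unit_ρ, s.toDual_apply]
    simp [mul_assoc]

/-- The generator `1 ⊗ 1` of `A ⊗ k` is a left unit for `π`. -/
lemma piLin_one_left (N : FDMod k H) (v : A ⊗[k] N.carrier) :
    (TensorProduct.lid k N.carrier).toLinearMap.lTensor A
      (piLin Q T s (QuasiTriangular.unit k H) N ((1 ⊗ₜ (1 : k)) ⊗ₜ v)) = v := by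
  induction v with
  | zero => simp
  | add z w hz hw => simp only [TensorProduct.tmul_add, map_add, hz, hw]
  | tmul d n =>
    refine Eq.trans (congrArg _ (piLin_tmul Q T s (QuasiTriangular.unit k H) N 1 d 1 n)) ?_
    have h := sum_counit_fst Q ((TensorProduct.mk k A N.carrier).flip n ∘ₗ
      T.act.toLinearMap.flip d)
    simp only [LinearMap.comp_apply, LinearMap.flip_apply, AlgHom.toLinearMap_apply, map_one,
      TensorProduct.mk_apply, Module.End.one_apply] at h
    conv_rhs => rw [← h]
    rw [map_sum]
    refine Finset.sum_congr rfl fun p _ => ?_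
    rw [LinearMap.lTensor_tmul, LinearEquiv.coe_coe, TensorProduct.lid_tmul, unit_ρ, mul_one,
      one_mul, TensorProduct.tmul_smul]

/-- The generator `1 ⊗ 1` of `A ⊗ k` is a right unit for `π`. -/
lemma piLin_one_right (M : FDMod k H) (v : A ⊗[k] M.carrier) :
    (TensorProduct.rid k M.carrier).toLinearMap.lTensor A
      (piLin Q T s M (QuasiTriangular.unit k H) (v ⊗ₜ (1 ⊗ₜ (1 : k)))) = v := by
  induction v with
  | zero => simp
  | add z w hz hw => simp only [TensorProduct.add_tmul, map_add, hz, hw]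
  | tmul d m =>
    refine Eq.trans (congrArg _ (piLin_tmul Q T s M (QuasiTriangular.unit k H) d 1 m 1)) ?_
    have h := sum_counit_snd Q (TensorProduct.mk k A M.carrier d ∘ₗ M.ρ.toLinearMap.flip m)
    simp only [LinearMap.comp_apply, LinearMap.flip_apply, AlgHom.toLinearMap_apply, map_one,
      TensorProduct.mk_apply, Module.End.one_apply] at h
    conv_rhs => rw [← h]
    rw [map_sum]
    refine Finset.sum_congr rfl fun p _ => ?_
    rw [LinearMap.lTensor_tmul, LinearEquiv.coe_coe, TensorProduct.rid_tmul, one_smul, T.act_one,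
      mul_smul_comm, mul_one, TensorProduct.smul_tmul']

/-- The functional `α ⊗ id` on `A ⊗ k` is a left counit for `ι`. -/
lemma epsA_ioLin_left (N : FDMod k H)
    (w : A ⊗[k] ((QuasiTriangular.unit k H).carrier ⊗[k] N.carrier)) :
    TensorProduct.lid k _ ((epsA s).rTensor _ (ioLin Q T s (QuasiTriangular.unit k H) N w)) =
      (TensorProduct.lid k N.carrier).toLinearMap.lTensor A w := by
  induction w with
  | zero => simp
  | add z w hz hw => simp only [map_add, hz, hw]
  | tmul c v =>
  induction v with
  | zero => simp
  | add z w hz hw => simp only [TensorProduct.tmul_add, map_add, hz, hw]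
  | tmul r n =>
    have h : ∀ y : A, ∑ p ∈ reps Q.R, counit (R := k) p.1 •
        (T.act (antipode k p.2) y ⊗ₜ[k] n) = y ⊗ₜ n := by
      intro y
      have := sum_counit_fst Q ((TensorProduct.mk k A N.carrier).flip n ∘ₗ
        T.act.toLinearMap.flip y ∘ₗ antipode k)
      simpa using this
    rw [ioLin_tmul]
    simp only [map_sum, LinearMap.rTensor_tmul, TensorProduct.lid_tmul, LinearMap.lTensor_tmul,
      LinearEquiv.coe_coe]
    conv_rhs => rw [← s.sum_α_mul c]
    rw [TensorProduct.sum_tmul]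
    refine Finset.sum_congr rfl fun y _ => ?_
    have h2 : ∀ p ∈ reps Q.R, epsA s ((c * y.1) ⊗ₜ[k] (QuasiTriangular.unit k H).ρ p.1 r) •
        (T.act (antipode k p.2) y.2 ⊗ₜ[k] n) = (s.α (c * y.1) * r) • counit (R := k) p.1 •
        (T.act (antipode k p.2) y.2 ⊗ₜ[k] n) := by
      intro p _
      rw [unit_ρ, smul_smul]
      congr 1
      change counit (R := k) p.1 * r * _ = _
      ring
    rw [Finset.sum_congr rfl h2, ← Finset.smul_sum, h, mul_smul, TensorProduct.smul_tmul',
      TensorProduct.tmul_smul, TensorProduct.smul_tmul', smul_comm]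
    rfl

/-- The functional `α ⊗ id` on `A ⊗ k` is a right counit for `ι`. -/
lemma epsA_ioLin_right (M : FDMod k H)
    (w : A ⊗[k] (M.carrier ⊗[k] (QuasiTriangular.unit k H).carrier)) :
    TensorProduct.rid k _ ((epsA s).lTensor _ (ioLin Q T s M (QuasiTriangular.unit k H) w)) =
      (TensorProduct.rid k M.carrier).toLinearMap.lTensor A w := by
  induction w with
  | zero => simp
  | add z w hz hw => simp only [map_add, hz, hw]
  | tmul c v =>
  induction v with
  | zero => simp
  | add z w hz hw => simp only [TensorProduct.tmul_add, map_add, hz, hw]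
  | tmul m r =>
    have h : ∀ y : A, ∑ p ∈ reps Q.R, counit (R := k) p.2 • (y ⊗ₜ[k] M.ρ p.1 m) = y ⊗ₜ m := by
      intro y
      have := sum_counit_snd Q (TensorProduct.mk k A M.carrier y ∘ₗ M.ρ.toLinearMap.flip m)
      simpa using this
    have h1 : ∑ y ∈ reps s.x, s.α y.2 • (c * y.1) = c := by
      have h := congrArg (c * ·) (s.sum_α_mul_snd 1)
      simpa [Finset.mul_sum] using h
    rw [ioLin_tmul]
    simp only [map_sum, LinearMap.lTensor_tmul, TensorProduct.rid_tmul, LinearEquiv.coe_coe]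
    conv_rhs => rw [← h1]
    rw [TensorProduct.sum_tmul]
    refine Finset.sum_congr rfl fun y _ => ?_
    have h2 : ∀ p ∈ reps Q.R, epsA s (T.act (antipode k p.2) y.2 ⊗ₜ[k] r) •
        ((c * y.1) ⊗ₜ[k] M.ρ p.1 m) = (r * s.α y.2) • counit (R := k) p.2 •
        ((c * y.1) ⊗ₜ[k] M.ρ p.1 m) := by
      intro p _
      rw [epsA_tmul, α_act, HopfAlgebra.counit_antipode, smul_smul]
      congr 1
      ring
    rw [Finset.sum_congr rfl h2, ← Finset.smul_sum, h, mul_smul, TensorProduct.smul_tmul',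
      TensorProduct.tmul_smul]

end units

end WeakHopf

/-! ### The antipode and the evaluation pairing -/

namespace WeakHopf

open Coalgebra HopfAlgebra HopfConv QuasiTriangular

section antipode
variable {k H A : Type u} [Field k] [CharZero k] [Ring H] [HopfAlgebra k H] [IsSemisimpleRing H]
  [Ring A] [Algebra k A] (Q : QuasiTriangular k H) (T : ModuleAlgebra k H A)
  (s : SymmSepIdempotent k A)

/-- `a ⊗ h ⊗ φ`, as a bilinear function of `a` and `h`. -/
def triLin₂ (φ : Module.Dual k A) : A →ₗ[k] H →ₗ[k] BAlg H s :=
  (triLin s).compr₂ (LinearMap.applyₗ φ)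

lemma triLin₂_apply (a : A) (h : H) (φ : Module.Dual k A) :
    triLin₂ s φ a h = BAlg.tri s a h φ := rfl

/-- `S_B(a ⊗ h ⊗ α(- e)) = (R₂² e) ⊗ R₁¹ S(h) R₂¹ ⊗ α(- (R₁² a))` -/
lemma antipodeB_toDual (a : A) (h : H) (e : A) :
    BAlg.antipodeB Q T s (BAlg.tri s a h (s.toDual e)) =
      ∑ p ∈ reps Q.R, ∑ q ∈ reps Q.R,
        BAlg.tri s (T.act q.2 e) (p.1 * (antipode k h * q.1)) (s.toDual (T.act p.2 a)) := by
  rw [BAlg.antipodeB_tri]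
  refine Finset.sum_congr rfl fun p _ => ?_
  let f : H →ₗ[k] H →ₗ[k] BAlg H s := (triLin₂ s (s.toDual (T.act p.2 a))).flip.compl₁₂
    (LinearMap.mulLeft k p.1 ∘ₗ LinearMap.mulLeft k (antipode k h)) (T.act.toLinearMap.flip e)
  refine Eq.trans (Finset.sum_congr rfl fun q _ => ?_) (sum_R_antipode Q f)
  have h1 : ∀ x : A × A, T.transp (s.toDual e) q.2 x.1 =
      s.α (x.1 * T.act (antipode k q.2) e) := by
    intro x
    rw [transp_toDual, s.toDual_apply]
  have h2 : rharp s.α (T.act p.2 a) = s.toDual (T.act p.2 a) := by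
    rw [← s.toDual_one, s.rharp_toDual, one_mul]
  have h3 := congrArg (fun w => triLin₂ s (s.toDual (T.act p.2 a)) w
    (p.1 * (antipode k h * antipode k q.1))) (s.sum_α_mul' (T.act (antipode k q.2) e))
  simp only [map_sum, map_smul, LinearMap.sum_apply, LinearMap.smul_apply, triLin₂_apply] at h3
  simp only [sw, h1, h2, HopfAlgebra.antipode_mul_antidistrib]
  exact h3

/-- `α((R₁² x¹) a (R₂² x²)) R₁¹ R₂¹ = α(a) 1` -/
lemma sum_α_R_R {P : Type u} [AddCommGroup P] [Module k P] (f : H →ₗ[k] P) (a : A) :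
    ∑ p ∈ reps Q.R, ∑ x ∈ reps s.x, ∑ r ∈ reps Q.R,
      s.α (T.act p.2 x.1 * a * T.act r.2 x.2) • f (p.1 * r.1) = s.α a • f 1 := by
  let ψ : A ⊗[k] A →ₗ[k] k :=
    s.α ∘ₗ TensorProduct.lift ((LinearMap.mul k A ∘ₗ LinearMap.mulRight k a).flip)
  have hψ : ∀ u v, ψ (u ⊗ₜ v) = s.α (v * a * u) := fun u v => rfl
  let θ : H ⊗[k] H →ₗ[k] k :=
    ψ ∘ₗ LinearMap.applyₗ s.x ∘ₗ (pairRep T.act T.act).toLinearMap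
  let Θ : H ⊗[k] (H ⊗[k] H) →ₗ[k] P :=
    (TensorProduct.rid k P).toLinearMap ∘ₗ TensorProduct.map f θ
  have h1 : Θ ((comul (R := k)).lTensor H Q.R) = s.α a • f 1 := by
    have hx : ψ s.x = s.α a := by
      rw [← sum_reps s.x, map_sum]
      have := congrArg (fun w => s.α (a * w)) s.mul_x
      rw [← sum_reps s.x] at this
      simp only [map_sum, LinearMap.mul'_apply, Finset.mul_sum, mul_one] at this
      rw [← this]
      refine Finset.sum_congr rfl fun x _ => ?_
      rw [hψ, mul_assoc, s.α_mul_comm, mul_assoc]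
    have h2 : ∀ z : H ⊗[k] H, Θ ((comul (R := k)).lTensor H z) =
        s.α a • f (TensorProduct.rid k H ((counit (R := k)).lTensor H z)) := by
      intro z
      induction z with
      | zero => simp
      | add z w hz hw => simp only [map_add, smul_add, hz, hw]
      | tmul g h =>
        have : θ (comul (R := k) h) = counit (R := k) h * s.α a := by
          change ψ (pairRep T.act T.act (comul (R := k) h) s.x) = _
          rw [pairRep_x, map_smul, hx, smul_eq_mul]
        simp only [Θ, LinearMap.comp_apply, LinearMap.lTensor_tmul, TensorProduct.map_tmul, this,
          LinearEquiv.coe_coe, TensorProduct.rid_tmul, map_smul]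
        rw [mul_smul, smul_comm]
    rw [h2, counit_lTensor_R]
  -- expanding `(id ⊗ Δ)(R) = R₁₃ R₁₂` gives the left side
  rw [← h1, Q.comul_lTensor_R]
  have h3 : ∀ g u v, Θ (g ⊗ₜ (u ⊗ₜ v)) =
      ∑ x ∈ reps s.x, s.α (T.act v x.1 * a * T.act u x.2) • f g := by
    intro g u v
    have : θ (u ⊗ₜ v) = ∑ x ∈ reps s.x, s.α (T.act v x.1 * a * T.act u x.2) := by
      change ψ (pairRep T.act T.act (u ⊗ₜ v) s.x) = _
      conv_lhs => rw [← s.comm_x, ← sum_reps s.x]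
      simp only [map_sum, TensorProduct.comm_tmul, pairRep_tmul_tmul, hψ]
    simp only [Θ, LinearMap.comp_apply, TensorProduct.map_tmul, LinearEquiv.coe_coe,
      TensorProduct.rid_tmul, this, Finset.sum_smul]
  conv_rhs => rw [← sum_reps Q.R]
  simp only [map_sum, leg13_tmul, leg12_tmul, Finset.sum_mul_sum,
    Algebra.TensorProduct.tmul_mul_tmul, one_mul, mul_one, h3]
  have h4 : ∀ p : H × H, ∑ x ∈ reps s.x, ∑ r ∈ reps Q.R,
      s.α (T.act p.2 x.1 * a * T.act r.2 x.2) • f (p.1 * r.1) =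
      ∑ r ∈ reps Q.R, ∑ x ∈ reps s.x,
        s.α (T.act p.2 x.1 * a * T.act r.2 x.2) • f (p.1 * r.1) := fun p => Finset.sum_comm
  simp only [h4]

/-- `R₁¹ R₂¹ ⊗ R₂² S(R₁²) = 1` -/
lemma sum_R_mul_antipode {P : Type u} [AddCommGroup P] [Module k P] (f : H →ₗ[k] H →ₗ[k] P) :
    ∑ p ∈ reps Q.R, ∑ q ∈ reps Q.R, f (p.1 * q.1) (q.2 * antipode k p.2) = f 1 1 := by
  have h := congrArg (TensorProduct.lift f) Q.contract_leg13_leg12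
  conv_lhs at h => rw [← sum_reps Q.R]
  simp only [map_sum, leg13_tmul, leg12_tmul, Finset.sum_mul_sum, LinearMap.lTensor_tmul,
    Algebra.TensorProduct.tmul_mul_tmul, one_mul, mul_one, LinearMap.comp_apply,
    LinearMap.mul'_apply, TensorProduct.lift.tmul, Algebra.TensorProduct.one_def] at h
  exact h

/-- `b₁ S(b₂)` for `b = a ⊗ h ⊗ φ`, where `φ = α(- e)`. -/
lemma mul_antipodeB_toDual (a : A) (h : H) (e : A) :
    LinearMap.mul' k (BAlg H s) ((BAlg.antipodeB Q T s).lTensor (BAlg H s)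
      (BAlg.comulB Q T s (BAlg.tri s a h (s.toDual e)))) =
      (counit (R := k) h * s.α a) • ∑ y ∈ reps s.x, BAlg.tri s y.2 1 (s.toDual (e * y.1)) := by
  have h1 : ∀ (q : H × H) (y : A × A) (u v : H),
      ∑ p ∈ reps Q.R, ∑ x ∈ reps s.x, ∑ r ∈ reps Q.R, ∑ t ∈ reps Q.R,
        s.α (T.act p.2 x.1 * a * T.act r.2 x.2) •
          BAlg.tri s (T.act t.2 (T.act (antipode k q.2) y.2))
            (q.1 * u * p.1 * (r.1 * (antipode k v * t.1))) (s.toDual (e * y.1)) =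
      s.α a • ∑ t ∈ reps Q.R, BAlg.tri s (T.act t.2 (T.act (antipode k q.2) y.2))
            (q.1 * (u * antipode k v) * t.1) (s.toDual (e * y.1)) := by
    intro q y u v
    let f : H →ₗ[k] BAlg H s := ∑ t ∈ reps Q.R,
      triLin₂ s (s.toDual (e * y.1)) (T.act t.2 (T.act (antipode k q.2) y.2)) ∘ₗ
        LinearMap.mulLeft k (q.1 * u) ∘ₗ LinearMap.mulRight k (antipode k v * t.1)
    have hf : ∀ g, f g = ∑ t ∈ reps Q.R, BAlg.tri s (T.act t.2 (T.act (antipode k q.2) y.2))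
        (q.1 * u * (g * (antipode k v * t.1))) (s.toDual (e * y.1)) := by
      intro g
      simp only [f, LinearMap.sum_apply]
      rfl
    have := sum_α_R_R Q T s f a
    simp only [hf, Finset.smul_sum] at this
    simp only [mul_assoc, one_mul, Finset.smul_sum] at this ⊢
    exact this
  have h2 : ∀ (q : H × H) (y : A × A), ∑ i ∈ (ℛ k h).index, ∑ t ∈ reps Q.R,
      BAlg.tri s (T.act t.2 (T.act (antipode k q.2) y.2))
        (q.1 * ((ℛ k h).left i * antipode k ((ℛ k h).right i)) * t.1) (s.toDual (e * y.1)) =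
      counit (R := k) h • ∑ t ∈ reps Q.R, BAlg.tri s (T.act (t.2 * antipode k q.2) y.2)
        (q.1 * t.1) (s.toDual (e * y.1)) := by
    intro q y
    let f : H →ₗ[k] BAlg H s := ∑ t ∈ reps Q.R,
      triLin₂ s (s.toDual (e * y.1)) (T.act t.2 (T.act (antipode k q.2) y.2)) ∘ₗ
        LinearMap.mulLeft k q.1 ∘ₗ LinearMap.mulRight k t.1
    have hf : ∀ g, f g = ∑ t ∈ reps Q.R, BAlg.tri s (T.act t.2 (T.act (antipode k q.2) y.2))
        (q.1 * g * t.1) (s.toDual (e * y.1)) := by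
      intro g
      simp only [f, LinearMap.sum_apply, mul_assoc]
      rfl
    have := congrArg f (sum_mul_antipode_eq_smul (R := k) (ℛ k h))
    rw [map_sum, map_smul] at this
    simp only [hf] at this
    simp only [this, mul_one, map_mul, Module.End.mul_apply]
  have h3 : ∀ y : A × A, ∑ q ∈ reps Q.R, ∑ t ∈ reps Q.R,
      BAlg.tri s (T.act (t.2 * antipode k q.2) y.2) (q.1 * t.1) (s.toDual (e * y.1)) =
      BAlg.tri s y.2 1 (s.toDual (e * y.1)) := by
    intro y
    have := sum_R_mul_antipode Q ((triLin₂ s (s.toDual (e * y.1))).flip.compl₁₂ LinearMap.id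
      (T.act.toLinearMap.flip y.2))
    simp only [LinearMap.compl₁₂_apply, LinearMap.flip_apply, triLin₂_apply, LinearMap.id_apply,
      AlgHom.toLinearMap_apply, map_one, Module.End.one_apply] at this
    exact this
  rw [comulB_toDual]
  simp only [map_sum, LinearMap.lTensor_tmul, LinearMap.mul'_apply, antipodeB_toDual,
    Finset.mul_sum, BAlg.tri_mul_tri, s.toDual_apply]
  refine Eq.trans (Finset.sum_congr rfl fun q _ => Finset.sum_congr rfl fun y _ =>
    Finset.sum_congr rfl fun i _ => h1 q y ((ℛ k h).left i) ((ℛ k h).right i)) ?_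
  refine Eq.trans (b := ∑ q ∈ reps Q.R, ∑ y ∈ reps s.x, s.α a • counit (R := k) h •
    ∑ t ∈ reps Q.R, BAlg.tri s (T.act (t.2 * antipode k q.2) y.2) (q.1 * t.1)
      (s.toDual (e * y.1))) (Finset.sum_congr rfl fun q _ => Finset.sum_congr rfl fun y _ => ?_) ?_
  · rw [← h2 q y]
    exact Finset.smul_sum.symm
  · rw [Finset.sum_comm, Finset.smul_sum]
    refine Finset.sum_congr rfl fun y _ => ?_
    rw [← h3 y, mul_comm, mul_smul, Finset.smul_sum, Finset.smul_sum]

/-- The action `(h f)(m) = f(S(h) m)` of `H` on the dual of an `H`-module. -/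
def dualAct (M : FDMod k H) : H →ₐ[k] Module.End k (Module.Dual k M.carrier) :=
  AlgHom.ofLinearMap (Module.Dual.transpose ∘ₗ M.ρ.toLinearMap ∘ₗ antipode k)
    (LinearMap.ext fun f => LinearMap.ext fun m => by
      change f (M.ρ (antipode k 1) m) = f m
      rw [HopfAlgebra.antipode_one, map_one, Module.End.one_apply])
    (fun g h => LinearMap.ext fun f => LinearMap.ext fun m => by
      change f (M.ρ (antipode k (g * h)) m) = f (M.ρ (antipode k h) (M.ρ (antipode k g) m))
      rw [HopfAlgebra.antipode_mul_antidistrib, map_mul, Module.End.mul_apply])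

/-- The dual of an `H`-module. -/
abbrev dualMod (M : FDMod k H) : FDMod k H where
  carrier := Module.Dual k M.carrier
  ρ := dualAct M

/-- The evaluation `M* ⊗ M → k`. -/
def evMor (M : FDMod k H) : tensor (dualMod M) M ⟶ QuasiTriangular.unit k H :=
  FDMod.ofLin (M := tensor (dualMod M) M) (N := QuasiTriangular.unit k H)
    (contractLeft k M.carrier) (fun h t => by
      rw [tensor_ρ, unit_ρ]
      change Module.Dual k M.carrier ⊗[k] M.carrier at t
      induction t with
      | zero => simp
      | add z w hz hw => simp only [map_add, mul_add, hz, hw]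
      | tmul f m =>
        have e := congrArg (fun g => f (M.ρ g m)) (sum_antipode_mul_eq_smul (R := k) (ℛ k h))
        simp only [map_sum, map_smul, map_mul, map_one, LinearMap.sum_apply, LinearMap.smul_apply,
          Module.End.mul_apply, Module.End.one_apply, smul_eq_mul] at e
        conv_lhs => rw [← (ℛ k h).eq]
        simp only [map_sum, LinearMap.sum_apply, pairRep_tmul_tmul, contractLeft_apply]
        exact e)

/-- The pairing `(d ⊗ f) ⊗ (c ⊗ m) ↦ α(d (R² c)) f(S(R¹) m)` of `A ⊗ M*` and `A ⊗ M`. -/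
def evF (M : FDMod k H) :
    (A ⊗[k] (dualMod M).carrier) ⊗[k] (A ⊗[k] M.carrier) →ₗ[k] k :=
  epsA s ∘ₗ (FDMod.lin (evMor M)).lTensor A ∘ₗ piLin Q T s (dualMod M) M

lemma evF_tmul (M : FDMod k H) (d c : A) (f : Module.Dual k M.carrier) (m : M.carrier) :
    evF Q T s M ((d ⊗ₜ f) ⊗ₜ (c ⊗ₜ m)) =
      ∑ p ∈ reps Q.R, s.α (d * T.act p.2 c) * f (M.ρ (antipode k p.1) m) := by
  rw [evF, LinearMap.comp_apply, LinearMap.comp_apply, piLin_tmul, map_sum, map_sum]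
  refine Finset.sum_congr rfl fun p _ => ?_
  exact mul_comm _ _

/-- The antipode of `B` is adjoint to the identity with respect to the evaluation pairing. -/
theorem evF_antipodeB (M : FDMod k H) (b : BAlg H s) (w : A ⊗[k] (dualMod M).carrier)
    (v : A ⊗[k] M.carrier) :
    evF Q T s M (algAct s (dualMod M) b w ⊗ₜ v) =
      evF Q T s M (w ⊗ₜ algAct s M (BAlg.antipodeB Q T s b) v) := by
  induction b using BAlg.induction_toDual with
  | h0 => simp
  | ha b b' hb hb' =>
    simp only [map_add, LinearMap.add_apply, TensorProduct.add_tmul, TensorProduct.tmul_add, hb,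
      hb']
  | ht a h e =>
  induction w with
  | zero => simp
  | add z w hz hw => simp only [map_add, TensorProduct.add_tmul, hz, hw]
  | tmul d f =>
  induction v with
  | zero => simp
  | add z w hz hw => simp only [map_add, TensorProduct.tmul_add, hz, hw]
  | tmul c m =>
    let φ (t : H) : H →ₗ[k] H →ₗ[k] k := (LinearMap.mul k k).compl₁₂
      (f ∘ₗ M.ρ.toLinearMap.flip (M.ρ (antipode k h) (M.ρ t m)))
      (s.α ∘ₗ LinearMap.mulLeft k d ∘ₗ T.act.toLinearMap.flip a)
    have hφ : ∀ t u v, φ t u v =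
        f (M.ρ u (M.ρ (antipode k h) (M.ρ t m))) * s.α (d * T.act v a) := fun t u v => rfl
    have h1 : ∀ t : H × H, ∑ r ∈ reps Q.R, ∑ p ∈ reps Q.R, s.α (c * T.act t.2 e) *
        (s.α (d * T.act p.2 (T.act r.2 a)) * f (M.ρ (antipode k p.1)
          (M.ρ r.1 (M.ρ (antipode k h) (M.ρ t.1 m))))) =
        s.α (c * T.act t.2 e) * (s.α (d * a) * f (M.ρ (antipode k h) (M.ρ t.1 m))) := by
      intro t
      have := sum_antipode_R_mul_R Q (φ t.1)
      simp only [hφ, map_mul, map_one, Module.End.mul_apply, Module.End.one_apply] at this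
      rw [Finset.sum_comm]
      simp only [← Finset.mul_sum]
      congr 1
      rw [mul_comm, ← this]
      exact Finset.sum_congr rfl fun p _ => Finset.sum_congr rfl fun r _ => mul_comm _ _
    let χ : H →ₗ[k] H →ₗ[k] k := (LinearMap.mul k k).compl₁₂
      (f ∘ₗ M.ρ (antipode k h) ∘ₗ M.ρ.toLinearMap.flip m)
      (s.α ∘ₗ LinearMap.mulLeft k e ∘ₗ T.act.toLinearMap.flip c ∘ₗ antipode k)
    have hχ : ∀ u v, χ u v =
        f (M.ρ (antipode k h) (M.ρ u m)) * s.α (e * T.act (antipode k v) c) := fun u v => rfl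
    have h2 := sum_R_antipode Q χ
    simp only [hχ, antipode_antipode_of_isSemisimpleRing] at h2
    have h3 : ∀ g : H, s.α (c * T.act g e) = s.α (e * T.act (antipode k g) c) := by
      intro g
      rw [α_mul_act T s, s.α_mul_comm]
    have hl : evF Q T s M (algAct s (dualMod M) (BAlg.tri s a h (s.toDual e)) (d ⊗ₜ f) ⊗ₜ
        (c ⊗ₜ m)) = s.α (d * a) * ∑ p ∈ reps Q.R,
          s.α (e * T.act p.2 c) * f (M.ρ (antipode k h) (M.ρ (antipode k p.1) m)) := by
      rw [algAct_tri, ← TensorProduct.smul_tmul', map_smul, smul_eq_mul]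
      exact congrArg _ (evF_tmul Q T s M e c (dualAct M h f) m)
    have hr : evF Q T s M ((d ⊗ₜ f) ⊗ₜ algAct s M (BAlg.antipodeB Q T s
        (BAlg.tri s a h (s.toDual e))) (c ⊗ₜ m)) = ∑ r ∈ reps Q.R, ∑ t ∈ reps Q.R,
          ∑ p ∈ reps Q.R, s.α (c * T.act t.2 e) * (s.α (d * T.act p.2 (T.act r.2 a)) *
            f (M.ρ (antipode k p.1) (M.ρ r.1 (M.ρ (antipode k h) (M.ρ t.1 m))))) := by
      rw [antipodeB_toDual]
      simp only [map_sum, LinearMap.sum_apply, algAct_tri, TensorProduct.tmul_sum,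
        TensorProduct.tmul_smul, map_smul, smul_eq_mul, map_mul, Module.End.mul_apply,
        ← Finset.mul_sum]
      exact Finset.sum_congr rfl fun r _ => Finset.sum_congr rfl fun t _ =>
        congrArg _ (evF_tmul Q T s M d _ f _)
    rw [hl, hr]
    rw [Finset.sum_comm]
    rw [Finset.sum_congr rfl fun t _ => h1 t]
    simp only [h3, mul_left_comm _ (s.α (d * a))]
    rw [← Finset.mul_sum]
    congr 1
    simp only [mul_comm (s.α (e * _))]
    exact h2

/-- The evaluation pairing is nondegenerate on the right. -/
lemma evF_ext (M : FDMod k H) {v v' : A ⊗[k] M.carrier}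
    (h : ∀ w, evF Q T s M (w ⊗ₜ v) = evF Q T s M (w ⊗ₜ v')) : v = v' := by
  -- the pairing is the trace form tensored with evaluation, twisted by the invertible `R² ⊗ S(R¹)`
  let z : H ⊗[k] H := Algebra.TensorProduct.comm k H H ((antipode k).rTensor H Q.R)
  have hz : Algebra.TensorProduct.comm k H H Q.R * z = 1 := by
    rw [← map_mul, R_mul_rTensor_antipode_R, map_one]
  have hinj : Function.Injective (pairRep T.act M.ρ z) := by
    refine Function.LeftInverse.injective
      (g := pairRep T.act M.ρ (Algebra.TensorProduct.comm k H H Q.R)) fun t => ?_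
    rw [← pairRep_mul, hz, map_one, Module.End.one_apply]
  have key : ∀ (d : A) (f : Module.Dual k M.carrier) (v : A ⊗[k] M.carrier),
      evF Q T s M ((d ⊗ₜ f) ⊗ₜ v) = f (s.contr _ d (pairRep T.act M.ρ z v)) := by
    intro d f v
    have hz' : z = ∑ p ∈ reps Q.R, p.2 ⊗ₜ antipode k p.1 := by
      simp only [z]
      conv_lhs => rw [← sum_reps Q.R]
      simp
    induction v with
    | zero => simp
    | add z w hz hw => simp only [map_add, TensorProduct.tmul_add, hz, hw]
    | tmul c m =>
      rw [evF_tmul, hz']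
      simp [map_sum, s.α_mul_comm d]
  refine hinj (s.ext_contr fun d => ?_)
  rw [← sub_eq_zero, ← Module.forall_dual_apply_eq_zero_iff k]
  intro f
  rw [map_sub, ← key, ← key, h, sub_self]

end antipode

end WeakHopf

/-! ### The weak bialgebra axioms -/

namespace WeakHopf

open Coalgebra HopfAlgebra HopfConv QuasiTriangular

section legs
variable {k : Type u} [Field k] {B : Type u} [Ring B] [Algebra k B]
variable {M N P : Type u} [AddCommGroup M] [Module k M] [AddCommGroup N] [Module k N]
  [AddCommGroup P] [Module k P]
variable (ρ : B →ₐ[k] Module.End k M) (σ : B →ₐ[k] Module.End k N) (τ : B →ₐ[k] Module.End k P)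

lemma pairRep_leg23 (z : B ⊗[k] B) (t : M ⊗[k] (N ⊗[k] P)) :
    pairRep ρ (pairRep σ τ) (leg23 B z) t = (pairRep σ τ z).lTensor M t := by
  rw [leg23_apply, pairRep_tmul, map_one]
  rfl

lemma pairRep_leg12 (z : B ⊗[k] B) (t : (M ⊗[k] N) ⊗[k] P) :
    pairRep ρ (pairRep σ τ) (leg12 B z) (TensorProduct.assoc k M N P t) =
      TensorProduct.assoc k M N P ((pairRep ρ σ z).rTensor P t) := by
  rw [leg12_apply, ← assoc_pairRep, pairRep_tmul, map_one]
  rfl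

lemma flipAct_mul (z w : B ⊗[k] B) (t : M ⊗[k] N) :
    flipAct ρ σ (z * w) t = flipAct ρ σ z (pairRep ρ σ w t) := by
  rw [flipAct_apply, pairRep_mul, flipAct_apply]

/-- An element `z₂₁ w` acts by `w`, the flip and then `z`. -/
lemma flipAct_comm_mul (z w : B ⊗[k] B) (t : M ⊗[k] N) :
    flipAct ρ σ (TensorProduct.comm k B B z * w) t = pairRep σ ρ z (flipAct ρ σ w t) := by
  rw [flipAct_apply, pairRep_mul, comm_pairRep, TensorProduct.comm_comm, flipAct_apply]

end legs

section bialgebra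
variable {k H A : Type u} [Field k] [CharZero k] [Ring H] [HopfAlgebra k H] [IsSemisimpleRing H]
  [Ring A] [Algebra k A] (Q : QuasiTriangular k H) (T : ModuleAlgebra k H A)
  (s : SymmSepIdempotent k A)

variable (k H) in
/-- A semisimple Hopf algebra is finite-dimensional. -/
lemma finite_of_isSemisimpleRing : Module.Finite k H := by
  obtain ⟨Λ, hΛ⟩ := exists_isIntegral k H
  exact finite_of_separability (sepElt k Λ) (mul'_sepElt hΛ) (tmul_mul_sepElt hΛ)

variable (k H) in
/-- The regular `H`-module. -/
abbrev regMod : FDMod k H where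
  carrier := H
  fin := finite_of_isSemisimpleRing k H
  ρ := Algebra.lmul k H

lemma algAct_regMod_injective : Function.Injective (algAct s (regMod k H)) :=
  algAct_injective s (regMod k H) (1 : H) fun g h e => by simpa using e

/-- An element of `B` is determined by its action on the modules `A ⊗ M`. -/
lemma ext_algAct {b c : BAlg H s}
    (h : ∀ (M : FDMod k H) (t : A ⊗[k] M.carrier), algAct s M b t = algAct s M c t) : b = c :=
  algAct_regMod_injective s (LinearMap.ext (h _))

lemma ext_algAct₂ {z w : BAlg H s ⊗[k] BAlg H s}
    (h : ∀ (M N : FDMod k H) (t : (A ⊗[k] M.carrier) ⊗[k] (A ⊗[k] N.carrier)),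
      pairRep (algAct s M) (algAct s N) z t = pairRep (algAct s M) (algAct s N) w t) : z = w := by
  have := s.finite
  have := finite_of_isSemisimpleRing k H
  exact pairRep_injective (algAct_regMod_injective s) (algAct_regMod_injective s)
    (LinearMap.ext (h _ _))

lemma ext_algAct₃ {z w : BAlg H s ⊗[k] (BAlg H s ⊗[k] BAlg H s)}
    (h : ∀ (M N P : FDMod k H)
      (t : ((A ⊗[k] M.carrier) ⊗[k] (A ⊗[k] N.carrier)) ⊗[k] (A ⊗[k] P.carrier)),
      pairRep (algAct s M) (pairRep (algAct s N) (algAct s P)) z (TensorProduct.assoc k _ _ _ t) =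
      pairRep (algAct s M) (pairRep (algAct s N) (algAct s P)) w (TensorProduct.assoc k _ _ _ t)) :
    z = w := by
  have := s.finite
  have := finite_of_isSemisimpleRing k H
  exact pairRep_injective (algAct_regMod_injective s)
    (pairRep_injective (algAct_regMod_injective s) (algAct_regMod_injective s))
    (LinearMap.ext fun t => by
      obtain ⟨t, rfl⟩ := (TensorProduct.assoc k _ _ _).surjective t
      exact h (regMod k H) (regMod k H) (regMod k H) t)

lemma ext_flipAct {z w : BAlg H s ⊗[k] BAlg H s}
    (h : ∀ (M N : FDMod k H) (t : (A ⊗[k] M.carrier) ⊗[k] (A ⊗[k] N.carrier)),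
      flipAct (algAct s M) (algAct s N) z t = flipAct (algAct s M) (algAct s N) w t) : z = w :=
  ext_algAct₂ s fun M N t => (TensorProduct.comm k _ _).injective (h M N t)

lemma pairRep_comulB_rTensor (M N P : FDMod k H) (z : BAlg H s ⊗[k] BAlg H s)
    (t : ((A ⊗[k] M.carrier) ⊗[k] (A ⊗[k] N.carrier)) ⊗[k] (A ⊗[k] P.carrier)) :
    pairRep (pairRep (algAct s M) (algAct s N)) (algAct s P)
      ((BAlg.comulB Q T s).rTensor _ z) t =
    (ioLin Q T s M N).rTensor _ (pairRep (algAct s (tensor M N)) (algAct s P) z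
      ((piLin Q T s M N).rTensor _ t)) := by
  induction z with
  | zero => simp
  | add z w hz hw => simp only [map_add, LinearMap.add_apply, hz, hw]
  | tmul b c =>
  induction t with
  | zero => simp
  | add z w hz hw => simp only [map_add, hz, hw]
  | tmul u v =>
    rw [LinearMap.rTensor_tmul, LinearMap.rTensor_tmul, pairRep_tmul_tmul, pairRep_comulB]
    rfl

lemma pairRep_comulB_lTensor (M N P : FDMod k H) (z : BAlg H s ⊗[k] BAlg H s)
    (t : (A ⊗[k] M.carrier) ⊗[k] ((A ⊗[k] N.carrier) ⊗[k] (A ⊗[k] P.carrier))) :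
    pairRep (algAct s M) (pairRep (algAct s N) (algAct s P))
      ((BAlg.comulB Q T s).lTensor _ z) t =
    (ioLin Q T s N P).lTensor _ (pairRep (algAct s M) (algAct s (tensor N P)) z
      ((piLin Q T s N P).lTensor _ t)) := by
  induction z with
  | zero => simp
  | add z w hz hw => simp only [map_add, LinearMap.add_apply, hz, hw]
  | tmul b c =>
  induction t with
  | zero => simp
  | add z w hz hw => simp only [map_add, hz, hw]
  | tmul u v =>
    rw [LinearMap.lTensor_tmul, LinearMap.lTensor_tmul, pairRep_tmul_tmul, pairRep_comulB]
    rfl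

lemma assocA_algAct (M N P : FDMod k H) (b : BAlg H s)
    (t : A ⊗[k] ((M.carrier ⊗[k] N.carrier) ⊗[k] P.carrier)) :
    assocA A M N P (algAct s (tensor (tensor M N) P) b t) =
      algAct s (tensor M (tensor N P)) b (assocA A M N P t) :=
  algAct_natural s (QuasiTriangular.associator M N P).hom b t

lemma comulB_coassoc (b : BAlg H s) :
    TensorProduct.assoc k _ _ _ ((BAlg.comulB Q T s).rTensor _ (BAlg.comulB Q T s b)) =
      (BAlg.comulB Q T s).lTensor _ (BAlg.comulB Q T s b) := by
  refine ext_algAct₃ s fun M N P t => ?_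
  rw [← assoc_pairRep, pairRep_comulB_rTensor, pairRep_comulB, pairRep_comulB_lTensor,
    pairRep_comulB, ioLin_coassoc, assocA_algAct, piLin_assoc]

/-- `Δ_B(1)` acts as the idempotent `ι π`. -/
lemma pairRep_comulB_one (M N : FDMod k H) (t : (A ⊗[k] M.carrier) ⊗[k] (A ⊗[k] N.carrier)) :
    pairRep (algAct s M) (algAct s N) (BAlg.comulB Q T s 1) t =
      ioLin Q T s M N (piLin Q T s M N t) := by
  rw [pairRep_comulB, map_one, Module.End.one_apply]

lemma pairRep_comulB_one_eq (M N : FDMod k H) :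
    pairRep (algAct s M) (algAct s N) (BAlg.comulB Q T s 1) =
      ioLin Q T s M N ∘ₗ piLin Q T s M N :=
  LinearMap.ext (pairRep_comulB_one Q T s M N)

/-- The first weak unit axiom is the Frobenius relation `piLin_ioLin_right`. -/
lemma comulB_one₁ : (BAlg.comulB Q T s).lTensor _ (BAlg.comulB Q T s 1) =
    leg12 _ (BAlg.comulB Q T s 1) * leg23 _ (BAlg.comulB Q T s 1) := by
  refine ext_algAct₃ s fun M N P t => ?_
  generalize TensorProduct.assoc k _ _ _ t = t
  have h : pairRep (algAct s M) (pairRep (algAct s N) (algAct s P))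
      (leg23 _ (BAlg.comulB Q T s 1)) t = TensorProduct.assoc k _ _ _
        ((TensorProduct.assoc k _ _ _).symm ((ioLin Q T s N P).lTensor _
          ((piLin Q T s N P).lTensor _ t))) := by
    rw [LinearEquiv.apply_symm_apply, pairRep_leg23, pairRep_comulB_one_eq, LinearMap.lTensor_comp]
    rfl
  rw [pairRep_mul, h, pairRep_leg12, pairRep_comulB_one_eq, LinearMap.rTensor_comp,
    LinearMap.comp_apply, piLin_ioLin_right, ioLin_coassoc, LinearEquiv.apply_symm_apply,
    pairRep_comulB_lTensor, pairRep_comulB_one]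

/-- The second weak unit axiom is the Frobenius relation `piLin_ioLin_left`. -/
lemma comulB_one₂ : (BAlg.comulB Q T s).lTensor _ (BAlg.comulB Q T s 1) =
    leg23 _ (BAlg.comulB Q T s 1) * leg12 _ (BAlg.comulB Q T s 1) := by
  refine ext_algAct₃ s fun M N P t => ?_
  rw [pairRep_mul, pairRep_leg12, pairRep_leg23, pairRep_comulB_one_eq, pairRep_comulB_one_eq,
    LinearMap.rTensor_comp, LinearMap.lTensor_comp, LinearMap.comp_apply, LinearMap.comp_apply,
    piLin_ioLin_left, piLin_assoc, pairRep_comulB_lTensor, pairRep_comulB_one]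

/-- Multiplicativity of `Δ_B` amounts to `π ι = 1`. -/
lemma comulB_mul (b c : BAlg H s) :
    BAlg.comulB Q T s (b * c) = BAlg.comulB Q T s b * BAlg.comulB Q T s c := by
  refine ext_algAct₂ s fun M N t => ?_
  rw [pairRep_mul, pairRep_comulB, pairRep_comulB, pairRep_comulB, piLin_ioLin, map_mul,
    Module.End.mul_apply]

lemma lid_algAct (N : FDMod k H) (b : BAlg H s)
    (w : A ⊗[k] ((QuasiTriangular.unit k H).carrier ⊗[k] N.carrier)) :
    (TensorProduct.lid k N.carrier).toLinearMap.lTensor A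
      (algAct s (tensor (QuasiTriangular.unit k H) N) b w) =
    algAct s N b ((TensorProduct.lid k N.carrier).toLinearMap.lTensor A w) :=
  algAct_natural s (QuasiTriangular.leftUnitor N).hom b w

lemma rid_algAct (M : FDMod k H) (b : BAlg H s)
    (w : A ⊗[k] (M.carrier ⊗[k] (QuasiTriangular.unit k H).carrier)) :
    (TensorProduct.rid k M.carrier).toLinearMap.lTensor A
      (algAct s (tensor M (QuasiTriangular.unit k H)) b w) =
    algAct s M b ((TensorProduct.rid k M.carrier).toLinearMap.lTensor A w) :=
  algAct_natural s (QuasiTriangular.rightUnitor M).hom b w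

/-- The generator `1 ⊗ 1` of the unit object `A ⊗ k`. -/
abbrev etaA (k A : Type u) [Field k] [Ring A] [Algebra k A] : A ⊗[k] k := 1 ⊗ₜ 1

/-- `ε_B(z¹ c) z²` acts on `v` by applying `z` to `c η ⊗ v`, for the generator `η` of `A ⊗ k`, and then
`α` to the first factor. -/
lemma epsA_pairRep_left (N : FDMod k H) (c : BAlg H s) (z : BAlg H s ⊗[k] BAlg H s)
    (v : A ⊗[k] N.carrier) :
    algAct s N (TensorProduct.lid k _ ((BAlg.counitB s ∘ₗ LinearMap.mulRight k c).rTensor _ z)) v =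
      TensorProduct.lid k _ ((epsA s).rTensor _
        (pairRep (algAct s (QuasiTriangular.unit k H)) (algAct s N) z
          (algAct s (QuasiTriangular.unit k H) c (etaA k A) ⊗ₜ v))) := by
  induction z with
  | zero => simp
  | add z w hz hw => simp only [map_add, LinearMap.add_apply, hz, hw]
  | tmul b d =>
    rw [LinearMap.rTensor_tmul, TensorProduct.lid_tmul, LinearMap.comp_apply,
      LinearMap.mulRight_apply, counitB_eq, map_mul, map_smul, pairRep_tmul_tmul,
      LinearMap.rTensor_tmul, TensorProduct.lid_tmul]
    rfl

/-- `z¹ ε_B(d z² c)` acts on `v` by applying `z` to `v ⊗ c η`, for the generator `η` of `A ⊗ k`, and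
then `α` after `d` to the second factor. -/
lemma epsA_pairRep_right (M : FDMod k H) (c d : BAlg H s) (z : BAlg H s ⊗[k] BAlg H s)
    (v : A ⊗[k] M.carrier) :
    algAct s M (TensorProduct.rid k _ ((BAlg.counitB s ∘ₗ LinearMap.mulLeft k d ∘ₗ
        LinearMap.mulRight k c).lTensor _ z)) v =
      TensorProduct.rid k _ ((epsA s ∘ₗ algAct s (QuasiTriangular.unit k H) d).lTensor _
        (pairRep (algAct s M) (algAct s (QuasiTriangular.unit k H)) z
          (v ⊗ₜ algAct s (QuasiTriangular.unit k H) c (etaA k A)))) := by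
  induction z with
  | zero => simp
  | add z w hz hw => simp only [map_add, LinearMap.add_apply, hz, hw]
  | tmul b e =>
    rw [LinearMap.lTensor_tmul, TensorProduct.rid_tmul, LinearMap.comp_apply, LinearMap.comp_apply,
      LinearMap.mulLeft_apply, LinearMap.mulRight_apply, counitB_eq, map_mul, map_mul, map_smul,
      pairRep_tmul_tmul, LinearMap.lTensor_tmul, TensorProduct.rid_tmul]
    rfl

lemma counitB_comulB (b : BAlg H s) :
    TensorProduct.lid k _ ((BAlg.counitB s).rTensor _ (BAlg.comulB Q T s b)) = b := by
  refine ext_algAct s fun M v => ?_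
  have h := epsA_pairRep_left s M 1 (BAlg.comulB Q T s b) v
  rw [LinearMap.mulRight_one, LinearMap.comp_id] at h
  rw [h, pairRep_comulB, epsA_ioLin_left, lid_algAct, map_one, Module.End.one_apply, piLin_one_left]

lemma comulB_counitB (b : BAlg H s) :
    TensorProduct.rid k _ ((BAlg.counitB s).lTensor _ (BAlg.comulB Q T s b)) = b := by
  refine ext_algAct s fun M v => ?_
  have h := epsA_pairRep_right s M 1 1 (BAlg.comulB Q T s b) v
  rw [LinearMap.mulRight_one, LinearMap.mulLeft_one, LinearMap.comp_id, LinearMap.comp_id, map_one,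
    Module.End.one_eq_id, LinearMap.comp_id] at h
  rw [h, pairRep_comulB, epsA_ioLin_right, rid_algAct, LinearMap.id_apply, piLin_one_right]

lemma counitB_mul₁ (a b c : BAlg H s) : BAlg.counitB s (a * b * c) =
    LinearMap.mul' k k (TensorProduct.map (BAlg.counitB s ∘ₗ LinearMap.mulLeft k a)
      (BAlg.counitB s ∘ₗ LinearMap.mulRight k c) (BAlg.comulB Q T s b)) := by
  have h : ∀ z : BAlg H s ⊗[k] BAlg H s,
      LinearMap.mul' k k (TensorProduct.map (BAlg.counitB s ∘ₗ LinearMap.mulLeft k a)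
        (BAlg.counitB s ∘ₗ LinearMap.mulRight k c) z) =
      epsA s (algAct s (QuasiTriangular.unit k H) a (TensorProduct.rid k _ ((epsA s).lTensor _
        (pairRep (algAct s (QuasiTriangular.unit k H)) (algAct s (QuasiTriangular.unit k H)) z
          (etaA k A ⊗ₜ algAct s (QuasiTriangular.unit k H) c (etaA k A)))))) := by
    intro z
    induction z with
    | zero => simp
    | add z w hz hw => simp only [map_add, LinearMap.add_apply, hz, hw]
    | tmul b e =>
      simp only [TensorProduct.map_tmul, LinearMap.mul'_apply, LinearMap.comp_apply,
        LinearMap.mulLeft_apply, LinearMap.mulRight_apply, counitB_eq, map_mul,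
        Module.End.mul_apply, pairRep_tmul_tmul, LinearMap.lTensor_tmul, TensorProduct.rid_tmul,
        map_smul, smul_eq_mul]
      rw [mul_comm]
  rw [h, pairRep_comulB, epsA_ioLin_right, rid_algAct]
  have e : (TensorProduct.rid k (QuasiTriangular.unit k H).carrier).toLinearMap =
      (TensorProduct.lid k (QuasiTriangular.unit k H).carrier).toLinearMap := by
    ext
    simp
  rw [e, piLin_one_left, counitB_eq, map_mul, map_mul]
  rfl

lemma counitB_mul₂ (a b c : BAlg H s) : BAlg.counitB s (a * b * c) =
    LinearMap.mul' k k (TensorProduct.map (BAlg.counitB s ∘ₗ LinearMap.mulRight k c)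
      (BAlg.counitB s ∘ₗ LinearMap.mulLeft k a) (BAlg.comulB Q T s b)) := by
  have h : ∀ z : BAlg H s ⊗[k] BAlg H s,
      LinearMap.mul' k k (TensorProduct.map (BAlg.counitB s ∘ₗ LinearMap.mulRight k c)
        (BAlg.counitB s ∘ₗ LinearMap.mulLeft k a) z) =
      epsA s (algAct s (QuasiTriangular.unit k H) a (TensorProduct.lid k _ ((epsA s).rTensor _
        (pairRep (algAct s (QuasiTriangular.unit k H)) (algAct s (QuasiTriangular.unit k H)) z
          (algAct s (QuasiTriangular.unit k H) c (etaA k A) ⊗ₜ etaA k A))))) := by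
    intro z
    induction z with
    | zero => simp
    | add z w hz hw => simp only [map_add, LinearMap.add_apply, hz, hw]
    | tmul b e =>
      simp only [TensorProduct.map_tmul, LinearMap.mul'_apply, LinearMap.comp_apply,
        LinearMap.mulLeft_apply, LinearMap.mulRight_apply, counitB_eq, map_mul,
        Module.End.mul_apply, pairRep_tmul_tmul, LinearMap.rTensor_tmul, TensorProduct.lid_tmul,
        map_smul, smul_eq_mul]
  rw [h, pairRep_comulB, epsA_ioLin_left, lid_algAct]
  have e : (TensorProduct.lid k (QuasiTriangular.unit k H).carrier).toLinearMap =
      (TensorProduct.rid k (QuasiTriangular.unit k H).carrier).toLinearMap := by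
    ext
    simp
  rw [e, piLin_one_right, counitB_eq, map_mul, map_mul]
  rfl

/-- The weak bialgebra structure on `B`. -/
def weakBialgebraB : WeakBialgebra k (BAlg H s) where
  comul := BAlg.comulB Q T s
  counit := BAlg.counitB s
  coassoc := comulB_coassoc Q T s
  counit_comul := counitB_comulB Q T s
  comul_counit := comulB_counitB Q T s
  comul_mul := comulB_mul Q T s
  comul_one₁ := comulB_one₁ Q T s
  comul_one₂ := comulB_one₂ Q T s
  counit_mul₁ := counitB_mul₁ Q T s
  counit_mul₂ := counitB_mul₂ Q T s

end bialgebra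

end WeakHopf

/-! ### The antipode axioms -/

namespace WeakHopf

open Coalgebra HopfAlgebra HopfConv QuasiTriangular

section weakHopf
variable {k H A : Type u} [Field k] [CharZero k] [Ring H] [HopfAlgebra k H] [IsSemisimpleRing H]
  [Ring A] [Algebra k A] (Q : QuasiTriangular k H) (T : ModuleAlgebra k H A)
  (s : SymmSepIdempotent k A)

/-- `ε_t(c)` acts as left multiplication by the element `c η` of `A ⊗ k`. -/
lemma algAct_εt (N : FDMod k H) (c : BAlg H s) (v : A ⊗[k] N.carrier) :
    algAct s N ((weakBialgebraB Q T s).εt c) v =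
      (TensorProduct.lid k N.carrier).toLinearMap.lTensor A
        (piLin Q T s (QuasiTriangular.unit k H) N
          (algAct s (QuasiTriangular.unit k H) c (etaA k A) ⊗ₜ v)) := by
  have h := epsA_pairRep_left s N c (BAlg.comulB Q T s 1) v
  rw [pairRep_comulB_one, epsA_ioLin_left] at h
  exact h

lemma algAct_εs (M : FDMod k H) (d : BAlg H s) (v : A ⊗[k] M.carrier) :
    algAct s M ((weakBialgebraB Q T s).εs d) v =
      TensorProduct.rid k _ ((epsA s ∘ₗ algAct s (QuasiTriangular.unit k H) d).lTensor _
        (ioLin Q T s M (QuasiTriangular.unit k H) (piLin Q T s M (QuasiTriangular.unit k H)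
          (v ⊗ₜ etaA k A)))) := by
  have h := epsA_pairRep_right s M 1 d (BAlg.comulB Q T s 1) v
  rw [pairRep_comulB_one, map_one (algAct s (QuasiTriangular.unit k H)), Module.End.one_apply,
    LinearMap.mulRight_one, LinearMap.comp_id] at h
  exact h

/-- `b₁ S(b₂) = ε_t(b)`: both sides act on `A ⊗ M` as left multiplication by `ε(h) α(a) e`, for
`b = a ⊗ h ⊗ α(- e)`. -/
lemma mul_antipodeB (b : BAlg H s) :
    LinearMap.mul' k _ ((BAlg.antipodeB Q T s).lTensor _ (BAlg.comulB Q T s b)) =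
      (weakBialgebraB Q T s).εt b := by
  induction b using BAlg.induction_toDual with
  | h0 => simp
  | ha b c hb hc => simp only [map_add, hb, hc]
  | ht a h e =>
  rw [mul_antipodeB_toDual]
  refine ext_algAct s fun M t => ?_
  rw [algAct_εt]
  induction t with
  | zero => simp
  | add z w hz hw => simp only [map_add, TensorProduct.tmul_add, hz, hw]
  | tmul c m =>
    have h1 := sum_counit_fst Q (k := k) ((TensorProduct.mk k A M.carrier).flip m ∘ₗ
      LinearMap.mulLeft k e ∘ₗ T.act.toLinearMap.flip c)
    simp only [LinearMap.comp_apply, LinearMap.flip_apply, TensorProduct.mk_apply,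
      LinearMap.mulLeft_apply, AlgHom.toLinearMap_apply, map_one, Module.End.one_apply] at h1
    have h2 : algAct s (QuasiTriangular.unit k H) (BAlg.tri s a h (s.toDual e)) (etaA k A) =
        (counit (R := k) h * s.α a) • (e ⊗ₜ (1 : k)) := by
      rw [algAct_tri, unit_ρ, one_mul, mul_one, mul_comm, ← TensorProduct.tmul_smul,
        ← TensorProduct.tmul_smul, smul_eq_mul]
      exact congrArg (e ⊗ₜ[k] ·) (mul_one _).symm
    have h3 := congrArg (fun w => (e * w) ⊗ₜ[k] m) (s.sum_α_mul_snd c)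
    simp only [Finset.mul_sum, mul_smul_comm, TensorProduct.sum_tmul,
      ← TensorProduct.smul_tmul'] at h3
    rw [h2, ← TensorProduct.smul_tmul', map_smul, map_smul, map_smul, LinearMap.smul_apply]
    congr 1
    simp only [map_sum, LinearMap.sum_apply, algAct_tri, map_one, Module.End.one_apply]
    rw [h3, piLin_tmul, map_sum, ← h1]
    refine Finset.sum_congr rfl fun p _ => ?_
    rw [LinearMap.lTensor_tmul, unit_ρ, LinearEquiv.coe_coe, TensorProduct.lid_tmul, mul_one,
      TensorProduct.tmul_smul]

/-- The evaluation pairing with values in `A`. -/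
def evA (M : FDMod k H) :
    (A ⊗[k] (dualMod M).carrier) ⊗[k] (A ⊗[k] M.carrier) →ₗ[k] A ⊗[k] k :=
  (FDMod.lin (evMor M)).lTensor A ∘ₗ piLin Q T s (dualMod M) M

lemma evF_eq (M : FDMod k H) : evF Q T s M = epsA s ∘ₗ evA Q T s M := rfl

lemma evA_ioLin (M : FDMod k H) (b : BAlg H s)
    (t : A ⊗[k] ((dualMod M).carrier ⊗[k] M.carrier)) :
    evA Q T s M (ioLin Q T s (dualMod M) M (algAct s (tensor (dualMod M) M) b t)) =
      algAct s (QuasiTriangular.unit k H) b ((FDMod.lin (evMor M)).lTensor A t) := by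
  rw [evA, LinearMap.comp_apply, piLin_ioLin]
  exact algAct_natural s (evMor M) b t

/-- `(f, S(b₁) b₂ v) = ε(b (f, v))` -/
lemma evF_antipodeB_mul (M : FDMod k H) (b : BAlg H s) (w : A ⊗[k] (dualMod M).carrier)
    (v : A ⊗[k] M.carrier) :
    evF Q T s M (w ⊗ₜ algAct s M (LinearMap.mul' k _
      ((BAlg.antipodeB Q T s).rTensor _ (BAlg.comulB Q T s b))) v) =
    epsA s (algAct s (QuasiTriangular.unit k H) b (evA Q T s M (w ⊗ₜ v))) := by
  have h : ∀ z : BAlg H s ⊗[k] BAlg H s, evF Q T s M (w ⊗ₜ algAct s M (LinearMap.mul' k _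
      ((BAlg.antipodeB Q T s).rTensor _ z)) v) =
      evF Q T s M (pairRep (algAct s (dualMod M)) (algAct s M) z (w ⊗ₜ v)) := by
    intro z
    induction z with
    | zero => simp
    | add z w hz hw => simp only [map_add, LinearMap.add_apply, TensorProduct.tmul_add, hz, hw]
    | tmul b c =>
      rw [LinearMap.rTensor_tmul, LinearMap.mul'_apply, map_mul, Module.End.mul_apply,
        ← evF_antipodeB, pairRep_tmul_tmul]
  rw [h, pairRep_comulB, evF_eq, LinearMap.comp_apply, evA_ioLin]
  rfl

/-- `(f, ε_s(b) v) = ε(b (f, v))` -/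
lemma evF_εs (M : FDMod k H) (b : BAlg H s) (w : A ⊗[k] (dualMod M).carrier)
    (v : A ⊗[k] M.carrier) :
    evF Q T s M (w ⊗ₜ algAct s M ((weakBialgebraB Q T s).εs b) v) =
    epsA s (algAct s (QuasiTriangular.unit k H) b (evA Q T s M (w ⊗ₜ v))) := by
  let u := QuasiTriangular.unit k H
  let ev := evMor M
  let v' : A ⊗[k] (M.carrier ⊗[k] u.carrier) := piLin Q T s M u (v ⊗ₜ etaA k A)
  have hv : (TensorProduct.rid k M.carrier).toLinearMap.lTensor A v' = v :=
    piLin_one_right Q T s M v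
  have h1 : ∀ x : (A ⊗[k] M.carrier) ⊗[k] (A ⊗[k] u.carrier),
      evF Q T s M (w ⊗ₜ TensorProduct.rid k _ ((epsA s ∘ₗ algAct s u b).lTensor _ x)) =
      epsA s (algAct s u b (TensorProduct.lid k _ ((epsA s).rTensor _
        ((lA ev).rTensor (A ⊗[k] u.carrier) ((piLin Q T s (dualMod M) M).rTensor _
          ((TensorProduct.assoc k _ _ _).symm (w ⊗ₜ x))))))) := by
    intro x
    induction x with
    | zero => simp
    | add z w hz hw => simp only [map_add, TensorProduct.tmul_add, hz, hw]
    | tmul x y =>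
      simp only [LinearMap.lTensor_tmul, TensorProduct.rid_tmul, TensorProduct.tmul_smul,
        map_smul, TensorProduct.assoc_symm_tmul, LinearMap.rTensor_tmul, TensorProduct.lid_tmul,
        smul_eq_mul, evF, LinearMap.comp_apply]
      exact mul_comm _ _
  rw [algAct_εs, h1]
  congr 2
  -- by a Frobenius relation, pairing the first factor of `ι v'` with `w` gives `ι (w v')`
  have h2 := piLin_ioLin_right Q T s (dualMod M) M u (w ⊗ₜ v')
  rw [LinearMap.lTensor_tmul] at h2
  rw [h2]
  have h3 := ioLin_natural Q T s ev (𝟙 u)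
    ((assocA A (dualMod M) M u).symm (piLin Q T s (dualMod M) (tensor M u) (w ⊗ₜ v')))
  have h4 : TensorProduct.map (lA (A := A) ev) (lA (A := A) (𝟙 u)) = (lA ev).rTensor (A ⊗[k] u.carrier) := by
    rw [lA, lA, FDMod.lin_id, LinearMap.lTensor_id]
    rfl
  rw [h4] at h3
  rw [← h3]
  rw [epsA_ioLin_left]
  have h5 := piLin_natural Q T s (𝟙 (dualMod M)) (QuasiTriangular.rightUnitor M).hom (w ⊗ₜ v')
  have h6 : TensorProduct.map (lA (𝟙 (dualMod M))) (lA (QuasiTriangular.rightUnitor M).hom)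
      (w ⊗ₜ v') = w ⊗ₜ v := by
    rw [TensorProduct.map_tmul]
    refine congrArg₂ _ ?_ hv
    rw [lA, FDMod.lin_id, LinearMap.lTensor_id]
    rfl
  rw [h6] at h5
  rw [evA, LinearMap.comp_apply, h5]
  generalize piLin Q T s (dualMod M) (tensor M u) (w ⊗ₜ v') = t
  have h7 : (TensorProduct.lid k u.carrier).toLinearMap ∘ₗ TensorProduct.map (FDMod.lin ev)
      (FDMod.lin (𝟙 u)) ∘ₗ (TensorProduct.assoc k _ _ _).symm.toLinearMap =
      FDMod.lin ev ∘ₗ TensorProduct.map (FDMod.lin (𝟙 (dualMod M)))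
        (FDMod.lin (QuasiTriangular.rightUnitor M).hom) := by
    refine TensorProduct.ext_threefold' fun f m c => ?_
    change f m • c = f (c • m)
    rw [map_smul, smul_eq_mul, smul_eq_mul, mul_comm]
  have h8 := LinearMap.congr_fun (congrArg (LinearMap.lTensor A) h7) t
  rw [LinearMap.lTensor_comp, LinearMap.lTensor_comp, LinearMap.lTensor_comp] at h8
  exact h8

/-- `S(b₁) b₂ = ε_s(b)`: both sides have the same matrix coefficients `ε(b (f, v))`. -/
lemma antipodeB_mul (b : BAlg H s) :
    LinearMap.mul' k _ ((BAlg.antipodeB Q T s).rTensor _ (BAlg.comulB Q T s b)) =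
      (weakBialgebraB Q T s).εs b :=
  ext_algAct s fun M v => evF_ext Q T s M fun w => by
    rw [evF_antipodeB_mul, evF_εs]

/-- `S(b₁) b₂ S(b₃) = S(b)`. As `b₂ S(b₃) = ε_t(b₂)`, the left side pairs with `f` and `v` as
`(b₁ f, b₂ η v)`, where `b₁ f ⊗ b₂ η = ι (b π(f ⊗ η))`; a Frobenius relation and the unit law for `η`
reduce this to `(b f, v)`. -/
lemma antipodeB_mul_antipodeB (b : BAlg H s) :
    LinearMap.mul' k _ (TensorProduct.map (BAlg.antipodeB Q T s)
      (LinearMap.mul' k _ ∘ₗ (BAlg.antipodeB Q T s).lTensor _)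
      ((BAlg.comulB Q T s).lTensor _ (BAlg.comulB Q T s b))) = BAlg.antipodeB Q T s b := by
  let u := QuasiTriangular.unit k H
  have h0 : ∀ z : BAlg H s ⊗[k] BAlg H s, TensorProduct.map (BAlg.antipodeB Q T s)
      (LinearMap.mul' k _ ∘ₗ (BAlg.antipodeB Q T s).lTensor _) ((BAlg.comulB Q T s).lTensor _ z) =
      TensorProduct.map (BAlg.antipodeB Q T s) (weakBialgebraB Q T s).εt z := by
    intro z
    induction z with
    | zero => simp
    | add z w hz hw => simp only [map_add, hz, hw]
    | tmul b c =>
      rw [LinearMap.lTensor_tmul, TensorProduct.map_tmul, TensorProduct.map_tmul,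
        LinearMap.comp_apply, mul_antipodeB]
  rw [h0]
  refine ext_algAct s fun M v => evF_ext Q T s M fun w => ?_
  have h1 : ∀ z : BAlg H s ⊗[k] BAlg H s, evF Q T s M (w ⊗ₜ algAct s M (LinearMap.mul' k _
      (TensorProduct.map (BAlg.antipodeB Q T s) (weakBialgebraB Q T s).εt z)) v) =
      evF Q T s M ((lA (QuasiTriangular.leftUnitor M).hom).lTensor _
        ((piLin Q T s u M).lTensor _ (TensorProduct.assoc k _ _ _
          (pairRep (algAct s (dualMod M)) (algAct s u) z (w ⊗ₜ etaA k A) ⊗ₜ v)))) := by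
    intro z
    induction z with
    | zero => simp
    | add z w hz hw => simp only [map_add, LinearMap.add_apply, TensorProduct.tmul_add,
        TensorProduct.add_tmul, hz, hw]
    | tmul b c =>
      rw [TensorProduct.map_tmul, LinearMap.mul'_apply, map_mul, Module.End.mul_apply,
        ← evF_antipodeB, algAct_εt, pairRep_tmul_tmul, TensorProduct.assoc_tmul,
        LinearMap.lTensor_tmul, LinearMap.lTensor_tmul]
      rfl
  rw [h1, ← evF_antipodeB, pairRep_comulB]
  -- `t` represents `b w` in `A ⊗ (M* ⊗ k)`
  let t := algAct s (tensor (dualMod M) u) b (piLin Q T s (dualMod M) u (w ⊗ₜ etaA k A))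
  have ht : (TensorProduct.rid k (dualMod M).carrier).toLinearMap.lTensor A t =
      algAct s (dualMod M) b w := by
    rw [rid_algAct, piLin_one_right]
  have h2 := piLin_ioLin_left Q T s (dualMod M) u M (t ⊗ₜ v)
  rw [LinearMap.rTensor_tmul] at h2
  rw [h2]
  have h3 := ioLin_natural Q T s (𝟙 (dualMod M)) (QuasiTriangular.leftUnitor M).hom
    (assocA A (dualMod M) u M (piLin Q T s (tensor (dualMod M) u) M (t ⊗ₜ v)))
  have h4 : TensorProduct.map (lA (A := A) (𝟙 (dualMod M)))
      (lA (A := A) (QuasiTriangular.leftUnitor M).hom) =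
      (lA (QuasiTriangular.leftUnitor M).hom).lTensor (A ⊗[k] (dualMod M).carrier) := by
    rw [lA, lA, FDMod.lin_id, LinearMap.lTensor_id]
    rfl
  rw [h4] at h3
  rw [← h3]
  have h5 := piLin_natural Q T s (QuasiTriangular.rightUnitor (dualMod M)).hom (𝟙 M) (t ⊗ₜ v)
  have h6 : TensorProduct.map (lA (QuasiTriangular.rightUnitor (dualMod M)).hom) (lA (𝟙 M))
      (t ⊗ₜ v) = algAct s (dualMod M) b w ⊗ₜ v := by
    rw [TensorProduct.map_tmul]
    refine congrArg₂ _ ht ?_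
    rw [lA, FDMod.lin_id, LinearMap.lTensor_id]
    rfl
  rw [h6] at h5
  rw [evF, LinearMap.comp_apply, LinearMap.comp_apply, LinearMap.comp_apply, LinearMap.comp_apply,
    piLin_ioLin, h5]
  generalize piLin Q T s (tensor (dualMod M) u) M (t ⊗ₜ v) = x
  have h7 : TensorProduct.map (FDMod.lin (𝟙 (dualMod M)))
      (FDMod.lin (QuasiTriangular.leftUnitor M).hom) ∘ₗ
      (TensorProduct.assoc k (dualMod M).carrier u.carrier M.carrier).toLinearMap =
      TensorProduct.map (FDMod.lin (QuasiTriangular.rightUnitor (dualMod M)).hom)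
        (FDMod.lin (𝟙 M)) := by
    refine TensorProduct.ext_threefold fun f c m => ?_
    change f ⊗ₜ (c • m) = (c • f) ⊗ₜ m
    rw [TensorProduct.smul_tmul]
  have h8 := LinearMap.congr_fun (congrArg (LinearMap.lTensor A) h7) x
  rw [LinearMap.lTensor_comp] at h8
  exact congrArg (fun y => epsA s ((FDMod.lin (evMor M)).lTensor A y)) h8

end weakHopf

end WeakHopf

/-! ### The quasi-triangularity axioms -/

namespace WeakHopf

open Coalgebra HopfAlgebra HopfConv QuasiTriangular

section quasi
variable {k H A : Type u} [Field k] [CharZero k] [Ring H] [HopfAlgebra k H] [IsSemisimpleRing H]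
  [Ring A] [Algebra k A] (Q : QuasiTriangular k H) (T : ModuleAlgebra k H A)
  (s : SymmSepIdempotent k A)

lemma ioLin_piLin_brLin (M N : FDMod k H) (t : (A ⊗[k] M.carrier) ⊗[k] (A ⊗[k] N.carrier)) :
    ioLin Q T s N M (piLin Q T s N M (brLin Q T s M N t)) = brLin Q T s M N t := by
  rw [brLin, LinearMap.comp_apply, piLin_ioLin]

lemma brLin_ioLin (M N : FDMod k H) (t : A ⊗[k] (M.carrier ⊗[k] N.carrier)) :
    brLin Q T s M N (ioLin Q T s M N t) =
      ioLin Q T s N M ((flipAct M.ρ N.ρ Q.R).lTensor A t) := by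
  rw [brLin, LinearMap.comp_apply, LinearMap.comp_apply, piLin_ioLin]

lemma comm_mul_RB_mul :
    TensorProduct.comm k _ _ (BAlg.comulB Q T s 1) * BAlg.RB Q T s * BAlg.comulB Q T s 1 =
      BAlg.RB Q T s := by
  refine ext_flipAct s fun M N t => ?_
  rw [flipAct_mul, flipAct_comm_mul, flipAct_RB, flipAct_RB, pairRep_comulB_one,
    pairRep_comulB_one, ioLin_piLin_brLin, brLin_ioLin]
  rfl

/-- The intertwining property of `R_B` is the `H`-linearity of the braiding of `M` and `N`. -/
lemma RB_mul_comulB (b : BAlg H s) : BAlg.RB Q T s * BAlg.comulB Q T s b =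
    TensorProduct.comm k _ _ (BAlg.comulB Q T s b) * BAlg.RB Q T s := by
  refine ext_flipAct s fun M N t => ?_
  rw [flipAct_mul, flipAct_comm_mul, flipAct_RB, flipAct_RB, pairRep_comulB, pairRep_comulB,
    brLin_ioLin, brLin, LinearMap.comp_apply, LinearMap.comp_apply, piLin_ioLin]
  exact congrArg _ (algAct_natural s (M := tensor M N) (N := tensor N M)
    (Q.braid M N).hom b (piLin Q T s M N t))

/-- `(Δ ⊗ id)(R_B) = R₁₃ R₂₃` is the first hexagon for the transported braiding. -/
lemma comulB_rTensor_RB :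
    TensorProduct.assoc k _ _ _ ((BAlg.comulB Q T s).rTensor _ (BAlg.RB Q T s)) =
      leg13 _ (BAlg.RB Q T s) * leg23 _ (BAlg.RB Q T s) := by
  refine ext_algAct₃ s fun M N P t => ?_
  apply (TensorProduct.assoc k _ _ _).symm.injective
  apply (TensorProduct.comm k _ _).injective
  apply (TensorProduct.assoc k _ _ _).symm.injective
  rw [hexagon_aux₂, ← assoc_pairRep, LinearEquiv.symm_apply_apply, pairRep_comulB_rTensor]
  have h1 : ∀ (M N : FDMod k H), flipAct (algAct s M) (algAct s N) (BAlg.RB Q T s) =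
    brLin Q T s M N := fun M N => LinearMap.ext (flipAct_RB Q T s M N)
  have h2 := flipAct_RB Q T s (tensor M N) P ((piLin Q T s M N).rTensor _ t)
  rw [flipAct_apply] at h2
  have h3 : ∀ x, TensorProduct.comm k _ _ ((ioLin Q T s M N).rTensor (A ⊗[k] P.carrier) x) =
      (ioLin Q T s M N).lTensor _ (TensorProduct.comm k _ _ x) := fun x =>
    (LinearMap.congr_fun (LinearMap.lTensor_comp_comm (ioLin Q T s M N)) x).symm
  rw [h1, h1, h3, h2, brLin_tensor_left, LinearEquiv.symm_apply_apply]

/-- `(id ⊗ Δ)(R_B) = R₁₃ R₁₂` is the second hexagon for the transported braiding. -/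
lemma comulB_lTensor_RB :
    (BAlg.comulB Q T s).lTensor _ (BAlg.RB Q T s) =
      leg13 _ (BAlg.RB Q T s) * leg12 _ (BAlg.RB Q T s) := by
  refine ext_algAct₃ s fun M N P t => ?_
  apply (TensorProduct.comm k _ _).injective
  apply (TensorProduct.assoc k _ _ _).injective
  rw [hexagon_aux₁, pairRep_comulB_lTensor]
  have h1 : ∀ (M N : FDMod k H), flipAct (algAct s M) (algAct s N) (BAlg.RB Q T s) =
    brLin Q T s M N := fun M N => LinearMap.ext (flipAct_RB Q T s M N)
  have h2 := flipAct_RB Q T s M (tensor N P)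
    ((piLin Q T s N P).lTensor _ (TensorProduct.assoc k _ _ _ t))
  rw [flipAct_apply] at h2
  have h3 : ∀ x, TensorProduct.comm k _ _ ((ioLin Q T s N P).lTensor (A ⊗[k] M.carrier) x) =
      (ioLin Q T s N P).rTensor _ (TensorProduct.comm k _ _ x) := fun x =>
    (LinearMap.congr_fun (LinearMap.rTensor_comp_comm (ioLin Q T s N P)) x).symm
  rw [h1, h1, h3, h2, brLin_tensor_right, LinearEquiv.apply_symm_apply,
    LinearEquiv.symm_apply_apply]

/-- Right multiplication by `R_B` is injective on `(B ⊗ B) Δᶜᵒᵖ(1)`. -/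
lemma mul_RB_injective {z w : BAlg H s ⊗[k] BAlg H s}
    (hz : z * TensorProduct.comm k _ _ (BAlg.comulB Q T s 1) = z)
    (hw : w * TensorProduct.comm k _ _ (BAlg.comulB Q T s 1) = w)
    (h : z * BAlg.RB Q T s = w * BAlg.RB Q T s) : z = w := by
  have hR := Q.isUnit_R
  refine ext_algAct₂ s fun M N t => ?_
  -- `Δᶜᵒᵖ(1) t` is in the image of `R_B`, since the braiding of `M` and `N` is bijective
  obtain ⟨y, hy⟩ : ∃ y, pairRep (algAct s M) (algAct s N)
      (TensorProduct.comm k _ _ (BAlg.comulB Q T s 1)) t =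
      pairRep (algAct s M) (algAct s N) (BAlg.RB Q T s) y := by
    let br := (QuasiTriangular.braid Q M N)
    refine ⟨ioLin Q T s M N ((FDMod.lin br.inv).lTensor A
      (piLin Q T s N M (TensorProduct.comm k _ _ t))), ?_⟩
    apply (TensorProduct.comm k _ _).injective
    rw [comm_pairRep, TensorProduct.comm_comm, pairRep_comulB_one, ← flipAct_apply, flipAct_RB,
      brLin_ioLin]
    have e : (flipAct M.ρ N.ρ Q.R) ∘ₗ (FDMod.lin br.inv) = LinearMap.id :=
      congrArg FDMod.lin br.inv_hom_id
    rw [← LinearMap.comp_apply (LinearMap.lTensor A _), ← LinearMap.lTensor_comp, e,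
      LinearMap.lTensor_id, LinearMap.id_apply]
  rw [← hz, ← hw, pairRep_mul, pairRep_mul, hy, ← pairRep_mul, ← pairRep_mul, h]

/-- The weak inverse of `R_B`: an injective endomorphism of a finite-dimensional space of tensors hits
`Δ(1)`. -/
lemma exists_inverse_RB : ∃ R' : BAlg H s ⊗[k] BAlg H s,
    BAlg.comulB Q T s 1 * R' * TensorProduct.comm k _ _ (BAlg.comulB Q T s 1) = R' ∧
    BAlg.RB Q T s * R' = TensorProduct.comm k _ _ (BAlg.comulB Q T s 1) ∧
    R' * BAlg.RB Q T s = BAlg.comulB Q T s 1 := by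
  have := s.finite
  have := finite_of_isSemisimpleRing k H
  have : Module.Finite k (BAlg H s) :=
    inferInstanceAs (Module.Finite k (A ⊗[k] (H ⊗[k] Module.Dual k A)))
  set e := BAlg.comulB Q T s 1 with he
  set e' := TensorProduct.comm k _ _ e with he'
  set R := BAlg.RB Q T s with hR
  have hcomm : ∀ z w : BAlg H s ⊗[k] BAlg H s, TensorProduct.comm k _ _ (z * w) =
      TensorProduct.comm k _ _ z * TensorProduct.comm k _ _ w :=
    map_mul (Algebra.TensorProduct.comm k (BAlg H s) (BAlg H s))
  have hee : e * e = e := by rw [he, ← comulB_mul, one_mul]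
  have hee' : e' * e' = e' := by rw [he', ← hcomm, hee]
  have hRR : e' * R * e = R := comm_mul_RB_mul Q T s
  have h1 : e' * R = R := by
    conv_rhs => rw [← hRR]
    conv_lhs => rw [← hRR]
    simp only [← mul_assoc, hee']
  have h2 : R * e = R := by
    conv_rhs => rw [← hRR]
    conv_lhs => rw [← hRR]
    simp only [mul_assoc, hee]
  -- `z ↦ (z R)₂₁` is an injective endomorphism of the space of all `z` with `z Δᶜᵒᵖ(1) = z`
  let X : Submodule k (BAlg H s ⊗[k] BAlg H s) :=
    LinearMap.ker (LinearMap.mulRight k e' - LinearMap.id)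
  have hX : ∀ z, z ∈ X ↔ z * e' = z := by
    intro z
    simp [X, sub_eq_zero]
  let f : X →ₗ[k] X := LinearMap.restrict
    ((TensorProduct.comm k _ _).toLinearMap ∘ₗ LinearMap.mulRight k R) (fun z _ => by
      rw [hX, LinearMap.comp_apply, LinearEquiv.coe_coe, LinearMap.mulRight_apply, he', ← hcomm,
        mul_assoc, h2])
  have hf : Function.Injective f := fun z w h =>
    Subtype.ext (mul_RB_injective Q T s ((hX _).1 z.2) ((hX _).1 w.2)
      ((TensorProduct.comm k _ _).injective (congrArg Subtype.val h)))
  obtain ⟨z, hz⟩ := LinearMap.surjective_of_injective hf ⟨e', (hX _).2 hee'⟩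
  have hz' : (z : BAlg H s ⊗[k] BAlg H s) * R = e :=
    (TensorProduct.comm k _ _).injective (congrArg Subtype.val hz)
  have hz2 := (hX _).1 z.2
  have h3 : e * z * R = e := by rw [mul_assoc, hz', hee]
  refine ⟨e * z, ?_, ?_, h3⟩
  · rw [mul_assoc, mul_assoc, hz2, ← mul_assoc, hee]
  · refine mul_RB_injective Q T s ?_ hee' ?_
    · rw [mul_assoc, mul_assoc, hz2]
    · rw [mul_assoc, h3, h2, h1]

/-- The quasi-triangular weak Hopf algebra structure on `B`. -/
def weakHopfB : QuasiTriangularWeakHopf k (BAlg H s) where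
  toWeakBialgebra := weakBialgebraB Q T s
  antipode := BAlg.antipodeB Q T s
  mul_antipode := mul_antipodeB Q T s
  antipode_mul := antipodeB_mul Q T s
  antipode_mul_antipode := antipodeB_mul_antipodeB Q T s
  R := BAlg.RB Q T s
  one_mul_R_mul_one := comm_mul_RB_mul Q T s
  R_mul_comul := RB_mul_comulB Q T s
  comul_rTensor_R := comulB_rTensor_RB Q T s
  comul_lTensor_R := comulB_lTensor_RB Q T s
  exists_inverse := exists_inverse_RB Q T s

lemma isStructureOnB_weakHopfB : IsStructureOnB Q T s (weakHopfB Q T s) where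
  comul_eq := BAlg.comulB_tri Q T s
  counit_eq := BAlg.counitB_tri s
  antipode_eq := BAlg.antipodeB_tri Q T s
  R_eq := rfl

end quasi

end WeakHopf

/-! ### The tensor product over `A` -/

namespace WeakHopf

open Coalgebra HopfAlgebra HopfConv QuasiTriangular

section dual
variable {k H A : Type u} [Field k] [CharZero k] [Ring H] [HopfAlgebra k H] [IsSemisimpleRing H]
  [Ring A] [Algebra k A] (Q : QuasiTriangular k H) (T : ModuleAlgebra k H A)
  (s : SymmSepIdempotent k A)

/-- The isomorphism `A ⊗ M ≃ A* ⊗ M` as a morphism of `B`-modules. -/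
def dualTensorHom (M : FDMod k H) : algTensor s M ⟶ BAlg.dualTensor s M :=
  FDMod.ofLin (M := algTensor s M) (N := BAlg.dualTensor s M) (dualTensorEquiv s M).toLinearMap
    (fun b t => by
      rw [LinearEquiv.coe_coe, algAct_apply, LinearEquiv.apply_symm_apply])

/-- The isomorphism `(A ⊗ M) ⊗ (A ⊗ N) ≃ (A* ⊗ M) ⊗ (A* ⊗ N)`. -/
abbrev dualTensorEquiv₂ (M N : FDMod k H) :
    (A ⊗[k] M.carrier) ⊗[k] (A ⊗[k] N.carrier) ≃ₗ[k]
      (Module.Dual k A ⊗[k] M.carrier) ⊗[k] (Module.Dual k A ⊗[k] N.carrier) :=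
  TensorProduct.congr (dualTensorEquiv s M) (dualTensorEquiv s N)

/-- The map `π`, for the modules `A* ⊗ M`. -/
def piD (M N : FDMod k H) :
    (Module.Dual k A ⊗[k] M.carrier) ⊗[k] (Module.Dual k A ⊗[k] N.carrier) →ₗ[k]
      Module.Dual k A ⊗[k] (M.carrier ⊗[k] N.carrier) :=
  (dualTensorEquiv s (tensor M N)).toLinearMap ∘ₗ piLin Q T s M N ∘ₗ
    (dualTensorEquiv₂ s M N).symm.toLinearMap

/-- The map `ι`, for the modules `A* ⊗ M`. -/
def ioD (M N : FDMod k H) : Module.Dual k A ⊗[k] (M.carrier ⊗[k] N.carrier) →ₗ[k]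
    (Module.Dual k A ⊗[k] M.carrier) ⊗[k] (Module.Dual k A ⊗[k] N.carrier) :=
  (dualTensorEquiv₂ s M N).toLinearMap ∘ₗ ioLin Q T s M N ∘ₗ
    (dualTensorEquiv s (tensor M N)).symm.toLinearMap

lemma piD_equiv (M N : FDMod k H) (t : (A ⊗[k] M.carrier) ⊗[k] (A ⊗[k] N.carrier)) :
    piD Q T s M N (dualTensorEquiv₂ s M N t) =
      dualTensorEquiv s (tensor M N) (piLin Q T s M N t) := by
  rw [piD, LinearMap.comp_apply, LinearMap.comp_apply, LinearEquiv.coe_coe, LinearEquiv.coe_coe,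
    LinearEquiv.symm_apply_apply]

lemma ioD_equiv (M N : FDMod k H) (t : A ⊗[k] (M.carrier ⊗[k] N.carrier)) :
    ioD Q T s M N (dualTensorEquiv s (tensor M N) t) =
      dualTensorEquiv₂ s M N (ioLin Q T s M N t) := by
  rw [ioD, LinearMap.comp_apply, LinearMap.comp_apply, LinearEquiv.coe_coe, LinearEquiv.coe_coe,
    LinearEquiv.symm_apply_apply]

lemma piD_ioD (M N : FDMod k H) (t : Module.Dual k A ⊗[k] (M.carrier ⊗[k] N.carrier)) :
    piD Q T s M N (ioD Q T s M N t) = t := by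
  obtain ⟨t, rfl⟩ := (dualTensorEquiv s (tensor M N)).surjective t
  rw [ioD_equiv, piD_equiv, piLin_ioLin]

/-- `b (v ⊗ w) = ι (b π (v ⊗ w))` -/
lemma act_eq_ioD (M N : FDMod k H) (b : BAlg H s)
    (t : (Module.Dual k A ⊗[k] M.carrier) ⊗[k] (Module.Dual k A ⊗[k] N.carrier)) :
    (weakHopfB Q T s).act (BAlg.dualTensor s M) (BAlg.dualTensor s N) b t =
      ioD Q T s M N ((BAlg.dualTensor s (tensor M N)).ρ b (piD Q T s M N t)) := by
  obtain ⟨t, rfl⟩ := (dualTensorEquiv₂ s M N).surjective t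
  have h1 := (weakHopfB Q T s).map_act (dualTensorHom s M) (dualTensorHom s N) b t
  have h2 := pairRep_comulB Q T s M N b t
  have h3 := FDMod.lin_ρ (dualTensorHom s (tensor M N)) b (piLin Q T s M N t)
  rw [piD_equiv]
  refine h1.symm.trans ((congrArg (dualTensorEquiv₂ s M N) h2).trans ?_)
  rw [← ioD_equiv]
  exact congrArg _ h3

lemma act_one_eq_ioD (M N : FDMod k H)
    (t : (Module.Dual k A ⊗[k] M.carrier) ⊗[k] (Module.Dual k A ⊗[k] N.carrier)) :
    (weakHopfB Q T s).act (BAlg.dualTensor s M) (BAlg.dualTensor s N) 1 t =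
      ioD Q T s M N (piD Q T s M N t) := by
  rw [act_eq_ioD, map_one, Module.End.one_apply]

lemma ker_act_one (M N : FDMod k H) :
    LinearMap.ker ((weakHopfB Q T s).act (BAlg.dualTensor s M) (BAlg.dualTensor s N) 1) =
      LinearMap.ker (piD Q T s M N) := by
  ext t
  rw [LinearMap.mem_ker, LinearMap.mem_ker, act_one_eq_ioD]
  constructor
  · intro h
    rw [← piD_ioD Q T s M N (piD Q T s M N t), h, map_zero]
  · intro h
    rw [h, map_zero]

/-- The right action `(c ⊗ m) a = c (R² a) ⊗ R¹ m` of `A` on `A ⊗ M`. -/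
def rightAlg (M : FDMod k H) (a : A) : Module.End k (A ⊗[k] M.carrier) :=
  ∑ p ∈ reps Q.R, TensorProduct.map (LinearMap.mulRight k (T.act p.2 a)) (M.ρ p.1)

lemma rightAlg_tmul (M : FDMod k H) (a c : A) (m : M.carrier) :
    rightAlg Q T M a (c ⊗ₜ m) = ∑ p ∈ reps Q.R, (c * T.act p.2 a) ⊗ₜ M.ρ p.1 m := by
  simp [rightAlg, LinearMap.sum_apply]

lemma rightA_equiv (M : FDMod k H) (a : A) (v : A ⊗[k] M.carrier) :
    rightA Q T M a (dualTensorEquiv s M v) = dualTensorEquiv s M (rightAlg Q T M a v) := by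
  induction v with
  | zero => simp
  | add z w hz hw => simp only [map_add, hz, hw]
  | tmul c m =>
    rw [rightAlg_tmul, map_sum, dualTensorEquiv_tmul, rightA, sw, LinearMap.sum_apply]
    refine Finset.sum_congr rfl fun p _ => ?_
    rw [TensorProduct.map_tmul, dualTensorEquiv_tmul]
    exact congrArg (· ⊗ₜ[k] M.ρ p.1 m) (s.rharp_toDual _ _)

lemma leftA_equiv (M : FDMod k H) (a : A) (v : A ⊗[k] M.carrier) :
    leftA M a (dualTensorEquiv s M v) =
      dualTensorEquiv s M ((LinearMap.mulLeft k a).rTensor M.carrier v) := by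
  induction v with
  | zero => simp
  | add z w hz hw => simp only [map_add, hz, hw]
  | tmul c m =>
    rw [LinearMap.rTensor_tmul, dualTensorEquiv_tmul, dualTensorEquiv_tmul, leftA,
      LinearMap.rTensor_tmul]
    exact congrArg (· ⊗ₜ[k] m) (s.lharp_toDual _ _)

/-- The map `π` is balanced over `A`. This is the axiom `(id ⊗ Δ)(R) = R₁₃ R₁₂`. -/
lemma piLin_rightAlg (M N : FDMod k H) (a : A) (v : A ⊗[k] M.carrier) (w : A ⊗[k] N.carrier) :
    piLin Q T s M N (rightAlg Q T M a v ⊗ₜ w) =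
      piLin Q T s M N (v ⊗ₜ (LinearMap.mulLeft k a).rTensor N.carrier w) := by
  induction v with
  | zero => simp
  | add z w hz hw => simp only [map_add, TensorProduct.add_tmul, hz, hw]
  | tmul c m =>
  induction w with
  | zero => simp
  | add z w hz hw => simp only [map_add, TensorProduct.tmul_add, hz, hw]
  | tmul d n =>
    let φ : A ⊗[k] A →ₗ[k] A := LinearMap.mulLeft k c ∘ₗ LinearMap.mul' k A
    let Φ : H ⊗[k] (H ⊗[k] H) →ₗ[k] A ⊗[k] (M.carrier ⊗[k] N.carrier) :=
      (TensorProduct.comm k _ _).toLinearMap ∘ₗ TensorProduct.map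
        ((TensorProduct.mk k M.carrier N.carrier).flip n ∘ₗ M.ρ.toLinearMap.flip m)
        (φ ∘ₗ (pairRep T.act T.act).toLinearMap.flip (a ⊗ₜ d))
    have h1 : ∀ g u v, Φ (g ⊗ₜ (u ⊗ₜ v)) =
        (c * (T.act u a * T.act v d)) ⊗ₜ (M.ρ g m ⊗ₜ n) := fun g u v => rfl
    have h2 : ∀ z : H ⊗[k] H, Φ ((comul (R := k)).lTensor H z) =
        ∑ p ∈ reps z, (c * T.act p.2 (a * d)) ⊗ₜ (M.ρ p.1 m ⊗ₜ n) := by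
      intro z
      conv_lhs => rw [← sum_reps z]
      simp only [map_sum]
      refine Finset.sum_congr rfl fun p _ => ?_
      rw [LinearMap.lTensor_tmul, T.act_mul_eq]
      rfl
    have h3 := h2 Q.R
    rw [Q.comul_lTensor_R] at h3
    conv_lhs at h3 => rw [← sum_reps Q.R]
    simp only [map_sum, leg13_tmul, leg12_tmul, Finset.sum_mul_sum,
      Algebra.TensorProduct.tmul_mul_tmul, one_mul, mul_one, h1, map_mul,
      Module.End.mul_apply] at h3
    rw [LinearMap.rTensor_tmul, LinearMap.mulLeft_apply, piLin_tmul, ← h3, rightAlg_tmul,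
      TensorProduct.sum_tmul, map_sum, Finset.sum_comm]
    refine Finset.sum_congr rfl fun p _ => ?_
    rw [piLin_tmul]
    simp only [mul_assoc]

/-- The kernel of `Δ(1)` on `F(M) ⊗ F(N)` is the space of relations defining `F(M) ⊗_A F(N)`. -/
theorem ker_act_one_eq_balanced (M N : FDMod k H) :
    LinearMap.ker ((weakHopfB Q T s).act (BAlg.dualTensor s M) (BAlg.dualTensor s N) 1) =
      balanced Q T M N := by
  rw [ker_act_one]
  refine le_antisymm (fun t ht => ?_) (Submodule.span_le.2 ?_)
  · -- modulo the relations, `t` is the image of `π t` under `c ⊗ (m ⊗ n) ↦ (c ⊗ m) ⊗ (1 ⊗ n)`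
    obtain ⟨t, rfl⟩ := (dualTensorEquiv₂ s M N).surjective t
    rw [LinearMap.mem_ker, piD_equiv, LinearEquiv.map_eq_zero_iff] at ht
    let σ : A ⊗[k] (M.carrier ⊗[k] N.carrier) →ₗ[k] (A ⊗[k] M.carrier) ⊗[k] (A ⊗[k] N.carrier) :=
      (TensorProduct.mk k A N.carrier 1).lTensor _ ∘ₗ
        (TensorProduct.assoc k A M.carrier N.carrier).symm.toLinearMap
    have key : ∀ t : (A ⊗[k] M.carrier) ⊗[k] (A ⊗[k] N.carrier),
        dualTensorEquiv₂ s M N (σ (piLin Q T s M N t) - t) ∈ balanced Q T M N := by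
      intro t
      induction t with
      | zero => simp
      | add z w hz hw =>
        have := add_mem hz hw
        rw [← map_add] at this
        convert this using 2
        rw [map_add, map_add]
        abel
      | tmul v w =>
      induction v with
      | zero => simp
      | add x y hx hy =>
        have := add_mem hx hy
        rw [← map_add] at this
        convert this using 2
        rw [TensorProduct.add_tmul, map_add, map_add]
        abel
      | tmul c m =>
      induction w with
      | zero => simp
      | add x y hx hy =>
        have := add_mem hx hy
        rw [← map_add] at this
        convert this using 2
        rw [TensorProduct.tmul_add, map_add, map_add]
        abel
      | tmul d n =>
        refine Submodule.subset_span ⟨dualTensorEquiv s M (c ⊗ₜ m),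
          dualTensorEquiv s N (1 ⊗ₜ n), d, ?_⟩
        rw [rightA_equiv, leftA_equiv, LinearMap.rTensor_tmul, LinearMap.mulLeft_apply, mul_one,
          rightAlg_tmul, piLin_tmul, map_sub, map_sum, map_sum, map_sum, TensorProduct.sum_tmul]
        rfl
    have := key t
    rw [ht, map_zero, zero_sub, map_neg, neg_mem_iff] at this
    exact this
  · rintro _ ⟨v, w, a, rfl⟩
    obtain ⟨v, rfl⟩ := (dualTensorEquiv s M).surjective v
    obtain ⟨w, rfl⟩ := (dualTensorEquiv s N).surjective w
    have e : ∀ v w, dualTensorEquiv s M v ⊗ₜ dualTensorEquiv s N w =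
      dualTensorEquiv₂ s M N (v ⊗ₜ w) := fun _ _ => rfl
    rw [SetLike.mem_coe, LinearMap.mem_ker, rightA_equiv, leftA_equiv, e, e, map_sub, piD_equiv,
      piD_equiv, piLin_rightAlg, sub_self]

end dual

end WeakHopf

/-! ### Morita equivalence and simplicity of the unit -/

namespace WeakHopf

open Coalgebra HopfAlgebra HopfConv QuasiTriangular

section morita
variable {k H A : Type u} [Field k] [CharZero k] [Ring H] [HopfAlgebra k H] [IsSemisimpleRing H]
  [Ring A] [Algebra k A] (Q : QuasiTriangular k H)
  (s : SymmSepIdempotent k A) (W : QuasiTriangularWeakHopf k (BAlg H s))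

/-- The map `φ ⊗ m ↦ φ(a) m`. -/
def evAt (M : FDMod k H) (a : A) : Module.Dual k A ⊗[k] M.carrier →ₗ[k] M.carrier :=
  (TensorProduct.lid k M.carrier).toLinearMap ∘ₗ (Module.Dual.eval k A a).rTensor M.carrier

lemma evAt_tmul (M : FDMod k H) (a : A) (φ : Module.Dual k A) (m : M.carrier) :
    evAt M a (φ ⊗ₜ m) = φ a • m := rfl

lemma dualTensor_ρ_tri_eq_evAt (M : FDMod k H) (a : A) (h : H) (φ : Module.Dual k A)
    (t : Module.Dual k A ⊗[k] M.carrier) :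
    (BAlg.dualTensor s M).ρ (BAlg.tri s a h φ) t = φ ⊗ₜ M.ρ h (evAt M a t) := by
  refine TensorProduct.induction_on t ?_ (fun ψ m => ?_) (fun y z hy hz => ?_)
  · simp
  · rw [BAlg.dualTensor_ρ_tri, evAt_tmul, map_smul, TensorProduct.tmul_smul]
  · rw [map_add, map_add, map_add, TensorProduct.tmul_add, hy, hz]

lemma exists_α_eq_one [Nontrivial A] : ∃ a : A, s.α a = 1 := by
  by_contra! h
  have h0 : s.α = 0 := by
    ext a
    by_contra ha
    refine h ((s.α a)⁻¹ • a) ?_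
    rw [map_smul, smul_eq_mul, inv_mul_cancel₀ ha]
  have h1 := s.toDual_one
  rw [h0, LinearEquiv.map_eq_zero_iff] at h1
  exact one_ne_zero h1

lemma functorF_faithful [Nontrivial A] : (functorF Q s W).Faithful where
  map_injective := by
    intro (M : FDMod k H) (N : FDMod k H) f g h
    obtain ⟨a, ha⟩ := exists_α_eq_one s
    refine FDMod.hom_ext (LinearMap.ext fun m => ?_)
    have h1 : (FDMod.lin (k := k) (B := H) f).lTensor (Module.Dual k A) (s.α ⊗ₜ m) =
        (FDMod.lin (k := k) (B := H) g).lTensor (Module.Dual k A) (s.α ⊗ₜ m) :=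
      LinearMap.congr_fun (congrArg (FDMod.lin (M := BAlg.dualTensor s M)
        (N := BAlg.dualTensor s N)) h) (s.α ⊗ₜ m)
    have h2 := congrArg (evAt N a) h1
    rwa [LinearMap.lTensor_tmul, LinearMap.lTensor_tmul, evAt_tmul, evAt_tmul, ha, one_smul,
      one_smul] at h2

/-- A `B`-linear map `g` commutes with `a ⊗ 1 ⊗ φ`, where `α(a) = 1`, so that `g(φ ⊗ m) = φ ⊗ f(m)` for
the map `f(m)` obtained by evaluating `g(α ⊗ m)` at `a`. -/
lemma functorF_full [Nontrivial A] : (functorF Q s W).Full where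
  map_surjective := by
    intro (M : FDMod k H) (N : FDMod k H) g
    obtain ⟨a, ha⟩ := exists_α_eq_one s
    let g' : BAlg.dualTensor s M ⟶ BAlg.dualTensor s N := g
    let f : M.carrier →ₗ[k] N.carrier :=
      evAt N a ∘ₗ FDMod.lin g' ∘ₗ TensorProduct.mk k (Module.Dual k A) M.carrier s.α
    have key : ∀ (h : H) (φ : Module.Dual k A) (m : M.carrier),
        FDMod.lin g' (φ ⊗ₜ M.ρ h m) = φ ⊗ₜ N.ρ h (f m) := by
      intro h φ m
      have h1 := FDMod.lin_ρ g' (BAlg.tri s a h φ) (s.α ⊗ₜ m)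
      rw [BAlg.dualTensor_ρ_tri, ha, one_smul, dualTensor_ρ_tri_eq_evAt] at h1
      exact h1
    refine ⟨FDMod.ofLin (M := M) (N := N) f fun h m => ?_,
      FDMod.hom_ext (M := BAlg.dualTensor s M) (N := BAlg.dualTensor s N)
        (TensorProduct.ext' fun φ m => ?_)⟩
    · have h1 := congrArg (evAt N a) (key h s.α m)
      rw [evAt_tmul, ha, one_smul] at h1
      exact h1
    · have h1 := key 1 φ m
      rw [map_one, map_one, Module.End.one_apply, Module.End.one_apply] at h1
      exact h1.symm

/-- The `H`-module `e V` for the idempotent `e = a ⊗ 1 ⊗ α` of `B`, where `α(a) = 1`; an element `h`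
acts by `a ⊗ h ⊗ α`. -/
def cornerMod (a : A) (ha : s.α a = 1) (V : FDMod k (BAlg H s)) : FDMod k H where
  carrier := LinearMap.range (V.ρ (BAlg.tri s a 1 s.α))
  ρ := AlgHom.ofLinearMap
    { toFun := fun h => (V.ρ (BAlg.tri s a h s.α)).restrict (fun v _ => by
        refine ⟨V.ρ (BAlg.tri s a h s.α) v, ?_⟩
        rw [← Module.End.mul_apply, ← map_mul, BAlg.tri_mul_tri, ha, one_smul, one_mul])
      map_add' := fun g h => LinearMap.ext fun v => Subtype.ext (by
        change V.ρ (triLin s a (g + h) s.α) v.1 =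
          V.ρ (triLin s a g s.α) v.1 + V.ρ (triLin s a h s.α) v.1
        rw [map_add, LinearMap.add_apply, map_add, LinearMap.add_apply])
      map_smul' := fun r h => LinearMap.ext fun v => Subtype.ext (by
        change V.ρ (triLin s a (r • h) s.α) v.1 = r • V.ρ (triLin s a h s.α) v.1
        rw [map_smul, LinearMap.smul_apply, map_smul, LinearMap.smul_apply]) }
    (LinearMap.ext fun v => Subtype.ext (by
      obtain ⟨_, v, rfl⟩ := v
      change V.ρ _ (V.ρ _ v) = V.ρ _ v
      rw [← Module.End.mul_apply, ← map_mul, BAlg.tri_mul_tri, ha, one_smul, one_mul]))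
    (fun g h => LinearMap.ext fun v => Subtype.ext (by
      change V.ρ _ (v : V.carrier) = V.ρ _ (V.ρ _ (v : V.carrier))
      rw [← Module.End.mul_apply, ← map_mul, BAlg.tri_mul_tri, ha, one_smul]))

/-- The inclusion `e V → V`. -/
def cornerIncl (a : A) (ha : s.α a = 1) (V : FDMod k (BAlg H s)) :
    (cornerMod s a ha V).carrier →ₗ[k] V.carrier :=
  (LinearMap.range (V.ρ (BAlg.tri s a 1 s.α))).subtype

lemma cornerIncl_injective (a : A) (ha : s.α a = 1) (V : FDMod k (BAlg H s)) :
    Function.Injective (cornerIncl s a ha V) := Submodule.injective_subtype _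

lemma cornerIncl_ρ (a : A) (ha : s.α a = 1) (V : FDMod k (BAlg H s)) (h : H)
    (m : (cornerMod s a ha V).carrier) :
    cornerIncl s a ha V ((cornerMod s a ha V).ρ h m) =
      V.ρ (BAlg.tri s a h s.α) (cornerIncl s a ha V m) := rfl

lemma tri_one_cornerIncl (a : A) (ha : s.α a = 1) (V : FDMod k (BAlg H s))
    (m : (cornerMod s a ha V).carrier) :
    V.ρ (BAlg.tri s a 1 s.α) (cornerIncl s a ha V m) = cornerIncl s a ha V m := by
  rw [← cornerIncl_ρ, map_one, Module.End.one_apply]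

/-- The map `v ↦ (b ⊗ 1 ⊗ α) v` from `V` to `e V`. -/
def cornerProj (a : A) (ha : s.α a = 1) (V : FDMod k (BAlg H s)) (b : A) :
    V.carrier →ₗ[k] (cornerMod s a ha V).carrier :=
  (V.ρ (BAlg.tri s b 1 s.α)).codRestrict (LinearMap.range (V.ρ (BAlg.tri s a 1 s.α))) (fun v => by
    refine ⟨V.ρ (BAlg.tri s b 1 s.α) v, ?_⟩
    rw [← Module.End.mul_apply, ← map_mul, BAlg.tri_mul_tri, ha, one_smul, one_mul])

lemma cornerIncl_cornerProj (a : A) (ha : s.α a = 1) (V : FDMod k (BAlg H s)) (b : A)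
    (v : V.carrier) : cornerIncl s a ha V (cornerProj s a ha V b v) =
      V.ρ (BAlg.tri s b 1 s.α) v := rfl

/-- The map `φ ⊗ m ↦ (a ⊗ 1 ⊗ φ) m` from `A* ⊗ e V` to `V`. -/
def cornerAct (a : A) (ha : s.α a = 1) (V : FDMod k (BAlg H s)) :
    Module.Dual k A ⊗[k] (cornerMod s a ha V).carrier →ₗ[k] V.carrier :=
  TensorProduct.lift ((V.ρ.toLinearMap ∘ₗ triLin s a 1).compl₂ (cornerIncl s a ha V))

lemma cornerAct_tmul (a : A) (ha : s.α a = 1) (V : FDMod k (BAlg H s)) (φ : Module.Dual k A)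
    (m : (cornerMod s a ha V).carrier) :
    cornerAct s a ha V (φ ⊗ₜ m) = V.ρ (BAlg.tri s a 1 φ) (cornerIncl s a ha V m) := rfl

lemma cornerAct_ρ (a : A) (ha : s.α a = 1) (V : FDMod k (BAlg H s)) (b : BAlg H s)
    (t : Module.Dual k A ⊗[k] (cornerMod s a ha V).carrier) :
    cornerAct s a ha V ((BAlg.dualTensor s (cornerMod s a ha V)).ρ b t) =
      V.ρ b (cornerAct s a ha V t) := by
  induction b using BAlg.induction_tri with
  | h0 => simp
  | ha b b' hb hb' => simp only [map_add, LinearMap.add_apply, hb, hb']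
  | ht c h φ =>
  refine TensorProduct.induction_on t ?_ (fun ψ m => ?_) (fun y z hy hz => ?_)
  · simp
  · rw [BAlg.dualTensor_ρ_tri, map_smul, cornerAct_tmul, cornerAct_tmul, cornerIncl_ρ,
      ← Module.End.mul_apply, ← map_mul, BAlg.tri_mul_tri, ha, one_smul, one_mul,
      ← Module.End.mul_apply, ← map_mul, BAlg.tri_mul_tri, map_smul, mul_one]
    rfl
  · simp only [map_add, hy, hz]

lemma sum_toDual_smul (φ : Module.Dual k A) : ∑ x ∈ reps s.x, φ x.1 • s.toDual x.2 = φ := by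
  obtain ⟨c, rfl⟩ := s.toDual.surjective φ
  have h := congrArg s.toDual (s.sum_α_mul' c)
  simp only [map_sum, map_smul] at h
  simpa only [s.toDual_apply] using h

/-- The inverse of `A* ⊗ e V → V` is `v ↦ α(- x²) ⊗ (x¹ ⊗ 1 ⊗ α) v`. -/
lemma cornerAct_bijective (a : A) (ha : s.α a = 1) (V : FDMod k (BAlg H s)) :
    Function.Bijective (cornerAct s a ha V) := by
  let g : V.carrier →ₗ[k] Module.Dual k A ⊗[k] (cornerMod s a ha V).carrier :=
    ∑ x ∈ reps s.x, TensorProduct.mk k _ _ (s.toDual x.2) ∘ₗ cornerProj s a ha V x.1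
  have hg : ∀ v, g v = ∑ x ∈ reps s.x, s.toDual x.2 ⊗ₜ cornerProj s a ha V x.1 v := by
    intro v
    simp only [g, LinearMap.sum_apply]
    rfl
  have h1 : ∀ t, g (cornerAct s a ha V t) = t := by
    intro t
    refine TensorProduct.induction_on t ?_ (fun φ m => ?_) (fun y z hy hz => ?_)
    · simp
    · have h2 : ∀ x : A × A, cornerProj s a ha V x.1 (cornerAct s a ha V (φ ⊗ₜ m)) = φ x.1 • m := by
        intro x
        apply cornerIncl_injective
        rw [cornerIncl_cornerProj, cornerAct_tmul, ← Module.End.mul_apply, ← map_mul,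
          BAlg.tri_mul_tri, map_smul, mul_one, LinearMap.smul_apply, tri_one_cornerIncl, map_smul]
      simp only [hg, h2, TensorProduct.tmul_smul, TensorProduct.smul_tmul',
        ← TensorProduct.sum_tmul, sum_toDual_smul]
    · rw [map_add, map_add, hy, hz]
  have h2 : ∀ v, cornerAct s a ha V (g v) = v := by
    intro v
    have h3 : ∀ x : A × A, V.ρ (BAlg.tri s a 1 (s.toDual x.2)) (V.ρ (BAlg.tri s x.1 1 s.α) v) =
        V.ρ (BAlg.tri s x.1 1 (lharp x.2 s.α)) v := by
      intro x
      rw [← Module.End.mul_apply, ← map_mul, BAlg.tri_mul_tri, ha, one_smul, one_mul]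
      rfl
    have h4 := congrArg (fun b => V.ρ b v) (BAlg.one_eq (H := H) s)
    simp only [sw, map_one, Module.End.one_apply, map_sum, LinearMap.sum_apply] at h4
    simp only [hg, map_sum, cornerAct_tmul, cornerIncl_cornerProj, h3]
    exact h4.symm
  exact ⟨Function.LeftInverse.injective h1, Function.RightInverse.surjective h2⟩

lemma functorF_essSurj [Nontrivial A] : (functorF Q s W).EssSurj where
  mem_essImage := by
    intro (V : FDMod k (BAlg H s))
    obtain ⟨a, ha⟩ := exists_α_eq_one s
    exact ⟨(cornerMod s a ha V : FDMod k H),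
      ⟨FDMod.isoOfEquiv (M := BAlg.dualTensor s (cornerMod s a ha V)) (N := V)
        (LinearEquiv.ofBijective _ (cornerAct_bijective s a ha V)) (cornerAct_ρ s a ha V)⟩⟩

/-- `F` is an equivalence of categories. This is the Morita equivalence given by the idempotent
`a ⊗ 1 ⊗ α`, where `α(a) = 1`. -/
theorem functorF_isEquivalence [Nontrivial A] : (functorF Q s W).IsEquivalence where
  faithful := functorF_faithful Q s W
  full := functorF_full Q s W
  essSurj := functorF_essSurj Q s W

lemma functorF_additive : (functorF Q s W).Additive where
  map_add := by
    intro (M : FDMod k H) (N : FDMod k H) f g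
    exact FDMod.hom_ext (M := BAlg.dualTensor s M) (N := BAlg.dualTensor s N)
      (LinearMap.lTensor_add _ _ _)

lemma functorF_linear [(functorF Q s W).Additive] : (functorF Q s W).Linear k where
  map_smul := by
    intro (M : FDMod k H) (N : FDMod k H) f r
    exact FDMod.hom_ext (M := BAlg.dualTensor s M) (N := BAlg.dualTensor s N)
      (LinearMap.lTensor_smul _ _ _)

/-- A nonzero module on which the algebra acts transitively on nonzero vectors is simple. -/
lemma simple_of_transitive (V : FDMod k (BAlg H s)) (v₀ : V.carrier) (hv₀ : v₀ ≠ 0)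
    (hV : ∀ v : V.carrier, v ≠ 0 → ∀ w, ∃ b, V.ρ b v = w) : Simple V where
  mono_isIso_iff_nonzero := by
    intro (Y : FDMod k (BAlg H s)) f _
    let f' : Y ⟶ V := f
    constructor
    · rintro h rfl
      have h1 : (0 : V ⟶ V) = 𝟙 V := by
        have := IsIso.inv_hom_id (0 : Y ⟶ V)
        rwa [Limits.comp_zero] at this
      exact hv₀ (LinearMap.congr_fun (congrArg FDMod.lin h1) v₀).symm
    · intro hf
      -- the kernel of `f` is a submodule, so it vanishes because `f` is a monomorphism
      let K : FDMod k (BAlg H s) :=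
        { carrier := LinearMap.ker (FDMod.lin f')
          ρ := AlgHom.ofLinearMap
            { toFun := fun b => (Y.ρ b).restrict (fun y hy => by
                rw [LinearMap.mem_ker] at hy ⊢
                rw [FDMod.lin_ρ, hy, map_zero])
              map_add' := fun b c => LinearMap.ext fun y => Subtype.ext (by simp)
              map_smul' := fun r c => LinearMap.ext fun y => Subtype.ext (by simp) }
            (LinearMap.ext fun y => Subtype.ext (by simp))
            (fun b c => LinearMap.ext fun y => Subtype.ext (by simp)) }
      let i : K ⟶ Y := FDMod.ofLin (M := K) (N := Y) (LinearMap.ker (FDMod.lin f')).subtype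
        (fun _ _ => rfl)
      have hi : i ≫ f' = 0 := FDMod.hom_ext (LinearMap.ext fun y => y.2)
      have hi0 : i = 0 := by
        have h1 : i ≫ f = 0 ≫ f := by
          rw [Limits.zero_comp]
          exact hi
        exact (cancel_mono f).1 h1
      have hinj : Function.Injective (FDMod.lin f') := by
        rw [← LinearMap.ker_eq_bot, Submodule.eq_bot_iff]
        intro y hy
        exact LinearMap.congr_fun (congrArg FDMod.lin hi0) (⟨y, hy⟩ : LinearMap.ker (FDMod.lin f'))
      have hsurj : Function.Surjective (FDMod.lin f') := by
        intro w
        by_contra! hw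
        refine hf (FDMod.hom_ext (M := Y) (N := V) (LinearMap.ext fun y => ?_))
        by_contra hy
        obtain ⟨b, hb⟩ := hV _ hy w
        exact hw (Y.ρ b y) ((FDMod.lin_ρ f' b y).trans hb)
      have h1 := (FDMod.isoOfEquiv (M := Y) (N := V)
        (LinearEquiv.ofBijective (FDMod.lin f') ⟨hinj, hsurj⟩) (FDMod.lin_ρ f')).isIso_hom
      exact h1

/-- The module `F(k) = A*` is simple: if `φ(b) ≠ 0`, then `φ(b)⁻¹ b ⊗ 1 ⊗ ψ` sends `φ` to `ψ`. -/
lemma simple_dualTensor_unit [Nontrivial A] :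
    Simple (BAlg.dualTensor s (QuasiTriangular.unit k H)) := by
  obtain ⟨a, ha⟩ := exists_α_eq_one s
  refine simple_of_transitive s _ (s.α ⊗ₜ (1 : k)) (fun h => ?_) fun v hv w => ?_
  · have h1 := congrArg (evAt (QuasiTriangular.unit k H) a) h
    rw [evAt_tmul, ha, one_smul, map_zero] at h1
    exact one_ne_zero h1
  · have key : ∀ v : Module.Dual k A ⊗[k] k, ∃ φ : Module.Dual k A, v = φ ⊗ₜ 1 := fun v =>
      ⟨TensorProduct.rid k _ v, ((TensorProduct.rid k _).symm_apply_apply v).symm⟩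
    obtain ⟨φ, rfl⟩ := key v
    obtain ⟨ψ, rfl⟩ := key w
    obtain ⟨b, hb⟩ : ∃ b, φ b ≠ 0 := by
      by_contra! h
      refine hv ?_
      rw [show φ = 0 from LinearMap.ext h, TensorProduct.zero_tmul]
    refine ⟨(φ b)⁻¹ • BAlg.tri s b 1 ψ, ?_⟩
    rw [map_smul, LinearMap.smul_apply, dualTensor_ρ_tri_eq_evAt, evAt_tmul, map_one,
      Module.End.one_apply, TensorProduct.tmul_smul, smul_smul, inv_mul_cancel₀ hb, one_smul]

end morita

end WeakHopf

/-! ### The monoidal structure of the functor -/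

namespace WeakHopf

open Coalgebra HopfAlgebra HopfConv QuasiTriangular

section monoidal
variable {k H A : Type u} [Field k] [CharZero k] [Ring H] [HopfAlgebra k H] [IsSemisimpleRing H]
  [Ring A] [Algebra k A] (Q : QuasiTriangular k H) (T : ModuleAlgebra k H A)
  (s : SymmSepIdempotent k A)

lemma dualTensorEquiv_lTensor {M N : FDMod k H} (f : M.carrier →ₗ[k] N.carrier)
    (t : A ⊗[k] M.carrier) :
    dualTensorEquiv s N (f.lTensor A t) = f.lTensor (Module.Dual k A) (dualTensorEquiv s M t) := by
  induction t with
  | zero => simp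
  | add z w hz hw => simp only [map_add, hz, hw]
  | tmul a m => rfl

lemma piD_natural {M M' N N' : FDMod k H} (f : M ⟶ M') (g : N ⟶ N')
    (t : (Module.Dual k A ⊗[k] M.carrier) ⊗[k] (Module.Dual k A ⊗[k] N.carrier)) :
    piD Q T s M' N' (TensorProduct.map ((FDMod.lin f).lTensor (Module.Dual k A))
      ((FDMod.lin g).lTensor (Module.Dual k A)) t) =
    (TensorProduct.map (FDMod.lin f) (FDMod.lin g)).lTensor (Module.Dual k A)
      (piD Q T s M N t) := by
  obtain ⟨t, rfl⟩ := (dualTensorEquiv₂ s M N).surjective t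
  have h : TensorProduct.map ((FDMod.lin f).lTensor (Module.Dual k A))
      ((FDMod.lin g).lTensor (Module.Dual k A)) (dualTensorEquiv₂ s M N t) =
      dualTensorEquiv₂ s M' N' (TensorProduct.map (lA f) (lA g) t) := by
    induction t with
    | zero => simp
    | add z w hz hw => simp only [map_add, hz, hw]
    | tmul v w =>
      rw [TensorProduct.congr_tmul, TensorProduct.map_tmul, TensorProduct.map_tmul,
        TensorProduct.congr_tmul, dualTensorEquiv_lTensor, dualTensorEquiv_lTensor]
  rw [h, piD_equiv, piD_equiv, piLin_natural]
  exact dualTensorEquiv_lTensor s (M := tensor M N) (N := tensor M' N') _ _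

lemma piD_assoc (M N P : FDMod k H)
    (t : ((Module.Dual k A ⊗[k] M.carrier) ⊗[k] (Module.Dual k A ⊗[k] N.carrier)) ⊗[k]
      (Module.Dual k A ⊗[k] P.carrier)) :
    (TensorProduct.assoc k M.carrier N.carrier P.carrier).toLinearMap.lTensor (Module.Dual k A)
      (piD Q T s (tensor M N) P ((piD Q T s M N).rTensor _ t)) =
    piD Q T s M (tensor N P) ((piD Q T s N P).lTensor _ (TensorProduct.assoc k _ _ _ t)) := by
  obtain ⟨t, rfl⟩ := (TensorProduct.congr (dualTensorEquiv₂ s M N)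
    (dualTensorEquiv s P)).surjective t
  have h2 : (piD Q T s N P).lTensor _ (TensorProduct.assoc k _ _ _
      (TensorProduct.congr (dualTensorEquiv₂ s M N) (dualTensorEquiv s P) t)) =
      dualTensorEquiv₂ s M (tensor N P) ((piLin Q T s N P).lTensor _
        (TensorProduct.assoc k _ _ _ t)) := by
    induction t with
    | zero => simp
    | add z w hz hw => simp only [map_add, hz, hw]
    | tmul v w =>
    induction v with
    | zero => simp
    | add z w hz hw => simp only [map_add, TensorProduct.add_tmul, hz, hw]
    | tmul v v' =>
      have h3 := piD_equiv Q T s N P (v' ⊗ₜ w)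
      rw [TensorProduct.congr_tmul] at h3
      rw [TensorProduct.congr_tmul, TensorProduct.congr_tmul, TensorProduct.assoc_tmul,
        TensorProduct.assoc_tmul, LinearMap.lTensor_tmul, LinearMap.lTensor_tmul, h3]
      rfl
  have h1 : (piD Q T s M N).rTensor _ (TensorProduct.congr (dualTensorEquiv₂ s M N)
      (dualTensorEquiv s P) t) =
      dualTensorEquiv₂ s (tensor M N) P ((piLin Q T s M N).rTensor _ t) := by
    clear h2
    induction t with
    | zero => simp
    | add z w hz hw => simp only [map_add, hz, hw]
    | tmul v w =>
      rw [TensorProduct.congr_tmul, LinearMap.rTensor_tmul, piD_equiv]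
      rfl
  rw [h1, h2, piD_equiv, piD_equiv, ← piLin_assoc]
  exact (dualTensorEquiv_lTensor s (M := tensor (tensor M N) P) (N := tensor M (tensor N P))
    (TensorProduct.assoc k M.carrier N.carrier P.carrier).toLinearMap _).symm

lemma flipAct_RB_eq_ioD (M N : FDMod k H)
    (t : (Module.Dual k A ⊗[k] M.carrier) ⊗[k] (Module.Dual k A ⊗[k] N.carrier)) :
    flipAct (BAlg.dualTensor s M).ρ (BAlg.dualTensor s N).ρ (BAlg.RB Q T s) t =
      ioD Q T s N M ((flipAct M.ρ N.ρ Q.R).lTensor (Module.Dual k A) (piD Q T s M N t)) := by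
  obtain ⟨t, rfl⟩ := (dualTensorEquiv₂ s M N).surjective t
  have h1 := flipAct_naturality (dualTensorHom s M) (dualTensorHom s N) (BAlg.RB Q T s) t
  have h2 := flipAct_RB Q T s M N t
  refine h1.trans ((congrArg (dualTensorEquiv₂ s N M) h2).trans ?_)
  rw [brLin, LinearMap.comp_apply, LinearMap.comp_apply, ← ioD_equiv, piD_equiv]
  exact congrArg _ (dualTensorEquiv_lTensor s (M := tensor M N) (N := tensor N M) _ _)

/-- `π((φ ⊗ m) ⊗ (α ⊗ n)) = φ ⊗ m ⊗ n`, so that the maps `ξ` are right inverse to `π`. -/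
lemma piD_α (M N : FDMod k H) (φ : Module.Dual k A) (m : M.carrier) (n : N.carrier) :
    piD Q T s M N ((φ ⊗ₜ m) ⊗ₜ (s.α ⊗ₜ n)) = φ ⊗ₜ (m ⊗ₜ n) := by
  obtain ⟨c, rfl⟩ := s.toDual.surjective φ
  have h1 := piD_equiv Q T s M N ((c ⊗ₜ m) ⊗ₜ ((1 : A) ⊗ₜ n))
  rw [TensorProduct.congr_tmul, dualTensorEquiv_tmul, dualTensorEquiv_tmul, s.toDual_one,
    piLin_tmul] at h1
  rw [h1]
  have h2 := sum_counit_snd Q (k := k) (TensorProduct.mk k A (M.carrier ⊗[k] N.carrier) c ∘ₗ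
    (TensorProduct.mk k M.carrier N.carrier).flip n ∘ₗ M.ρ.toLinearMap.flip m)
  simp only [LinearMap.comp_apply, LinearMap.flip_apply, TensorProduct.mk_apply,
    AlgHom.toLinearMap_apply, map_one, Module.End.one_apply] at h2
  have h3 : ∀ p : H × H, (c * T.act p.2 1) ⊗ₜ[k] (M.ρ p.1 m ⊗ₜ[k] n) =
      counit (R := k) p.2 • c ⊗ₜ[k] (M.ρ p.1 m ⊗ₜ[k] n) := by
    intro p
    rw [T.act_one, mul_smul_comm, mul_one, TensorProduct.smul_tmul']
  simp only [h3]
  rw [h2]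
  rfl

/-- The generator `α ⊗ 1` of the unit object `F(k)`. -/
abbrev etaD : Module.Dual k A ⊗[k] k := s.α ⊗ₜ 1

lemma dualTensorEquiv_etaA :
    dualTensorEquiv s (QuasiTriangular.unit k H) (etaA k A) = etaD s := by
  rw [dualTensorEquiv_tmul, s.toDual_one]

lemma dualTensorEquiv_algAct (M : FDMod k H) (b : BAlg H s) (t : A ⊗[k] M.carrier) :
    dualTensorEquiv s M (algAct s M b t) =
      (BAlg.dualTensor s M).ρ b (dualTensorEquiv s M t) :=
  FDMod.lin_ρ (dualTensorHom s M) b t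

/-- Left multiplication by `c (α ⊗ 1)` on `F(N)` is the action of `ε_t(c)`. -/
lemma lid_piD (N : FDMod k H) (c : BAlg H s) (v : Module.Dual k A ⊗[k] N.carrier) :
    (TensorProduct.lid k N.carrier).toLinearMap.lTensor (Module.Dual k A)
      (piD Q T s (QuasiTriangular.unit k H) N
        ((BAlg.dualTensor s (QuasiTriangular.unit k H)).ρ c (etaD s) ⊗ₜ v)) =
      (BAlg.dualTensor s N).ρ ((weakHopfB Q T s).εt c) v := by
  obtain ⟨v, rfl⟩ := (dualTensorEquiv s N).surjective v
  have h1 := piD_equiv Q T s (QuasiTriangular.unit k H) N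
    (algAct s (QuasiTriangular.unit k H) c (etaA k A) ⊗ₜ v)
  rw [TensorProduct.congr_tmul, dualTensorEquiv_algAct, dualTensorEquiv_etaA] at h1
  rw [h1, ← dualTensorEquiv_algAct]
  refine Eq.trans ?_ (congrArg (dualTensorEquiv s N) (algAct_εt Q T s N c v).symm)
  exact (dualTensorEquiv_lTensor s (M := tensor (QuasiTriangular.unit k H) N) (N := N) _ _).symm

/-- Right multiplication by `c (α ⊗ 1)` on `F(M)` is the action of `ε_r(c)`. -/
lemma rid_piD (M : FDMod k H) (c : BAlg H s) (v : Module.Dual k A ⊗[k] M.carrier) :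
    (TensorProduct.rid k M.carrier).toLinearMap.lTensor (Module.Dual k A)
      (piD Q T s M (QuasiTriangular.unit k H)
        (v ⊗ₜ (BAlg.dualTensor s (QuasiTriangular.unit k H)).ρ c (etaD s))) =
      (BAlg.dualTensor s M).ρ ((weakHopfB Q T s).εr c) v := by
  obtain ⟨v, rfl⟩ := (dualTensorEquiv s M).surjective v
  have h1 := piD_equiv Q T s M (QuasiTriangular.unit k H)
    (v ⊗ₜ algAct s (QuasiTriangular.unit k H) c (etaA k A))
  rw [TensorProduct.congr_tmul, dualTensorEquiv_algAct, dualTensorEquiv_etaA] at h1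
  have h2 := epsA_pairRep_right s M c 1 (BAlg.comulB Q T s 1) v
  rw [pairRep_comulB_one, LinearMap.mulLeft_one, LinearMap.id_comp,
    map_one (algAct s (QuasiTriangular.unit k H)), Module.End.one_eq_id, LinearMap.comp_id,
    epsA_ioLin_right] at h2
  rw [h1, ← dualTensorEquiv_algAct]
  refine Eq.trans ?_ (congrArg (dualTensorEquiv s M) h2.symm)
  exact (dualTensorEquiv_lTensor s (M := tensor M (QuasiTriangular.unit k H)) (N := M) _ _).symm

/-- `z ↦ z (α ⊗ 1)`, from `B_t` to `F(k)`. -/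
def unitLin : LinearMap.range (weakHopfB Q T s).εt →ₗ[k] Module.Dual k A ⊗[k] k :=
  LinearMap.applyₗ (etaD s) ∘ₗ
    (BAlg.dualTensor s (QuasiTriangular.unit k H)).ρ.toLinearMap ∘ₗ
      (LinearMap.range (weakHopfB Q T s).εt).subtype

lemma unitLin_apply (z : LinearMap.range (weakHopfB Q T s).εt) : unitLin Q T s z =
    (BAlg.dualTensor s (QuasiTriangular.unit k H)).ρ (z : BAlg H s) (etaD s) := rfl

/-- `ε_t(c) (α ⊗ 1) = c (α ⊗ 1)` -/
lemma εt_etaD (c : BAlg H s) :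
    (BAlg.dualTensor s (QuasiTriangular.unit k H)).ρ ((weakHopfB Q T s).εt c) (etaD s) =
      (BAlg.dualTensor s (QuasiTriangular.unit k H)).ρ c (etaD s) := by
  rw [← lid_piD]
  have key : ∀ v : Module.Dual k A ⊗[k] k,
      (TensorProduct.lid k k).toLinearMap.lTensor (Module.Dual k A)
        (piD Q T s (QuasiTriangular.unit k H) (QuasiTriangular.unit k H) (v ⊗ₜ etaD s)) = v := by
    intro v
    refine TensorProduct.induction_on v ?_ (fun φ r => ?_) (fun y z hy hz => ?_)
    · simp
    · have h1 := piD_α Q T s (QuasiTriangular.unit k H) (QuasiTriangular.unit k H) φ r 1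
      refine (congrArg _ h1).trans ?_
      rw [LinearMap.lTensor_tmul, LinearEquiv.coe_coe, TensorProduct.lid_tmul, smul_eq_mul,
        mul_one]
    · rw [TensorProduct.add_tmul, map_add, map_add, hy, hz]
  exact key _

lemma unitLin_ρ (b : BAlg H s) (z : LinearMap.range (weakHopfB Q T s).εt) :
    unitLin Q T s ((weakHopfB Q T s).unit.ρ b z) =
      (BAlg.dualTensor s (QuasiTriangular.unit k H)).ρ b (unitLin Q T s z) := by
  rw [unitLin_apply, unitLin_apply, WeakBialgebra.unit_ρ_val, εt_etaD, map_mul]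
  rfl

lemma unitLin_bijective [Nontrivial A] : Function.Bijective (unitLin Q T s) := by
  constructor
  · rw [← LinearMap.ker_eq_bot, Submodule.eq_bot_iff]
    rintro ⟨_, c, rfl⟩ hz
    rw [LinearMap.mem_ker, unitLin_apply, εt_etaD] at hz
    refine Subtype.ext (ext_algAct s fun N v => (dualTensorEquiv s N).injective ?_)
    rw [dualTensorEquiv_algAct, dualTensorEquiv_algAct, ← lid_piD, hz]
    simp
  · intro v
    obtain ⟨a, ha⟩ := exists_α_eq_one s
    obtain ⟨φ, rfl⟩ : ∃ φ : Module.Dual k A, v = φ ⊗ₜ 1 :=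
      ⟨TensorProduct.rid k _ v, ((TensorProduct.rid k _).symm_apply_apply v).symm⟩
    refine ⟨⟨_, BAlg.tri s a 1 φ, rfl⟩, ?_⟩
    rw [unitLin_apply, εt_etaD, dualTensor_ρ_tri_eq_evAt, evAt_tmul, ha, one_smul,
      map_one (QuasiTriangular.unit k H).ρ]
    rfl

/-- The unit isomorphism `B_t ≅ F(k)`. -/
def unitIso [Nontrivial A] :
    (weakHopfB Q T s).unit ≅ BAlg.dualTensor s (QuasiTriangular.unit k H) :=
  FDMod.isoOfEquiv (M := (weakHopfB Q T s).unit) (N := BAlg.dualTensor s (QuasiTriangular.unit k H))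
    (LinearEquiv.ofBijective _ (unitLin_bijective Q T s)) (unitLin_ρ Q T s)

lemma simple_unit [Nontrivial A] : Simple (𝟙_ (weakHopfB Q T s).ModCat) := by
  have h1 : Simple (C := FDMod k (BAlg H s)) _ := simple_dualTensor_unit (H := H) s
  have h2 := Simple.of_iso (unitIso Q T s)
  exact h2

/-- The isomorphism `F(M) ⊠ F(N) ≅ F(M ⊗ N)`, given by `π` with inverse `ι`. -/
def tensorIso (M N : FDMod k H) :
    (weakHopfB Q T s).tensor (BAlg.dualTensor s M) (BAlg.dualTensor s N) ≅
      BAlg.dualTensor s (tensor M N) :=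
  FDMod.isoOfEquiv
    (M := (weakHopfB Q T s).tensor (BAlg.dualTensor s M) (BAlg.dualTensor s N))
    (N := BAlg.dualTensor s (tensor M N))
    (LinearEquiv.ofLinearMap
      (piD Q T s M N ∘ₗ (weakHopfB Q T s).incl (BAlg.dualTensor s M) (BAlg.dualTensor s N))
      ((ioD Q T s M N).codRestrict _ (fun t => by
        rw [WeakBialgebra.mem_tensorSpace, act_one_eq_ioD, piD_ioD]))
      (LinearMap.ext fun t => piD_ioD Q T s M N t)
      (LinearMap.ext fun t => Subtype.ext (by
        have h := WeakBialgebra.mem_tensorSpace _ |>.1 t.2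
        rw [act_one_eq_ioD] at h
        exact h)))
    (fun b t => by
      have h := congrArg (piD Q T s M N) (act_eq_ioD Q T s M N b t.1)
      rw [piD_ioD] at h
      exact h)

end monoidal

end WeakHopf

/-! ### Coherence and the braiding -/

namespace WeakHopf

open Coalgebra HopfAlgebra HopfConv QuasiTriangular

section braided
variable {k H A : Type u} [Field k] [CharZero k] [Ring H] [HopfAlgebra k H] [IsSemisimpleRing H]
  [Ring A] [Algebra k A] (Q : QuasiTriangular k H) (T : ModuleAlgebra k H A)
  (s : SymmSepIdempotent k A)

lemma incl_lin_tensorIso_inv (M N : FDMod k H)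
    (t : Module.Dual k A ⊗[k] (M.carrier ⊗[k] N.carrier)) :
    (weakHopfB Q T s).incl (BAlg.dualTensor s M) (BAlg.dualTensor s N)
      (FDMod.lin (tensorIso Q T s M N).inv t) = ioD Q T s M N t := rfl

lemma tensorIso_natural {M M' N N' : FDMod k H} (f : M ⟶ M') (g : N ⟶ N') :
    (weakHopfB Q T s).tensorMap (BAlg.dualTensorMap s f) (BAlg.dualTensorMap s g) ≫
      (tensorIso Q T s M' N').hom =
    (tensorIso Q T s M N).hom ≫ BAlg.dualTensorMap s (QuasiTriangular.tensorMap f g) :=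
  FDMod.hom_ext (LinearMap.ext fun t => piD_natural Q T s f g
    ((weakHopfB Q T s).incl (BAlg.dualTensor s M) (BAlg.dualTensor s N) t))

lemma dualTensorMap_id (M : FDMod k H) :
    BAlg.dualTensorMap s (𝟙 M) = 𝟙 (BAlg.dualTensor s M) :=
  FDMod.hom_ext (LinearMap.lTensor_id _ _)

lemma tensorIso_assoc (M N P : FDMod k H) :
    (weakHopfB Q T s).tensorMap (tensorIso Q T s M N).hom (𝟙 (BAlg.dualTensor s P)) ≫
      (tensorIso Q T s (tensor M N) P).hom ≫
        BAlg.dualTensorMap s (QuasiTriangular.associator M N P).hom =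
    ((weakHopfB Q T s).associator (BAlg.dualTensor s M) (BAlg.dualTensor s N)
      (BAlg.dualTensor s P)).hom ≫
      (weakHopfB Q T s).tensorMap (𝟙 (BAlg.dualTensor s M)) (tensorIso Q T s N P).hom ≫
        (tensorIso Q T s M (tensor N P)).hom := by
  refine FDMod.hom_ext (LinearMap.ext fun t => ?_)
  have h1 := LinearMap.congr_fun (LinearMap.rTensor_comp (BAlg.dualTensor s P).carrier
    (piD Q T s M N) ((weakHopfB Q T s).incl (BAlg.dualTensor s M) (BAlg.dualTensor s N)))
    ((weakHopfB Q T s).incl ((weakHopfB Q T s).tensor (BAlg.dualTensor s M) (BAlg.dualTensor s N))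
      (BAlg.dualTensor s P) t)
  have h2 := LinearMap.congr_fun (LinearMap.lTensor_comp (BAlg.dualTensor s M).carrier
    (piD Q T s N P) ((weakHopfB Q T s).incl (BAlg.dualTensor s N) (BAlg.dualTensor s P)))
    ((weakHopfB Q T s).incl (BAlg.dualTensor s M)
      ((weakHopfB Q T s).tensor (BAlg.dualTensor s N) (BAlg.dualTensor s P))
      ((weakHopfB Q T s).assocLin _ _ _ t))
  have h3 := (weakHopfB Q T s).inclR_assocLin (BAlg.dualTensor s M) (BAlg.dualTensor s N)
    (BAlg.dualTensor s P) t
  refine (congrArg (fun x => (TensorProduct.assoc k _ _ _).toLinearMap.lTensor (Module.Dual k A)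
    (piD Q T s (tensor M N) P x)) h1).trans ?_
  refine Eq.trans ?_ (congrArg (piD Q T s M (tensor N P)) h2).symm
  refine (piD_assoc Q T s M N P _).trans ?_
  exact congrArg (fun x => piD Q T s M (tensor N P) ((piD Q T s N P).lTensor _ x)) h3.symm

lemma leftUnitor_eq [Nontrivial A] (M : FDMod k H) :
    ((weakHopfB Q T s).leftUnitor (BAlg.dualTensor s M)).hom =
      (weakHopfB Q T s).tensorMap (unitIso Q T s).hom (𝟙 (BAlg.dualTensor s M)) ≫
        (tensorIso Q T s (QuasiTriangular.unit k H) M).hom ≫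
          BAlg.dualTensorMap s (QuasiTriangular.leftUnitor M).hom := by
  refine FDMod.hom_ext (LinearMap.ext fun t => ?_)
  let W := weakHopfB Q T s
  let u := QuasiTriangular.unit k H
  have key : ∀ r : LinearMap.range W.εt ⊗[k] (BAlg.dualTensor s M).carrier,
      W.lu (BAlg.dualTensor s M) (W.act W.unit (BAlg.dualTensor s M) 1 r) =
      (TensorProduct.lid k M.carrier).toLinearMap.lTensor (Module.Dual k A)
        (piD Q T s u M (TensorProduct.map (FDMod.lin (unitIso Q T s).hom)
          (FDMod.lin (𝟙 (BAlg.dualTensor s M)))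
          (W.act W.unit (BAlg.dualTensor s M) 1 r))) := by
    intro r
    rw [W.map_act, act_one_eq_ioD, piD_ioD]
    induction r with
    | zero => simp
    | add y z hy hz => simp only [map_add, hy, hz]
    | tmul z v =>
      obtain ⟨_, c, rfl⟩ := z
      rw [WeakBialgebra.lu_act_tmul, one_mul, TensorProduct.map_tmul]
      have h := lid_piD Q T s M (W.εt c) v
      rw [W.εt_εt] at h
      exact h.symm
  have ht : W.act W.unit (BAlg.dualTensor s M) 1 (W.incl W.unit (BAlg.dualTensor s M) t) =
      W.incl W.unit (BAlg.dualTensor s M) t := W.mem_tensorSpace.1 t.2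
  have h := key (W.incl W.unit (BAlg.dualTensor s M) t)
  rw [ht] at h
  exact h

lemma rightUnitor_eq [Nontrivial A] (M : FDMod k H) :
    ((weakHopfB Q T s).rightUnitor (BAlg.dualTensor s M)).hom =
      (weakHopfB Q T s).tensorMap (𝟙 (BAlg.dualTensor s M)) (unitIso Q T s).hom ≫
        (tensorIso Q T s M (QuasiTriangular.unit k H)).hom ≫
          BAlg.dualTensorMap s (QuasiTriangular.rightUnitor M).hom := by
  refine FDMod.hom_ext (LinearMap.ext fun t => ?_)
  let W := weakHopfB Q T s
  let u := QuasiTriangular.unit k H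
  have key : ∀ r : (BAlg.dualTensor s M).carrier ⊗[k] LinearMap.range W.εt,
      W.ru (BAlg.dualTensor s M) (W.act (BAlg.dualTensor s M) W.unit 1 r) =
      (TensorProduct.rid k M.carrier).toLinearMap.lTensor (Module.Dual k A)
        (piD Q T s M u (TensorProduct.map (FDMod.lin (𝟙 (BAlg.dualTensor s M)))
          (FDMod.lin (unitIso Q T s).hom)
          (W.act (BAlg.dualTensor s M) W.unit 1 r))) := by
    intro r
    rw [W.map_act, act_one_eq_ioD, piD_ioD]
    induction r with
    | zero => simp
    | add y z hy hz => simp only [map_add, hy, hz]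
    | tmul v z =>
      rw [WeakBialgebra.ru_act_tmul, one_mul, TensorProduct.map_tmul]
      exact (rid_piD Q T s M (z : BAlg H s) v).symm
  have ht : W.act (BAlg.dualTensor s M) W.unit 1 (W.incl (BAlg.dualTensor s M) W.unit t) =
      W.incl (BAlg.dualTensor s M) W.unit t := W.mem_tensorSpace.1 t.2
  have h := key (W.incl (BAlg.dualTensor s M) W.unit t)
  rw [ht] at h
  exact h

lemma tensorIso_braid (M N : FDMod k H) :
    (tensorIso Q T s M N).hom ≫ BAlg.dualTensorMap s (Q.braid M N).hom =
      ((weakHopfB Q T s).braid (BAlg.dualTensor s M) (BAlg.dualTensor s N)).hom ≫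
        (tensorIso Q T s N M).hom := by
  refine FDMod.hom_ext (LinearMap.ext fun t => ?_)
  have h := congrArg (piD Q T s N M) (flipAct_RB_eq_ioD Q T s M N
    ((weakHopfB Q T s).incl (BAlg.dualTensor s M) (BAlg.dualTensor s N) t))
  rw [piD_ioD] at h
  exact h.symm

/-- The monoidal structure of `F`. -/
def functorFCoreMonoidal [Nontrivial A] :
    (functorF Q s (weakHopfB Q T s)).CoreMonoidal where
  εIso := unitIso Q T s
  μIso := fun (M N : FDMod k H) => tensorIso Q T s M N
  μIso_hom_natural_left := fun {M M' : FDMod k H} f (N : FDMod k H) => by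
    have h := tensorIso_natural Q T s f (𝟙 N)
    rw [dualTensorMap_id] at h
    exact h
  μIso_hom_natural_right := fun {N N' : FDMod k H} (M : FDMod k H) f => by
    have h := tensorIso_natural Q T s (𝟙 M) f
    rw [dualTensorMap_id] at h
    exact h
  associativity := tensorIso_assoc Q T s
  left_unitality := leftUnitor_eq Q T s
  right_unitality := rightUnitor_eq Q T s

/-- The braided monoidal structure of `F`. -/
abbrev functorFBraided [Nontrivial A] : (functorF Q s (weakHopfB Q T s)).Braided where
  toMonoidal := (functorFCoreMonoidal Q T s).toMonoidal
  braided := tensorIso_braid Q T s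

end braided

end WeakHopf

end

theorem mainTheorem4 {k H A : Type u} [Field k] [CharZero k] [Ring H] [HopfAlgebra k H]
    [IsSemisimpleRing H] [Ring A] [Algebra k A] [Nontrivial A]
    (Q : WeakHopf.QuasiTriangular k H) (T : WeakHopf.ModuleAlgebra k H A)
    (s : WeakHopf.SymmSepIdempotent k A) (hqc : T.IsQuantumCommutative Q) :
    ∃ W : WeakHopf.QuasiTriangularWeakHopf k (WeakHopf.BAlg H s),
      WeakHopf.IsStructureOnB Q T s W ∧
      Simple (𝟙_ W.ModCat) ∧
      (∀ M N : WeakHopf.FDMod k H,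
        LinearMap.ker (W.act (WeakHopf.BAlg.dualTensor s M) (WeakHopf.BAlg.dualTensor s N) 1) =
          WeakHopf.balanced Q T M N) ∧
      (WeakHopf.functorF Q s W).IsEquivalence ∧
      (∃ _ : (WeakHopf.functorF Q s W).Additive, (WeakHopf.functorF Q s W).Linear k) ∧
      ∃ _ : (WeakHopf.functorF Q s W).Braided,
        ∀ (M N : WeakHopf.FDMod k H) (φ : Module.Dual k A) (m : M.carrier) (n : N.carrier),
          W.incl (WeakHopf.BAlg.dualTensor s M) (WeakHopf.BAlg.dualTensor s N)
            (WeakHopf.FDMod.lin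
              (Functor.OplaxMonoidal.δ (WeakHopf.functorF Q s W) (M : Q.ModCat) (N : Q.ModCat))
              (φ ⊗ₜ[k] (m ⊗ₜ[k] n))) =
          W.act (WeakHopf.BAlg.dualTensor s M) (WeakHopf.BAlg.dualTensor s N) 1
            ((φ ⊗ₜ[k] m) ⊗ₜ[k] (s.α ⊗ₜ[k] n)) := by
  have hadd := WeakHopf.functorF_additive Q s (WeakHopf.weakHopfB Q T s)
  refine ⟨WeakHopf.weakHopfB Q T s, WeakHopf.isStructureOnB_weakHopfB Q T s,
    WeakHopf.simple_unit Q T s, WeakHopf.ker_act_one_eq_balanced Q T s,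
    WeakHopf.functorF_isEquivalence Q s _, ⟨hadd, WeakHopf.functorF_linear Q s _⟩,
    WeakHopf.functorFBraided Q T s, fun M N φ m n => ?_⟩
  rw [WeakHopf.act_one_eq_ioD, WeakHopf.piD_α]
  exact WeakHopf.incl_lin_tensorIso_inv Q T s M N _
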